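/- **Notation.** Let $|a|<M$, $r_\pm=M\pm\sqrt{M^2-a^2}$, $\Delta=r^2-2Mr+a^2$, and for $r>r_+$ let $'=\frac{d}{dr_*}=\frac{\Delta}{r^2+a^2}\frac{d}{dr}$, $dr_*=\frac{r^2+a^2}{\Delta}dr$. A triple $(\omega,m,\Lambda)\in\mathbb R\times\mathbb Z\times\mathbb R$ is *admissible* if $\Lambda\ge|m|(|m|+1)$ and $\Lambda\ge|am\omega|$. Put $$V_0=\frac{4Mram\omega-a^2m^2+\Delta\Lambda}{(r^2+a^2)^2},\qquad V_1=\frac{\Delta}{(r^2+a^2)^4}\bigl(a^2\Delta+2Mr(r^2-a^2)\bigr),\qquad V=V_0+V_1 .$$ For $\gamma>0$ let $r_{\rm elp}(\omega,m)=r_+$ if $a=0$ or $m=0$ or $|\omega/(am)|\ge\gamma$, and $r_{\rm elp}(\omega,m)=2.03M$ otherwise. $\iota_A$ is the indicator of $A$. All integrals of nonnegative functions take values in $[0,\infty]$. **(A) Fixed-frequency estimate.** For all $R_{\rm pot}>5M$, $b>0$, $\gamma>0$ there is $C>0$, depending only on $a,M,R_{\rm pot},b,\gamma$, such that for every admissible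 $(\omega,m,\Lambda)$ and every $u\in C^2((r_+,\infty);\mathbb C)$, with $G:=u''+(\omega^2-V)u$ on $r>r_+$, $$\int_{r_{\rm elp}}^{1.2R_{\rm pot}}\frac{\Delta}{r^2}\,\iota_{\{V_0-\omega^2\ge b\omega^2\}}(V_0-\omega^2)^2|u|^2\,dr_*\le C\int_{\max(0.99\,r_{\rm elp},\,r_+)}^{1.3R_{\rm pot}}\frac{\Delta}{r^2}\,\iota_{\{V_0-\omega^2\ge\frac b2\omega^2\}}\bigl((\omega^2+\Lambda)|u|^2+|G|^2\bigr)\,dr_* .$$ **Geometric setting for (B).** Fix parameters $r_-<r_0<r_+<r_1<r_2<r_{\rm pot}<2.01M$ and $5M<R_{\rm pot}$, $2R_{\rm pot}<R_{\rm freq}\le R/4$. The manifold is $\mathcal M=\mathbb R^4\cap\{r\ge r_0\}$ with Cartesian coordinates $(t^*,x^1,x^2,x^3)$, $r=|x|$, and polar coordinates $(r,\theta,\varphi^*)$ of $x$. Let $r_{BL}$ be a smooth radius function, invariant under $T$ and $\Omega_1$ below, strictly increasing and unbounded in $r$ along rays, with $r_{BL}=r$ for $r\le R/2$. The metric $g=g_{a,M}$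 is the Kerr metric with Boyer–Lindquist coordinates $(t,r_{BL},\theta,\varphi)$, where for $r_{BL}>r_+$, $t^*=t+\bar t(r_{BL})$, $\varphi^*=\varphi+\bar\varphi(r_{BL})$, the functions $\bar t,\bar\varphi$ vanish for $r_{BL}\ge 9M/4$, and $\frac{r^2+a^2}{\Delta}-\bar t\,'$, $\frac a\Delta-\bar\varphi'$ (here $'=d/dr$) extend smoothly to $r>r_-$. It is assumed that $\sqrt{|\det g|}$ is bounded above and below by positive constants on $r\ge r_0$ and that the level sets of $t^*$ are spacelike for $r\le R$. Let $T=\partial_{t^*}$, let $\Omega_1=\partial_{\varphi^*},\Omega_2,\Omega_3$ be the rotations of $\mathbb R^3_x$, and $Z=T+\frac{a}{2Mr_+}\Omega_1$. - Foliation: let $h$ be smooth on $[R,\infty)$ with $h(R)=0$, $h'>0$ on $(R,\infty)$, and such that the level sets of $\mathsf u=t^*-h(r)$ and $\mathsf v=t^*+h(r)$ are null for $r>R$. Set $\Sigma(\tau)=\{t^*=\tau,\,r_0\le r\le R\}\cup\{\mathsf u=\tau,\,r\ge R\}$, the level sets of a function $\tau$ on $\mathcal M$; $\mathcal R(\tau_0,\tau_1)=\bigcup_{\tau_0\le\tau\le\tau_1}\Sigma(\tau)$;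 $\underline C_v=\{\mathsf v=v,\,r\ge R\}$. - $L,\underline L$ are smooth fields invariant under the flows of $T,\Omega_1$ and spanning the tangent space together with $\Omega_1,\Omega_2,\Omega_3$; for $r>R$ they are the future null generators of the level sets of $\mathsf u$ and of $\mathsf v$ respectively, with $g(L,\underline L)=-1$ and $-g(\underline L,T)$ bounded above and below by positive constants. - $Y$ is a smooth invariant field vanishing for $r>r_1+\frac{r_2-r_1}2$ and spanning together with $Z,\Omega_1,\Omega_2,\Omega_3$ on $r_0\le r\le r_1+\frac{r_2-r_1}4$. - $\zeta,\hat\zeta\colon\mathbb R\to[0,1]$ are smooth; $\zeta(r)=1$ for $r\ge\frac34R$ and $0$ for $r\le\frac12R$; $\hat\zeta(r)=1$ for $r_0\le r\le r_1+\frac{r_2-r_1}4$ and $0$ for $r\ge r_1+\frac{r_2-r_1}2$. - $\chi_{\tau_0,\tau_1}(\tau)=\alpha_1(\tau-\tau_0)\,\alpha_2(\tau_1-\tau)$ with $\alpha_i\colon\mathbb R\to[0,1]$ smooth, $\alpha_i(s)=0$ for $s\le0$, $\alpha_i(s)=1$ for $s\ge\frac12$; it is evaluated on $\mathcal M$ at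 the function $\tau$. - $\mathfrak D=(T,\Omega_1,Y,\zeta L,\zeta\underline L,(\zeta+\hat\zeta)\Omega_1,(\zeta+\hat\zeta)\Omega_2,(\zeta+\hat\zeta)\Omega_3)$ and $\tilde{\mathfrak D}=(L,\underline L,\Omega_1,\Omega_2,\Omega_3)$; $\mathfrak D^\kappa,\tilde{\mathfrak D}^\kappa$ denote the ordered products for multi-indices $\kappa$. $|\nabla\!\!\!\!/f|^2:=\sum_i r^{-2}|\Omega_if|^2$. Spacetime integrals use the metric volume; integrals over $\{t^*=\tau,r\le R\}$ the induced Riemannian volume; integrals over null level sets of $\mathsf u$ (resp. $\mathsf v$) the volume associated to the normal $L$ (resp. $\underline L$). **Energies.** For $0<\delta<\frac1{10}$ and $k\in\mathbb N_0$, $${}^{\chi}\mathcal X_k=\sup_{\tau\in[\tau_0,\tau_1]}\mathcal E_k(\tau)+\sup_{v\ge\tau_1}\mathcal F_k(v)+\int_{\tau_0}^{\tau_1}\bigl({}^\chi\mathcal E'_k(\tau)+\mathcal E'_{k-1}(\tau)\bigr)d\tau,$$ $$\mathcal E_k(\tau)=\sum_{|\kappa|\le k}\int_{\Sigma(\tau)}|L\tilde{\mathfrak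 D}^\kappa\psi|^2+|\nabla\!\!\!\!/\tilde{\mathfrak D}^\kappa\psi|^2+\iota_{\{r\le R\}}|\underline L\tilde{\mathfrak D}^\kappa\psi|^2+r^{-2}|\tilde{\mathfrak D}^\kappa\psi|^2,$$ $$\mathcal F_k(v)=\sum_{|\kappa|\le k}\int_{\underline C_v\cap\mathcal R(\tau_0,\tau_1)}|\underline L\tilde{\mathfrak D}^\kappa\psi|^2+|\nabla\!\!\!\!/\tilde{\mathfrak D}^\kappa\psi|^2+r^{-2}|\tilde{\mathfrak D}^\kappa\psi|^2,$$ $${}^\chi\mathcal E'_k(\tau)=\sum_{|\kappa|\le k}\int_{\Sigma(\tau)}r^{-1-\delta}\chi(r)\bigl(|L\mathfrak D^\kappa\psi|^2+|\underline L\mathfrak D^\kappa\psi|^2+|\nabla\!\!\!\!/\mathfrak D^\kappa\psi|^2\bigr),$$ $$\mathcal E'_{k-1}(\tau)=\sum_{|\kappa|\le k-1}\int_{\Sigma(\tau)}r^{-1-\delta}\bigl(|L\tilde{\mathfrak D}^\kappa\psi|^2+|\underline L\tilde{\mathfrak D}^\kappa\psi|^2+|\nabla\!\!\!\!/\tilde{\mathfrak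 D}^\kappa\psi|^2\bigr)+r^{-3-\delta}|\tilde{\mathfrak D}^\kappa\psi|^2\quad(k\ge1),\qquad\mathcal E'_{-1}(\tau)=\int_{\Sigma(\tau)}r^{-3-\delta}|\psi|^2,$$ where $\chi=0$ on $(r_{\rm pot},R_{\rm pot})$ and $\chi=1$ elsewhere. **Frequency quantities.** Let $S_{m\ell}^{(\nu)}(\cos\theta)$, $\ell\ge|m|$, be the oblate spheroidal harmonics: the eigenfunctions, regular at the poles and normalised in $L^2(\sin\theta\,d\theta)$, of $-\frac1{\sin\theta}\partial_\theta(\sin\theta\,\partial_\theta)+\frac{m^2}{\sin^2\theta}-\nu^2\cos^2\theta$, with eigenvalues $\lambda_{m\ell}^{(\nu)}$ listed in increasing order in $\ell$. Let $\Lambda=\Lambda_{m\ell}(\omega)=\lambda_{m\ell}^{(a\omega)}+a^2\omega^2$. For $r_+<r\le R/2$ and $\kappa=(\kappa_1,\kappa_2)$ let $$u_\kappa(r,\omega,m,\ell)=\int_0^\pi\!\int_{\mathbb R}\int_0^{2\pi}e^{i\omega t}e^{-im\varphi}\,T^{\kappa_1}\Omega_1^{\kappa_2}\bigl(\chi_{\tau_0,\tau_1}^2\psi\bigr)(t,r,\theta,\varphi)\,S_{m\ell}^{(a\omega)}(\cos\theta)\sin\theta\;d\varphi\,dt\,d\theta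 .$$ Given $\omega_{\rm high},\epsilon_{\rm width},\alpha,b_{\rm trap}>0$, let $\mathcal G_\natural(b_{\rm trap})$ be the set of admissible $(\omega,m,\Lambda)$ with $|\omega|\ge\omega_{\rm high}$, $\epsilon_{\rm width}\Lambda\le\omega^2\le\epsilon_{\rm width}^{-1}\Lambda$, $m\omega\notin\bigl(0,\frac{am^2}{2Mr_+}+\alpha\Lambda\bigr]$, and such that $V_0$ attains its maximum $V_{\max}$ over $(r_+,\infty)$, with $|V_{\max}-\omega^2|\le b_{\rm trap}\omega^2$. Let $\chi_\natural(r,\omega,m,\Lambda)\ge0$ be any function such that, for $r>r_+$ and admissible frequencies: $\chi_\natural=1$ outside $\mathcal G_\natural(b_{\rm trap})$; inside, $\chi_\natural$ is smooth in $r$ and vanishes where $V_0$ is maximal; and, for some $c>0$ independent of $r$ and the frequencies, $\chi_\natural''\ge c$ wherever $\chi_\natural\le\frac12$. With $\Lambda=\Lambda_{m\ell}(\omega)$ set $${}^\natural\mathcal X_k=\sum_{|\kappa|\le k}\int_{\mathbb R}\sum_{m\in\mathbb Z}\sum_{\ell\ge|m|}\int_{r_+<r\le R_{\rm freq}}\frac\Delta{r^2}\Bigl(|u_\kappa'|^2+\chi_\natural\,(\omega^2+r^{-1}m^2+r^{-1}\Lambda)|u_\kappa|^2\Bigr)dr_*\,d\omega,$$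 $${}^{\rm elp}\mathcal X_k=\sum_{|\kappa|\le k}\int_{\mathbb R}\sum_{m\in\mathbb Z}\sum_{\ell\ge|m|}\int_{r_+<r\le1.2R_{\rm pot}}\frac\Delta{r^2}\,\iota_{\rm elliptic}\,(V_0-\omega^2)^2|u_\kappa|^2\,dr_*\,d\omega,$$ where $\iota_{\rm elliptic}$ is the indicator of $\{V_0\ge(1+b)\omega^2\}\cap\{r_{\rm elp}(\omega,m)<r\le1.2R_{\rm pot}\}$. **(B) Estimate for the wave equation.** For every $b>0$ there is $b_0>0$, depending only on $a,M,b$, such that for every choice of the geometric setting above, all $\gamma,\omega_{\rm high},\epsilon_{\rm width},\alpha>0$, $0<b_{\rm trap}\le b_0$, $0<\delta<\frac1{10}$, every $\chi_\natural$ as above and every $k\ge0$ there is $C>0$ such that, for all $\tau_0+2\le\tau_1$ and all complex-valued $\psi$ smooth on a neighbourhood of $\mathcal R(\tau_0,\tau_1)$, with $F:=\Box_{g_{a,M}}\psi$ on $\mathcal R(\tau_0,\tau_1)$, $${}^{\rm elp}\mathcal X_k\le C\Bigl({}^\chi\mathcal X_k+{}^\natural\mathcal X_k+\sum_{|\kappa|\le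 k}\int_{\mathcal R(\tau_0,\tau_1)\cap\{r_+\le r\le1.3R_{\rm pot}\}}|\mathfrak D^\kappa F|^2\Bigr).$$ -/

import Mathlib

noncomputable section

namespace KerrElliptic

/-! ### Kerr functions, potentials and the fixed-frequency quantities

Throughout, functions of the tortoise coordinate are regarded as functions of
`r ∈ (r₊, ∞)`, with `d r_* / dr = (r² + a²)/Δ`. -/

/-- Outer horizon radius `r₊ = M + √(M² - a²)`. -/
def rPlus (M a : ℝ) : ℝ := M + √(M ^ 2 - a ^ 2)

/-- Inner horizon radius `r₋ = M - √(M² - a²)`. -/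
def rMinus (M a : ℝ) : ℝ := M - √(M ^ 2 - a ^ 2)

/-- `Δ = r² - 2Mr + a²`. -/
def Del (M a r : ℝ) : ℝ := r ^ 2 - 2 * M * r + a ^ 2

/-- The tortoise derivative `d/dr_* = Δ/(r²+a²) d/dr`. -/
def dStar {E : Type*} [NormedAddCommGroup E] [NormedSpace ℝ E]
    (M a : ℝ) (f : ℝ → E) (r : ℝ) : E :=
  (Del M a r / (r ^ 2 + a ^ 2)) • deriv f r

/-- `∫_s f dr_*` for a nonnegative `f` and a set `s` of radii contained in `(r₊, ∞)`,
that is, `∫_s f (r²+a²)/Δ dr`. -/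
def lintStar (M a : ℝ) (s : Set ℝ) (f : ℝ → ℝ) : ENNReal :=
  ∫⁻ r in s, ENNReal.ofReal (f r * ((r ^ 2 + a ^ 2) / Del M a r))

/-- Admissible frequency triples `(ω, m, Λ)`. -/
def Admissible (a ω : ℝ) (m : ℤ) (Λ : ℝ) : Prop :=
  |(m : ℝ)| * (|(m : ℝ)| + 1) ≤ Λ ∧ |a * m * ω| ≤ Λ

/-- The high frequency potential. -/
def V0 (M a ω : ℝ) (m : ℤ) (Λ r : ℝ) : ℝ :=
  (4 * M * r * a * m * ω - a ^ 2 * (m : ℝ) ^ 2 + Del M a r * Λ) / (r ^ 2 + a ^ 2) ^ 2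

/-- The remainder potential. -/
def V1 (M a r : ℝ) : ℝ :=
  Del M a r / (r ^ 2 + a ^ 2) ^ 4 * (a ^ 2 * Del M a r + 2 * M * r * (r ^ 2 - a ^ 2))

/-- The full potential of the radial equation. -/
def Vfull (M a ω : ℝ) (m : ℤ) (Λ r : ℝ) : ℝ := V0 M a ω m Λ r + V1 M a r

/-- `u'' + (ω² - V) u = G` on `r > r₊`, the prime being `d/dr_*`. -/
def RadialODE (M a ω : ℝ) (m : ℤ) (Λ : ℝ) (u G : ℝ → ℂ) : Prop :=
  ∀ r, rPlus M a < r →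
    dStar M a (dStar M a u) r + ((ω ^ 2 - Vfull M a ω m Λ r : ℝ) : ℂ) * u r = G r

open Classical in
/-- The radius `r_elliptic(ω, m)`. -/
def rElliptic (M a γ ω : ℝ) (m : ℤ) : ℝ :=
  if a = 0 ∨ m = 0 ∨ γ ≤ |ω / (a * m)| then rPlus M a else 2.03 * M

open Classical in
/-- The indicator of `{V₀ - ω² ≥ b ω²}`. -/
def iotaV (M a b ω : ℝ) (m : ℤ) (Λ r : ℝ) : ℝ :=
  if b * ω ^ 2 ≤ V0 M a ω m Λ r - ω ^ 2 then 1 else 0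

open Classical in
/-- The indicator `ι_elliptic` of `{V₀ ≥ (1+b) ω²} ∩ {r_elliptic(ω,m) < r ≤ 1.2 R_pot}`. -/
def iotaElliptic (M a Rpot b γ r ω : ℝ) (m : ℤ) (Λ : ℝ) : ℝ :=
  if (1 + b) * ω ^ 2 ≤ V0 M a ω m Λ r ∧ rElliptic M a γ ω m < r ∧ r ≤ 1.2 * Rpot then 1 else 0

/-! ### The trapped range and the frequency dependent degeneration function -/

/-- The frequency range `𝒢_♮`. -/
def GNat (M a ωhigh εwidth α ω : ℝ) (m : ℤ) (Λ : ℝ) : Prop :=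
  Admissible a ω m Λ ∧ ωhigh ≤ |ω| ∧ εwidth * Λ ≤ ω ^ 2 ∧ ω ^ 2 ≤ εwidth⁻¹ * Λ ∧
    ¬ (0 < m * ω ∧ m * ω ≤ a * (m : ℝ) ^ 2 / (2 * M * rPlus M a) + α * Λ)

/-- `r` is an interior maximum point of `V₀` on `(r₊, ∞)`. -/
def IsInteriorMax (M a ω : ℝ) (m : ℤ) (Λ r : ℝ) : Prop :=
  rPlus M a < r ∧ ∀ s, rPlus M a < s → V0 M a ω m Λ s ≤ V0 M a ω m Λ r

/-- The smaller range `𝒢_♮(b_trap)`: the maximum value of `V₀` is within `b_trap ω²` of `ω²`. -/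
def GNatTrap (M a ωhigh εwidth α btrap ω : ℝ) (m : ℤ) (Λ : ℝ) : Prop :=
  GNat M a ωhigh εwidth α ω m Λ ∧
    ∃ r, IsInteriorMax M a ω m Λ r ∧ |V0 M a ω m Λ r - ω ^ 2| ≤ btrap * ω ^ 2

/-- The defining properties of the degeneration function `χ_♮(r, ω, m, Λ)`: it is nonnegative,
identically `1` outside `𝒢_♮(b_trap)`; inside it is smooth in `r` and vanishes at the maximum
of `V₀`; and `χ_♮'' ≥ c` wherever `χ_♮ ≤ 1/2`, with `c > 0` independent of the frequencies. -/
structure IsChiNat (M a ωhigh εwidth α btrap : ℝ) (χ : ℝ → ℝ → ℤ → ℝ → ℝ) : Prop where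
  nonneg : ∀ r ω m Λ, 0 ≤ χ r ω m Λ
  eq_one : ∀ ω m Λ, Admissible a ω m Λ → ¬ GNatTrap M a ωhigh εwidth α btrap ω m Λ →
    ∀ r, rPlus M a < r → χ r ω m Λ = 1
  smooth : ∀ ω m Λ, GNatTrap M a ωhigh εwidth α btrap ω m Λ →
    ContDiffOn ℝ (⊤ : ℕ∞) (fun r => χ r ω m Λ) (Set.Ioi (rPlus M a))
  vanish : ∀ ω m Λ, GNatTrap M a ωhigh εwidth α btrap ω m Λ →
    ∀ r, IsInteriorMax M a ω m Λ r → χ r ω m Λ = 0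
  convex : ∃ c : ℝ, 0 < c ∧ ∀ ω m Λ, Admissible a ω m Λ → ∀ r, rPlus M a < r →
    χ r ω m Λ ≤ 1 / 2 → c ≤ dStar M a (dStar M a (fun s => χ s ω m Λ)) r

/-! ### Oblate spheroidal harmonics -/

/-- `f`, a function of `θ ∈ (0, π)`, is an eigenfunction with eigenvalue `lam` of
`P(ν, m) = -(sin θ)⁻¹ d/dθ (sin θ d/dθ) + m² (sin θ)⁻² - ν² cos² θ`.
Boundedness is the regularity condition at the poles: it selects the solutions for which
`e^{imφ} f(θ)` is a regular function on the sphere. -/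
structure IsSpheroidalEigenfunction (ν : ℝ) (m : ℤ) (lam : ℝ) (f : ℝ → ℝ) : Prop where
  contDiff : ContDiffOn ℝ 2 f (Set.Ioo 0 Real.pi)
  bounded : ∃ B, ∀ θ ∈ Set.Ioo 0 Real.pi, |f θ| ≤ B
  nonzero : ∃ θ ∈ Set.Ioo 0 Real.pi, f θ ≠ 0
  eqn : ∀ θ ∈ Set.Ioo 0 Real.pi,
    -(Real.sin θ)⁻¹ * deriv (fun s => Real.sin s * deriv f s) θ
      + ((m : ℝ) ^ 2 / Real.sin θ ^ 2 - ν ^ 2 * Real.cos θ ^ 2) * f θ = lam * f θ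

/-- The set of eigenvalues of `P(ν, m)`. -/
def spheroidalSpectrum (ν : ℝ) (m : ℤ) : Set ℝ :=
  {lam | ∃ f, IsSpheroidalEigenfunction ν m lam f}

/-- The eigenvalue `λ_{mℓ}^{(ν)}`, `ℓ ≥ |m|`: the one with exactly `ℓ - |m|` smaller eigenvalues
(the infimum is over a one-point set). -/
def spheroidalEigenvalue (ν : ℝ) (m : ℤ) (l : ℕ) : ℝ :=
  sInf {lam | lam ∈ spheroidalSpectrum ν m ∧
    {mu | mu ∈ spheroidalSpectrum ν m ∧ mu < lam}.encard = ((l - m.natAbs : ℕ) : ℕ∞)}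

/-- The eigenfunction `θ ↦ S_{mℓ}^{(ν)}(cos θ)`, normalised in `L²(sin θ dθ)`. It is real and
unique up to sign. -/
def spheroidalS (ν : ℝ) (m : ℤ) (l : ℕ) : ℝ → ℝ :=
  Classical.epsilon fun f =>
    IsSpheroidalEigenfunction ν m (spheroidalEigenvalue ν m l) f ∧
      ∫ θ in (0 : ℝ)..Real.pi, f θ ^ 2 * Real.sin θ = 1

/-- `Λ_{mℓ}^{(aω)} = λ_{mℓ}^{(aω)} + a²ω²`. -/
def LambdaFreq (a ω : ℝ) (m : ℤ) (l : ℕ) : ℝ :=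
  spheroidalEigenvalue (a * ω) m l + a ^ 2 * ω ^ 2

/-! ### Ambient Cartesian space, vector fields, wave operator -/

/-- Points of the ambient space; the coordinates are `(x⁰, x¹, x², x³)` with `x⁰ = t^*`. -/
abbrev Pt := Fin 4 → ℝ

/-- `r = |(x¹, x², x³)|`. -/
def rad (x : Pt) : ℝ := √(x 1 ^ 2 + x 2 ^ 2 + x 3 ^ 2)

/-- `dr(w)` at `x`. -/
def dRad (x w : Pt) : ℝ := (x 1 * w 1 + x 2 * w 2 + x 3 * w 3) / rad x

/-- The stationary Killing field `T = ∂_{t^*}`. -/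
def TField : Pt → Pt := fun _ => ![1, 0, 0, 0]

/-- The rotations `Ω₁, Ω₂, Ω₃`; `Ω₁ = ∂_{φ^*}` is the axisymmetric Killing field. -/
def Om : Fin 3 → Pt → Pt
  | 0 => fun x => ![0, -x 2, x 1, 0]
  | 1 => fun x => ![0, 0, -x 3, x 2]
  | 2 => fun x => ![0, x 3, 0, -x 1]

/-- Rotation of the ambient space by the angle `s` about the axis (the flow of `Ω₁`). -/
def rotAxis (s : ℝ) (x : Pt) : Pt :=
  ![x 0, Real.cos s * x 1 - Real.sin s * x 2, Real.sin s * x 1 + Real.cos s * x 2, x 3]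

/-- A function on space invariant under the flows of `T` and `Ω₁`. -/
def InvariantFun (f : Pt → ℝ) : Prop :=
  (∀ (s : ℝ) x, f (x + s • TField x) = f x) ∧ ∀ s x, f (rotAxis s x) = f x

/-- A vector field invariant under the flows of `T` and `Ω₁`. -/
def InvariantField (X : Pt → Pt) : Prop :=
  (∀ (s : ℝ) x, X (x + s • TField x) = X x) ∧ ∀ s x, X (rotAxis s x) = rotAxis s (X x)

/-- The derivative `X f` of a function along a vector field. -/
def vder (X : Pt → Pt) (f : Pt → ℂ) (x : Pt) : ℂ := fderiv ℝ f x (X x)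

/-- `X₀^{κ₀} X₁^{κ₁} ⋯ X_{n-1}^{κ_{n-1}} f`. -/
def multiDer {n : ℕ} (X : Fin n → Pt → Pt) (κ : Fin n → ℕ) (f : Pt → ℂ) : Pt → ℂ :=
  (List.finRange n).foldr (fun i g => (vder (X i))^[κ i] g) f

/-- The multi-indices `κ` of length `n` with `|κ| < N`. -/
def multiIdx (n N : ℕ) : Finset (Fin n → ℕ) :=
  (Fintype.piFinset fun _ : Fin n => Finset.range N).filter fun κ => ∑ i, κ i < N

/-- The Kerr metric at `x`, evaluated on `w` and `w'`. With `ϱ` the Boyer--Lindquist radius as a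
function on the ambient space, `dv = dt^* + p(ϱ) dϱ` and `dφ' = dφ^* + q(ϱ) dϱ`, this is
`-(Δ/ρ²)(dv - a sin²θ dφ')² + 2 dϱ (dv - a sin²θ dφ') + ρ² dθ² + (sin²θ/ρ²)(a dv - (ϱ²+a²) dφ')²`,
which is the Boyer--Lindquist form of the metric once `dv = dt + (ϱ²+a²)/Δ dϱ` and
`dφ' = dφ + a/Δ dϱ`. The last two squares have been rearranged, using the round metric
`σ = dθ² + sin²θ dφ^*²` and `η = sin²θ dφ^*`, so that every term is regular on the axis:
`ρ² dθ² + ((ϱ²+a²)²/ρ²) sin²θ dφ^*² = ρ² σ + (a² (ϱ²+a²+ρ²)/ρ²) η²`. -/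
def kerrForm (M a : ℝ) (p q : ℝ → ℝ) (rBL : Pt → ℝ) (x w w' : Pt) : ℝ :=
  let rb := rBL x
  let sin2 := (x 1 ^ 2 + x 2 ^ 2) / rad x ^ 2
  let rho2 := rb ^ 2 + a ^ 2 * (x 3 ^ 2 / rad x ^ 2)
  let B := rb ^ 2 + a ^ 2
  let dr : Pt → ℝ := fun z => fderiv ℝ rBL x z
  let dv : Pt → ℝ := fun z => z 0 + p rb * dr z
  let eta : Pt → ℝ := fun z => (x 1 * z 2 - x 2 * z 1) / rad x ^ 2
  let etap : Pt → ℝ := fun z => eta z + sin2 * (q rb * dr z)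
  let e : Pt → ℝ := fun z => dv z - a * etap z
  let sigma : ℝ := (w 1 * w' 1 + w 2 * w' 2 + w 3 * w' 3 - dRad x w * dRad x w') / rad x ^ 2;
  rho2 * sigma + (dr w * e w' + e w * dr w') - Del M a rb / rho2 * (e w * e w')
    + (1 / rho2) * (a ^ 2 * (B + rho2) * (eta w * eta w') + a ^ 2 * sin2 * (dv w * dv w')
      - a * B * (dv w * etap w' + etap w * dv w')
      + B ^ 2 * (q rb * (dr w * eta w' + eta w * dr w') + sin2 * q rb ^ 2 * (dr w * dr w')))

/-- The matrix of metric components in the ambient Cartesian coordinates. -/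
def kerrMatrix (M a : ℝ) (p q : ℝ → ℝ) (rBL : Pt → ℝ) (x : Pt) : Matrix (Fin 4) (Fin 4) ℝ :=
  Matrix.of fun i j => kerrForm M a p q rBL x (Pi.single i 1) (Pi.single j 1)

/-- `√|det g|`. -/
def volDensity (g : Pt → Matrix (Fin 4) (Fin 4) ℝ) (x : Pt) : ℝ := √|(g x).det|

/-- The wave operator `□_g f = |g|^{-1/2} ∂_μ (|g|^{1/2} g^{μν} ∂_ν f)`. -/
def boxOp (g : Pt → Matrix (Fin 4) (Fin 4) ℝ) (f : Pt → ℂ) (x : Pt) : ℂ :=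
  (volDensity g x)⁻¹ • ∑ μ : Fin 4, ∑ ν : Fin 4,
    fderiv ℝ (fun y => (volDensity g y * (g y)⁻¹ μ ν) • fderiv ℝ f y (Pi.single ν 1)) x
      (Pi.single μ 1)

/-! ### The Kerr manifold with its foliation and commutation fields -/

/-- The Kerr manifold `𝓜 = ℝ⁴ ∖ {r < r₀}` with parameters `a, M`, together with the choices of
radial parameters, Kerr star coordinates, radial function, double null foliation of `r ≥ R`,
vector fields `L, L̲, Y` and cutoff functions on which the foliation and the energies depend. -/
structure KerrSetup (M a : ℝ) where
  (r0 r1 r2 rpot Rpot Rfreq R : ℝ)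
  params : rMinus M a < r0 ∧ r0 < rPlus M a ∧ rPlus M a < r1 ∧ r1 < r2 ∧ r2 < rpot ∧
    rpot < 2.01 * M ∧ 5 * M < Rpot ∧ 2 * Rpot < Rfreq ∧ Rfreq ≤ R / 4
  /- Kerr star coordinates `t^* = t + tbar(r)`, `φ^* = φ + phibar(r)` for `r > r₊`, where
    `(r²+a²)/Δ - tbar'` and `a/Δ - phibar'` extend to smooth functions `p`, `q` on `r > r₋`. -/
  (tbar phibar p q : ℝ → ℝ)
  bar_eq_zero : ∀ r, 9 * M / 4 ≤ r → tbar r = 0 ∧ phibar r = 0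
  p_smooth : ContDiffOn ℝ (⊤ : ℕ∞) p (Set.Ioi (rMinus M a))
  q_smooth : ContDiffOn ℝ (⊤ : ℕ∞) q (Set.Ioi (rMinus M a))
  tbar_deriv : ∀ r, rPlus M a < r → HasDerivAt tbar ((r ^ 2 + a ^ 2) / Del M a r - p r) r
  phibar_deriv : ∀ r, rPlus M a < r → HasDerivAt phibar (a / Del M a r - q r) r
  /- The Boyer--Lindquist radius as a function on the ambient space; it is `r` for `r ≤ R/2`. -/
  rBL : Pt → ℝ
  rBL_smooth : ContDiffOn ℝ (⊤ : ℕ∞) rBL {x | rMinus M a < rad x}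
  rBL_inv : InvariantFun rBL
  rBL_eq : ∀ x, rad x ≤ R / 2 → rBL x = rad x
  rBL_mono : ∀ x, rMinus M a < rad x → 0 < fderiv ℝ rBL x ![0, x 1, x 2, x 3]
  rBL_proper : ∀ B, ∃ ρ, ∀ x, ρ ≤ rad x → B ≤ rBL x
  /- The volume form is comparable to `dt^* dx¹ dx² dx³`, and the level sets of `t^*` are
    spacelike for `r ≤ R`. -/
  vol_comparable : ∃ c C : ℝ, 0 < c ∧ ∀ x, r0 ≤ rad x →
    c ≤ volDensity (kerrMatrix M a p q rBL) x ∧ volDensity (kerrMatrix M a p q rBL) x ≤ C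
  spacelike : ∀ x, r0 ≤ rad x → rad x ≤ R → (kerrMatrix M a p q rBL x)⁻¹ 0 0 < 0
  /- The double null foliation of `r ≥ R` by the level sets of `u = t^* - h(r)` and
    `v = t^* + h(r)`. -/
  h : ℝ → ℝ
  h_smooth : ContDiffOn ℝ (⊤ : ℕ∞) h (Set.Ici R)
  h_R : h R = 0
  h_mono : ∀ r, R < r → 0 < deriv h r
  /- The globally defined fields `L`, `L̲`, spanning the tangent space together with the `Ω_i`;
    for `r > R` they are the null generators of the level sets of `u` and of `v`. -/
  (L Lb : Pt → Pt)
  L_smooth : ContDiffOn ℝ (⊤ : ℕ∞) L {x | rMinus M a < rad x}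
  Lb_smooth : ContDiffOn ℝ (⊤ : ℕ∞) Lb {x | rMinus M a < rad x}
  L_inv : InvariantField L
  Lb_inv : InvariantField Lb
  L_span : ∀ x, r0 ≤ rad x →
    Submodule.span ℝ ({L x, Lb x, Om 0 x, Om 1 x, Om 2 x} : Set Pt) = ⊤
  L_null : ∀ x, R < rad x →
    kerrForm M a p q rBL x (L x) (L x) = 0 ∧ kerrForm M a p q rBL x (Lb x) (Lb x) = 0 ∧
      kerrForm M a p q rBL x (L x) (Lb x) = -1
  L_conormal : ∀ x w, R < rad x → kerrForm M a p q rBL x (L x) w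
    = kerrForm M a p q rBL x (L x) (TField x) * (w 0 - deriv h (rad x) * dRad x w)
  Lb_conormal : ∀ x w, R < rad x → kerrForm M a p q rBL x (Lb x) w
    = kerrForm M a p q rBL x (Lb x) (TField x) * (w 0 + deriv h (rad x) * dRad x w)
  L_future : ∀ x, R < rad x → kerrForm M a p q rBL x (L x) (TField x) < 0
  Lb_future : ∃ c C : ℝ, 0 < c ∧ ∀ x, R < rad x →
    c ≤ -kerrForm M a p q rBL x (Lb x) (TField x) ∧ -kerrForm M a p q rBL x (Lb x) (TField x) ≤ C
  /- The field `Y` near the horizon; with `Z = T + a/(2Mr₊) Ω₁` and the `Ω_i` it spans. -/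
  Y : Pt → Pt
  Y_smooth : ContDiffOn ℝ (⊤ : ℕ∞) Y {x | rMinus M a < rad x}
  Y_inv : InvariantField Y
  Y_supp : ∀ x, r1 + (r2 - r1) / 2 < rad x → Y x = 0
  Y_span : ∀ x, r0 ≤ rad x → rad x ≤ r1 + (r2 - r1) / 4 →
    Submodule.span ℝ ({Y x, TField x + (a / (2 * M * rPlus M a)) • Om 0 x,
      Om 0 x, Om 1 x, Om 2 x} : Set Pt) = ⊤
  /- The radial cutoffs `ζ` and `ζ̂`. -/
  (zeta zetaHat : ℝ → ℝ)
  zeta_smooth : ContDiff ℝ (⊤ : ℕ∞) zeta ∧ ContDiff ℝ (⊤ : ℕ∞) zetaHat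
  zeta_range : ∀ r, zeta r ∈ Set.Icc (0 : ℝ) 1 ∧ zetaHat r ∈ Set.Icc (0 : ℝ) 1
  zeta_eq : (∀ r, 3 * R / 4 ≤ r → zeta r = 1) ∧ ∀ r, r ≤ R / 2 → zeta r = 0
  zetaHat_eq : (∀ r, r0 ≤ r → r ≤ r1 + (r2 - r1) / 4 → zetaHat r = 1) ∧
    ∀ r, r1 + (r2 - r1) / 2 ≤ r → zetaHat r = 0
  /- The profiles of the temporal cutoff `χ_{τ₀,τ₁}(τ) = rise(τ - τ₀) fall(τ₁ - τ)`. -/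
  (rise fall : ℝ → ℝ)
  rise_smooth : ContDiff ℝ (⊤ : ℕ∞) rise ∧ ContDiff ℝ (⊤ : ℕ∞) fall
  rise_range : ∀ s, rise s ∈ Set.Icc (0 : ℝ) 1 ∧ fall s ∈ Set.Icc (0 : ℝ) 1
  rise_eq : (∀ s, s ≤ 0 → rise s = 0 ∧ fall s = 0) ∧ ∀ s, 1 / 2 ≤ s → rise s = 1 ∧ fall s = 1

namespace KerrSetup

variable {M a : ℝ} (K : KerrSetup M a)

/-- The Kerr metric as a bilinear form. -/
def g (x w w' : Pt) : ℝ := kerrForm M a K.p K.q K.rBL x w w'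

/-- The Kerr metric as a matrix. -/
def gMat (x : Pt) : Matrix (Fin 4) (Fin 4) ℝ := kerrMatrix M a K.p K.q K.rBL x

/-- The wave operator of the Kerr metric. -/
def box (f : Pt → ℂ) : Pt → ℂ := boxOp K.gMat f

open Classical in
/-- `Σ(τ) = {t^* = τ + hSigma(r)}`. -/
def hSigma (r : ℝ) : ℝ := if r ≤ K.R then 0 else K.h r

/-- The function `τ` whose level sets are the `Σ(τ)`. -/
def tau (x : Pt) : ℝ := x 0 - K.hSigma (rad x)

/-- The spacetime region `𝓡(τ₀, τ₁)`. -/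
def region (τ₀ τ₁ : ℝ) : Set Pt := {x | K.r0 ≤ rad x ∧ τ₀ ≤ K.tau x ∧ K.tau x ≤ τ₁}

/-- `∫_s f dV_𝓜` for nonnegative `f`. -/
def bulkInt (s : Set Pt) (f : Pt → ℝ) : ENNReal :=
  ∫⁻ x in s, ENNReal.ofReal (f x * volDensity K.gMat x)

open Classical in
/-- The induced volume density of `Σ(τ)` with respect to `dx¹ dx² dx³`: the Riemannian one on
the spacelike part `{t^* = τ, r ≤ R}`, and the one associated to the null normal `L` for
`r > R`. -/
def sliceDensity (x : Pt) : ℝ :=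
  if rad x ≤ K.R then volDensity K.gMat x * √(-(K.gMat x)⁻¹ 0 0)
  else volDensity K.gMat x / |K.g x (K.L x) (TField x)|

/-- `∫_{Σ(τ)} f` for nonnegative `f`. -/
def sliceInt (τ : ℝ) (f : Pt → ℝ) : ENNReal :=
  ∫⁻ y : Fin 3 → ℝ in {y | K.r0 ≤ rad ![0, y 0, y 1, y 2]},
    (fun x : Pt => ENNReal.ofReal (f x * K.sliceDensity x))
      ![τ + K.hSigma (rad ![0, y 0, y 1, y 2]), y 0, y 1, y 2]

/-- `∫_{C̲_v ∩ 𝓡(τ₀,τ₁)} f` for nonnegative `f`, where `C̲_v = {t^* + h(r) = v, r ≥ R}`, with the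
volume form associated to the null normal `L̲`. Since `h(R) = 0`, the cone `C̲_v` meets `r = R`
in the same sphere as `Σ(v)`, that is, `τ(v) = v`. -/
def coneInt (v τ₀ τ₁ : ℝ) (f : Pt → ℝ) : ENNReal :=
  ∫⁻ y : Fin 3 → ℝ in {y | K.R ≤ rad ![0, y 0, y 1, y 2] ∧
      τ₀ ≤ v - 2 * K.h (rad ![0, y 0, y 1, y 2]) ∧ v - 2 * K.h (rad ![0, y 0, y 1, y 2]) ≤ τ₁},
    (fun x : Pt => ENNReal.ofReal (f x * (volDensity K.gMat x / |K.g x (K.Lb x) (TField x)|)))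
      ![v - K.h (rad ![0, y 0, y 1, y 2]), y 0, y 1, y 2]

/-- The commutation fields `𝔇₁, …, 𝔇₈`. -/
def DF : Fin 8 → Pt → Pt :=
  ![TField, Om 0, K.Y, fun x => K.zeta (rad x) • K.L x, fun x => K.zeta (rad x) • K.Lb x,
    fun x => (K.zeta (rad x) + K.zetaHat (rad x)) • Om 0 x,
    fun x => (K.zeta (rad x) + K.zetaHat (rad x)) • Om 1 x,
    fun x => (K.zeta (rad x) + K.zetaHat (rad x)) • Om 2 x]

/-- The spanning fields `𝔇̃₁, …, 𝔇̃₅`. -/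
def DT : Fin 5 → Pt → Pt := ![K.L, K.Lb, Om 0, Om 1, Om 2]

/-- `|L f|²`. -/
def sqL (f : Pt → ℂ) (x : Pt) : ℝ := ‖vder K.L f x‖ ^ 2

/-- `|L̲ f|²`. -/
def sqLb (f : Pt → ℂ) (x : Pt) : ℝ := ‖vder K.Lb f x‖ ^ 2

/-- `|∇̸ f|² = ∑ᵢ r⁻² |Ωᵢ f|²`. -/
def sqAng (f : Pt → ℂ) (x : Pt) : ℝ := ∑ i : Fin 3, (rad x ^ 2)⁻¹ * ‖vder (Om i) f x‖ ^ 2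

open Classical in
/-- The energy `𝓔_k^{(0)}(τ)[ψ]`. -/
def energy (k : ℕ) (ψ : Pt → ℂ) (τ : ℝ) : ENNReal :=
  ∑ κ ∈ multiIdx 5 (k + 1), K.sliceInt τ fun x =>
    K.sqL (multiDer K.DT κ ψ) x + sqAng (multiDer K.DT κ ψ) x
      + (if rad x ≤ K.R then K.sqLb (multiDer K.DT κ ψ) x else 0)
      + (rad x ^ 2)⁻¹ * ‖multiDer K.DT κ ψ x‖ ^ 2

/-- The flux `𝓕_k^{(0)}(v, τ₀, τ₁)[ψ]`. -/
def flux (k : ℕ) (ψ : Pt → ℂ) (v τ₀ τ₁ : ℝ) : ENNReal :=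
  ∑ κ ∈ multiIdx 5 (k + 1), K.coneInt v τ₀ τ₁ fun x =>
    K.sqLb (multiDer K.DT κ ψ) x + sqAng (multiDer K.DT κ ψ) x
      + (rad x ^ 2)⁻¹ * ‖multiDer K.DT κ ψ x‖ ^ 2

open Classical in
/-- The degeneration function `χ`: it is `0` in `(r_pot, R_pot)` and `1` elsewhere. -/
def chiDeg (r : ℝ) : ℝ := if K.rpot < r ∧ r < K.Rpot then 0 else 1

/-- The degenerate bulk energy `^χ𝓔'_k^{(-1-δ)}(τ)[ψ]`. -/
def bulkEnergyChi (δ : ℝ) (k : ℕ) (ψ : Pt → ℂ) (τ : ℝ) : ENNReal :=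
  ∑ κ ∈ multiIdx 8 (k + 1), K.sliceInt τ fun x =>
    rad x ^ (-1 - δ) * K.chiDeg (rad x) * (K.sqL (multiDer K.DF κ ψ) x
      + K.sqLb (multiDer K.DF κ ψ) x + sqAng (multiDer K.DF κ ψ) x)

/-- The nondegenerate bulk energy `𝓔'_{k-1}^{(-1-δ)}(τ)[ψ]`, for `k = 0` read as
`∫_{Σ(τ)} r^{-3-δ} |ψ|²`. -/
def bulkEnergyPred (δ : ℝ) (k : ℕ) (ψ : Pt → ℂ) (τ : ℝ) : ENNReal :=
  match k with
  | 0 => K.sliceInt τ fun x => rad x ^ (-3 - δ) * ‖ψ x‖ ^ 2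
  | j + 1 => ∑ κ ∈ multiIdx 5 (j + 1), K.sliceInt τ fun x =>
      rad x ^ (-1 - δ) * (K.sqL (multiDer K.DT κ ψ) x + K.sqLb (multiDer K.DT κ ψ) x
        + sqAng (multiDer K.DT κ ψ) x) + rad x ^ (-3 - δ) * ‖multiDer K.DT κ ψ x‖ ^ 2

/-- The master energy `^χ𝓧_k^{(0)}(τ₀, τ₁)[ψ]`. -/
def chiX (δ : ℝ) (k : ℕ) (τ₀ τ₁ : ℝ) (ψ : Pt → ℂ) : ENNReal :=
  (⨆ τ ∈ Set.Icc τ₀ τ₁, K.energy k ψ τ) + (⨆ v ∈ Set.Ici τ₁, K.flux k ψ v τ₀ τ₁)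
    + ∫⁻ τ in Set.Icc τ₀ τ₁, (K.bulkEnergyChi δ k ψ τ + K.bulkEnergyPred δ k ψ τ)

/-! #### Frequency analysis -/

/-- The temporal cutoff `χ_{τ₀,τ₁}`, as a function of `τ`. -/
def cutoff (τ₀ τ₁ τ : ℝ) : ℝ := K.rise (τ - τ₀) * K.fall (τ₁ - τ)

/-- `χ²_{τ₀,τ₁} ψ`. -/
def cutPsi (τ₀ τ₁ : ℝ) (ψ : Pt → ℂ) (x : Pt) : ℂ := (K.cutoff τ₀ τ₁ (K.tau x) ^ 2 : ℝ) * ψ x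

/-- The point with Boyer--Lindquist coordinates `(t, r, θ, φ)`, for `r₊ < r ≤ R/2`. -/
def ptBL (t r θ φ : ℝ) : Pt :=
  ![t + K.tbar r, r * Real.sin θ * Real.cos (φ + K.phibar r),
    r * Real.sin θ * Real.sin (φ + K.phibar r), r * Real.cos θ]

/-- The Fourier transform `𝔉_{BL}` in `(t, φ)`. -/
def fourierBL (Ψ : Pt → ℂ) (r θ ω : ℝ) (m : ℤ) : ℂ :=
  ∫ t : ℝ, ∫ φ in (0 : ℝ)..(2 * Real.pi),
    Complex.exp (Complex.I * ω * t) * Complex.exp (-(Complex.I * m * φ)) * Ψ (K.ptBL t r θ φ)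

/-- `ℭ ∘ 𝔉_{BL}[Ψ](r, ω, m, ℓ)`: the coefficient of `𝔉_{BL}[Ψ]` along the spheroidal harmonic
`S_{mℓ}^{(aω)}` in `L²(sin θ dθ)`. -/
def carter (Ψ : Pt → ℂ) (ω : ℝ) (m : ℤ) (l : ℕ) (r : ℝ) : ℂ :=
  ∫ θ in (0 : ℝ)..Real.pi,
    K.fourierBL Ψ r θ ω m * (spheroidalS (a * ω) m l θ : ℂ) * (Real.sin θ : ℂ)

/-- `u_κ = ℭ ∘ 𝔉_{BL}[T^{κ₀} Ω₁^{κ₁} (χ²_{τ₀,τ₁} ψ)]`, as a function of `r > r₊`. -/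
def mode (κ : Fin 2 → ℕ) (τ₀ τ₁ : ℝ) (ψ : Pt → ℂ) (ω : ℝ) (m : ℤ) (l : ℕ) : ℝ → ℂ :=
  K.carter (multiDer ![TField, Om 0] κ (K.cutPsi τ₀ τ₁ ψ)) ω m l

/-- `∫_ω ∑_{m, ℓ ≥ |m|} ∫_{r₊ < r ≤ ρ} f(ω, m, ℓ, r) dr_* dω` for nonnegative `f`. -/
def freqInt (M a ρ : ℝ) (f : ℝ → ℤ → ℕ → ℝ → ℝ) : ENNReal :=
  ∫⁻ ω : ℝ, ∑' m : ℤ, ∑' l : {l : ℕ // m.natAbs ≤ l},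
    lintStar M a (Set.Ioc (rPlus M a) ρ) (f ω m l)

/-- The trapping energy `^♮𝓧_k(τ₀, τ₁)[ψ]`. -/
def natX (χ : ℝ → ℝ → ℤ → ℝ → ℝ) (k : ℕ) (τ₀ τ₁ : ℝ) (ψ : Pt → ℂ) : ENNReal :=
  ∑ κ ∈ multiIdx 2 (k + 1), freqInt M a K.Rfreq fun ω m l r =>
    Del M a r * (r ^ 2)⁻¹ * (‖dStar M a (K.mode κ τ₀ τ₁ ψ ω m l) r‖ ^ 2
      + χ r ω m (LambdaFreq a ω m l) * (ω ^ 2 + r⁻¹ * (m : ℝ) ^ 2 + r⁻¹ * LambdaFreq a ω m l)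
        * ‖K.mode κ τ₀ τ₁ ψ ω m l r‖ ^ 2)

/-- The elliptic quantity `^{elp}𝓧_k(τ₀, τ₁)[ψ]`. -/
def elpX (b γ : ℝ) (k : ℕ) (τ₀ τ₁ : ℝ) (ψ : Pt → ℂ) : ENNReal :=
  ∑ κ ∈ multiIdx 2 (k + 1), freqInt M a (1.2 * K.Rpot) fun ω m l r =>
    Del M a r * (r ^ 2)⁻¹ * iotaElliptic M a K.Rpot b γ r ω m (LambdaFreq a ω m l)
      * (V0 M a ω m (LambdaFreq a ω m l) r - ω ^ 2) ^ 2 * ‖K.mode κ τ₀ τ₁ ψ ω m l r‖ ^ 2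

/-- `∑_{|κ| ≤ k} ∫_{𝓡(τ₀,τ₁) ∩ {r₊ ≤ r ≤ 1.3 R_pot}} |𝔇^κ F|²`. -/
def sourceX (k : ℕ) (τ₀ τ₁ : ℝ) (F : Pt → ℂ) : ENNReal :=
  ∑ κ ∈ multiIdx 8 (k + 1),
    K.bulkInt (K.region τ₀ τ₁ ∩ {x | rPlus M a ≤ rad x ∧ rad x ≤ 1.3 * K.Rpot}) fun x =>
      ‖multiDer K.DF κ F x‖ ^ 2

end KerrSetup

end KerrElliptic

end

noncomputable section
namespace KerrElliptic
open Set MeasureTheory Filter Topology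
open scoped Real
open Real (sin cos exp cosh tanh artanh smoothTransition norm_eq_abs)
open ENNReal (ofReal ofReal_mul ofReal_ne_top ofReal_le_ofReal ofReal_add)
open Complex (I)
open Finset (sum_congr sum_add_distrib sum_le_sum)
local notation "∞" => (⊤ : ℕ∞)

section Basic
variable {M a r : ℝ}

lemma mass_pos (ha : |a| < M) : 0 < M := lt_of_le_of_lt (abs_nonneg a) ha

lemma sq_sub_sq_pos (ha : |a| < M) : 0 < M ^ 2 - a ^ 2 := by
  have := sq_lt_sq' (by linarith [abs_nonneg a]) ha
  rw [sq_abs] at this; linarith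

lemma mass_lt_rPlus (ha : |a| < M) : M < rPlus M a := by
  have := Real.sqrt_pos.2 (sq_sub_sq_pos ha)
  unfold rPlus; linarith

lemma rPlus_le (ha : |a| < M) : rPlus M a ≤ 2 * M := by
  have h1 : √(M ^ 2 - a ^ 2) ≤ √(M ^ 2) := Real.sqrt_le_sqrt (by nlinarith [sq_nonneg a])
  rw [Real.sqrt_sq (mass_pos ha).le] at h1
  unfold rPlus; linarith

lemma rPlus_pos (ha : |a| < M) : 0 < rPlus M a := (mass_pos ha).trans (mass_lt_rPlus ha)

lemma rMinus_nonneg (ha : |a| < M) : 0 ≤ rMinus M a := by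
  have := rPlus_le ha
  unfold rPlus at this; unfold rMinus; linarith

lemma rMinus_lt_rPlus (ha : |a| < M) : rMinus M a < rPlus M a := by
  have := Real.sqrt_pos.2 (sq_sub_sq_pos ha)
  unfold rPlus rMinus; linarith

lemma Del_eq (ha : |a| < M) (r : ℝ) : Del M a r = (r - rPlus M a) * (r - rMinus M a) := by
  have := Real.sq_sqrt (sq_sub_sq_pos ha).le
  unfold Del rPlus rMinus; linarith

lemma Del_pos (ha : |a| < M) (hr : rPlus M a < r) : 0 < Del M a r := by
  rw [Del_eq ha]
  exact mul_pos (by linarith) (by linarith [rMinus_lt_rPlus ha])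

lemma abs_lt_of_rPlus_lt (ha : |a| < M) (hr : rPlus M a < r) : |a| < r :=
  ha.trans ((mass_lt_rPlus ha).trans hr)

lemma sq_le_of_rPlus_lt (ha : |a| < M) (hr : rPlus M a < r) : a ^ 2 ≤ r ^ 2 := by
  have := abs_lt_of_rPlus_lt ha hr
  nlinarith [abs_nonneg a, sq_abs a]

lemma V1_nonneg (ha : |a| < M) (hr : rPlus M a < r) : 0 ≤ V1 M a r := by
  have h1 := Del_pos ha hr
  have h2 := sq_le_of_rPlus_lt ha hr
  have h3 := mass_pos ha
  have h4 : 0 < r := (rPlus_pos ha).trans hr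
  have h5 : 0 ≤ r ^ 2 - a ^ 2 := by linarith
  unfold V1; positivity

lemma hasDerivAt_Del : HasDerivAt (Del M a) (2 * r - 2 * M) r := by
  unfold Del
  have := (((hasDerivAt_id r).pow 2).sub ((hasDerivAt_id r).const_mul (2 * M))).add_const (a ^ 2)
  simpa using this

lemma Admissible.nonneg {ω Λ : ℝ} {m : ℤ} (h : Admissible a ω m Λ) : 0 ≤ Λ :=
  (abs_nonneg _).trans h.2

lemma Admissible.sq_le {ω Λ : ℝ} {m : ℤ} (h : Admissible a ω m Λ) : (m : ℝ) ^ 2 ≤ Λ := by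
  have := h.1
  nlinarith [abs_nonneg (m : ℝ), sq_abs (m : ℝ)]

/-- The derivative of the high frequency potential in `r`. -/
def V0deriv (M a ω : ℝ) (m : ℤ) (Λ r : ℝ) : ℝ :=
  (4 * M * a * m * ω + (2 * r - 2 * M) * Λ) / (r ^ 2 + a ^ 2) ^ 2
    - 4 * r * (4 * M * r * a * m * ω - a ^ 2 * (m : ℝ) ^ 2 + Del M a r * Λ) / (r ^ 2 + a ^ 2) ^ 3

lemma hasDerivAt_V0 {ω Λ : ℝ} {m : ℤ} (hr : 0 < r) :
    HasDerivAt (V0 M a ω m Λ) (V0deriv M a ω m Λ r) r := by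
  have hB : r ^ 2 + a ^ 2 ≠ 0 := by positivity
  have h1 : HasDerivAt (fun r => 4 * M * r * a * m * ω - a ^ 2 * (m : ℝ) ^ 2 + Del M a r * Λ)
      (4 * M * a * m * ω + (2 * r - 2 * M) * Λ) r := by
    have := (((hasDerivAt_id r).const_mul (4 * M * a * m * ω)).sub_const
      (a ^ 2 * (m : ℝ) ^ 2)).add ((hasDerivAt_Del (M := M) (a := a) (r := r)).mul_const Λ)
    refine (this.congr_deriv (by simp)).congr_of_eventuallyEq (Eventually.of_forall fun x => ?_)
    simp; ring
  have h2 : HasDerivAt (fun r : ℝ => (r ^ 2 + a ^ 2) ^ 2) (4 * r * (r ^ 2 + a ^ 2)) r := by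
    have := (((hasDerivAt_id r).pow 2).add_const (a ^ 2)).pow 2
    refine (this.congr_deriv ?_).congr_of_eventuallyEq (Eventually.of_forall fun x => ?_)
    · simp; ring
    · simp
  have := h1.div h2 (by positivity)
  refine (this.congr_deriv ?_).congr_of_eventuallyEq (Eventually.of_forall fun x => ?_)
  · unfold V0deriv; field_simp
  · simp [V0]

lemma abs_V0deriv_le (ha : |a| < M) {ω Λ ρ : ℝ} {m : ℤ} (h : Admissible a ω m Λ)
    (hr : rPlus M a < r) (hρ : r ≤ ρ) :
    |V0deriv M a ω m Λ r| ≤ ((4 * M + 4 * ρ) / M ^ 4 + 4 * ρ * (4 * M * ρ + 3 * ρ ^ 2) / M ^ 6) * Λ := by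
  have hM := mass_pos ha
  have hMr := (mass_lt_rPlus ha).trans hr
  have h0 : 0 < r := hM.trans hMr
  have hΛ := h.nonneg
  have hB : M ^ 2 ≤ r ^ 2 + a ^ 2 := by nlinarith [sq_nonneg a]
  have hB4 : M ^ 4 ≤ (r ^ 2 + a ^ 2) ^ 2 := by
    calc M ^ 4 = (M ^ 2) ^ 2 := by ring
      _ ≤ _ := by gcongr
  have hB6 : M ^ 6 ≤ (r ^ 2 + a ^ 2) ^ 3 := by
    calc M ^ 6 = (M ^ 2) ^ 3 := by ring
      _ ≤ _ := by gcongr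
  have hD := Del_pos ha hr
  have ha2 := sq_le_of_rPlus_lt ha hr
  have hDle : Del M a r ≤ 2 * ρ ^ 2 := by unfold Del; nlinarith
  have h2 := abs_le.1 h.2
  have hm := h.sq_le
  have hn1 : |4 * M * a * m * ω + (2 * r - 2 * M) * Λ| ≤ (4 * M + 4 * ρ) * Λ := by
    rw [abs_le]; constructor <;> nlinarith
  have hρr : r ^ 2 ≤ ρ ^ 2 := by gcongr
  have hn2 : |4 * M * r * a * m * ω - a ^ 2 * (m : ℝ) ^ 2 + Del M a r * Λ|
      ≤ (4 * M * ρ + 3 * ρ ^ 2) * Λ := by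
    have e1 : |4 * M * r * a * m * ω| ≤ 4 * M * ρ * Λ := by
      rw [show 4 * M * r * a * m * ω = 4 * M * r * (a * m * ω) by ring, abs_mul,
        abs_of_pos (by positivity)]
      have := h0.le.trans hρ
      gcongr; exact h.2
    have e2 : a ^ 2 * (m : ℝ) ^ 2 ≤ ρ ^ 2 * Λ :=
      mul_le_mul (by linarith) hm (sq_nonneg _) (sq_nonneg _)
    have e3 : Del M a r * Λ ≤ 2 * ρ ^ 2 * Λ := by gcongr
    have e4 : 0 ≤ a ^ 2 * (m : ℝ) ^ 2 := by positivity
    have e5 : 0 ≤ Del M a r * Λ := by positivity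
    grind
  unfold V0deriv
  refine (abs_sub _ _).trans ?_
  rw [abs_div, abs_div, abs_mul, abs_of_pos (show 0 < (r ^ 2 + a ^ 2) ^ 2 by positivity),
    abs_of_pos (show 0 < (r ^ 2 + a ^ 2) ^ 3 by positivity), abs_of_pos (show 0 < 4 * r by positivity),
    add_mul]
  have hρ0 : 0 < ρ := h0.trans_le hρ
  refine add_le_add ?_ ?_
  · rw [div_mul_eq_mul_div]; gcongr
  · rw [div_mul_eq_mul_div]
    calc 4 * r * _ / _ ≤ 4 * ρ * ((4 * M * ρ + 3 * ρ ^ 2) * Λ) / M ^ 6 := by gcongr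
      _ = _ := by ring

end Basic

section Coercive
variable {M a : ℝ}

lemma Del_le {r ρ : ℝ} (ha : |a| < M) (hr : rPlus M a < r) (hρ : r ≤ ρ) :
    Del M a r ≤ 2 * ρ ^ 2 := by
  have hM := mass_pos ha
  have hMr := (mass_lt_rPlus ha).trans hr
  have ha2 := sq_le_of_rPlus_lt ha hr
  unfold Del; nlinarith

lemma B_le {r ρ : ℝ} (ha : |a| < M) (hr : rPlus M a < r) (hρ : r ≤ ρ) :
    r ^ 2 + a ^ 2 ≤ 2 * ρ ^ 2 := by
  have hM := mass_pos ha
  have hMr := (mass_lt_rPlus ha).trans hr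
  have ha2 := sq_le_of_rPlus_lt ha hr
  nlinarith

lemma V0_mul {r ω Λ : ℝ} {m : ℤ} (hr : 0 < r) : (r ^ 2 + a ^ 2) ^ 2 * V0 M a ω m Λ r
    = 4 * M * r * (a * m * ω) - (a * m) ^ 2 + Del M a r * Λ := by
  unfold V0
  field_simp

/-- Away from the superradiant regime, the elliptic set controls `Δ Λ`. -/
lemma coercive_of_le (ha : |a| < M) {ρ β γ : ℝ} (hρ0 : 0 < ρ) (hβ : 0 < β) (hγ : 0 < γ) :
    ∃ K : ℝ, 0 < K ∧ ∀ (ω : ℝ) (m : ℤ) (Λ r : ℝ), Admissible a ω m Λ → γ * |a * m| ≤ |ω| →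
      rPlus M a < r → r ≤ ρ → β * ω ^ 2 ≤ V0 M a ω m Λ r - ω ^ 2 →
      Del M a r * Λ + ω ^ 2 ≤ K * (V0 M a ω m Λ r - ω ^ 2) ∧
      V0 M a ω m Λ r - ω ^ 2 ≤ K * (Del M a r * Λ + ω ^ 2) := by
  have hM := mass_pos ha
  set K1 := 4 * M * ρ / γ + (1 / γ) ^ 2 with hK1
  have hK1p : 0 < K1 := by positivity
  set K2 := (2 * ρ ^ 2) ^ 2 + (K1 + (2 * ρ ^ 2) ^ 2) / β + 1 / β
  have hK2 : 0 < K2 := by positivity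
  set K3 := (1 + K1) / M ^ 4
  have hK3 : 0 < K3 := by positivity
  refine ⟨K2 + K3, by positivity, ?_⟩
  intro ω m Λ r had hω hr hρ hW
  have hMr := (mass_lt_rPlus ha).trans hr
  have h0 : 0 < r := hM.trans hMr
  have hB := B_le ha hr hρ
  have hΛ := had.nonneg
  have hD := Del_pos ha hr
  have hDΛ : 0 ≤ Del M a r * Λ := by positivity
  have e := V0_mul (M := M) (a := a) (ω := ω) (Λ := Λ) (m := m) h0
  set W := V0 M a ω m Λ r - ω ^ 2 with hWdef
  have hW0 : 0 ≤ W := le_trans (by positivity) hW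
  have ham : |a * m| ≤ |ω| / γ := by rw [le_div_iff₀ hγ]; linarith
  have ham2 : (a * m) ^ 2 ≤ (1 / γ) ^ 2 * ω ^ 2 := by
    rw [← sq_abs (a * m), ← sq_abs ω, ← mul_pow]
    gcongr; grind
  have hamω : |a * m * ω| ≤ 1 / γ * ω ^ 2 := by
    rw [abs_mul, ← sq_abs ω, sq, ← mul_assoc]
    gcongr; grind
  have h4 : |4 * M * r * (a * m * ω)| ≤ 4 * M * ρ / γ * ω ^ 2 := by
    rw [abs_mul, abs_of_pos (show 0 < 4 * M * r by positivity)]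
    calc _ ≤ 4 * M * ρ * (1 / γ * ω ^ 2) := by gcongr
      _ = _ := by ring
  have h4' := abs_le.1 h4
  have hω2 : ω ^ 2 ≤ W / β := by rw [le_div_iff₀ hβ]; linarith
  have hBp : 0 ≤ (r ^ 2 + a ^ 2) ^ 2 := by positivity
  have hB2 : (r ^ 2 + a ^ 2) ^ 2 ≤ (2 * ρ ^ 2) ^ 2 := by gcongr
  constructor
  · have h5 : Del M a r * Λ ≤ (r ^ 2 + a ^ 2) ^ 2 * W + (r ^ 2 + a ^ 2) ^ 2 * ω ^ 2 + K1 * ω ^ 2 := by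
      linarith
    have h6 : (r ^ 2 + a ^ 2) ^ 2 * W ≤ (2 * ρ ^ 2) ^ 2 * W := by gcongr
    have h7 : (r ^ 2 + a ^ 2) ^ 2 * ω ^ 2 ≤ (2 * ρ ^ 2) ^ 2 * (W / β) := by gcongr
    have h8 : K1 * ω ^ 2 ≤ K1 * (W / β) := by gcongr
    calc _ ≤ K2 * W := by
            grind
      _ ≤ _ := by linarith [add_mul K2 K3 W, mul_nonneg hK3.le hW0]
  · have hM4 : M ^ 4 ≤ (r ^ 2 + a ^ 2) ^ 2 := by
      calc M ^ 4 = (M ^ 2) ^ 2 := by ring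
        _ ≤ _ := by gcongr; nlinarith [sq_nonneg a]
    have h5 : (r ^ 2 + a ^ 2) ^ 2 * W ≤ (1 + K1) * (Del M a r * Λ + ω ^ 2) := by
      have : 0 ≤ (1 / γ) ^ 2 * ω ^ 2 := by positivity
      have : 0 ≤ K1 * (Del M a r * Λ) := by positivity
      have h9 : 0 ≤ (r ^ 2 + a ^ 2) ^ 2 * ω ^ 2 := by positivity
      have : K1 * ω ^ 2 = 4 * M * ρ / γ * ω ^ 2 + (1 / γ) ^ 2 * ω ^ 2 := by rw [hK1]; ring
      have h10 := sq_nonneg (a * m)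
      have h11 := sq_nonneg ω
      linarith
    have h6 : M ^ 4 * W ≤ (r ^ 2 + a ^ 2) ^ 2 * W := by gcongr
    have h7 : W ≤ K3 * (Del M a r * Λ + ω ^ 2) := by
      simp only [K3]; rw [div_mul_eq_mul_div, le_div_iff₀ (by positivity)]; linarith
    have : 0 ≤ K2 * (Del M a r * Λ + ω ^ 2) := by positivity
    linarith

set_option maxHeartbeats 1000000 in
/-- In the remaining range the potential is coercive to the right of `r = 2.0097 M`. -/
lemma coercive_of_small (ha : |a| < M) {ρ : ℝ} (hρ0 : 0 < ρ) :
    ∃ ε K : ℝ, 0 < ε ∧ 0 < K ∧ ∀ (ω : ℝ) (m : ℤ) (Λ r : ℝ), Admissible a ω m Λ →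
      |ω| ≤ ε * |a * m| →
      2.0097 * M ≤ r → r ≤ ρ →
      Del M a r * Λ + ω ^ 2 ≤ K * (V0 M a ω m Λ r - ω ^ 2) ∧
      V0 M a ω m Λ r - ω ^ 2 ≤ K * (Del M a r * Λ + ω ^ 2) := by
  have hM := mass_pos ha
  have hrp := rPlus_le ha
  set E := 4 * M * ρ + 4 * ρ ^ 4 with hE
  have hE0 : 0 < E := by positivity
  set ε := min 1 (0.009 / E)
  have hε : 0 < ε := by positivity
  have hε1 : ε ≤ 1 := min_le_left _ _
  have hεE : ε * E ≤ 0.009 := by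
    have : ε ≤ 0.009 / E := min_le_right _ _
    rwa [le_div_iff₀ hE0] at this
  set K1 := (2 * ρ ^ 2 + M ^ 2) * (4 * ρ ^ 4) / (0.01 * M ^ 2) with hK1
  set K2 := (4 * M * ρ + 2 * ρ ^ 2) / M ^ 4 / (0.019 * M ^ 2) with hK2
  have hK1p : 0 < K1 := by positivity
  have hK2p : 0 < K2 := by positivity
  refine ⟨ε, K1 + K2, hε, by positivity, ?_⟩
  intro ω m Λ r had hω hr hρ
  have hrp' : rPlus M a < r := by linarith
  have hMr := (mass_lt_rPlus ha).trans hrp'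
  have h0 : 0 < r := hM.trans hMr
  have hB := B_le ha hrp' hρ
  have hΛ := had.nonneg
  have hm := had.sq_le
  have hD := Del_pos ha hrp'
  have hDle := Del_le ha hrp' hρ
  have e := V0_mul (M := M) (a := a) (ω := ω) (Λ := Λ) (m := m) h0
  have ha2 : a ^ 2 ≤ M ^ 2 := by linarith [sq_sub_sq_pos ha]
  have ham : (a * m) ^ 2 ≤ M ^ 2 * Λ := by rw [mul_pow]; gcongr
  have ham0 := sq_nonneg (a * m)
  have hω2 : ω ^ 2 ≤ ε ^ 2 * (a * m) ^ 2 := by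
    rw [← sq_abs ω, ← sq_abs (a * m), ← mul_pow]; gcongr
  have hε2 : ε ^ 2 ≤ ε := by nlinarith
  have hω3 : ω ^ 2 ≤ ε * (M ^ 2 * Λ) := by
    calc ω ^ 2 ≤ _ := hω2
      _ ≤ ε * (M ^ 2 * Λ) := by gcongr
  have hamω : |a * m * ω| ≤ ε * (M ^ 2 * Λ) := by
    rw [abs_mul]
    calc _ ≤ |a * m| * (ε * |a * m|) := by gcongr
      _ = ε * (a * m) ^ 2 := by rw [← sq_abs (a * m)]; ring
      _ ≤ _ := by gcongr
  have h4 : |4 * M * r * (a * m * ω)| ≤ 4 * M * ρ * (ε * (M ^ 2 * Λ)) := by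
    rw [abs_mul, abs_of_pos (show 0 < 4 * M * r by positivity)]
    gcongr
  have h4' := abs_le.1 h4
  have hdr : 0.019 * M ^ 2 ≤ Del M a r - a ^ 2 := by
    have h1 : 0.0097 * M ≤ r - 2 * M := by linarith
    have h2 : 2.0097 * M * (0.0097 * M) ≤ r * (r - 2 * M) := by gcongr
    have h3 : Del M a r - a ^ 2 = r * (r - 2 * M) := by unfold Del; ring
    rw [h3]; linarith [sq_nonneg M]
  have hB2 : (r ^ 2 + a ^ 2) ^ 2 ≤ 4 * ρ ^ 4 := by
    calc _ ≤ (2 * ρ ^ 2) ^ 2 := by gcongr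
      _ = _ := by ring
  have hBω : (r ^ 2 + a ^ 2) ^ 2 * ω ^ 2 ≤ 4 * ρ ^ 4 * (ε * (M ^ 2 * Λ)) := by gcongr
  have hML : 0 ≤ M ^ 2 * Λ := by positivity
  set W := V0 M a ω m Λ r - ω ^ 2 with hWdef
  have key : 0.01 * M ^ 2 * Λ ≤ (r ^ 2 + a ^ 2) ^ 2 * W := by
    have h1 : (a * m) ^ 2 ≤ a ^ 2 * Λ := by rw [mul_pow]; gcongr
    have h2 : 0.019 * M ^ 2 * Λ ≤ Del M a r * Λ - a ^ 2 * Λ := by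
      rw [← sub_mul]; gcongr
    have h3 : ε * E * (M ^ 2 * Λ) ≤ 0.009 * (M ^ 2 * Λ) := by gcongr
    have h4 : ε * E * (M ^ 2 * Λ) = 4 * M * ρ * (ε * (M ^ 2 * Λ)) + 4 * ρ ^ 4 * (ε * (M ^ 2 * Λ)) := by
      rw [hE]; ring
    rw [hWdef, mul_sub, e]; linarith [h4'.1]
  have hW0 : 0 ≤ W := by
    have : 0 ≤ (r ^ 2 + a ^ 2) ^ 2 * W := le_trans (by positivity) key
    exact nonneg_of_mul_nonneg_right this (by positivity)
  have hωM : ω ^ 2 ≤ M ^ 2 * Λ := hω3.trans (mul_le_of_le_one_left hML hε1)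
  constructor
  · have h1 : 0.01 * M ^ 2 * Λ ≤ 4 * ρ ^ 4 * W := key.trans (by gcongr)
    have h2 : Del M a r * Λ + ω ^ 2 ≤ (2 * ρ ^ 2 + M ^ 2) * Λ := by
      have : Del M a r * Λ ≤ 2 * ρ ^ 2 * Λ := by gcongr
      linarith
    have h3 : Λ ≤ 4 * ρ ^ 4 * W / (0.01 * M ^ 2) := by
      rw [le_div_iff₀ (by positivity)]; linarith
    have h5 : (2 * ρ ^ 2 + M ^ 2) * Λ ≤ K1 * W := by
      calc _ ≤ (2 * ρ ^ 2 + M ^ 2) * (4 * ρ ^ 4 * W / (0.01 * M ^ 2)) := by gcongr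
        _ = _ := by rw [hK1]; ring
    have : 0 ≤ K2 * W := by positivity
    linarith [add_mul K1 K2 W]
  · have hM4 : M ^ 4 ≤ (r ^ 2 + a ^ 2) ^ 2 := by
      calc M ^ 4 = (M ^ 2) ^ 2 := by ring
        _ ≤ _ := by gcongr; nlinarith [sq_nonneg a]
    have h1 : M ^ 4 * W ≤ (r ^ 2 + a ^ 2) ^ 2 * W := by gcongr
    have h2 : (r ^ 2 + a ^ 2) ^ 2 * W ≤ (4 * M * ρ + 2 * ρ ^ 2) * Λ := by
      have e2 : 4 * M * r * (a * m * ω) ≤ 4 * M * ρ * Λ := by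
        have : 4 * M * r * (a * m * ω) ≤ 4 * M * r * Λ := by
          gcongr; exact (abs_le.1 had.2).2
        have h' : 4 * M * r * Λ ≤ 4 * M * ρ * Λ := by gcongr
        linarith
      have e3 : Del M a r * Λ ≤ 2 * ρ ^ 2 * Λ := by gcongr
      have : 0 ≤ (r ^ 2 + a ^ 2) ^ 2 * ω ^ 2 := by positivity
      rw [hWdef, mul_sub, e]; linarith
    have h3 : Λ ≤ Del M a r * Λ / (0.019 * M ^ 2) := by
      rw [le_div_iff₀ (by positivity)]
      have : 0.019 * M ^ 2 * Λ ≤ Del M a r * Λ := by gcongr; linarith [sq_nonneg a]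
      linarith
    have h5 : W ≤ K2 * (Del M a r * Λ) := by
      have : W ≤ (4 * M * ρ + 2 * ρ ^ 2) * Λ / M ^ 4 := by
        rw [le_div_iff₀ (by positivity)]; linarith
      refine this.trans ?_
      calc _ ≤ (4 * M * ρ + 2 * ρ ^ 2) * (Del M a r * Λ / (0.019 * M ^ 2)) / M ^ 4 := by gcongr
        _ = _ := by rw [hK2]; ring
    have : 0 ≤ K1 * (Del M a r * Λ + ω ^ 2) := by positivity
    have : 0 ≤ K2 * ω ^ 2 := by positivity
    linarith [add_mul K1 K2 (Del M a r * Λ + ω ^ 2), mul_add K2 (Del M a r * Λ) (ω ^ 2)]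

lemma coercive_elliptic (ha : |a| < M) {ρ β γ : ℝ} (hρ0 : 0 < ρ) (hβ : 0 < β) (hγ : 0 < γ) :
    ∃ K : ℝ, 0 < K ∧ ∀ (ω : ℝ) (m : ℤ) (Λ r : ℝ), Admissible a ω m Λ →
      max (0.99 * rElliptic M a γ ω m) (rPlus M a) < r → r ≤ ρ →
      β * ω ^ 2 ≤ V0 M a ω m Λ r - ω ^ 2 →
      Del M a r * Λ + ω ^ 2 ≤ K * (V0 M a ω m Λ r - ω ^ 2) ∧
      V0 M a ω m Λ r - ω ^ 2 ≤ K * (Del M a r * Λ + ω ^ 2) := by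
  obtain ⟨ε, K1, hε, hK1, H1⟩ := coercive_of_small ha hρ0
  obtain ⟨K2, hK2, H2⟩ := coercive_of_le ha hρ0 hβ (lt_min hε hγ)
  have hM := mass_pos ha
  refine ⟨max K1 K2, by positivity, ?_⟩
  intro ω m Λ r had hr hρ hW
  obtain ⟨hr1, hr2⟩ := max_lt_iff.1 hr
  have hW0 : 0 ≤ V0 M a ω m Λ r - ω ^ 2 := le_trans (by positivity) hW
  have hD0 : 0 ≤ Del M a r * Λ + ω ^ 2 := by
    have := Del_pos ha hr2; have := had.nonneg; positivity
  have fin : ∀ K, K ≤ max K1 K2 → (Del M a r * Λ + ω ^ 2 ≤ K * (V0 M a ω m Λ r - ω ^ 2) ∧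
      V0 M a ω m Λ r - ω ^ 2 ≤ K * (Del M a r * Λ + ω ^ 2)) →
      (Del M a r * Λ + ω ^ 2 ≤ max K1 K2 * (V0 M a ω m Λ r - ω ^ 2) ∧
      V0 M a ω m Λ r - ω ^ 2 ≤ max K1 K2 * (Del M a r * Λ + ω ^ 2)) := by
    intro K hK h
    exact ⟨h.1.trans (by gcongr), h.2.trans (by gcongr)⟩
  by_cases hc : min ε γ * |a * m| ≤ |ω|
  · grind
  · refine fin K1 (le_max_left _ _) (H1 ω m Λ r had ?_ ?_ hρ)
    · push Not at hc
      exact hc.le.trans (by gcongr; simp)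
    · have : rElliptic M a γ ω m = 2.03 * M := by
        unfold rElliptic
        rw [if_neg]
        rintro (h | h | h)
        · simp [h] at hc
        · simp [h] at hc
        · apply hc
          by_cases h0 : a * m = 0
          · simp [h0]
          · rw [abs_div, le_div_iff₀ (abs_pos.2 h0)] at h
            exact le_trans (by gcongr; simp) h
      linarith

end Coercive

set_option maxHeartbeats 1000000 in
/-- The algebraic inequality behind the elliptic multiplier. -/
lemma multiplier_pointwise {K Δ η y D W Δs ηs Ds Ws q ι : ℝ} {u v G : ℂ} (hK : 0 ≤ K)
    (hΔ : 0 < Δ) (hD : 0 < D) (hη : 0 ≤ η) (hη1 : η ≤ 1) (hy : 0 ≤ y) (hq : 0 ≤ q)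
    (hΔs : |Δs| ≤ K * Δ) (hηs : |ηs| ≤ K) (hDs : |Ds| ≤ K * D)
    (hpos : 0 < y → ι = 1 ∧ |Ws| ≤ K * D ∧ D ≤ K * W ∧ W ≤ K * D ∧ y ≤ W) (hι : 0 ≤ ι)
    {f fs : ℝ} (hf : f = Δ * η ^ 2 * y ^ 2 / D)
    (hfs : fs = ((Δs * η ^ 2 + 2 * Δ * η * ηs) * D - Δ * η ^ 2 * Ds) / D ^ 2 * y ^ 2
      + Δ * η ^ 2 / D * (2 * y * Ws)) :
    1 / 2 * (f * W * ‖u‖ ^ 2) ≤ (fs * inner ℝ u v + f * (‖v‖ ^ 2 + inner ℝ u ((W + q) • u + G)))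
      + ((4 * K ^ 2 + 2 * K) ^ 2 + K) * (ι * (Δ * (D * ‖u‖ ^ 2 + ‖G‖ ^ 2))) := by
  rcases hy.eq_or_lt with h0 | hy0
  · subst hf hfs
    simp only [← h0]
    have : 0 ≤ ((4 * K ^ 2 + 2 * K) ^ 2 + K) * (ι * (Δ * (D * ‖u‖ ^ 2 + ‖G‖ ^ 2))) := by positivity
    simpa using this
  obtain ⟨hι1, hWs, hDW, hWD, hyW⟩ := hpos hy0
  have hW : 0 < W := hy0.trans_le hyW
  have hf0 : 0 ≤ f := by rw [hf]; positivity
  set C := 4 * K ^ 2 + 2 * K with hC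
  have hC0 : 0 ≤ C := by positivity
  have hyD : y ≤ K * D := hyW.trans hWD
  have hηη : η ^ 2 ≤ η := by nlinarith
  have hfs' : |fs| ≤ C * (Δ * η * y) := by
    have e : fs = y / D * (Δs * η ^ 2 * y + 2 * Δ * η * ηs * y - Δ * η ^ 2 * y * (Ds / D)
        + Δ * η ^ 2 * (2 * Ws)) := by rw [hfs]; field_simp
    have hdd : |Ds / D| ≤ K := by rw [abs_div, abs_of_pos hD, div_le_iff₀ hD]; exact hDs
    have e1 : |Δs * η ^ 2 * y| ≤ (K * Δ) * η * (K * D) := by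
      rw [abs_mul, abs_mul, abs_of_nonneg hy, abs_of_nonneg (sq_nonneg η)]
      gcongr
    have e2 : |2 * Δ * η * ηs * y| ≤ 2 * Δ * η * K * (K * D) := by
      rw [abs_mul, abs_mul, abs_of_nonneg hy, abs_of_nonneg (show 0 ≤ 2 * Δ * η by positivity)]
      gcongr
    have e3 : |Δ * η ^ 2 * y * (Ds / D)| ≤ Δ * η * (K * D) * K := by
      rw [abs_mul, abs_of_nonneg (show 0 ≤ Δ * η ^ 2 * y by positivity)]
      gcongr
    have e4 : |Δ * η ^ 2 * (2 * Ws)| ≤ Δ * η * (2 * (K * D)) := by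
      rw [abs_mul, abs_mul 2, abs_of_nonneg (show 0 ≤ Δ * η ^ 2 by positivity), abs_two]
      gcongr
    rw [e, abs_mul, abs_of_pos (show 0 < y / D by positivity)]
    calc _ ≤ y / D * ((K * Δ) * η * (K * D) + 2 * Δ * η * K * (K * D) + Δ * η * (K * D) * K
          + Δ * η * (2 * (K * D))) := by
          gcongr
          refine (abs_add_le _ _).trans (add_le_add ((abs_sub _ _).trans (add_le_add ((abs_add_le _ _).trans (add_le_add e1 e2)) e3)) e4)
      _ = _ := by rw [hC]; field_simp; ring
  have hI1 : |fs * inner ℝ u v| ≤ C * (Δ * η * y) * (‖u‖ * ‖v‖) := by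
    rw [abs_mul]; gcongr; exact abs_real_inner_le_norm u v
  have hA : C * (Δ * η * y) * (‖u‖ * ‖v‖) ≤ f * ‖v‖ ^ 2 + C ^ 2 * (Δ * (D * ‖u‖ ^ 2)) := by
    have h1 : 2 * ((η * y * ‖v‖) * (C * D * ‖u‖)) ≤ (η * y * ‖v‖) ^ 2 + (C * D * ‖u‖) ^ 2 :=
      by linarith [two_mul_le_add_sq (η * y * ‖v‖) (C * D * ‖u‖)]
    have h2 : 0 ≤ (η * y * ‖v‖) * (C * D * ‖u‖) := by positivity
    have e1 : C * (Δ * η * y) * (‖u‖ * ‖v‖) = Δ / D * ((η * y * ‖v‖) * (C * D * ‖u‖)) := by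
      field_simp
    have e2 : f * ‖v‖ ^ 2 + C ^ 2 * (Δ * (D * ‖u‖ ^ 2))
        = Δ / D * ((η * y * ‖v‖) ^ 2 + (C * D * ‖u‖) ^ 2) := by rw [hf]; field_simp
    rw [e1, e2]; gcongr; linarith
  have hI2 : |inner ℝ u G| ≤ ‖u‖ * ‖G‖ := abs_real_inner_le_norm u G
  have hfW : f ≤ K * Δ * W := by
    rw [hf, div_le_iff₀ hD]
    have h1 : η ^ 2 ≤ 1 := hηη.trans hη1
    have h2 : y ^ 2 ≤ y * W := by rw [sq]; gcongr
    calc Δ * η ^ 2 * y ^ 2 ≤ Δ * 1 * (y * W) := by gcongr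
      _ ≤ Δ * 1 * ((K * D) * W) := by gcongr
      _ = _ := by ring
  have hB : f * (‖u‖ * ‖G‖) ≤ 1 / 2 * (f * W * ‖u‖ ^ 2) + K * (Δ * ‖G‖ ^ 2) := by
    have h1 : 2 * ((W * ‖u‖) * ‖G‖) ≤ (W * ‖u‖) ^ 2 + ‖G‖ ^ 2 := by
      linarith [two_mul_le_add_sq (W * ‖u‖) ‖G‖]
    have h2 : f * (‖u‖ * ‖G‖) ≤ f / (2 * W) * ((W * ‖u‖) ^ 2 + ‖G‖ ^ 2) := by
      calc _ = f / (2 * W) * (2 * ((W * ‖u‖) * ‖G‖)) := by field_simp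
        _ ≤ _ := by gcongr
    have h3 : f / (2 * W) * ((W * ‖u‖) ^ 2 + ‖G‖ ^ 2)
        = 1 / 2 * (f * W * ‖u‖ ^ 2) + f / (2 * W) * ‖G‖ ^ 2 := by field_simp
    have h4 : f / (2 * W) ≤ K * Δ := by
      rw [div_le_iff₀ (by positivity)]; linarith [mul_nonneg (mul_nonneg hK hΔ.le) hW.le]
    have h5 : f / (2 * W) * ‖G‖ ^ 2 ≤ K * Δ * ‖G‖ ^ 2 := by gcongr
    linarith
  have e : inner ℝ u ((W + q) • u + G) = (W + q) * ‖u‖ ^ 2 + inner ℝ u G := by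
    rw [inner_add_right, inner_smul_right, real_inner_self_eq_norm_sq]
  rw [e, hι1]
  have h1 := (abs_le.1 hI1).1
  have h2 : -(f * (‖u‖ * ‖G‖)) ≤ f * inner ℝ u G := by
    have := mul_le_mul_of_nonneg_left (abs_le.1 hI2).1 hf0; linarith
  have h3 : 0 ≤ f * (q * ‖u‖ ^ 2) := by positivity
  have h4 : 0 ≤ K * (Δ * (D * ‖u‖ ^ 2)) := by positivity
  have h5 : 0 ≤ C ^ 2 * (Δ * ‖G‖ ^ 2) := by positivity
  have e6 : (C ^ 2 + K) * (1 * (Δ * (D * ‖u‖ ^ 2 + ‖G‖ ^ 2))) = C ^ 2 * (Δ * (D * ‖u‖ ^ 2))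
    + C ^ 2 * (Δ * ‖G‖ ^ 2) + K * (Δ * (D * ‖u‖ ^ 2)) + K * (Δ * ‖G‖ ^ 2) := by ring
  have e7 : f * (‖v‖ ^ 2 + ((W + q) * ‖u‖ ^ 2 + inner ℝ u G)) = f * ‖v‖ ^ 2 + f * W * ‖u‖ ^ 2
    + f * (q * ‖u‖ ^ 2) + f * inner ℝ u G := by ring
  rw [e6, e7]
  linarith

lemma hasDerivAt_max_zero_sq (t : ℝ) : HasDerivAt (fun x : ℝ => max x 0 ^ 2) (2 * max t 0) t := by
  rw [hasDerivAt_iff_isLittleO]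
  refine Asymptotics.IsBigO.trans_isLittleO (.of_bound 1 (.of_forall fun x => ?_)) (Asymptotics.isLittleO_pow_sub_sub t one_lt_two)
  rw [norm_pow, norm_norm, norm_eq_abs, norm_eq_abs, sq_abs, abs_le, smul_eq_mul]
  rcases le_total x 0 with h | h <;> rcases le_total t 0 with h' | h' <;> simp only [max_eq_left, max_eq_right, h, h'] <;>
    constructor <;> nlinarith [sq_nonneg (x - t)]

section
variable {M a : ℝ}

lemma ofReal_integral_le {X : Type*} [MeasurableSpace X] {μ : Measure X} {f : X → ℝ} (hf : Integrable f μ) :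
    ofReal (∫ x, f x ∂μ) ≤ ∫⁻ x, ofReal (f x) ∂μ := by
  rw [integral_eq_lintegral_pos_part_sub_lintegral_neg_part hf]
  exact ENNReal.ofReal_le_of_le_toReal (sub_le_self _ ENNReal.toReal_nonneg)

set_option maxHeartbeats 4000000 in
/-- The multiplier estimate, integrated over a compact range of radii. -/
lemma multiplier_integrated (ha : |a| < M) {K β ω Λ α0 α1 : ℝ} {m : ℤ} {η η' : ℝ → ℝ} (hK : 0 ≤ K)
    (hβ : 0 < β) (hΛ : 0 ≤ Λ) (hne : Λ ≠ 0 ∨ ω ≠ 0) (hα : rPlus M a < α0) (hα' : α0 ≤ α1)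
    (hη : ∀ r, HasDerivAt η (η' r) r) (hη'c : Continuous η') (hη0 : ∀ r, 0 ≤ η r) (hη1 : ∀ r, η r ≤ 1)
    (hηα0 : η α0 = 0) (hηα1 : η α1 = 0)
    (hηs : ∀ r ∈ Icc α0 α1, |Del M a r / (r ^ 2 + a ^ 2) * η' r| ≤ K)
    (hΔs : ∀ r ∈ Icc α0 α1, |(2 * r - 2 * M) / (r ^ 2 + a ^ 2)| ≤ K)
    (hell : ∀ r ∈ Icc α0 α1, β * ω ^ 2 ≤ V0 M a ω m Λ r - ω ^ 2 →
      Del M a r * Λ + ω ^ 2 ≤ K * (V0 M a ω m Λ r - ω ^ 2) ∧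
      V0 M a ω m Λ r - ω ^ 2 ≤ K * (Del M a r * Λ + ω ^ 2))
    (hV0 : ∀ r ∈ Icc α0 α1, |V0deriv M a ω m Λ r| / (r ^ 2 + a ^ 2) ≤ K * Λ)
    {ρ : ℝ} (hρ : α1 < ρ) {u G : ℝ → ℂ} (hu : ContDiffOn ℝ 2 u (Ioo (rPlus M a) ρ))
    (hode : ∀ r ∈ Ioo (rPlus M a) ρ,
      dStar M a (dStar M a u) r + ((ω ^ 2 - Vfull M a ω m Λ r : ℝ) : ℂ) * u r = G r) :
    ∫⁻ r in Icc α0 α1, ofReal ((r ^ 2 + a ^ 2) / Del M a r * (1 / 2 * ((Del M a r * η r ^ 2 *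
        max (V0 M a ω m Λ r - ω ^ 2 - β * ω ^ 2) 0 ^ 2 / (Del M a r * Λ + ω ^ 2)) *
        (V0 M a ω m Λ r - ω ^ 2) * ‖u r‖ ^ 2)))
      ≤ ∫⁻ r in Icc α0 α1, ofReal ((r ^ 2 + a ^ 2) / Del M a r *
        (((4 * K ^ 2 + 2 * K) ^ 2 + K) * (iotaV M a β ω m Λ r *
          (Del M a r * ((Del M a r * Λ + ω ^ 2) * ‖u r‖ ^ 2 + ‖G r‖ ^ 2))))) := by
  have hM := mass_pos ha
  set I := Ioo (rPlus M a) ρ with hI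
  have hIo : IsOpen I := isOpen_Ioo
  have hsub : Icc α0 α1 ⊆ I := fun r hr => ⟨hα.trans_le hr.1, hr.2.trans_lt hρ⟩
  have hpos : ∀ r ∈ I, 0 < r := fun r hr => (rPlus_pos ha).trans hr.1
  have hB : ∀ r ∈ I, 0 < r ^ 2 + a ^ 2 := fun r hr => by have := hpos r hr; positivity
  have hDel : ∀ r ∈ I, 0 < Del M a r := fun r hr => Del_pos ha hr.1
  set W := fun r => V0 M a ω m Λ r - ω ^ 2 with hW
  set y := fun r => max (W r - β * ω ^ 2) 0 with hy
  set D := fun r => Del M a r * Λ + ω ^ 2 with hD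
  have hDpos : ∀ r ∈ I, 0 < D r := by
    intro r hr
    have := hDel r hr
    simp only [hD]
    rcases hne with h | h <;> positivity
  set f := fun r => Del M a r * η r ^ 2 * y r ^ 2 / D r with hf
  set fr := fun r => (((2 * r - 2 * M) * η r ^ 2 + 2 * Del M a r * η r * η' r) * D r
      - Del M a r * η r ^ 2 * ((2 * r - 2 * M) * Λ)) / D r ^ 2 * y r ^ 2
      + Del M a r * η r ^ 2 / D r * (2 * y r * V0deriv M a ω m Λ r) with hfr
  have hfd : ∀ r ∈ I, HasDerivAt f (fr r) r := by
    intro r hr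
    have h1 := hasDerivAt_Del (M := M) (a := a) (r := r)
    have h2 : HasDerivAt D ((2 * r - 2 * M) * Λ) r := (h1.mul_const Λ).add_const _
    have h3 : HasDerivAt (fun r => y r ^ 2) (2 * y r * V0deriv M a ω m Λ r) r := by
      have h4 : HasDerivAt (fun r => W r - β * ω ^ 2) (V0deriv M a ω m Λ r) r :=
        ((hasDerivAt_V0 (hpos r hr)).sub_const _).sub_const _
      exact (hasDerivAt_max_zero_sq (W r - β * ω ^ 2)).comp r h4
    have h5 := ((h1.mul ((hη r).pow 2)).div h2 (hDpos r hr).ne').mul h3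
    refine (h5.congr_deriv ?_).congr_of_eventuallyEq (.of_forall fun x => ?_)
    · simp only [hfr, Pi.mul_apply, Pi.div_apply, Pi.pow_apply]; push_cast; ring
    · simp [hf]; ring
  have hu1 : ∀ r ∈ I, HasDerivAt u (deriv u r) r := fun r hr =>
    ((hu.differentiableOn (by norm_num)).differentiableAt (hIo.mem_nhds hr)).hasDerivAt
  have hdu : ContDiffOn ℝ 1 (deriv u) I := ((contDiffOn_succ_iff_deriv_of_isOpen (n := 1) hIo).1 hu).2.2
  set v := dStar M a u with hv
  have hvC : ContDiffOn ℝ 1 v I := by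
    refine (ContDiffOn.div ?_ ?_ fun r hr => (hB r hr).ne').smul hdu
    · unfold Del; fun_prop
    · fun_prop
  have hv1 : ∀ r ∈ I, HasDerivAt v (deriv v r) r := fun r hr =>
    ((hvC.differentiableOn (by norm_num)).differentiableAt (hIo.mem_nhds hr)).hasDerivAt
  have hdv : ContinuousOn (deriv v) I := hvC.continuousOn_deriv_of_isOpen hIo le_rfl
  set P := fun r => f r * inner ℝ (u r) (v r) with hP
  set Pr := fun r => fr r * inner ℝ (u r) (v r)
    + f r * (inner ℝ (u r) (deriv v r) + inner ℝ (deriv u r) (v r)) with hPr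
  have hPd : ∀ r ∈ I, HasDerivAt P (Pr r) r := fun r hr =>
    (hfd r hr).mul ((hu1 r hr).inner ℝ (hv1 r hr))
  have hV0c : ContinuousOn (V0 M a ω m Λ) I := fun r hr =>
    (hasDerivAt_V0 (hpos r hr)).continuousAt.continuousWithinAt
  have hWc : ContinuousOn W I := hV0c.sub continuousOn_const
  have hyc : ContinuousOn y I := (hWc.sub continuousOn_const).sup continuousOn_const
  have hDelc : Continuous (Del M a) := by unfold Del; fun_prop
  have hDc : Continuous D := by simp only [hD]; fun_prop
  have hηc : Continuous η := continuous_iff_continuousAt.2 fun r => (hη r).continuousAt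
  have hV0dc : ContinuousOn (V0deriv M a ω m Λ) I := by
    have := fun r hr => pow_ne_zero 2 (hB r hr).ne'
    have := fun r hr => pow_ne_zero 3 (hB r hr).ne'
    unfold V0deriv; fun_prop (disch := assumption)
  have hfc : ContinuousOn f I := fun r hr => (hfd r hr).continuousAt.continuousWithinAt
  have hfrc : ContinuousOn fr I := by
    have := fun r hr => (hDpos r hr).ne'
    have := hDelc.continuousOn (s := I)
    have := hηc.continuousOn (s := I)
    have := hη'c.continuousOn (s := I)
    have := hDc.continuousOn (s := I)
    have := fun r hr => pow_ne_zero 2 (hDpos r hr).ne'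
    fun_prop (disch := assumption)
  have hPrc : ContinuousOn Pr I := by
    have := hu.continuousOn
    have := hdu.continuousOn
    have := hvC.continuousOn
    fun_prop
  have hint0 : ∫ r in α0..α1, Pr r = 0 := by
    rw [← uIcc_of_le hα'] at hsub
    rw [intervalIntegral.integral_eq_sub_of_hasDerivAt (fun r hr => hPd r (hsub hr)) (hPrc.mono hsub).intervalIntegrable]
    simp [hP, hf, hηα0, hηα1]
  set Ψ := fun r => (r ^ 2 + a ^ 2) / Del M a r *
        (((4 * K ^ 2 + 2 * K) ^ 2 + K) * (iotaV M a β ω m Λ r * (Del M a r * (D r * ‖u r‖ ^ 2 + ‖G r‖ ^ 2)))) with hΨ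
  have hpt : ∀ r ∈ Icc α0 α1, (r ^ 2 + a ^ 2) / Del M a r * (1 / 2 * (f r * W r * ‖u r‖ ^ 2))
      ≤ Pr r + Ψ r := by
    intro r hr
    have hrI := hsub hr
    have hBr := hB r hrI
    have hDr := hDel r hrI
    have hVd := hV0 r hr
    have hΔr := hΔs r hr
    rw [abs_div, abs_of_pos hBr] at hΔr
    have hq : ∀ s, |Del M a r / (r ^ 2 + a ^ 2) * s| = |s| / (r ^ 2 + a ^ 2) * Del M a r := fun s => by
      rw [abs_mul, abs_div, abs_of_pos hBr, abs_of_pos hDr]; ring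
    have key := multiplier_pointwise (K := K) (Δ := Del M a r) (η := η r) (y := y r) (D := D r) (W := W r)
      (Δs := Del M a r / (r ^ 2 + a ^ 2) * (2 * r - 2 * M))
      (ηs := Del M a r / (r ^ 2 + a ^ 2) * η' r)
      (Ds := Del M a r / (r ^ 2 + a ^ 2) * ((2 * r - 2 * M) * Λ))
      (Ws := Del M a r / (r ^ 2 + a ^ 2) * V0deriv M a ω m Λ r)
      (q := V1 M a r) (ι := iotaV M a β ω m Λ r) (u := u r) (v := v r) (G := -(-G r))
      (f := f r) (fs := Del M a r / (r ^ 2 + a ^ 2) * fr r)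
      hK hDr (hDpos r hrI) (hη0 r) (hη1 r) (le_max_right _ _) (V1_nonneg ha hrI.1)
      ?_ (hηs r hr) ?_ ?_ (by unfold iotaV; split_ifs <;> norm_num) rfl ?_
    · have e1 : Del M a r / (r ^ 2 + a ^ 2) * Pr r
          = Del M a r / (r ^ 2 + a ^ 2) * fr r * inner ℝ (u r) (v r)
            + f r * (‖v r‖ ^ 2 + inner ℝ (u r) ((W r + V1 M a r) • u r + - (-G r))) := by
        have e2 : (W r + V1 M a r) • u r + - (-G r) = (Del M a r / (r ^ 2 + a ^ 2)) • deriv v r := by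
          have := hode r hrI
          change (Del M a r / (r ^ 2 + a ^ 2)) • deriv v r + _ = _ at this
          rw [← this, Complex.real_smul]
          simp only [hW, Vfull]
          push_cast; ring
        rw [e2, inner_smul_right]
        have e3 : ‖v r‖ ^ 2 = Del M a r / (r ^ 2 + a ^ 2) * inner ℝ (deriv u r) (v r) := by
          rw [← real_inner_self_eq_norm_sq]
          exact inner_smul_left (𝕜 := ℝ) _ _ _
        rw [e3]; simp only [hPr]; ring
      rw [← e1, neg_neg] at key
      have h2 := mul_le_mul_of_nonneg_left key (show 0 ≤ (r ^ 2 + a ^ 2) / Del M a r by positivity)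
      exact h2.trans_eq (by simp only [hΨ]; field_simp)
    · rw [hq]; gcongr
    · rw [hq, abs_mul, abs_of_nonneg hΛ, mul_div_right_comm, mul_assoc]
      gcongr
      simp only [hD]; nlinarith [sq_nonneg ω]
    · intro hy0
      have h1 : β * ω ^ 2 < W r := by
        by_contra hcon
        push Not at hcon
        have : y r = 0 := max_eq_right (by linarith)
        linarith
      have h2 : β * ω ^ 2 ≤ V0 M a ω m Λ r - ω ^ 2 := h1.le
      obtain ⟨h3, h4⟩ := hell r hr h2
      refine ⟨by unfold iotaV; rw [if_pos h2], ?_, h3, h4, ?_⟩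
      · rw [hq]
        calc _ ≤ K * Λ * Del M a r := by gcongr
          _ ≤ _ := by rw [mul_assoc]; gcongr; simp only [hD]; nlinarith [sq_nonneg ω]
      · simp only [hy]
        have : 0 ≤ β * ω ^ 2 := by positivity
        exact max_le (by linarith) (by linarith)
    · have := hDpos r hrI
      simp only [hfr]; field_simp
  have hPri : IntegrableOn Pr (Icc α0 α1) := (hPrc.mono hsub).integrableOn_compact isCompact_Icc
  have hΦi : IntegrableOn (fun r => (r ^ 2 + a ^ 2) / Del M a r * (1 / 2 * (f r * W r * ‖u r‖ ^ 2))) (Icc α0 α1) := by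
    refine (ContinuousOn.mono ?_ hsub).integrableOn_compact isCompact_Icc
    have hBc : ContinuousOn (fun r => (r ^ 2 + a ^ 2) / Del M a r) I :=
      ContinuousOn.div (by fun_prop) (by fun_prop) fun r hr => (hDel r hr).ne'
    have := hu.continuousOn
    fun_prop
  have hΦ0 : ∀ r ∈ Icc α0 α1, 0 ≤ (r ^ 2 + a ^ 2) / Del M a r * (1 / 2 * (f r * W r * ‖u r‖ ^ 2)) := by
    intro r hr
    have hBr := hB r (hsub hr); have hDr := hDel r (hsub hr); have hD' := hDpos r (hsub hr)
    have h0 : 0 ≤ f r * W r := by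
      rcases le_or_gt (W r - β * ω ^ 2) 0 with h | h
      · simp only [hf, hy]; rw [max_eq_right h]; simp
      · have : 0 ≤ W r := by have : 0 ≤ β * ω ^ 2 := by positivity
                             linarith
        positivity
    positivity
  rw [← ofReal_integral_eq_lintegral_ofReal hΦi ((ae_restrict_iff' measurableSet_Icc).2 (Eventually.of_forall hΦ0)),
    ← sub_zero (∫ r in _, _), ← hint0, intervalIntegral.integral_of_le hα', ← integral_Icc_eq_integral_Ioc, ← integral_sub hΦi hPri]
  refine (ofReal_integral_le (hΦi.sub hPri)).trans (setLIntegral_mono_ae' measurableSet_Icc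
    (Eventually.of_forall fun r hr => ofReal_le_ofReal (sub_le_iff_le_add'.2 (hpt r hr))))

end

lemma deriv_smoothTransition_eq_zero {x : ℝ} (hx : x ≤ 0 ∨ 1 ≤ x) :
    deriv smoothTransition x = 0 := by
  rcases hx with hx | hx
  · refine IsLocalMin.deriv_eq_zero (Eventually.of_forall fun y => ?_)
    rw [Real.smoothTransition.zero_of_nonpos hx]; exact Real.smoothTransition.nonneg y
  · refine IsLocalMax.deriv_eq_zero (Eventually.of_forall fun y => ?_)
    rw [Real.smoothTransition.one_of_one_le hx]; exact Real.smoothTransition.le_one y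

lemma continuous_deriv_smoothTransition : Continuous (deriv smoothTransition) :=
  (Real.smoothTransition.contDiff (n := 1)).continuous_deriv (by norm_num)

lemma hasDerivAt_smoothTransition (x : ℝ) :
    HasDerivAt smoothTransition (deriv smoothTransition x) x :=
  ((Real.smoothTransition.contDiff (n := 1)).differentiable (by norm_num) x).hasDerivAt

lemma exists_deriv_smoothTransition_le :
    ∃ L : ℝ, 0 < L ∧ ∀ x, |deriv smoothTransition x| ≤ L := by
  obtain ⟨C, hC⟩ := isCompact_Icc.exists_bound_of_continuousOn (s := Icc (0 : ℝ) 1)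
    continuous_deriv_smoothTransition.continuousOn
  refine ⟨max C 1, by positivity, fun x => ?_⟩
  by_cases hx : x ∈ Icc (0 : ℝ) 1
  · simp_all
  · rw [deriv_smoothTransition_eq_zero]
    · simp
    grind

lemma setLIntegral_chain {s t v : Set ℝ} {P A B Q : ℝ → ℝ} {c d : ℝ} (hs : MeasurableSet s)
    (ht : MeasurableSet t) (hc : 0 ≤ c) (hd : 0 ≤ d) (hst : s ⊆ t) (htv : t ⊆ v)
    (hP : ∀ r ∈ s, P r ≤ c * A r) (h : ∫⁻ r in t, ofReal (A r) ≤ ∫⁻ r in t, ofReal (B r))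
    (hB : ∀ r ∈ t, B r ≤ d * Q r) :
    ∫⁻ r in s, ofReal (P r) ≤ ofReal (c * d) * ∫⁻ r in v, ofReal (Q r) := by
  rw [ofReal_mul hc, mul_assoc, ← lintegral_const_mul' _ _ ofReal_ne_top]
  refine (setLIntegral_mono' hs fun r hr => (ofReal_le_ofReal (hP r hr)).trans_eq (ofReal_mul hc)).trans
    ((lintegral_mono_set hst).trans ?_)
  rw [lintegral_const_mul' _ _ ofReal_ne_top]
  gcongr ofReal c * ?_
  exact h.trans ((setLIntegral_mono' ht fun r hr =>
    (ofReal_le_ofReal (hB r hr)).trans_eq (ofReal_mul hd)).trans (lintegral_mono_set htv))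

section
variable {M a : ℝ}

lemma sq_mass_le {r : ℝ} (ha : |a| < M) (hr : rPlus M a < r) : M ^ 2 ≤ r ^ 2 + a ^ 2 := by
  nlinarith [mass_lt_rPlus ha, mass_pos ha]

set_option maxHeartbeats 1000000 in
lemma elliptic_weight_le {b K C2 r ω Λ η : ℝ} {m : ℤ} {u : ℝ → ℂ} (hM : 0 < M) (hb : 0 < b) (hK : 0 < K)
    (hMr : M < r) (hDpos : 0 < Del M a r * Λ + ω ^ 2) (hB : 0 < r ^ 2 + a ^ 2) (hD : 0 < Del M a r)
    (hell : b / 2 * ω ^ 2 ≤ V0 M a ω m Λ r - ω ^ 2 →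
      Del M a r * Λ + ω ^ 2 ≤ K * (V0 M a ω m Λ r - ω ^ 2)) (hC2 : C2 = 8 * K / M ^ 2) (hη : η = 1) :
    Del M a r * (r ^ 2)⁻¹ * iotaV M a b ω m Λ r * (V0 M a ω m Λ r - ω ^ 2) ^ 2 * ‖u r‖ ^ 2
      * ((r ^ 2 + a ^ 2) / Del M a r) ≤
    C2 * ((r ^ 2 + a ^ 2) / Del M a r * (1 / 2 * ((Del M a r * η ^ 2 *
        max (V0 M a ω m Λ r - ω ^ 2 - b / 2 * ω ^ 2) 0 ^ 2 / (Del M a r * Λ + ω ^ 2)) *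
        (V0 M a ω m Λ r - ω ^ 2) * ‖u r‖ ^ 2))) := by
  have hC2p : 0 < C2 := by simp_all
  subst hη
  have hiota : iotaV M a b ω m Λ r = if b * ω ^ 2 ≤ V0 M a ω m Λ r - ω ^ 2 then 1 else 0 := by
    unfold iotaV; rfl
  generalize V0 M a ω m Λ r - ω ^ 2 = W at *
  generalize Del M a r * Λ + ω ^ 2 = D at *
  generalize Del M a r = Δ at *
  have hmain : (r ^ 2)⁻¹ * iotaV M a b ω m Λ r * W ^ 2
      ≤ C2 * (1 / 2 * (max (W - b / 2 * ω ^ 2) 0 ^ 2 / D * W)) := by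
    by_cases hc : b * ω ^ 2 ≤ W
    · have hω : 0 ≤ b * ω ^ 2 := by positivity
      have hW0 : 0 ≤ W := hω.trans hc
      have hDW : D ≤ K * W := hell (by linarith)
      have hW2 : W / 2 ≤ max (W - b / 2 * ω ^ 2) 0 := le_max_of_le_left (by linarith)
      have hWp : 0 < W := by
        by_contra hcon
        have : W = 0 := by linarith
        rw [this] at hDW; linarith
      have e1 : (W / 2) ^ 2 / (K * W) * W ≤ max (W - b / 2 * ω ^ 2) 0 ^ 2 / D * W := by gcongr
      have e2 : (W / 2) ^ 2 / (K * W) * W = W ^ 2 / (4 * K) := by field_simp; ring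
      have e3 : (r ^ 2)⁻¹ ≤ (M ^ 2)⁻¹ := by gcongr
      rw [hiota, if_pos hc, mul_one]
      calc (r ^ 2)⁻¹ * W ^ 2 ≤ (M ^ 2)⁻¹ * W ^ 2 := by gcongr
        _ = C2 * (1 / 2 * (W ^ 2 / (4 * K))) := by grind
        _ ≤ _ := by rw [← e2]; gcongr
    · rw [hiota, if_neg hc, mul_zero, zero_mul]
      rcases le_or_gt (W - b / 2 * ω ^ 2) 0 with h | h
      · simp_all
      · have : 0 ≤ W := by linarith
        positivity
  calc _ = (r ^ 2)⁻¹ * iotaV M a b ω m Λ r * W ^ 2 * (Δ * ‖u r‖ ^ 2 * ((r ^ 2 + a ^ 2) / Δ)) := by ring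
    _ ≤ C2 * (1 / 2 * (max (W - b / 2 * ω ^ 2) 0 ^ 2 / D * W)) * (Δ * ‖u r‖ ^ 2 * ((r ^ 2 + a ^ 2) / Δ)) := by
      gcongr
    _ = _ := by ring

set_option maxHeartbeats 1000000 in
lemma source_weight_le {ρ C1 C3 r ω Λ ι : ℝ} {u G : ℝ → ℂ} (ha : |a| < M) (h1 : rPlus M a < r)
    (h2 : r ≤ ρ) (hΛ : 0 ≤ Λ) (hC1 : 0 ≤ C1) (hι : 0 ≤ ι) (hC3 : C3 = ρ ^ 2 * (2 * ρ ^ 2 + 1)) :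
    (r ^ 2 + a ^ 2) / Del M a r * (C1 * (ι *
          (Del M a r * ((Del M a r * Λ + ω ^ 2) * ‖u r‖ ^ 2 + ‖G r‖ ^ 2)))) ≤
    C1 * C3 * (Del M a r * (r ^ 2)⁻¹ * ι * ((ω ^ 2 + Λ) * ‖u r‖ ^ 2 + ‖G r‖ ^ 2)
      * ((r ^ 2 + a ^ 2) / Del M a r)) := by
  have hM := mass_pos ha
  have hD := Del_pos ha h1
  have hMr := (mass_lt_rPlus ha).trans h1
  have hr0 : 0 < r := hM.trans hMr
  have hDle := Del_le ha h1 h2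
  generalize Del M a r = Δ at *
  have hU : 0 ≤ ‖u r‖ ^ 2 := sq_nonneg _
  have hV : 0 ≤ ‖G r‖ ^ 2 := sq_nonneg _
  generalize ‖u r‖ ^ 2 = U at *
  generalize ‖G r‖ ^ 2 = V at *
  have hq : 0 < (r ^ 2 + a ^ 2) / Δ := by positivity
  have e1 : Δ * Λ + ω ^ 2 ≤ (2 * ρ ^ 2 + 1) * (ω ^ 2 + Λ) := by
    have : Δ * Λ ≤ 2 * ρ ^ 2 * Λ := by gcongr
    have : 0 ≤ 2 * ρ ^ 2 * ω ^ 2 := by positivity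
    linarith
  have e2 : 1 ≤ ρ ^ 2 * (r ^ 2)⁻¹ := by
    rw [← div_eq_mul_inv, le_div_iff₀ (by positivity), one_mul]; gcongr
  have e3 : (Δ * Λ + ω ^ 2) * U + V ≤ C3 * ((r ^ 2)⁻¹ * ((ω ^ 2 + Λ) * U + V)) := by
    have h6 : (Δ * Λ + ω ^ 2) * U ≤ (2 * ρ ^ 2 + 1) * (ω ^ 2 + Λ) * U := by gcongr
    have h7 : 0 ≤ 2 * ρ ^ 2 * V := by positivity
    calc _ ≤ 1 * ((2 * ρ ^ 2 + 1) * ((ω ^ 2 + Λ) * U + V)) := by linarith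
      _ ≤ (ρ ^ 2 * (r ^ 2)⁻¹) * ((2 * ρ ^ 2 + 1) * ((ω ^ 2 + Λ) * U + V)) := by gcongr
      _ = _ := by rw [hC3]; ring
  calc _ = ((r ^ 2 + a ^ 2) / Δ) * C1 * ι * Δ * ((Δ * Λ + ω ^ 2) * U + V) := by ring
    _ ≤ ((r ^ 2 + a ^ 2) / Δ) * C1 * ι * Δ * (C3 * ((r ^ 2)⁻¹ * ((ω ^ 2 + Λ) * U + V))) := by
      gcongr
    _ = _ := by ring

set_option maxHeartbeats 2000000 in
lemma fixed_frequency_core (ha : |a| < M) {Rpot b γ ρ K0 : ℝ} (hR : 5 * M < Rpot) (hb : 0 < b)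
    (hγ : 0 < γ) (hρ : 1.3 * Rpot < ρ) (hK0 : 0 < K0) :
    ∃ C : ℝ, 0 < C ∧ ∀ (ω : ℝ) (m : ℤ) (Λ : ℝ), Admissible a ω m Λ → ∀ α α' : ℝ, α < α' →
      α' ≤ 1.2 * Rpot → max (0.99 * rElliptic M a γ ω m) (rPlus M a) < α →
      (∀ r ∈ Ioo α α', Del M a r / (r ^ 2 + a ^ 2) * (1 / (α' - α)) ≤ K0) →
      ∀ u G : ℝ → ℂ, ContDiffOn ℝ 2 u (Ioo (rPlus M a) ρ) →
      (∀ r ∈ Ioo (rPlus M a) ρ,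
        dStar M a (dStar M a u) r + ((ω ^ 2 - Vfull M a ω m Λ r : ℝ) : ℂ) * u r = G r) →
      lintStar M a (Ioc α' (1.2 * Rpot))
              (fun r => Del M a r * (r ^ 2)⁻¹ * iotaV M a b ω m Λ r
                * (V0 M a ω m Λ r - ω ^ 2) ^ 2 * ‖u r‖ ^ 2)
            ≤ ofReal C *
              lintStar M a
                (Ioc (max (0.99 * rElliptic M a γ ω m) (rPlus M a)) (1.3 * Rpot))
                (fun r => Del M a r * (r ^ 2)⁻¹ * iotaV M a (b / 2) ω m Λ r
                  * ((ω ^ 2 + Λ) * ‖u r‖ ^ 2 + ‖G r‖ ^ 2)) := by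
  have hM := mass_pos ha
  have hρ0 : 0 < ρ := by linarith
  have hR0 : 0 < Rpot := by linarith
  obtain ⟨L, hL, hLb⟩ := exists_deriv_smoothTransition_le
  obtain ⟨Ke, hKe, hell⟩ := coercive_elliptic ha hρ0 (half_pos hb) hγ
  set Kη := L * K0 + L / (0.1 * Rpot) * (2 * ρ ^ 2 / M ^ 2)
  set Kv := ((4 * M + 4 * ρ) / M ^ 4 + 4 * ρ * (4 * M * ρ + 3 * ρ ^ 2) / M ^ 6) / M ^ 2
  have hKη : 0 < Kη := by positivity
  have hKv : 0 < Kv := by positivity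
  have hKs : 0 < 4 * ρ / M ^ 2 := by positivity
  obtain ⟨K, hK, hKdef⟩ : ∃ K, 0 < K ∧ K = Ke + Kη + Kv + 4 * ρ / M ^ 2 := ⟨_, by positivity, rfl⟩
  obtain ⟨C1, hC1, hC1def⟩ : ∃ C, 0 < C ∧ C = (4 * K ^ 2 + 2 * K) ^ 2 + K := ⟨_, by positivity, rfl⟩
  obtain ⟨C2, hC2, hC2def⟩ : ∃ C, 0 < C ∧ C = 8 * K / M ^ 2 := ⟨_, by positivity, rfl⟩
  obtain ⟨C3, hC3, hC3def⟩ : ∃ C, 0 < C ∧ C = ρ ^ 2 * (2 * ρ ^ 2 + 1) := ⟨_, by positivity, rfl⟩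
  refine ⟨C2 * (C1 * C3), by positivity, ?_⟩
  intro ω m Λ had α α' hαα hα' hα hcut u G hu hode
  set r₀ := max (0.99 * rElliptic M a γ ω m) (rPlus M a) with hr₀
  have hrp : rPlus M a ≤ r₀ := le_max_right _ _
  have hΛ := had.nonneg
  by_cases hne : Λ ≠ 0 ∨ ω ≠ 0
  swap
  · push Not at hne
    have hm : (m : ℝ) = 0 := by
      have := had.sq_le; rw [hne.1] at this
      exact pow_eq_zero_iff (two_ne_zero) |>.1 (le_antisymm this (sq_nonneg _))
    have : ∀ r, V0 M a ω m Λ r - ω ^ 2 = 0 := by intro r; simp [V0, hne.1, hne.2, hm]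
    simp [lintStar, this]
  set Lr := 0.1 * Rpot with hLr
  have hLr0 : 0 < Lr := by positivity
  set R1 := 1.3 * Rpot with hR1
  set S := smoothTransition with hS
  set η : ℝ → ℝ := fun r => S ((r - α) / (α' - α)) * S ((R1 - r) / Lr) with hη
  set η' : ℝ → ℝ := fun r => deriv S ((r - α) / (α' - α)) * (1 / (α' - α)) * S ((R1 - r) / Lr)
    + S ((r - α) / (α' - α)) * (deriv S ((R1 - r) / Lr) * (-1 / Lr)) with hη'
  have hαpos : 0 < α' - α := by linarith
  have hηd : ∀ r, HasDerivAt η (η' r) r := by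
    intro r
    have h1 : HasDerivAt (fun r => (r - α) / (α' - α)) (1 / (α' - α)) r :=
      ((hasDerivAt_id r).sub_const α).div_const _
    have h2 : HasDerivAt (fun r => (R1 - r) / Lr) (-1 / Lr) r :=
      ((hasDerivAt_id r).const_sub R1).div_const _
    exact ((hasDerivAt_smoothTransition _).comp r h1).mul ((hasDerivAt_smoothTransition _).comp r h2)
  have hη'c : Continuous η' := by
    have := continuous_deriv_smoothTransition
    have := Real.smoothTransition.continuous
    simp only [hη', hS]; fun_prop
  have hS0 := Real.smoothTransition.nonneg
  have hS1 := Real.smoothTransition.le_one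
  have hsubI : ∀ r ∈ Icc α R1, rPlus M a < r ∧ r ≤ ρ ∧ r₀ < r := by
    intro r hr
    exact ⟨by linarith [hr.1], by linarith [hr.2], by linarith [hr.1]⟩
  have hΔB : ∀ r ∈ Icc α R1, Del M a r / (r ^ 2 + a ^ 2) ≤ 2 * ρ ^ 2 / M ^ 2 := fun r hr => by
    obtain ⟨h1, h2, -⟩ := hsubI r hr
    have := Del_pos ha h1
    gcongr
    · exact Del_le ha h1 h2
    · exact sq_mass_le ha h1
  have hηs : ∀ r ∈ Icc α R1, |Del M a r / (r ^ 2 + a ^ 2) * η' r| ≤ K := fun r hr => by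
    obtain ⟨h1, h2, -⟩ := hsubI r hr
    have hD := Del_pos ha h1
    have hq : 0 < Del M a r / (r ^ 2 + a ^ 2) := div_pos hD (by have := sq_mass_le ha h1; nlinarith)
    have e1 : |Del M a r / (r ^ 2 + a ^ 2) * (deriv S ((r - α) / (α' - α)) * (1 / (α' - α)) * S ((R1 - r) / Lr))|
        ≤ L * K0 := by
      by_cases hrr : r ∈ Ioo α α'
      · rw [abs_mul, abs_mul, abs_mul, abs_of_pos hq, abs_of_nonneg (hS0 _), abs_of_pos (show 0 < 1 / (α' - α) by positivity)]
        calc _ = |deriv S ((r - α) / (α' - α))| * (Del M a r / (r ^ 2 + a ^ 2) * (1 / (α' - α))) * S ((R1 - r) / Lr) := by ring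
          _ ≤ L * K0 * 1 := by
            have := hcut r hrr
            have := hLb ((r - α) / (α' - α))
            have := hS1 ((R1 - r) / Lr)
            have := hS0 ((R1 - r) / Lr)
            gcongr
          _ = _ := mul_one _
      · have : deriv S ((r - α) / (α' - α)) = 0 := by
          apply deriv_smoothTransition_eq_zero
          simp only [mem_Ioo, not_and_or, not_lt] at hrr
          rcases hrr with h | h
          · left; exact div_nonpos_of_nonpos_of_nonneg (by linarith) hαpos.le
          · right; rw [le_div_iff₀ hαpos]; linarith
        rw [this]; simp; positivity
    have e2 : |Del M a r / (r ^ 2 + a ^ 2) * (S ((r - α) / (α' - α)) * (deriv S ((R1 - r) / Lr) * (-1 / Lr)))|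
        ≤ L / Lr * (2 * ρ ^ 2 / M ^ 2) := by
      rw [abs_mul, abs_mul, abs_mul, abs_of_pos hq, abs_of_nonneg (hS0 _), abs_div, abs_neg, abs_one, abs_of_pos hLr0]
      calc _ ≤ 2 * ρ ^ 2 / M ^ 2 * (1 * (L * (1 / Lr))) := by
            have := hΔB r hr
            have := hLb ((R1 - r) / Lr)
            have := hS1 ((r - α) / (α' - α))
            have := hS0 ((r - α) / (α' - α))
            gcongr
        _ = _ := by ring
    have : |Del M a r / (r ^ 2 + a ^ 2) * η' r| ≤ Kη := by
      simp only [hη']; rw [mul_add]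
      exact (abs_add_le _ _).trans (add_le_add e1 e2)
    linarith
  have hΔs : ∀ r ∈ Icc α R1, |(2 * r - 2 * M) / (r ^ 2 + a ^ 2)| ≤ K := fun r hr => by
    obtain ⟨h1, h2, -⟩ := hsubI r hr
    have hMr := (mass_lt_rPlus ha).trans h1
    rw [abs_div, abs_of_pos (show 0 < r ^ 2 + a ^ 2 by have := sq_mass_le ha h1; nlinarith)]
    have : |2 * r - 2 * M| / (r ^ 2 + a ^ 2) ≤ 4 * ρ / M ^ 2 := by
      gcongr
      · rw [abs_le]; constructor <;> linarith
      · exact sq_mass_le ha h1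
    linarith
  have hell' : ∀ r ∈ Icc α R1, b / 2 * ω ^ 2 ≤ V0 M a ω m Λ r - ω ^ 2 →
      Del M a r * Λ + ω ^ 2 ≤ K * (V0 M a ω m Λ r - ω ^ 2) ∧
      V0 M a ω m Λ r - ω ^ 2 ≤ K * (Del M a r * Λ + ω ^ 2) := by
    intro r hr hW
    obtain ⟨h1, h2, h3⟩ := hsubI r hr
    have hW0 : 0 ≤ V0 M a ω m Λ r - ω ^ 2 := le_trans (by positivity) hW
    have hD := Del_pos ha h1
    have := hell ω m Λ r had h3 h2 hW
    have hle : Ke ≤ K := by linarith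
    exact ⟨this.1.trans (by gcongr), this.2.trans (by gcongr)⟩
  have hV0 : ∀ r ∈ Icc α R1, |V0deriv M a ω m Λ r| / (r ^ 2 + a ^ 2) ≤ K * Λ := fun r hr => by
    obtain ⟨h1, h2, -⟩ := hsubI r hr
    calc _ ≤ (((4 * M + 4 * ρ) / M ^ 4 + 4 * ρ * (4 * M * ρ + 3 * ρ ^ 2) / M ^ 6) * Λ) / M ^ 2 := by
          gcongr
          · exact abs_V0deriv_le ha had h1 h2
          · exact sq_mass_le ha h1
      _ = Kv * Λ := by simp only [Kv]; ring
      _ ≤ _ := by gcongr; linarith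
  have main := multiplier_integrated ha (K := K) (β := b / 2) (ω := ω) (Λ := Λ) (α0 := α) (α1 := R1)
    (m := m) (η := η) (η' := η') hK.le (half_pos hb) hΛ hne (by linarith) (by linarith) hηd hη'c
    (fun r => mul_nonneg (hS0 _) (hS0 _)) (fun r => mul_le_one₀ (hS1 _) (hS0 _) (hS1 _))
    (by simp [hη, hS, Real.smoothTransition.zero]) (by simp [hη, hS, Real.smoothTransition.zero])
    hηs hΔs hell' hV0 hρ hu hode
  rw [← hC1def] at main
  refine setLIntegral_chain measurableSet_Ioc measurableSet_Icc hC2.le (by positivity)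
    (fun r hr => ⟨by linarith [hr.1], by linarith [hr.2]⟩) (fun r hr => ⟨by linarith [hr.1], hr.2⟩)
    (fun r hr => ?_) main fun r hr => ?_
  · have hr' : r ∈ Icc α R1 := ⟨by linarith [hr.1], by linarith [hr.2]⟩
    obtain ⟨h1, h2, h3⟩ := hsubI r hr'
    have hD := Del_pos ha h1
    refine elliptic_weight_le hM hb hK ((mass_lt_rPlus ha).trans h1) (by rcases hne with h | h <;> positivity)
      (by have := sq_mass_le ha h1; nlinarith) hD (fun h => (hell' r hr' h).1) hC2def ?_
    simp only [hη, hS]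
    rw [Real.smoothTransition.one_of_one_le, Real.smoothTransition.one_of_one_le, one_mul]
    · rw [le_div_iff₀ hLr0]; linarith [hr.2]
    · rw [le_div_iff₀ hαpos]; linarith [hr.1]
  · obtain ⟨h1, h2, h3⟩ := hsubI r hr
    exact source_weight_le ha h1 h2 hΛ hC1.le (by unfold iotaV; positivity) hC3def

theorem fixed_frequency_local (ha : |a| < M) {Rpot b γ ρ : ℝ} (hR : 5 * M < Rpot) (hb : 0 < b)
    (hγ : 0 < γ) (hρ : 1.3 * Rpot < ρ) :
    ∃ C : ℝ, 0 < C ∧ ∀ (ω : ℝ) (m : ℤ) (Λ : ℝ), Admissible a ω m Λ →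
      ∀ u G : ℝ → ℂ, ContDiffOn ℝ 2 u (Ioo (rPlus M a) ρ) →
      (∀ r ∈ Ioo (rPlus M a) ρ,
        dStar M a (dStar M a u) r + ((ω ^ 2 - Vfull M a ω m Λ r : ℝ) : ℂ) * u r = G r) →
      lintStar M a (Ioc (rElliptic M a γ ω m) (1.2 * Rpot))
              (fun r => Del M a r * (r ^ 2)⁻¹ * iotaV M a b ω m Λ r
                * (V0 M a ω m Λ r - ω ^ 2) ^ 2 * ‖u r‖ ^ 2)
            ≤ ofReal C *
              lintStar M a
                (Ioc (max (0.99 * rElliptic M a γ ω m) (rPlus M a)) (1.3 * Rpot))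
                (fun r => Del M a r * (r ^ 2)⁻¹ * iotaV M a (b / 2) ω m Λ r
                  * ((ω ^ 2 + Λ) * ‖u r‖ ^ 2 + ‖G r‖ ^ 2)) := by
  have hM := mass_pos ha
  have hρ0 : 0 < ρ := by linarith
  have hrp := rPlus_le ha
  have hrp0 := rPlus_pos ha
  obtain ⟨C, hC, H⟩ := fixed_frequency_core ha (K0 := 2 * ρ ^ 2 / M ^ 2 * (1 / (0.015 * M)) + 2 * ρ / M ^ 2)
    hR hb hγ hρ (by positivity)
  refine ⟨C, hC, ?_⟩
  intro ω m Λ had u G hu hode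
  have H' := fun α α' h1 h2 h3 h4 => H ω m Λ had α α' h1 h2 h3 h4 u G hu hode
  have hcase : rElliptic M a γ ω m = rPlus M a ∨ rElliptic M a γ ω m = 2.03 * M := by
    unfold rElliptic; split_ifs <;> simp
  rcases hcase with hc | hc
  · rw [hc] at H' ⊢
    have hmax : max (0.99 * rPlus M a) (rPlus M a) = rPlus M a := max_eq_right (by linarith)
    rw [hmax] at H' ⊢
    set F := fun r => Del M a r * (r ^ 2)⁻¹ * iotaV M a b ω m Λ r
                * (V0 M a ω m Λ r - ω ^ 2) ^ 2 * ‖u r‖ ^ 2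
    set ε : ℕ → ℝ := fun n => M / (n + 1) with hε
    have hε0 : ∀ n, 0 < ε n := fun n => by positivity
    have hε1 : ∀ n, ε n ≤ M := fun n => by
      simp only [hε]; rw [div_le_iff₀ (by positivity)]; nlinarith [(Nat.cast_nonneg n : (0 : ℝ) ≤ n)]
    have hU : Ioc (rPlus M a) (1.2 * Rpot) = ⋃ n, Ioc (rPlus M a + 2 * ε n) (1.2 * Rpot) := by
      ext r
      simp only [mem_iUnion, mem_Ioc]
      constructor
      · rintro ⟨h1, h2⟩
        obtain ⟨n, hn⟩ := exists_nat_gt (2 * M / (r - rPlus M a))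
        refine ⟨n, ?_, h2⟩
        have h3 : 0 < r - rPlus M a := by linarith
        rw [div_lt_iff₀ h3] at hn
        have : 2 * ε n < r - rPlus M a := by
          simp only [hε]; rw [← mul_div_assoc, div_lt_iff₀ (by positivity)]; nlinarith
        linarith
      grind
    have hεanti : Antitone ε := by
      intro n k hnk
      simp only [hε]; gcongr
    unfold lintStar at H' ⊢
    rw [hU, setLIntegral_iUnion_of_directed]
    · refine iSup_le fun n => ?_
      refine H' (rPlus M a + ε n) (rPlus M a + 2 * ε n) (by grind) (by grind)
        (by grind) ?_
      intro r hr
      have h1 : rPlus M a < r := by grind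
      have h2 : r ≤ ρ := by grind
      have h3 : 0 ≤ r - rMinus M a := by linarith [rMinus_lt_rPlus ha]
      have h4 : r - rMinus M a ≤ ρ := by linarith [rMinus_nonneg ha]
      have h5 : Del M a r ≤ (2 * ε n) * ρ := by
        have := hε0 n
        rw [Del_eq ha]; exact mul_le_mul (by linarith [hr.2]) h4 h3 (by positivity)
      have e : rPlus M a + 2 * ε n - (rPlus M a + ε n) = ε n := by ring
      rw [e]
      calc _ ≤ (2 * ε n) * ρ / M ^ 2 * (1 / ε n) := by
            have := hε0 n
            gcongr; exact sq_mass_le ha h1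
        _ = 2 * ρ / M ^ 2 := by have := hε0 n; field_simp
        _ ≤ _ := by linarith [show 0 ≤ 2 * ρ ^ 2 / M ^ 2 * (1 / (0.015 * M)) by positivity]
    · refine directed_of_isDirected_le fun n k hnk => ?_
      exact Ioc_subset_Ioc_left (by linarith [hεanti hnk])
  · have e : rElliptic M a γ ω m = 2.03 * M := hc
    have hmax : max (0.99 * rElliptic M a γ ω m) (rPlus M a) = 0.99 * (2.03 * M) := by
      rw [hc]; exact max_eq_left (by linarith)
    rw [hmax] at H' ⊢
    rw [hc]
    refine H' (2.015 * M) (2.03 * M) (by linarith) (by linarith) (by linarith) ?_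
    intro r hr
    have h1 : rPlus M a < r := by linarith [hr.1]
    have h2 : r ≤ ρ := by linarith [hr.2]
    rw [show 2.03 * M - 2.015 * M = 0.015 * M by ring]
    calc _ ≤ 2 * ρ ^ 2 / M ^ 2 * (1 / (0.015 * M)) := by
          gcongr
          · exact Del_le ha h1 h2
          · exact sq_mass_le ha h1
      _ ≤ _ := by linarith [show 0 ≤ 2 * ρ / M ^ 2 by positivity]

end

/-- `sech² x`. -/
def sechSq (x : ℝ) : ℝ := (cosh x ^ 2)⁻¹

lemma sechSq_pos (x : ℝ) : 0 < sechSq x := by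
  have := Real.cosh_pos x; unfold sechSq; positivity

lemma sechSq_neg (x : ℝ) : sechSq (-x) = sechSq x := by simp [sechSq]

lemma sechSq_le_one (x : ℝ) : sechSq x ≤ 1 := by
  unfold sechSq
  exact inv_le_one_of_one_le₀ (one_le_pow₀ (Real.one_le_cosh x))

lemma continuous_sechSq : Continuous sechSq := by
  unfold sechSq
  exact (Real.continuous_cosh.pow 2).inv₀ fun x => (pow_pos (Real.cosh_pos x) 2).ne'

lemma one_add_sq_le_cosh (x : ℝ) : 1 + x ^ 2 ≤ 2 * cosh x := by
  have h : 1 + x ^ 2 / 2 ≤ cosh x := by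
    rw [← Real.cosh_abs]
    have h0 := abs_nonneg x
    rw [← sq_abs]
    generalize |x| = y at h0 ⊢
    have h1 := Real.cosh_sq (y / 2)
    have h2 : cosh y = 1 + 2 * Real.sinh (y / 2) ^ 2 := by
      have := Real.cosh_two_mul (y / 2)
      rw [show 2 * (y / 2) = y by ring] at this
      rw [this, h1]; ring
    have h3 : y / 2 ≤ Real.sinh (y / 2) := Real.self_le_sinh_iff.2 (by linarith)
    rw [h2]; nlinarith
  nlinarith [sq_nonneg x]

lemma sechSq_mul_le (x : ℝ) : (1 + x ^ 2) * sechSq x ≤ 4 * (1 + x ^ 2)⁻¹ := by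
  have h := one_add_sq_le_cosh x
  have hc := Real.cosh_pos x
  have h0 : 0 < 1 + x ^ 2 := by positivity
  unfold sechSq
  rw [← div_eq_mul_inv, ← div_eq_mul_inv, div_le_div_iff₀ (by positivity) h0]
  nlinarith

lemma integrable_one_add_sq_mul_sechSq : Integrable fun x => (1 + x ^ 2) * sechSq x := by
  refine (integrable_inv_one_add_sq.const_mul 4).mono' ?_ (Eventually.of_forall fun x => ?_)
  · have := continuous_sechSq
    exact (by fun_prop : Continuous fun x : ℝ => (1 + x ^ 2) * sechSq x).aestronglyMeasurable
  · rw [norm_eq_abs, abs_of_nonneg (by have := sechSq_pos x; positivity)]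
    exact sechSq_mul_le x

lemma integrable_sechSq : Integrable sechSq := by
  refine integrable_one_add_sq_mul_sechSq.mono' continuous_sechSq.aestronglyMeasurable
    (Eventually.of_forall fun x => ?_)
  rw [norm_eq_abs, abs_of_pos (sechSq_pos x)]
  nlinarith [sechSq_pos x, sq_nonneg x]

/-- `s` is a bounded nonzero solution, with derivative `s'`, of the angular equation in the
coordinate `x = artanh (cos θ)`. -/
structure IsLineEigenfunction (ν : ℝ) (m : ℤ) (μ : ℝ) (s s' : ℝ → ℝ) : Prop where
  d1 : ∀ x, HasDerivAt s (s' x) x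
  d2 : ∀ x, HasDerivAt s' (((m : ℝ) ^ 2 + ν ^ 2 * sechSq x ^ 2 - μ * sechSq x) * s x) x
  bounded : ∃ B, ∀ x, |s x| ≤ B
  nonzero : ∃ x, s x ≠ 0

lemma integral_eq_zero_of_hasDerivAt_of_memLp {E : Type*} [NormedAddCommGroup E] [NormedSpace ℝ E] [CompleteSpace E]
    {H H' : ℝ → E} (hd : ∀ x, HasDerivAt H (H' x) x) (hi : Integrable H') (h2 : MemLp H 2) : ∫ x, H' x = 0 := by
  have h0 : ∀ {l : Filter ℝ} {c : E}, Tendsto H l (𝓝 c) → (∀ s ∈ l, volume s = ⊤) → c = 0 := fun hl hs => by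
    have := IntegrableAtFilter.eq_zero_of_tendsto ⟨univ, univ_mem, (h2.integrable_norm_pow two_ne_zero).integrableOn⟩ hs (hl.norm.pow 2)
    simpa using this
  have ht := tendsto_limUnder_of_hasDerivAt_of_integrableOn_Ioi (a := 0) (fun x _ => hd x) hi.integrableOn
  have hb := tendsto_limUnder_of_hasDerivAt_of_integrableOn_Iic (a := 0) (fun x _ => hd x) hi.integrableOn
  rw [integral_of_hasDerivAt_of_tendsto hd hi hb ht, h0 ht, h0 hb, sub_zero]
  · intro s hs
    obtain ⟨a, ha⟩ := mem_atBot_sets.1 hs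
    exact measure_mono_top ha Real.volume_Iic
  · intro s hs
    obtain ⟨a, ha⟩ := mem_atTop_sets.1 hs
    exact measure_mono_top ha Real.volume_Ici

namespace IsLineEigenfunction
variable {ν μ μ2 : ℝ} {m : ℤ} {s s' t t' : ℝ → ℝ}

lemma hasDerivAt_tanh (x : ℝ) : HasDerivAt tanh (sechSq x) x := by
  have h0 := (Real.cosh_pos x).ne'
  have h1 := (Real.hasDerivAt_sinh x).div (Real.hasDerivAt_cosh x) h0
  have e : tanh = Real.sinh / cosh := by ext y; simp [Real.tanh_eq_sinh_div_cosh]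
  rw [e]
  refine h1.congr_deriv ?_
  unfold sechSq
  have := Real.cosh_sq x
  field_simp
  linarith

lemma tanh_sq (x : ℝ) : tanh x ^ 2 = 1 - sechSq x := by
  have h0 := (Real.cosh_pos x).ne'
  have := Real.cosh_sq x
  rw [Real.tanh_eq_sinh_div_cosh]; unfold sechSq
  field_simp
  linarith

lemma abs_tanh_le (x : ℝ) : |tanh x| ≤ 1 := by
  rw [← sq_le_one_iff_abs_le_one, tanh_sq]; linarith [sechSq_pos x]

lemma continuous (h : IsLineEigenfunction ν m μ s s') : Continuous s :=
  continuous_iff_continuousAt.2 fun x => (h.d1 x).continuousAt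

lemma continuous_deriv (h : IsLineEigenfunction ν m μ s s') : Continuous s' :=
  continuous_iff_continuousAt.2 fun x => (h.d2 x).continuousAt

lemma integrableOn_energy (h : IsLineEigenfunction ν m μ s s') :
    IntegrableOn (fun x => s' x ^ 2 + (m * s x) ^ 2) (Ioi 0) := by
  obtain ⟨B, hB⟩ := h.bounded
  have hd : ∀ x, HasDerivAt (fun x => s x * s' x + |μ| * B ^ 2 * tanh x) (s' x * s' x
      + s x * (((m : ℝ) ^ 2 + ν ^ 2 * sechSq x ^ 2 - μ * sechSq x) * s x) + |μ| * B ^ 2 * sechSq x) x := fun x =>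
    ((h.d1 x).mul (h.d2 x)).add ((hasDerivAt_tanh x).const_mul _)
  have hge : ∀ x, s' x ^ 2 + (m * s x) ^ 2 ≤ s' x * s' x
      + s x * (((m : ℝ) ^ 2 + ν ^ 2 * sechSq x ^ 2 - μ * sechSq x) * s x) + |μ| * B ^ 2 * sechSq x := fun x => by
    have h1 := mul_le_mul (le_abs_self μ) (sq_le_sq' (abs_le.1 (hB x)).1 (abs_le.1 (hB x)).2) (sq_nonneg _) (abs_nonneg _)
    nlinarith [mul_le_mul_of_nonneg_right h1 (sechSq_pos x).le, sq_nonneg (ν * sechSq x * s x)]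
  have h0 : ∀ x, 0 ≤ s' x ^ 2 + (m * s x) ^ 2 := fun x => by positivity
  rcases tendsto_of_monotone (monotone_of_hasDerivAt_nonneg hd fun x => (h0 x).trans (hge x)) with ht | ⟨l, ht⟩
  · obtain ⟨X, hX⟩ := eventually_atTop.1 (ht.eventually_ge_atTop (|μ| * B ^ 2 + 1))
    have hd2 : ∀ x, HasDerivAt (fun x => s x * s x) (s' x * s x + s x * s' x) x := fun x => (h.d1 x).mul (h.d1 x)
    have h3 := (convex_Ici X).mul_sub_le_image_sub_of_le_deriv (f := fun x => s x * s x) (C := 1)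
      (fun x _ => (hd2 x).continuousAt.continuousWithinAt) (fun x _ => (hd2 x).differentiableAt.differentiableWithinAt)
      (fun x hx => by
        rw [(hd2 x).deriv]
        have := hX x (interior_subset hx)
        have := (abs_le.1 (abs_tanh_le x)).2
        nlinarith [mul_nonneg (abs_nonneg μ) (sq_nonneg B)])
      X self_mem_Ici (X + B ^ 2 + 1) (by simp only [mem_Ici]; nlinarith) (by nlinarith)
    have h4 := sq_le_sq' (abs_le.1 (hB (X + B ^ 2 + 1))).1 (abs_le.1 (hB (X + B ^ 2 + 1))).2
    nlinarith [mul_self_nonneg (s X)]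
  · refine (integrableOn_Ioi_deriv_of_nonneg' (fun x _ => hd x) (fun x _ => (h0 x).trans (hge x)) ht).mono'
      ?_ (Eventually.of_forall fun x => ?_)
    · have := h.continuous; have := h.continuous_deriv
      exact (by fun_prop : Continuous _).aestronglyMeasurable
    · rw [norm_eq_abs, abs_of_nonneg (h0 x)]; exact hge x

lemma reflect (h : IsLineEigenfunction ν m μ s s') :
    IsLineEigenfunction ν m μ (fun x => s (-x)) fun x => -s' (-x) where
  d1 x := ((h.d1 (-x)).comp x (hasDerivAt_neg x)).congr_deriv (by ring)
  d2 x := (((h.d2 (-x)).comp x (hasDerivAt_neg x)).neg).congr_deriv (by rw [sechSq_neg]; ring)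
  bounded := by obtain ⟨B, hB⟩ := h.bounded; exact ⟨B, fun x => hB _⟩
  nonzero := by obtain ⟨x, hx⟩ := h.nonzero; exact ⟨-x, by simpa using hx⟩

lemma integrable_energy (h : IsLineEigenfunction ν m μ s s') : Integrable fun x => s' x ^ 2 + (m * s x) ^ 2 := by
  rw [← integrableOn_univ, ← Iic_union_Ioi (a := (0 : ℝ)), integrableOn_union]
  refine ⟨?_, h.integrableOn_energy⟩
  have := h.reflect.integrableOn_energy.comp_neg
  simpa [integrableOn_Iic_iff_integrableOn_Iio] using this

lemma memLp_deriv (h : IsLineEigenfunction ν m μ s s') : MemLp s' 2 :=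
  (memLp_two_iff_integrable_sq h.continuous_deriv.aestronglyMeasurable).2 <|
    h.integrable_energy.mono' (h.continuous_deriv.pow 2).aestronglyMeasurable
      (Eventually.of_forall fun x => by rw [norm_eq_abs, abs_of_nonneg (sq_nonneg _)]; nlinarith [sq_nonneg (m * s x)])

lemma memLp_const_mul (h : IsLineEigenfunction ν m μ s s') : MemLp (fun x => m * s x) 2 :=
  (memLp_two_iff_integrable_sq (h.continuous.const_mul _).aestronglyMeasurable).2 <|
    h.integrable_energy.mono' ((h.continuous.const_mul _).pow 2).aestronglyMeasurable
      (Eventually.of_forall fun x => by rw [norm_eq_abs, abs_of_nonneg (sq_nonneg _)]; nlinarith [sq_nonneg (s' x)])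

lemma integrable_mul_sechSq {f : ℝ → ℝ} (hf : Continuous f) (hB : ∃ B, ∀ x, |f x| ≤ B) :
    Integrable fun x => sechSq x * f x := by
  obtain ⟨B, hB⟩ := hB
  exact integrable_sechSq.mul_bdd hf.aestronglyMeasurable (Eventually.of_forall hB)

lemma bounded_mul {f g : ℝ → ℝ} (hf : ∃ B, ∀ x, |f x| ≤ B) (hg : ∃ B, ∀ x, |g x| ≤ B) :
    ∃ B, ∀ x, |f x * g x| ≤ B := by
  obtain ⟨B, hB⟩ := hf
  obtain ⟨C, hC⟩ := hg
  refine ⟨B * C, fun x => ?_⟩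
  rw [abs_mul]
  have := hB x
  have := (abs_nonneg _).trans (hB x)
  have := hC x
  gcongr

lemma integrable_mul (h : IsLineEigenfunction ν m μ s s') (h2 : IsLineEigenfunction ν m μ2 t t') :
    Integrable fun x => sechSq x * (s x * t x) :=
  integrable_mul_sechSq (h.continuous.mul h2.continuous) (bounded_mul h.bounded h2.bounded)

lemma integral_sq_pos (h : IsLineEigenfunction ν m μ s s') : 0 < ∫ x, sechSq x * (s x * s x) := by
  have hc : Continuous fun x => sechSq x * (s x * s x) := by
    have := h.continuous; have := continuous_sechSq; fun_prop
  obtain ⟨x, hx⟩ := h.nonzero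
  refine integral_pos_of_integrable_nonneg_nonzero (x := x) hc ?_ (fun y => ?_) ?_
  · exact h.integrable_mul h
  · have := sechSq_pos y; have := mul_self_nonneg (s y); simp only [Pi.zero_apply]; positivity
  · have := sechSq_pos x; positivity

lemma memLp_bounded_mul {f g : ℝ → ℝ} (hf : Continuous f) (hB : ∃ B, ∀ x, |f x| ≤ B) (hg : MemLp g 2) :
    MemLp (fun x => f x * g x) 2 := by
  obtain ⟨B, hB⟩ := hB
  exact hg.of_le_mul (hf.aestronglyMeasurable.mul hg.1) (c := B)
    (Eventually.of_forall fun x => by rw [norm_mul]; exact mul_le_mul_of_nonneg_right (hB x) (norm_nonneg _))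

lemma integrable_form (h : IsLineEigenfunction ν m μ s s') (h2 : IsLineEigenfunction ν m μ2 t t') :
    Integrable fun x => s' x * t' x + ((m : ℝ) ^ 2 + ν ^ 2 * sechSq x ^ 2) * (s x * t x) := by
  have h1 := integrable_mul_sechSq (continuous_sechSq.mul (h.continuous.mul h2.continuous))
    (bounded_mul ⟨1, fun x => by rw [abs_of_pos (sechSq_pos x)]; exact sechSq_le_one x⟩ (bounded_mul h.bounded h2.bounded))
  refine (((h.memLp_deriv.integrable_mul h2.memLp_deriv).add (h.memLp_const_mul.integrable_mul h2.memLp_const_mul)).add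
    (h1.const_mul (ν ^ 2))).congr (Eventually.of_forall fun x => ?_)
  simp only [Pi.add_apply, Pi.mul_apply]; ring

lemma integral_form (h : IsLineEigenfunction ν m μ s s') (h2 : IsLineEigenfunction ν m μ2 t t') :
    ∫ x, (s' x * t' x + ((m : ℝ) ^ 2 + ν ^ 2 * sechSq x ^ 2) * (s x * t x)) = μ2 * ∫ x, sechSq x * (s x * t x) := by
  have hi := (h.integrable_mul h2).const_mul μ2
  rw [← integral_const_mul, ← sub_eq_zero, ← integral_sub (h.integrable_form h2) hi]
  exact integral_eq_zero_of_hasDerivAt_of_memLp (fun x => ((h.d1 x).mul (h2.d2 x)).congr_deriv (by ring))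
    ((h.integrable_form h2).sub hi) (memLp_bounded_mul h.continuous h.bounded h2.memLp_deriv)

lemma orthogonal (h : IsLineEigenfunction ν m μ s s')
    (h2 : IsLineEigenfunction ν m μ2 t t') (hne : μ ≠ μ2) : ∫ x, sechSq x * (s x * t x) = 0 := by
  have h1 := h.integral_form h2
  have h3 := h2.integral_form h
  simp_rw [mul_comm (t' _), mul_comm (t _)] at h3
  exact (mul_eq_mul_right_iff.1 (h3.symm.trans h1)).resolve_left hne

lemma two_abs_mul_le (h : IsLineEigenfunction ν m μ s s') : 2 * |m * ν| ≤ μ := by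
  refine le_of_mul_le_mul_right ?_ h.integral_sq_pos
  rw [← h.integral_form h, ← integral_const_mul]
  refine integral_mono ((h.integrable_mul h).const_mul _)
    (h.integrable_form h) fun x => ?_
  have h1 : 2 * |m * ν| * sechSq x ≤ (m : ℝ) ^ 2 + ν ^ 2 * sechSq x ^ 2 := by
    have := two_mul_le_add_sq |(m : ℝ)| (|ν| * sechSq x)
    rw [mul_pow, sq_abs, sq_abs] at this
    rw [abs_mul]; linarith
  nlinarith [mul_self_nonneg (s' x), mul_le_mul_of_nonneg_right h1 (mul_self_nonneg (s x))]

lemma le_eigenvalue (h : IsLineEigenfunction ν m μ s s') : |(m : ℝ)| * (|(m : ℝ)| + 1) ≤ μ := by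
  obtain ⟨k, hk⟩ : ∃ k, k = |(m : ℝ)| := ⟨_, rfl⟩
  have hk2 : (m : ℝ) ^ 2 = k ^ 2 := by rw [hk, sq_abs]
  rw [← hk]
  have hks : MemLp (fun x => k * s x) 2 := h.memLp_const_mul.of_le (h.continuous.const_mul _).aestronglyMeasurable
    (Eventually.of_forall fun x => by simp [hk])
  have hT : Continuous tanh := continuous_iff_continuousAt.2 fun x => (hasDerivAt_tanh x).continuousAt
  have hm := memLp_bounded_mul hT ⟨1, abs_tanh_le⟩ hks
  have hi := h.integrable_mul h
  have hH := ((hi.const_mul k).add ((hm.integrable_mul h.memLp_deriv).const_mul 2))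
  have h0 := integral_eq_zero_of_hasDerivAt_of_memLp (H := fun x => s x * (tanh x * (k * s x)))
    (fun x => ((h.d1 x).mul ((hasDerivAt_tanh x).mul ((h.d1 x).const_mul k))).congr_deriv (by simp only [Pi.add_apply, Pi.mul_apply]; ring)) hH
    (memLp_bounded_mul h.continuous h.bounded hm)
  refine le_of_mul_le_mul_right ?_ h.integral_sq_pos
  rw [← h.integral_form h, ← integral_const_mul, ← add_zero (∫ x, _ + _), ← h0, ← integral_add (h.integrable_form h) hH]
  refine integral_mono (hi.const_mul _) ((h.integrable_form h).add hH) fun x => ?_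
  have ht := tanh_sq x
  simp only [Pi.add_apply, Pi.mul_apply]
  have : 0 ≤ ν ^ 2 * sechSq x ^ 2 * (s x * s x) := by have := mul_self_nonneg (s x); positivity
  rw [hk2]
  linear_combination sq_nonneg (s' x + k * tanh x * s x) + this + k ^ 2 * s x ^ 2 * ht

end IsLineEigenfunction

/-- The eigenvalues of the angular equation on the line. -/
def lineSpectrum (ν : ℝ) (m : ℤ) : Set ℝ := {μ | ∃ s s', IsLineEigenfunction ν m μ s s'}

lemma sum_sq_inner_div_le {H ι : Type*} [NormedAddCommGroup H] [InnerProductSpace ℝ H] {v : ι → H} (T : Finset ι)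
    (hv : ∀ i j, i ≠ j → inner ℝ (v i) (v j) = 0) (h0 : ∀ i, v i ≠ 0) (x : H) :
    ∑ i ∈ T, inner ℝ (v i) x ^ 2 / ‖v i‖ ^ 2 ≤ ‖x‖ ^ 2 := by
  have h : Orthonormal ℝ fun i => ‖v i‖⁻¹ • v i :=
    ⟨fun i => norm_smul_inv_norm (h0 i), fun i j hij => by simp [inner_smul_left, inner_smul_right, hv i j hij]⟩
  refine le_trans (sum_le_sum fun i _ => ?_) (h.sum_inner_products_le x (s := T))
  rw [inner_smul_left, norm_mul, mul_pow, norm_eq_abs, norm_eq_abs, sq_abs, sq_abs]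
  simp [div_eq_inv_mul]

lemma memLp_complex_mk {f g : ℝ → ℝ} (hf : MemLp f 2) (hg : MemLp g 2) : MemLp (fun x => (⟨f x, g x⟩ : ℂ)) 2 := by
  convert hf.ofReal (K := ℂ).add (hg.ofReal (K := ℂ).mul_const I) using 2 with x
  apply Complex.ext <;> simp

lemma inner_toLp_complex_mk {f g p q : ℝ → ℝ} (h₁ : MemLp (fun x => (⟨f x, g x⟩ : ℂ)) 2) (h₂ : MemLp (fun x => (⟨p x, q x⟩ : ℂ)) 2) :
    inner ℝ (h₁.toLp _) (h₂.toLp _) = ∫ x, (f x * p x + g x * q x) := by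
  rw [L2.inner_def]
  refine integral_congr_ae ?_
  filter_upwards [h₁.coeFn_toLp, h₂.coeFn_toLp] with x h1 h2
  rw [h1, h2, Complex.inner]; simp [mul_comm]

set_option maxHeartbeats 1000000 in
/-- Only finitely many eigenvalues lie below a given level. -/
lemma lineSpectrum_finite_le (ν : ℝ) (m : ℤ) (L : ℝ) : {μ ∈ lineSpectrum ν m | μ ≤ L}.Finite := by
  by_contra hinf
  obtain ⟨W, hW⟩ : ∃ W, W = ∫ x, sechSq x := ⟨_, rfl⟩
  obtain ⟨C, hC⟩ : ∃ C, C = ∫ x, (1 + x ^ 2) * sechSq x := ⟨_, rfl⟩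
  have hwc := continuous_sechSq
  have hW0 : 0 < W := hW ▸ integral_pos_of_integrable_nonneg_nonzero (x := 0) hwc integrable_sechSq (fun x => (sechSq_pos x).le) (sechSq_pos 0).ne'
  obtain ⟨N, hN⟩ := exists_nat_gt ((|L| + 1) * (C + 1))
  obtain ⟨T, hT, hcard⟩ := Set.Infinite.exists_subset_card_eq hinf N
  choose! s s' hs using fun μ (hμ : μ ∈ lineSpectrum ν m) => hμ
  have hsT : ∀ i : T, IsLineEigenfunction ν m i (s i) (s' i) := fun i => hs i (hT i.2).1
  obtain ⟨D, hD⟩ : ∃ D : ℝ → ℝ, ∀ x, D x = √((m : ℝ) ^ 2 + ν ^ 2 * sechSq x ^ 2 + sechSq x) := ⟨_, fun x => rfl⟩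
  have hDc : Continuous D := by rw [funext hD]; fun_prop
  have hDsq : ∀ x, D x ^ 2 = (m : ℝ) ^ 2 + ν ^ 2 * sechSq x ^ 2 + sechSq x := fun x => by
    rw [hD, Real.sq_sqrt]; have := sechSq_pos x; positivity
  have hD0 : ∀ x, 0 < D x := fun x => by rw [hD]; have := sechSq_pos x; positivity
  have hform : ∀ i j : T, Integrable (fun x => s' i x * s' j x + D x * s i x * (D x * s j x)) ∧
      ∫ x, (s' i x * s' j x + D x * s i x * (D x * s j x)) = (j + 1) * ∫ x, sechSq x * (s i x * s j x) := fun i j => by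
    have h1 := (hsT i).integrable_form (hsT j)
    have h2 := (hsT i).integrable_mul (hsT j)
    have e : (fun x => s' i x * s' j x + D x * s i x * (D x * s j x)) = fun x =>
      (s' i x * s' j x + ((m : ℝ) ^ 2 + ν ^ 2 * sechSq x ^ 2) * (s i x * s j x)) + sechSq x * (s i x * s j x) := funext fun x => by
      linear_combination s i x * s j x * hDsq x
    rw [e, integral_add h1 h2, (hsT i).integral_form (hsT j), add_one_mul]
    exact ⟨h1.add h2, rfl⟩
  have hDs : ∀ i : T, MemLp (fun x => D x * s i x) 2 := fun i => by
    have h1 := hDc.fun_mul (hsT i).continuous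
    refine (memLp_two_iff_integrable_sq h1.aestronglyMeasurable).2 ((hform i i).1.mono' (h1.pow 2).aestronglyMeasurable ?_)
    exact Eventually.of_forall fun x => by rw [norm_eq_abs, abs_of_nonneg (sq_nonneg _)]; nlinarith [mul_self_nonneg (s' i x)]
  obtain ⟨V, hV⟩ : ∃ V : T → Lp ℂ 2 (volume : Measure ℝ), ∀ i, V i = (memLp_complex_mk (hsT i).memLp_deriv (hDs i)).toLp _ := ⟨_, fun i => rfl⟩
  obtain ⟨n, hn⟩ : ∃ n : T → ℝ, ∀ i, n i = ∫ x, sechSq x * (s i x * s i x) := ⟨_, fun i => rfl⟩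
  have hn0 : ∀ i, 0 < n i := fun i => hn i ▸ (hsT i).integral_sq_pos
  have hμ0 : ∀ i : T, (0 : ℝ) < i + 1 := fun i => by
    have := (hsT i).le_eigenvalue
    have : 0 ≤ |(m : ℝ)| * (|(m : ℝ)| + 1) := by positivity
    linarith
  have hin : ∀ i j, inner ℝ (V i) (V j) = (j + 1) * ∫ x, sechSq x * (s i x * s j x) := fun i j => by
    rw [hV, hV, inner_toLp_complex_mk]; exact (hform i j).2
  have hVn : ∀ i, ‖V i‖ ^ 2 = (i + 1) * n i := fun i => by rw [← real_inner_self_eq_norm_sq, hin, hn]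
  have hB := sum_sq_inner_div_le (v := V) Finset.univ
    (fun i j hij => by rw [hin, (hsT i).orthogonal (hsT j) fun h => hij (Subtype.ext h), mul_zero])
    (fun i h => by have h1 := hVn i; have := mul_pos (hμ0 i) (hn0 i); rw [h, norm_zero] at h1; linarith)
  simp only [hVn] at hB
  have hpt : ∀ x, ∑ i : T, (s i x - s i 0) ^ 2 / ((i + 1) * n i) ≤ |x| := fun x => by
    have hi : MemLp ((uIoc 0 x).indicator fun _ => (1 : ℝ)) 2 := memLp_indicator_const 2 measurableSet_uIoc 1 (Or.inr (by simp))
    have e : ∀ f g : ℝ → ℝ, ∫ y, (f y * (uIoc 0 x).indicator (fun _ => 1) y + g y * 0) = ∫ y in uIoc 0 x, f y := fun f g => by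
      rw [← integral_indicator measurableSet_uIoc]
      congr 1; funext y
      by_cases h : y ∈ uIoc 0 x <;> simp [h]
    convert hB ((memLp_complex_mk hi (MemLp.zero' (p := 2))).toLp _) using 2 with i
    · rw [hV, inner_toLp_complex_mk, e, ← sq_abs (∫ y in _, _), ← intervalIntegral.abs_integral_eq_abs_integral_uIoc, sq_abs,
        intervalIntegral.integral_eq_sub_of_hasDerivAt (fun y _ => (hsT i).d1 y) ((hsT i).continuous_deriv.intervalIntegrable _ _)]
    · rw [← real_inner_self_eq_norm_sq, inner_toLp_complex_mk, e _ fun _ => 0, setIntegral_indicator measurableSet_uIoc]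
      simp [measureReal_def]
  have hmean : ∑ i : T, (∫ x, sechSq x * s i x) ^ 2 / ((i + 1) * n i) ≤ W := by
    have hwD : ∀ x, (sechSq x / D x) ^ 2 ≤ sechSq x := fun x => by
      rw [div_pow, div_le_iff₀ (pow_pos (hD0 x) 2), hDsq]
      nlinarith [sechSq_pos x, mul_nonneg (sechSq_pos x).le (by positivity : 0 ≤ (m : ℝ) ^ 2 + ν ^ 2 * sechSq x ^ 2)]
    have hc : Continuous fun x => sechSq x / D x := hwc.div hDc fun x => (hD0 x).ne'
    have hi : Integrable fun x => (sechSq x / D x) ^ 2 := integrable_sechSq.mono' (hc.pow 2).aestronglyMeasurable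
      (Eventually.of_forall fun x => by rw [norm_eq_abs, abs_of_nonneg (sq_nonneg _)]; exact hwD x)
    refine le_trans ?_ ((hB ((memLp_complex_mk MemLp.zero' ((memLp_two_iff_integrable_sq hc.aestronglyMeasurable).2 hi)).toLp _)).trans ?_)
    · refine sum_le_sum fun i _ => le_of_eq ?_
      rw [hV, inner_toLp_complex_mk]
      congr 3
      funext x
      have := (hD0 x).ne'
      simp; field_simp
    · rw [← real_inner_self_eq_norm_sq, inner_toLp_complex_mk, hW]
      exact integral_mono (by simpa [← sq] using hi) integrable_sechSq fun x => by simpa [← sq] using hwD x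
  have hvar : ∀ i : T, Integrable (fun x => sechSq x * (s i x - s i 0) ^ 2) ∧
      n i * W ≤ W * (∫ x, sechSq x * (s i x - s i 0) ^ 2) + (∫ x, sechSq x * s i x) ^ 2 := fun i => by
    have h1 := (hsT i).integrable_mul (hsT i)
    have h2 := IsLineEigenfunction.integrable_mul_sechSq (hsT i).continuous (hsT i).bounded
    have e : (fun x => sechSq x * (s i x - s i 0) ^ 2) = ((fun x => sechSq x * (s i x * s i x)) - fun x => 2 * s i 0 * (sechSq x * s i x))
        + fun x => s i 0 ^ 2 * sechSq x := funext fun x => by simp only [Pi.add_apply, Pi.sub_apply]; ring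
    have h4 := integrable_sechSq.const_mul (s i 0 ^ 2)
    rw [e, integral_add' (h1.sub (h2.const_mul _)) h4, integral_sub' h1 (h2.const_mul _), integral_const_mul, integral_const_mul, ← hW, hn]
    exact ⟨(h1.sub (h2.const_mul _)).add h4, by nlinarith [sq_nonneg (W * s i 0 - ∫ x, sechSq x * s i x)]⟩
  have hsum : ∑ i : T, (∫ x, sechSq x * (s i x - s i 0) ^ 2) / ((i + 1) * n i) ≤ C := by
    simp_rw [← integral_div]
    rw [← integral_finsetSum _ fun i _ => (hvar i).1.div_const _, hC]
    refine integral_mono (integrable_finsetSum _ fun i _ => (hvar i).1.div_const _) integrable_one_add_sq_mul_sechSq fun x => ?_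
    simp only [mul_div_assoc, ← Finset.mul_sum]
    rw [mul_comm]
    have : |x| ≤ 1 + x ^ 2 := by rw [← sq_abs x]; nlinarith [sq_nonneg (|x| - 1)]
    exact mul_le_mul_of_nonneg_right ((hpt x).trans this) (sechSq_pos x).le
  have hfin : ∀ i : T, (|L| + 1)⁻¹ * W ≤ W * ((∫ x, sechSq x * (s i x - s i 0) ^ 2) / ((i + 1) * n i))
      + (∫ x, sechSq x * s i x) ^ 2 / ((i + 1) * n i) := fun i => by
    have h1 := hμ0 i
    have h2 := hn0 i
    have h3 : (|L| + 1)⁻¹ ≤ ((i : ℝ) + 1)⁻¹ := inv_anti₀ h1 (by have : (i : ℝ) ≤ L := (hT i.2).2; linarith [le_abs_self L])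
    rw [← mul_div_assoc, ← add_div, le_div_iff₀ (by positivity)]
    calc _ ≤ ((i : ℝ) + 1)⁻¹ * W * ((i + 1) * n i) := by gcongr
      _ = n i * W := by field_simp
      _ ≤ _ := (hvar i).2
  have := sum_le_sum fun i (_ : i ∈ Finset.univ) => hfin i
  rw [Finset.sum_const, sum_add_distrib, ← Finset.mul_sum, Finset.card_univ, Fintype.card_coe, hcard, nsmul_eq_mul] at this
  have h1 : N * W ≤ (|L| + 1) * ((C + 1) * W) := by
    rw [← div_le_iff₀' (by positivity)]
    calc _ = N * ((|L| + 1)⁻¹ * W) := by ring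
      _ ≤ _ := by nlinarith [mul_le_mul_of_nonneg_left hsum hW0.le]
  nlinarith

/-- In an infinite set of reals that is finite below every level, there is for every `n` an element
with exactly `n` predecessors. -/
lemma exists_encard_lt_eq {S : Set ℝ} (hinf : S.Infinite) (hfin : ∀ L, {x ∈ S | x ≤ L}.Finite) (n : ℕ) :
    ∃ x ∈ S, {y | y ∈ S ∧ y < x}.encard = n := by
  have hmin : ∀ T ⊆ S, T.Nonempty → ∃ x ∈ T, ∀ y ∈ T, x ≤ y := by
    rintro T hTS ⟨z, hz⟩
    have hf : {x ∈ T | x ≤ z}.Finite := (hfin z).subset fun x hx => ⟨hTS hx.1, hx.2⟩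
    obtain ⟨x, hx, hxm⟩ := Set.exists_min_image _ id hf ⟨z, hz, le_rfl⟩
    refine ⟨x, hx.1, fun y hy => ?_⟩
    rcases le_total y z with h | h
    · exact hxm y ⟨hy, h⟩
    · exact hx.2.trans h
  induction n with
  | zero =>
    obtain ⟨x, hx, hxm⟩ := hmin S subset_rfl hinf.nonempty
    refine ⟨x, hx, ?_⟩
    have : {y | y ∈ S ∧ y < x} = ∅ := by
      ext y; simp only [mem_setOf_eq, mem_empty_iff_false, iff_false, not_and, not_lt]
      exact fun hy => hxm y hy
    simp [this]
  | succ n ih =>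
    obtain ⟨x, hx, hxn⟩ := ih
    have hne : {y ∈ S | x < y}.Nonempty := by
      obtain ⟨y, hy, hy2⟩ := (hinf.diff (hfin x)).nonempty
      exact ⟨y, hy, by by_contra h; exact hy2 ⟨hy, not_lt.1 h⟩⟩
    obtain ⟨z, hz, hzm⟩ := hmin _ (fun y hy => hy.1) hne
    refine ⟨z, hz.1, ?_⟩
    have : {y | y ∈ S ∧ y < z} = insert x {y | y ∈ S ∧ y < x} := by
      ext y
      simp only [mem_setOf_eq, mem_insert_iff]
      constructor
      · rintro ⟨h1, h2⟩
        rcases lt_trichotomy y x with h | h | h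
        · exact Or.inr ⟨h1, h⟩
        · exact Or.inl h
        · exact absurd (hzm y ⟨h1, h⟩) (not_le.2 h2)
      · rintro (h | ⟨h1, h2⟩)
        · subst h; exact ⟨hx, hz.2⟩
        · exact ⟨h1, h2.trans hz.2⟩
    rw [this, encard_insert_of_notMem (by simp), hxn]
    norm_cast

lemma sInf_encard_lt_eq {S : Set ℝ} {x : ℝ} {n : ℕ} (hx : x ∈ S) (hxn : {y | y ∈ S ∧ y < x}.encard = n) :
    sInf {z | z ∈ S ∧ {y | y ∈ S ∧ y < z}.encard = (n : ℕ∞)} = x := by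
  have hlt : ∀ u v, u ∈ S → {y | y ∈ S ∧ y < u}.encard = (n : ℕ∞) →
      {y | y ∈ S ∧ y < v}.encard = (n : ℕ∞) → ¬ u < v := by
    intro u v hu hun hvn huv
    have h1 : insert u {y | y ∈ S ∧ y < u} ⊆ {y | y ∈ S ∧ y < v} := by
      rintro y (h | h)
      · subst h; exact ⟨hu, huv⟩
      · exact ⟨h.1, h.2.trans huv⟩
    have h2 := encard_le_encard h1
    rw [encard_insert_of_notMem (by simp), hun, hvn] at h2
    norm_cast at h2; omega
  have : {z | z ∈ S ∧ {y | y ∈ S ∧ y < z}.encard = (n : ℕ∞)} = {x} := by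
    ext z
    simp only [mem_setOf_eq, mem_singleton_iff]
    constructor
    · rintro ⟨h1, h2⟩
      exact le_antisymm (not_lt.1 (hlt x z hx hxn h2)) (not_lt.1 (hlt z x h1 h2 hxn))
    · rintro rfl; exact ⟨hx, hxn⟩
  rw [this, csInf_singleton]

open scoped RealInnerProductSpace

section Abstract
variable {H G : Type*} [NormedAddCommGroup H] [InnerProductSpace ℝ H] [CompleteSpace H]
  [NormedAddCommGroup G] [InnerProductSpace ℝ G] [CompleteSpace G]

/-- The generalized eigenvalue problem `(1 + E† E) g = J† h`, `J g = τ h` with `J` compact and of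
infinite rank has infinitely many nonzero eigenvalues. -/
lemma infinite_generalized_eigenvalues (J E : H →L[ℝ] G) (hJ : IsCompactOperator J)
    (hrank : ¬ FiniteDimensional ℝ (LinearMap.range (J : H →ₗ[ℝ] G))) :
    {τ : ℝ | τ ≠ 0 ∧ ∃ h, h ≠ 0 ∧ ∃ g, g + E.adjoint (E g) = J.adjoint h ∧ J g = τ • h}.Infinite := by
  set A : H →L[ℝ] H := ContinuousLinearMap.id ℝ H + E.adjoint ∘L E with hA
  have hAapp : ∀ g, A g = g + E.adjoint (E g) := fun g => rfl
  have hAin : ∀ x y, ⟪A x, y⟫ = ⟪x, y⟫ + ⟪E x, E y⟫ := fun x y => by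
    rw [hAapp, inner_add_left, ContinuousLinearMap.adjoint_inner_left]
  have hcoer : IsCoercive ((innerSL ℝ (E := H)) ∘L A) := by
    refine ⟨1, one_pos, fun u => ?_⟩
    show 1 * ‖u‖ * ‖u‖ ≤ ⟪A u, u⟫
    rw [hAin, real_inner_self_eq_norm_mul_norm, one_mul]
    linarith [real_inner_self_nonneg (x := E u)]
  set B := hcoer.continuousLinearEquivOfBilin.symm with hB
  have hAB : ∀ g, A (B g) = g := fun g =>
    (hcoer.unique_continuousLinearEquivOfBilin (v := B g) (f := A (B g)) fun w => rfl).trans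
      (ContinuousLinearEquiv.apply_symm_apply _ g)
  set T : G →L[ℝ] G := J ∘L (B : H →L[ℝ] H) ∘L J.adjoint with hT
  have hTin : ∀ x y, ⟪T x, y⟫ = ⟪B (J.adjoint y), B (J.adjoint x)⟫ + ⟪E (B (J.adjoint y)), E (B (J.adjoint x))⟫ :=
    fun x y => by
      have h := hAin (B (J.adjoint y)) (B (J.adjoint x))
      rwa [hAB, ContinuousLinearMap.adjoint_inner_left, real_inner_comm] at h
  have hTs : T.IsSymmetric := fun x y => by
    show ⟪T x, y⟫ = ⟪x, T y⟫
    rw [hTin, real_inner_comm (T y), hTin, real_inner_comm, real_inner_comm (E _)]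
  have hTker : ∀ h, T h = 0 → J.adjoint h = 0 := fun h hh => by
    have h1 := hTin h h
    rw [hh, inner_zero_left, real_inner_self_eq_norm_sq] at h1
    have : ‖B (J.adjoint h)‖ = 0 := by nlinarith [real_inner_self_nonneg (x := E (B (J.adjoint h)))]
    simpa using this
  intro hfin
  obtain ⟨e, he⟩ : ∃ e, e = Module.End.eigenspace (T : G →ₗ[ℝ] G) := ⟨_, rfl⟩
  obtain ⟨V, hV⟩ : ∃ V, V = ⨆ τ : hfin.toFinset, e τ := ⟨_, rfl⟩
  have hTc : IsCompactOperator T := hJ.comp_clm _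
  have : ∀ τ : hfin.toFinset, FiniteDimensional ℝ (e τ) := fun τ => by
    rw [he]; exact ContinuousLinearMap.finite_dimensional_eigenspace hTc _ (hfin.mem_toFinset.1 τ.2).1
  have hVfin : FiniteDimensional ℝ V := by rw [hV]; exact Submodule.finiteDimensional_iSup _
  have hmem : ∀ τ h, h ∈ e τ ↔ T h = τ • h := fun τ h => by rw [he]; exact Module.End.mem_eigenspace_iff
  have hle : ∀ τ ≠ 0, e τ ≤ V := fun τ h0 h hh => by
    rcases eq_or_ne h 0 with rfl | hne
    · exact V.zero_mem
    · rw [hV]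
      exact Submodule.mem_iSup_of_mem
        (⟨τ, hfin.mem_toFinset.2 ⟨h0, h, hne, B (J.adjoint h), hAB _, (hmem τ h).1 hh⟩⟩ : hfin.toFinset) hh
  have hperp : ∀ h ∈ Vᗮ, T h = 0 := fun h hh => by
    have h1 : T h ∈ (⨆ τ, e τ)ᗮ := by
      rw [Submodule.mem_orthogonal]
      intro u hu
      induction hu using Submodule.iSup_induction' with
      | mem τ x hx =>
        rw [← hTs.apply_clm, (hmem τ x).1 hx, inner_smul_left]
        rcases eq_or_ne τ 0 with rfl | h0
        · simp
        · rw [hh x (hle τ h0 hx), mul_zero]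
      | zero => exact inner_zero_left _
      | add x y _ _ hx hy => rw [inner_add_left, hx, hy, add_zero]
    rw [he, ContinuousLinearMap.orthogonalComplement_iSup_eigenspaces_eq_bot hTc hTs] at h1
    exact h1
  refine hrank (Submodule.finiteDimensional_of_le (S₂ := V) ?_)
  rintro _ ⟨g, rfl⟩
  rw [← V.orthogonal_orthogonal]
  refine fun h hh => ?_
  show ⟪h, J g⟫ = 0
  rw [← ContinuousLinearMap.adjoint_inner_left, hTker h (hperp h hh), inner_zero_left]

end Abstract

section HilbertSchmidt
variable {X : Type*} [MeasurableSpace X] {lam : Measure X}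
variable {G : Type*} [NormedAddCommGroup G] [InnerProductSpace ℝ G] [CompleteSpace G]

/-- The integral operator `h ↦ (x ↦ ⟪Φ x, h⟫)` of a square integrable family of vectors. -/
def kernelOp : Lp G 2 lam →L[ℝ] G →L[ℝ] Lp ℝ 2 lam :=
  LinearMap.mkContinuous₂
    (LinearMap.mk₂ ℝ (fun (Φ : Lp G 2 lam) (h : G) => (innerSL ℝ h).compLp Φ)
      (fun Φ Ψ h => ((innerSL ℝ h).compLpₗ 2 lam).map_add Φ Ψ)
      (fun c Φ h => ((innerSL ℝ h).compLpₗ 2 lam).map_smul c Φ)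
      (fun Φ h k => by rw [map_add, ContinuousLinearMap.add_compLp])
      (fun c Φ h => by rw [map_smul, ContinuousLinearMap.smul_compLp]))
    1 (fun Φ h => by
      refine (ContinuousLinearMap.norm_compLp_le _ _).trans ?_
      rw [innerSL_apply_norm, one_mul, mul_comm])

lemma kernelOp_coeFn (Φ : Lp G 2 lam) (h : G) : ∀ᵐ x ∂lam, kernelOp Φ h x = ⟪h, Φ x⟫ :=
  ContinuousLinearMap.coeFn_compLp (innerSL ℝ h) Φ

lemma isCompactOperator_kernelOp (Φ : Lp G 2 lam) : IsCompactOperator (kernelOp Φ) := by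
  refine Lp.induction (p := 2) (by norm_num) (fun Φ : Lp G 2 lam => IsCompactOperator (kernelOp Φ)) ?_ ?_ ?_ Φ
  · intro v s hs hμ
    set φ : Lp ℝ 2 lam := indicatorConstLp 2 hs hμ.ne (1 : ℝ) with hφ
    have : (kernelOp (Lp.simpleFunc.indicatorConst 2 hs hμ.ne v : Lp G 2 lam) : G → Lp ℝ 2 lam)
        = (ContinuousLinearMap.toSpanSingleton ℝ φ) ∘ (innerSL ℝ v) := by
      funext h
      apply Lp.ext
      filter_upwards [kernelOp_coeFn (Lp.simpleFunc.indicatorConst 2 hs hμ.ne v : Lp G 2 lam) h,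
        Lp.coeFn_smul (⟪v, h⟫ : ℝ) φ, (indicatorConstLp_coeFn (p := 2) (hs := hs) (hμs := hμ.ne) (c := v)),
        (indicatorConstLp_coeFn (p := 2) (hs := hs) (hμs := hμ.ne) (c := (1:ℝ)))] with x h1 h2 h3 h4
      rw [h1]
      have e1 : (Lp.simpleFunc.indicatorConst 2 hs hμ.ne v : Lp G 2 lam) = indicatorConstLp 2 hs hμ.ne v := rfl
      rw [e1, h3]
      show _ = (⟪v, h⟫ • φ : Lp ℝ 2 lam) x
      rw [h2, Pi.smul_apply, hφ, h4]
      by_cases hx : x ∈ s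
      · simp [hx, real_inner_comm]
      · simp [hx]
    rw [this]
    exact (isCompactOperator_of_locallyCompactSpace_rng (ContinuousLinearMap.toSpanSingleton ℝ φ)).comp_clm _
  · intro f g hf hg _ h1 h2
    rw [map_add]
    exact h1.add h2
  · exact isClosed_setOfPred_isCompactOperator.preimage (kernelOp (lam := lam) (G := G)).continuous

end HilbertSchmidt

section
open scoped RealInnerProductSpace

/-- Lebesgue measure on the half line. -/
abbrev halfLine : Measure ℝ := volume.restrict (Ioi (0 : ℝ))

lemma memLp_halfLine {F : Type*} [NormedAddCommGroup F] {q : ℝ → F} {C : ℝ} (hq : AEStronglyMeasurable q halfLine)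
    (hb : ∀ y, 0 < y → ‖q y‖ ≤ C * exp (-y / 2)) : MemLp q 2 halfLine := by
  have h : MemLp (fun y : ℝ => exp (-y / 2)) 2 halfLine := by
    rw [memLp_two_iff_integrable_sq (by fun_prop)]
    refine (integrableOn_exp_mul_Ioi (by norm_num : (-1 : ℝ) < 0) 0).congr (Eventually.of_forall fun y => ?_)
    simp only [← Real.exp_nat_mul]; congr 1; push_cast; ring
  refine (h.const_mul C).of_le hq ?_
  filter_upwards [ae_restrict_mem measurableSet_Ioi] with y hy
  exact (hb y hy).trans (le_abs_self _)

/-- The indicator function of `(0, t]`. -/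
def indVec (t : ℝ) : Lp ℝ 2 (volume : Measure ℝ) :=
  indicatorConstLp 2 (measurableSet_Ioc (a := 0) (b := t)) measure_Ioc_lt_top.ne 1

lemma inner_indVec {s t : ℝ} (hs : 0 ≤ s) (ht : 0 ≤ t) : ⟪indVec s, indVec t⟫ = min s t := by
  rw [indVec, indVec, L2.real_inner_indicatorConstLp_one_indicatorConstLp_one _ _ measure_Ioc_lt_top.ne
    measure_Ioc_lt_top.ne, Ioc_inter_Ioc, Real.volume_real_Ioc]
  simp [hs, ht]

/-- `∫_0^x e^{2ks} ds`. -/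
def expInt (k x : ℝ) : ℝ := ∫ s in (0 : ℝ)..x, exp (2 * k * s)

variable {k x y C : ℝ} {q q' : ℝ → ℝ}

lemma hasDerivAt_expInt : HasDerivAt (expInt k) (exp (2 * k * x)) x :=
  (by fun_prop : Continuous fun s => exp (2 * k * s)).integral_hasStrictDerivAt 0 x |>.hasDerivAt

lemma continuous_expInt : Continuous (expInt k) :=
  continuous_iff_continuousAt.2 fun _ => hasDerivAt_expInt.continuousAt

lemma strictMono_expInt : StrictMono (expInt k) :=
  strictMono_of_deriv_pos fun x => by rw [hasDerivAt_expInt.deriv]; exact Real.exp_pos _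

lemma expInt_nonneg (hx : 0 ≤ x) : 0 ≤ expInt k x := by
  simpa [expInt] using strictMono_expInt.monotone hx

lemma min_expInt_le (hk : 0 ≤ k) (hx : 0 ≤ x) (hy : 0 ≤ y) :
    exp (-k * x) * exp (-k * y) * min (expInt k x) (expInt k y) ≤ min x y := by
  rw [← strictMono_expInt.monotone.map_min]
  have h0 : 0 ≤ min x y := le_min hx hy
  have h1 : expInt k (min x y) ≤ exp (k * x + k * y) * min x y := by
    have := intervalIntegral.integral_mono_on h0 (μ := volume) (f := fun s => exp (2 * k * s))
      (g := fun _ => exp (k * x + k * y)) ((by fun_prop : Continuous _).intervalIntegrable _ _) (by simp)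
      fun s hs => Real.exp_le_exp.2 (by nlinarith [hs.2, min_le_left x y, min_le_right x y])
    simpa [expInt, mul_comm] using this
  calc _ ≤ exp (-k * x) * exp (-k * y) * (exp (k * x + k * y) * min x y) := by gcongr
    _ = exp (-k * x + -k * y + (k * x + k * y)) * min x y := by simp only [Real.exp_add]; ring
    _ = _ := by ring_nf; simp

/-- Vectors with Gram matrix `q(x) q(y) G(x, y)`, where `G` is the Green function of `-d²/dx² + k²` on
the half line with Dirichlet condition at the origin. -/
def gramVec (k : ℝ) (q : ℝ → ℝ) (x : ℝ) : Lp ℝ 2 (volume : Measure ℝ) := (q x * exp (-k * x)) • indVec (expInt k x)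

lemma inner_gramVec (hx : 0 ≤ x) (hy : 0 ≤ y) : ⟪gramVec k q x, gramVec k q' y⟫
    = q x * q' y * (exp (-k * x) * exp (-k * y) * min (expInt k x) (expInt k y)) := by
  rw [gramVec, gramVec, inner_smul_left, inner_smul_right, inner_indVec (expInt_nonneg hx) (expInt_nonneg hy)]
  simp; ring

lemma continuousOn_indVec : ContinuousOn indVec (Ici 0) := fun s hs => by
  rw [ContinuousWithinAt, tendsto_iff_norm_sub_tendsto_zero]
  have h : Tendsto (fun t => √|t - s|) (𝓝[Ici 0] s) (𝓝 0) := by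
    have : Continuous fun t => √|t - s| := by fun_prop
    simpa using (this.tendsto s).mono_left nhdsWithin_le_nhds
  refine h.congr' ?_
  filter_upwards [self_mem_nhdsWithin] with t ht
  rw [Real.sqrt_eq_iff_eq_sq (abs_nonneg _) (norm_nonneg _), @norm_sub_sq_real, ← real_inner_self_eq_norm_sq,
    ← real_inner_self_eq_norm_sq, inner_indVec ht ht, inner_indVec ht hs, inner_indVec hs hs]
  grind

lemma continuousOn_indVec_expInt : ContinuousOn (fun x => indVec (expInt k x)) (Ici 0) :=
  continuousOn_indVec.comp continuous_expInt.continuousOn fun _ => expInt_nonneg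

lemma norm_gramVec_le (hk : 0 ≤ k) (hy : 0 ≤ y) : ‖gramVec k q y‖ ≤ |q y| * exp (y / 2) := by
  refine abs_le_of_sq_le_sq' ?_ (by positivity) |>.2
  rw [← real_inner_self_eq_norm_sq, inner_gramVec hy hy, mul_pow, sq_abs, ← Real.exp_nat_mul, sq]
  refine mul_le_mul_of_nonneg_left ((min_expInt_le hk hy hy).trans ?_) (mul_self_nonneg _)
  rw [min_self, Nat.cast_ofNat, mul_div_cancel₀ _ two_ne_zero]
  linarith [Real.add_one_le_exp y]

lemma memLp_gramVec (hk : 0 ≤ k) (hq : Continuous q) (hb : ∀ y, 0 < y → |q y| ≤ C * exp (-y)) :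
    MemLp (gramVec k q) 2 halfLine := by
  refine memLp_halfLine (C := C) ?_ fun y hy => ?_
  · exact (((by fun_prop : Continuous fun y => q y * exp (-k * y)).continuousOn.smul
      (continuousOn_indVec_expInt.mono Ioi_subset_Ici_self)).aestronglyMeasurable measurableSet_Ioi)
  · refine (norm_gramVec_le hk hy.le).trans ((mul_le_mul_of_nonneg_right (hb y hy) (Real.exp_pos _).le).trans_eq ?_)
    rw [mul_assoc, ← Real.exp_add]; ring_nf

lemma infinite_rank_kernelOp_gramVec (hq0 : ∀ y, q y ≠ 0) (hq : MemLp (gramVec k q) 2 halfLine) :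
    ¬ FiniteDimensional ℝ (LinearMap.range (kernelOp (hq.toLp _) : Lp ℝ 2 (volume : Measure ℝ) →ₗ[ℝ] Lp ℝ 2 halfLine)) := by
  intro hfin
  obtain ⟨v, hv⟩ : ∃ v : ℕ → Lp ℝ 2 (volume : Measure ℝ), ∀ n, v n = indVec (expInt k (n + 2)) - indVec (expInt k (n + 1)) :=
    ⟨_, fun n => rfl⟩
  have hm : ∀ i j : ℕ, i < j → expInt k (i + 2) ≤ expInt k (j + 1) := fun i j h => by
    refine strictMono_expInt.monotone ?_
    have : (i : ℝ) + 1 ≤ j := by exact_mod_cast h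
    linarith
  have hm1 : ∀ i : ℕ, expInt k (i + 1) < expInt k (i + 2) := fun i => strictMono_expInt (by linarith)
  have h0 : ∀ i : ℕ, 0 ≤ expInt k (i + 1) := fun i => expInt_nonneg (by positivity)
  have hin : ∀ i j, ⟪v i, v j⟫ = if i = j then expInt k (i + 2) - expInt k (i + 1) else 0 := fun i j => by
    rw [hv, hv, inner_sub_left, inner_sub_right, inner_sub_right, inner_indVec, inner_indVec, inner_indVec, inner_indVec] <;>
      have := hm i j <;> have := hm j i <;> have := hm1 i <;> have := hm1 j <;> have := h0 i <;> have := h0 j <;>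
      grind
  have hli : LinearIndependent ℝ v := by
    refine linearIndependent_of_ne_zero_of_inner_eq_zero (𝕜 := ℝ) (fun i h => ?_) fun i j hij => ?_
    · have := hin i i; rw [h, inner_zero_left] at this; grind
    · exact (hin i j).trans (if_neg hij)
  obtain ⟨J, hJ⟩ : ∃ J, J = (kernelOp (hq.toLp _) : Lp ℝ 2 (volume : Measure ℝ) →ₗ[ℝ] Lp ℝ 2 halfLine) := ⟨_, rfl⟩
  rw [← hJ] at hfin
  have hd : Disjoint (Submodule.span ℝ (range v)) (LinearMap.ker J.rangeRestrict) := by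
    rw [LinearMap.ker_rangeRestrict, Submodule.disjoint_def]
    intro z hz hJz
    have hae : ∀ᵐ x ∂halfLine, ⟪z, indVec (expInt k x)⟫ = 0 := by
      have h1 : kernelOp (hq.toLp _) z = 0 := by rw [LinearMap.mem_ker, hJ] at hJz; exact hJz
      filter_upwards [kernelOp_coeFn (hq.toLp _) z, hq.coeFn_toLp, Lp.coeFn_zero ℝ 2 halfLine] with x h2 h3 h4
      rw [h1, h4, h3, gramVec, inner_smul_right] at h2
      exact (mul_eq_zero.1 h2.symm).resolve_left (mul_ne_zero (hq0 x) (Real.exp_pos _).ne')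
    have hall : ∀ x, 0 < x → ⟪z, indVec (expInt k x)⟫ = 0 := fun x hx =>
      Measure.eqOn_open_of_ae_eq (μ := volume) hae isOpen_Ioi
        (continuousOn_const.inner (continuousOn_indVec_expInt.mono Ioi_subset_Ici_self)) continuousOn_const hx
    have hle : Submodule.span ℝ (range v) ≤ (Submodule.span ℝ {z})ᗮ := by
      rw [Submodule.span_le]
      rintro _ ⟨n, rfl⟩
      rw [SetLike.mem_coe, Submodule.mem_orthogonal_singleton_iff_inner_right, hv, inner_sub_right,
        hall _ (by positivity), hall _ (by positivity), sub_zero]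
    exact inner_self_eq_zero.1 (Submodule.mem_orthogonal_singleton_iff_inner_right.1 (hle hz))
  have := ((hli.map hd).comp (fun i : Fin (Module.finrank ℝ (LinearMap.range J) + 1) => (i : ℕ))
    Fin.val_injective).fintype_card_le_finrank
  simp at this

end

open scoped RealInnerProductSpace

lemma hasDerivAt_piecewise_zero {f g f' : ℝ → ℝ} (hf : ∀ x, 0 ≤ x → HasDerivAt f (f' x) x)
    (hg : ∀ x, x ≤ 0 → HasDerivAt g (f' x) x) (h0 : f 0 = g 0) (x : ℝ) :
    HasDerivAt (fun x => if 0 ≤ x then f x else g x) (f' x) x := by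
  rcases lt_trichotomy x 0 with hx | hx | hx
  · refine (hg x hx.le).congr_of_eventuallyEq ?_
    filter_upwards [isOpen_Iio.mem_nhds hx] with y hy
    rw [if_neg (not_le.2 hy)]
  · subst hx
    rw [← hasDerivWithinAt_univ, ← Iic_union_Ici (a := (0 : ℝ))]
    refine HasDerivWithinAt.union ?_ ?_
    · refine (hg 0 le_rfl).hasDerivWithinAt.congr (fun y hy => ?_) (by simp [h0])
      rcases (mem_Iic.1 hy).lt_or_eq with h | h
      · rw [if_neg (not_le.2 h)]
      · subst h; simp [h0]
    · exact (hf 0 le_rfl).hasDerivWithinAt.congr (fun y hy => by rw [if_pos (mem_Ici.1 hy)]) (by simp)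
  · refine (hf x hx.le).congr_of_eventuallyEq ?_
    filter_upwards [isOpen_Ioi.mem_nhds hx] with y hy
    rw [if_pos (le_of_lt hy)]

/-- The odd extension of a bounded solution on the half line vanishing at the origin. -/
lemma exists_isLineEigenfunction_of_halfLine {ν μ : ℝ} {m : ℤ} {f f' : ℝ → ℝ}
    (h1 : ∀ x, 0 ≤ x → HasDerivAt f (f' x) x)
    (h2 : ∀ x, 0 ≤ x → HasDerivAt f' (((m : ℝ) ^ 2 + ν ^ 2 * sechSq x ^ 2 - μ * sechSq x) * f x) x)
    (h0 : f 0 = 0) (hb : ∃ B, ∀ x, 0 ≤ x → |f x| ≤ B) (hne : ∃ x, 0 ≤ x ∧ f x ≠ 0) :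
    ∃ s s', IsLineEigenfunction ν m μ s s' := by
  refine ⟨fun x => if 0 ≤ x then f x else -f (-x), fun x => if 0 ≤ x then f' x else f' (-x), ?_, ?_, ?_, ?_⟩
  · have key := hasDerivAt_piecewise_zero (f := f) (g := fun x => -f (-x))
      (f' := fun x => if 0 ≤ x then f' x else f' (-x)) (fun x hx => by simpa [hx] using h1 x hx) (fun x hx => ?_) (by simp [h0])
    · exact key
    · have h3 := ((h1 (-x) (by linarith)).comp x (hasDerivAt_neg x)).neg
      refine (h3.congr_deriv ?_)
      rcases hx.lt_or_eq with h | h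
      · simp [not_le.2 h]
      · subst h; simp
  · have key := hasDerivAt_piecewise_zero (f := f') (g := fun x => f' (-x))
      (f' := fun x => ((m : ℝ) ^ 2 + ν ^ 2 * sechSq x ^ 2 - μ * sechSq x) * (if 0 ≤ x then f x else -f (-x)))
      (fun x hx => by simpa [hx] using h2 x hx) (fun x hx => ?_) (by simp)
    · exact key
    · have h3 := ((h2 (-x) (by linarith)).comp x (hasDerivAt_neg x))
      refine (h3.congr_deriv ?_)
      rcases hx.lt_or_eq with h | h
      · simp [not_le.2 h, sechSq_neg]
      · subst h; simp [h0]
  · obtain ⟨B, hB⟩ := hb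
    refine ⟨B, fun x => ?_⟩
    by_cases h : 0 ≤ x
    · simp only [if_pos h]; exact hB x h
    · simp only [if_neg h, abs_neg]; exact hB _ (by linarith)
  · obtain ⟨x, hx, hne⟩ := hne
    exact ⟨x, by simpa [hx] using hne⟩

lemma sech_le (y : ℝ) : |(cosh y)⁻¹| ≤ 2 * exp (-y) := by
  have hc := Real.cosh_pos y
  rw [abs_of_pos (by positivity), inv_le_iff_one_le_mul₀ hc, Real.cosh_eq]
  have h1 : exp (-y) * exp y = 1 := by rw [← Real.exp_add]; simp
  nlinarith [Real.exp_pos (-y)]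

set_option maxHeartbeats 1000000 in
lemma lineSpectrum_infinite (ν : ℝ) (m : ℤ) : (lineSpectrum ν m).Infinite := by
  obtain ⟨k, hkdef⟩ : ∃ k : ℝ, k = |(m : ℝ)| := ⟨_, rfl⟩
  have hk : 0 ≤ k := by rw [hkdef]; positivity
  have hk2 : k ^ 2 = (m : ℝ) ^ 2 := by rw [hkdef, sq_abs]
  have hwc := continuous_sechSq
  have hc : Continuous fun y => (cosh y)⁻¹ := Real.continuous_cosh.inv₀ fun y => (Real.cosh_pos y).ne'
  have hc0 : ∀ y, 0 < (cosh y)⁻¹ := fun y => inv_pos.2 (Real.cosh_pos y)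
  have hw : ∀ y, sechSq y = (cosh y)⁻¹ ^ 2 := fun y => (inv_pow _ _).symm
  have hp := memLp_gramVec (q := fun y => (cosh y)⁻¹) (C := 2) hk hc fun y _ => sech_le y
  have hq := memLp_gramVec (q := fun y => ν * sechSq y) (C := |ν| * 2) hk (by fun_prop) fun y _ => by
    rw [abs_mul, mul_assoc, abs_of_pos (sechSq_pos y)]
    have h1 := sech_le y
    rw [abs_of_pos (hc0 y)] at h1
    have h2 : (cosh y)⁻¹ ≤ 1 := inv_le_one_of_one_le₀ (Real.one_le_cosh y)
    gcongr
    rw [hw]; nlinarith [hc0 y]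
  refine Infinite.of_image (fun x => x⁻¹) (s := lineSpectrum ν m) <|
    (infinite_generalized_eigenvalues (kernelOp (hp.toLp _)) (kernelOp (hq.toLp _)) (isCompactOperator_kernelOp _)
      (infinite_rank_kernelOp_gramVec (fun y => (hc0 y).ne') hp)).mono ?_
  rintro τ ⟨hτ, h, hh0, g, hg1, hg2⟩
  refine ⟨τ⁻¹, ?_, by simp⟩
  have hee : ∀ x, exp (-k * x) = (exp (k * x))⁻¹ := fun x => by rw [neg_mul, Real.exp_neg]
  obtain ⟨F0, hF0⟩ : ∃ F0 : ℝ → ℝ, ∀ x, F0 x = τ⁻¹ * (exp (-k * x) * ⟪g, indVec (expInt k |x|)⟫) := ⟨_, fun x => rfl⟩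
  have hF0c : Continuous F0 := by
    have : Continuous fun x => indVec (expInt k |x|) := continuousOn_indVec_expInt.comp_continuous continuous_abs abs_nonneg
    rw [funext hF0]; fun_prop
  have hin : ∀ x, 0 ≤ x → ⟪g, indVec (expInt k x)⟫ = τ * exp (k * x) * F0 x := fun x hx => by
    rw [hF0, abs_of_nonneg hx, hee]; field_simp
  have hrel : ∀ᵐ x ∂halfLine, h x = (cosh x)⁻¹ * F0 x := by
    filter_upwards [kernelOp_coeFn (hp.toLp _) g, hp.coeFn_toLp, Lp.coeFn_smul τ h, ae_restrict_mem measurableSet_Ioi] with x h1 h2 h3 h4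
    rw [hg2, h3, h2, Pi.smul_apply, smul_eq_mul, gramVec, inner_smul_right] at h1
    rw [hF0, abs_of_pos h4]
    refine mul_left_cancel₀ hτ (h1.trans ?_)
    field_simp
  obtain ⟨P, hP⟩ : ∃ P : ℝ → ℝ, ∀ y, P y = τ⁻¹ * sechSq y - ν ^ 2 * sechSq y ^ 2 := ⟨_, fun y => rfl⟩
  have hPc : Continuous P := by rw [funext hP]; fun_prop
  obtain ⟨ρ, hρ⟩ : ∃ ρ : ℝ → ℝ, ∀ y, ρ y = exp (-k * y) * (P y * F0 y) := ⟨_, fun y => rfl⟩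
  have hρc : Continuous ρ := by rw [funext hρ]; fun_prop
  have hEc := continuous_expInt (k := k)
  have hrep : ∀ x, 0 ≤ x → exp (k * x) * F0 x = ∫ y in Ioi 0, min (expInt k x) (expInt k y) * ρ y := fun x hx => by
    have h1 : ⟪g, indVec (expInt k x)⟫ + ⟪kernelOp (hq.toLp _) g, kernelOp (hq.toLp _) (indVec (expInt k x))⟫
        = ⟪h, kernelOp (hp.toLp _) (indVec (expInt k x))⟫ := by
      rw [← ContinuousLinearMap.adjoint_inner_left, ← inner_add_left, hg1, ContinuousLinearMap.adjoint_inner_left]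
    have hi := L2.integrable_inner (𝕜 := ℝ) h (kernelOp (hp.toLp _) (indVec (expInt k x)))
    have hi' := L2.integrable_inner (𝕜 := ℝ) (kernelOp (hq.toLp _) g) (kernelOp (hq.toLp _) (indVec (expInt k x)))
    rw [hin x hx, L2.inner_def, L2.inner_def, ← eq_sub_iff_add_eq, ← integral_sub hi hi'] at h1
    refine mul_left_cancel₀ hτ ?_
    rw [← mul_assoc, h1, ← integral_const_mul]
    refine integral_congr_ae ?_
    filter_upwards [hrel, kernelOp_coeFn (hp.toLp _) (indVec (expInt k x)), kernelOp_coeFn (hq.toLp _) (indVec (expInt k x)),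
      kernelOp_coeFn (hq.toLp _) g, hp.coeFn_toLp, hq.coeFn_toLp, ae_restrict_mem measurableSet_Ioi] with y h1 h2 h3 h4 h5 h6 h7
    rw [h1, h2, h3, h4, h5, h6]
    simp only [gramVec, inner_smul_right, hin y (le_of_lt h7), inner_indVec (expInt_nonneg hx) (expInt_nonneg (le_of_lt h7)),
      RCLike.inner_apply, conj_trivial]
    rw [hρ, hP, hw, hee]
    field_simp
  obtain ⟨B, hB⟩ : ∃ B, ∀ y, 0 ≤ y → |exp (k * y) * ρ y| ≤ B * exp (-(3 / 2) * y) := by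
    refine ⟨(|τ⁻¹| + ν ^ 2) * 4 * (|τ⁻¹| * ‖g‖), fun y hy => ?_⟩
    have h1 : |exp (-k * y) * ⟪g, indVec (expInt k |y|)⟫| ≤ ‖g‖ * exp (y / 2) := by
      rw [← real_inner_smul_right, abs_of_nonneg hy]
      have := norm_gramVec_le (q := fun _ => 1) hk hy
      rw [gramVec, one_mul, abs_one, one_mul] at this
      exact (abs_real_inner_le_norm _ _).trans (mul_le_mul_of_nonneg_left this (norm_nonneg _))
    have h2 : |P y| ≤ (|τ⁻¹| + ν ^ 2) * sechSq y := by
      have := sechSq_pos y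
      have := sechSq_le_one y
      rw [hP]
      refine (abs_sub _ _).trans ?_
      rw [abs_mul τ⁻¹, abs_of_pos (sechSq_pos y), abs_of_nonneg (by positivity : 0 ≤ ν ^ 2 * sechSq y ^ 2)]
      nlinarith [mul_nonneg (sq_nonneg ν) (sechSq_pos y).le]
    have h3 : sechSq y ≤ 4 * exp (-2 * y) := by
      have := pow_le_pow_left₀ (abs_nonneg _) (sech_le y) 2
      rw [sq_abs, ← hw, mul_pow, ← Real.exp_nat_mul] at this
      exact this.trans_eq (by norm_num)
    rw [hρ, ← mul_assoc, hee, mul_inv_cancel₀ (Real.exp_pos _).ne', one_mul, hF0, abs_mul, abs_mul]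
    calc _ ≤ (|τ⁻¹| + ν ^ 2) * (4 * exp (-2 * y)) * (|τ⁻¹| * (‖g‖ * exp (y / 2))) := by
          gcongr; exact h2.trans (by gcongr)
      _ = (|τ⁻¹| + ν ^ 2) * 4 * (|τ⁻¹| * ‖g‖) * exp (-2 * y + y / 2) := by rw [Real.exp_add]; ring
      _ = _ := by ring_nf
  have hρi : IntegrableOn ρ (Ioi 0) := by
    refine (((integrableOn_exp_mul_Ioi (by norm_num : -(3 / 2 : ℝ) < 0) 0).const_mul B).mono' hρc.aestronglyMeasurable ?_)
    filter_upwards [ae_restrict_mem measurableSet_Ioi] with y hy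
    refine le_trans ?_ (hB y (le_of_lt hy))
    rw [abs_mul, Real.abs_exp]
    exact le_mul_of_one_le_left (abs_nonneg _) (Real.one_le_exp (mul_nonneg hk (le_of_lt hy)))
  have hAd : ∀ x, HasDerivAt (fun x => (∫ y in Ioi 0, ρ y) - ∫ y in (0 : ℝ)..x, ρ y) (-ρ x) x := fun x =>
    (hρc.integral_hasStrictDerivAt 0 x).hasDerivAt.const_sub _
  obtain ⟨A, hA⟩ : ∃ A : ℝ → ℝ, A = fun x => (∫ y in Ioi 0, ρ y) - ∫ y in (0 : ℝ)..x, ρ y := ⟨_, rfl⟩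
  rw [← hA] at hAd
  obtain ⟨F, hF⟩ : ∃ F : ℝ → ℝ, F = fun x => exp (-k * x) * ((∫ y in (0 : ℝ)..x, expInt k y * ρ y) + expInt k x * A x) := ⟨_, rfl⟩
  have hexp : ∀ c x : ℝ, HasDerivAt (fun x => exp (c * x)) (c * exp (c * x)) x := fun c x =>
    (((hasDerivAt_id x).const_mul c).exp).congr_deriv (by simp [mul_comm])
  have hFd : ∀ x, HasDerivAt F (-k * F x + exp (k * x) * A x) x := fun x => by
    have h1 := (hexp (-k) x).fun_mul (((hEc.fun_mul hρc).integral_hasStrictDerivAt 0 x).hasDerivAt.fun_add ((hasDerivAt_expInt (k := k)).fun_mul (hAd x)))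
    rw [hF]
    refine HasDerivAt.congr_deriv h1 ?_
    have e : exp (-k * x) * exp (2 * k * x) = exp (k * x) := by rw [← Real.exp_add]; ring_nf
    linear_combination A x * e
  have hFF : ∀ x, 0 ≤ x → F x = F0 x := fun x hx => by
    have hi : IntegrableOn (fun y => min (expInt k x) (expInt k y) * ρ y) (Ioi 0) := by
      refine (hρi.norm.const_mul (expInt k x)).mono' (by fun_prop : Continuous _).aestronglyMeasurable ?_
      filter_upwards [ae_restrict_mem measurableSet_Ioi] with y hy
      rw [norm_mul, norm_eq_abs, abs_of_nonneg (le_min (expInt_nonneg hx) (expInt_nonneg (le_of_lt hy)))]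
      gcongr; exact min_le_left _ _
    refine mul_left_cancel₀ (Real.exp_pos (k * x)).ne' ?_
    rw [hrep x hx, hF, hA]
    beta_reduce
    rw [hee, mul_inv_cancel_left₀ (Real.exp_pos _).ne', ← intervalIntegral.integral_Ioi_sub_Ioi hρi hx, sub_sub_cancel,
      sub_eq_iff_eq_add.1 (intervalIntegral.integral_Ioi_sub_Ioi hi hx), ← integral_const_mul]
    congr 1
    · refine intervalIntegral.integral_congr fun y hy => ?_
      rw [uIcc_of_le hx] at hy
      simp only [min_eq_right (strictMono_expInt.monotone hy.2)]
    · refine setIntegral_congr_fun measurableSet_Ioi fun y hy => ?_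
      simp only [min_eq_left (strictMono_expInt.monotone (le_of_lt hy))]
  refine exists_isLineEigenfunction_of_halfLine (f := F) (fun x _ => hFd x) ?_ ?_ ?_ ?_
  · intro x hx
    refine (((hFd x).const_mul (-k)).add ((hexp k x).mul (hAd x))).congr_deriv ?_
    have e : exp (k * x) * exp (-k * x) = 1 := by rw [← Real.exp_add]; simp
    rw [hρ, hFF x hx, ← hk2]
    linear_combination (-P x * F0 x) * e - F0 x * hP x
  · simp [hF, expInt]
  · refine ⟨∫ y in Ioi 0, B * exp (-(1 / 2) * y), fun x hx => ?_⟩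
    rw [hFF x hx, ← inv_mul_cancel_left₀ (Real.exp_pos (k * x)).ne' (F0 x), hrep x hx, ← hee, ← integral_const_mul, ← norm_eq_abs]
    refine norm_integral_le_of_norm_le ((integrableOn_exp_mul_Ioi (by norm_num) 0).const_mul B) ?_
    filter_upwards [ae_restrict_mem measurableSet_Ioi] with y hy
    have hy : 0 ≤ y := le_of_lt hy
    have h1 := hB y hy
    have h2 := (min_expInt_le hk hx hy).trans (min_le_right _ _)
    have h3 : y ≤ exp y := by linarith [Real.add_one_le_exp y]
    calc _ = |exp (-k * x) * exp (-k * y) * min (expInt k x) (expInt k y)| * |exp (k * y) * ρ y| := by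
          rw [← abs_mul, hee y, norm_eq_abs]; congr 1; field_simp
      _ ≤ exp y * (B * exp (-(3 / 2) * y)) := by
          refine mul_le_mul ?_ h1 (abs_nonneg _) (Real.exp_pos _).le
          exact (abs_of_nonneg (mul_nonneg (by positivity) (le_min (expInt_nonneg hx) (expInt_nonneg hy)))).trans_le (h2.trans h3)
      _ = B * exp (y + -(3 / 2) * y) := by rw [Real.exp_add]; ring
      _ = _ := by ring_nf
  · by_contra hcon
    push Not at hcon
    refine hh0 (Lp.ext ?_)
    filter_upwards [hrel, Lp.coeFn_zero ℝ 2 halfLine, ae_restrict_mem measurableSet_Ioi] with x h1 h2 h3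
    rw [h1, ← hFF x (le_of_lt h3), hcon x (le_of_lt h3), mul_zero, h2]; rfl

section
/-- The polar angle as a function of `x = artanh (cos θ)`. -/
def polarAngle (x : ℝ) : ℝ := Real.arccos (tanh x)

lemma one_sub_tanh_sq (x : ℝ) : 1 - tanh x ^ 2 = sechSq x := by
  rw [IsLineEigenfunction.tanh_sq]; ring

lemma abs_tanh_lt_one (x : ℝ) : -1 < tanh x ∧ tanh x < 1 := by
  have h1 := one_sub_tanh_sq x
  have h2 := sechSq_pos x
  exact abs_lt.1 ((sq_lt_one_iff_abs_lt_one _).1 (by linarith))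

lemma cos_polarAngle (x : ℝ) : cos (polarAngle x) = tanh x :=
  Real.cos_arccos (abs_tanh_lt_one x).1.le (abs_tanh_lt_one x).2.le

lemma sin_polarAngle (x : ℝ) : sin (polarAngle x) = (cosh x)⁻¹ := by
  have := Real.cosh_pos x
  rw [polarAngle, Real.sin_arccos, one_sub_tanh_sq, sechSq, Real.sqrt_inv, Real.sqrt_sq this.le]

lemma sin_polarAngle_sq (x : ℝ) : sin (polarAngle x) ^ 2 = sechSq x := by
  rw [sin_polarAngle, inv_pow, sechSq]

lemma polarAngle_mem (x : ℝ) : polarAngle x ∈ Ioo 0 π := by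
  constructor
  · exact Real.arccos_pos.2 (abs_tanh_lt_one x).2
  · refine lt_of_le_of_ne (Real.arccos_le_pi _) fun h => ?_
    have := cos_polarAngle x
    rw [show polarAngle x = π from h, Real.cos_pi] at this
    linarith [(abs_tanh_lt_one x).1]

lemma hasDerivAt_polarAngle (x : ℝ) : HasDerivAt polarAngle (-sin (polarAngle x)) x := by
  have h := (Real.hasDerivAt_arccos (abs_tanh_lt_one x).1.ne' (abs_tanh_lt_one x).2.ne).comp x
    (IsLineEigenfunction.hasDerivAt_tanh x)
  refine h.congr_deriv ?_
  have := Real.cosh_pos x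
  rw [one_sub_tanh_sq, sin_polarAngle, sechSq, Real.sqrt_inv, Real.sqrt_sq this.le]
  field_simp

lemma polarAngle_artanh {θ : ℝ} (hθ : θ ∈ Ioo 0 π) : polarAngle (artanh (cos θ)) = θ := by
  have h1 : cos θ ∈ Ioo (-1 : ℝ) 1 := by
    have := Real.sin_pos_of_mem_Ioo hθ
    have h2 := Real.sin_sq_add_cos_sq θ
    exact abs_lt.1 ((sq_lt_one_iff_abs_lt_one _).1 (by nlinarith))
  rw [polarAngle, Real.tanh_artanh h1, Real.arccos_cos hθ.1.le hθ.2.le]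

lemma polarAngle_injective : Function.Injective polarAngle := by
  intro x y h
  have := congrArg cos h
  rw [cos_polarAngle, cos_polarAngle] at this
  rw [← Real.artanh_tanh x, this, Real.artanh_tanh]

lemma range_polarAngle : range polarAngle = Ioo 0 π := by
  ext θ
  constructor
  · rintro ⟨x, rfl⟩; exact polarAngle_mem x
  · exact fun h => ⟨_, polarAngle_artanh h⟩

lemma integral_mul_sin {E : Type*} [NormedAddCommGroup E] [NormedSpace ℝ E] (g : ℝ → E) :
    ∫ θ in (0 : ℝ)..Real.pi, sin θ • g θ = ∫ x, sechSq x • g (polarAngle x) := by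
  rw [intervalIntegral.integral_of_le Real.pi_pos.le, integral_Ioc_eq_integral_Ioo, ← range_polarAngle, ← image_univ,
    integral_image_eq_integral_abs_deriv_smul MeasurableSet.univ
      (fun x _ => (hasDerivAt_polarAngle x).hasDerivWithinAt) polarAngle_injective.injOn, Measure.restrict_univ]
  refine integral_congr_ae (Eventually.of_forall fun x => ?_)
  simp only
  rw [abs_neg, abs_of_pos (Real.sin_pos_of_mem_Ioo (polarAngle_mem x)), smul_smul, ← sq, sin_polarAngle_sq]

variable {ν : ℝ} {m : ℤ} {lam : ℝ} {f : ℝ → ℝ}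

namespace IsSpheroidalEigenfunction

lemma hasDerivAt (h : IsSpheroidalEigenfunction ν m lam f) {θ : ℝ} (hθ : θ ∈ Ioo 0 π) :
    HasDerivAt f (deriv f θ) θ :=
  ((h.contDiff.differentiableOn (by norm_num)).differentiableAt (isOpen_Ioo.mem_nhds hθ)).hasDerivAt

lemma hasDerivAt_sin_mul_deriv (h : IsSpheroidalEigenfunction ν m lam f) {θ : ℝ} (hθ : θ ∈ Ioo 0 π) :
    HasDerivAt (fun s => sin s * deriv f s)
      (sin θ * ((m : ℝ) ^ 2 / sin θ ^ 2 - ν ^ 2 * cos θ ^ 2 - lam) * f θ) θ := by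
  have h1 : ContDiffOn ℝ 1 (deriv f) (Ioo 0 π) :=
    ((contDiffOn_succ_iff_deriv_of_isOpen (n := 1) isOpen_Ioo).1 h.contDiff).2.2
  have h2 : DifferentiableAt ℝ (fun s => sin s * deriv f s) θ :=
    Real.differentiable_sin.differentiableAt.mul
      ((h1.differentiableOn (by norm_num)).differentiableAt (isOpen_Ioo.mem_nhds hθ))
  refine h2.hasDerivAt.congr_deriv ?_
  have h3 := h.eqn θ hθ
  have hs := (Real.sin_pos_of_mem_Ioo hθ).ne'
  have h4 : (sin θ)⁻¹ * deriv (fun s => sin s * deriv f s) θ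
    = ((m : ℝ) ^ 2 / sin θ ^ 2 - ν ^ 2 * cos θ ^ 2 - lam) * f θ := by linarith
  rw [mul_assoc, ← h4, ← mul_assoc, mul_inv_cancel₀ hs, one_mul]

lemma isLineEigenfunction (h : IsSpheroidalEigenfunction ν m lam f) :
    IsLineEigenfunction ν m (lam + ν ^ 2) (fun x => f (polarAngle x))
      fun x => -(sin (polarAngle x) * deriv f (polarAngle x)) where
  d1 x := ((h.hasDerivAt (polarAngle_mem x)).comp x (hasDerivAt_polarAngle x)).congr_deriv (by ring)
  d2 x := by
    have h1 := ((h.hasDerivAt_sin_mul_deriv (polarAngle_mem x)).comp x (hasDerivAt_polarAngle x)).neg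
    refine h1.congr_deriv ?_
    have hs := (Real.sin_pos_of_mem_Ioo (polarAngle_mem x)).ne'
    rw [← sin_polarAngle_sq, Real.cos_sq']
    field_simp
    ring
  bounded := by
    obtain ⟨B, hB⟩ := h.bounded
    exact ⟨B, fun x => hB _ (polarAngle_mem x)⟩
  nonzero := by
    obtain ⟨θ, hθ, hne⟩ := h.nonzero
    exact ⟨_, by rwa [polarAngle_artanh hθ]⟩

end IsSpheroidalEigenfunction

lemma hasDerivAt_artanh_cos {θ : ℝ} (hθ : θ ∈ Ioo 0 π) :
    HasDerivAt (fun θ => artanh (cos θ)) (-(sin θ)⁻¹) θ := by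
  have hs := Real.sin_pos_of_mem_Ioo hθ
  have hc : ContinuousAt (fun θ => artanh (cos θ)) θ := by
    have h1 : -1 < cos θ ∧ cos θ < 1 := by
      have h2 := Real.sin_sq_add_cos_sq θ
      exact abs_lt.1 ((sq_lt_one_iff_abs_lt_one _).1 (by nlinarith))
    have e : (fun θ => artanh (cos θ)) = fun θ => Real.log (√((1 + cos θ) / (1 - cos θ))) := rfl
    rw [e]
    refine ContinuousAt.log (ContinuousAt.sqrt (ContinuousAt.div (by fun_prop) (by fun_prop) (by linarith))) ?_
    exact (Real.sqrt_pos.2 (div_pos (by linarith) (by linarith))).ne'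
  have h := HasDerivAt.of_local_left_inverse (f := polarAngle) (g := fun θ => artanh (cos θ)) hc
    (hasDerivAt_polarAngle _) (by rw [polarAngle_artanh hθ]; exact neg_ne_zero.2 hs.ne') ?_
  · rw [polarAngle_artanh hθ] at h
    exact h.congr_deriv (by rw [inv_neg])
  · filter_upwards [isOpen_Ioo.mem_nhds hθ] with y hy
    exact polarAngle_artanh hy

lemma IsLineEigenfunction.isSpheroidalEigenfunction {μ : ℝ} {s s' : ℝ → ℝ} (h : IsLineEigenfunction ν m μ s s') :
    IsSpheroidalEigenfunction ν m (μ - ν ^ 2) fun θ => s (artanh (cos θ)) := by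
  have hd1 : ∀ θ ∈ Ioo 0 π, HasDerivAt (fun θ => s (artanh (cos θ)))
      (-(sin θ)⁻¹ * s' (artanh (cos θ))) θ := fun θ hθ =>
    ((h.d1 _).comp θ (hasDerivAt_artanh_cos hθ)).congr_deriv (by ring)
  have hd2 : ∀ θ ∈ Ioo 0 π, HasDerivAt (fun θ => s' (artanh (cos θ)))
      (-(sin θ)⁻¹ * (((m : ℝ) ^ 2 + ν ^ 2 * (sin θ ^ 2) ^ 2 - μ * sin θ ^ 2) * s (artanh (cos θ)))) θ := by
    intro θ hθ
    refine ((h.d2 _).comp θ (hasDerivAt_artanh_cos hθ)).congr_deriv ?_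
    rw [← sin_polarAngle_sq, polarAngle_artanh hθ]; ring
  have hderiv : ∀ θ ∈ Ioo 0 π, deriv (fun θ => s (artanh (cos θ))) θ
      = -(sin θ)⁻¹ * s' (artanh (cos θ)) := fun θ hθ => (hd1 θ hθ).deriv
  have hsin : ∀ θ ∈ Ioo 0 π, sin θ ≠ 0 := fun θ hθ => (Real.sin_pos_of_mem_Ioo hθ).ne'
  have hcs : ContinuousOn (fun θ => s (artanh (cos θ))) (Ioo 0 π) := fun θ hθ =>
    (hd1 θ hθ).continuousAt.continuousWithinAt
  refine ⟨?_, ?_, ?_, ?_⟩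
  · have hC1 : ContDiffOn ℝ 1 (fun θ => s' (artanh (cos θ))) (Ioo 0 π) := by
      refine (contDiffOn_succ_iff_deriv_of_isOpen (n := 0) isOpen_Ioo).2
        ⟨fun θ hθ => (hd2 θ hθ).differentiableAt.differentiableWithinAt, by simp, ?_⟩
      rw [contDiffOn_zero]
      refine ContinuousOn.congr ?_ fun θ hθ => (hd2 θ hθ).deriv
      refine ContinuousOn.mul ((Real.continuous_sin.continuousOn.inv₀ hsin).neg) (ContinuousOn.mul (by fun_prop) hcs)
    refine (contDiffOn_succ_iff_deriv_of_isOpen (n := 1) isOpen_Ioo).2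
      ⟨fun θ hθ => (hd1 θ hθ).differentiableAt.differentiableWithinAt, by simp, ?_⟩
    refine ContDiffOn.congr ?_ hderiv
    exact ((Real.contDiff_sin.contDiffOn.inv hsin).neg).mul hC1
  · obtain ⟨B, hB⟩ := h.bounded
    exact ⟨B, fun θ _ => hB _⟩
  · obtain ⟨x, hx⟩ := h.nonzero
    refine ⟨polarAngle x, polarAngle_mem x, ?_⟩
    rwa [cos_polarAngle, Real.artanh_tanh]
  · intro θ hθ
    have hs := hsin θ hθ
    have e : deriv (fun t => sin t * deriv (fun θ => s (artanh (cos θ))) t) θ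
        = (sin θ)⁻¹ * (((m : ℝ) ^ 2 + ν ^ 2 * (sin θ ^ 2) ^ 2 - μ * sin θ ^ 2) * s (artanh (cos θ))) := by
      have h3 : (fun t => sin t * deriv (fun θ => s (artanh (cos θ))) t)
          =ᶠ[𝓝 θ] fun t => -s' (artanh (cos t)) := by
        filter_upwards [isOpen_Ioo.mem_nhds hθ] with t ht
        rw [hderiv t ht]
        have := hsin t ht
        field_simp
      rw [h3.deriv_eq, ((hd2 θ hθ).fun_neg).deriv]; ring
    rw [e, Real.cos_sq']
    field_simp
    ring

lemma mem_spheroidalSpectrum_iff : lam ∈ spheroidalSpectrum ν m ↔ lam + ν ^ 2 ∈ lineSpectrum ν m := by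
  constructor
  · rintro ⟨f, hf⟩; exact ⟨_, _, hf.isLineEigenfunction⟩
  · rintro ⟨s, s', hs⟩
    exact ⟨_, by simpa using hs.isSpheroidalEigenfunction⟩

lemma spheroidalSpectrum_infinite (ν : ℝ) (m : ℤ) : (spheroidalSpectrum ν m).Infinite := by
  intro hfin
  refine lineSpectrum_infinite ν m ((hfin.image fun x => x + ν ^ 2).subset fun μ hμ => ?_)
  exact ⟨μ - ν ^ 2, mem_spheroidalSpectrum_iff.2 (by simpa using hμ), by simp⟩

lemma spheroidalSpectrum_finite_le (ν : ℝ) (m : ℤ) (L : ℝ) : {x ∈ spheroidalSpectrum ν m | x ≤ L}.Finite := by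
  refine Set.Finite.of_finite_image (f := fun x => x + ν ^ 2) ((lineSpectrum_finite_le ν m (L + ν ^ 2)).subset ?_)
    (fun x _ y _ h => by simpa using h)
  rintro _ ⟨x, hx, rfl⟩
  exact ⟨mem_spheroidalSpectrum_iff.1 hx.1, by simpa using hx.2⟩

lemma spheroidalEigenvalue_spec (ν : ℝ) (m : ℤ) (l : ℕ) :
    spheroidalEigenvalue ν m l ∈ spheroidalSpectrum ν m ∧
      {mu | mu ∈ spheroidalSpectrum ν m ∧ mu < spheroidalEigenvalue ν m l}.encard = ((l - m.natAbs : ℕ) : ℕ∞) := by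
  obtain ⟨x, hx, hxn⟩ := exists_encard_lt_eq (spheroidalSpectrum_infinite ν m) (spheroidalSpectrum_finite_le ν m) (l - m.natAbs)
  have : spheroidalEigenvalue ν m l = x := sInf_encard_lt_eq hx hxn
  rw [this]; exact ⟨hx, hxn⟩

lemma spheroidalEigenvalue_injOn (ν : ℝ) (m : ℤ) {l l' : ℕ} (hl : m.natAbs ≤ l) (hl' : m.natAbs ≤ l')
    (h : spheroidalEigenvalue ν m l = spheroidalEigenvalue ν m l') : l = l' := by
  have h1 := (spheroidalEigenvalue_spec ν m l).2
  rw [h, (spheroidalEigenvalue_spec ν m l').2] at h1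
  norm_cast at h1; omega

lemma spheroidalS_spec (ν : ℝ) (m : ℤ) (l : ℕ) :
    IsSpheroidalEigenfunction ν m (spheroidalEigenvalue ν m l) (spheroidalS ν m l) ∧
      ∫ θ in (0 : ℝ)..Real.pi, spheroidalS ν m l θ ^ 2 * sin θ = 1 := by
  refine Classical.epsilon_spec (p := fun f => IsSpheroidalEigenfunction ν m (spheroidalEigenvalue ν m l) f ∧
      ∫ θ in (0 : ℝ)..Real.pi, f θ ^ 2 * sin θ = 1) ?_
  obtain ⟨f, hf⟩ := (spheroidalEigenvalue_spec ν m l).1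
  have hpos := hf.isLineEigenfunction.integral_sq_pos
  obtain ⟨N, hN⟩ : ∃ N, N = ∫ θ in (0 : ℝ)..Real.pi, f θ ^ 2 * sin θ := ⟨_, rfl⟩
  have hNpos : 0 < N := by
    have := integral_mul_sin fun θ => f θ ^ 2
    simp only [smul_eq_mul] at this
    rw [hN]
    simp_rw [mul_comm _ (sin _)]
    rw [this]
    simpa [sq] using hpos
  have hc : (√N)⁻¹ ≠ 0 := by positivity
  refine ⟨fun θ => (√N)⁻¹ * f θ, ⟨contDiffOn_const.mul hf.contDiff, ?_, ?_, ?_⟩, ?_⟩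
  · obtain ⟨B, hB⟩ := hf.bounded
    refine ⟨|(√N)⁻¹| * B, fun θ hθ => ?_⟩
    rw [abs_mul]; have := hB θ hθ; gcongr
  · obtain ⟨θ, hθ, hne⟩ := hf.nonzero
    exact ⟨θ, hθ, mul_ne_zero hc hne⟩
  · intro θ hθ
    have e : (fun s => sin s * deriv (fun θ => (√N)⁻¹ * f θ) s) = fun s => (√N)⁻¹ * (sin s * deriv f s) := by
      funext s; rw [deriv_const_mul_field]; ring
    rw [e, deriv_const_mul_field]
    linear_combination (√N)⁻¹ * hf.eqn θ hθ
  · have e : ∀ θ, ((√N)⁻¹ * f θ) ^ 2 * sin θ = N⁻¹ * (f θ ^ 2 * sin θ) := fun θ => by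
      rw [mul_pow, inv_pow, Real.sq_sqrt hNpos.le]; ring
    simp_rw [e]
    rw [intervalIntegral.integral_const_mul, ← hN, inv_mul_cancel₀ hNpos.ne']

/-- The spheroidal harmonic in the coordinate `x = artanh (cos θ)`. -/
lemma isLineEigenfunction_spheroidalS (ν : ℝ) (m : ℤ) (l : ℕ) :
    IsLineEigenfunction ν m (spheroidalEigenvalue ν m l + ν ^ 2) (fun x => spheroidalS ν m l (polarAngle x))
      fun x => -(sin (polarAngle x) * deriv (spheroidalS ν m l) (polarAngle x)) :=
  (spheroidalS_spec ν m l).1.isLineEigenfunction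

lemma admissible_LambdaFreq (a ω : ℝ) (m : ℤ) (l : ℕ) : Admissible a ω m (LambdaFreq a ω m l) := by
  have h := isLineEigenfunction_spheroidalS (a * ω) m l
  have e : spheroidalEigenvalue (a * ω) m l + (a * ω) ^ 2 = LambdaFreq a ω m l := by unfold LambdaFreq; ring
  rw [e] at h
  refine ⟨h.le_eigenvalue, ?_⟩
  have := h.two_abs_mul_le
  have e2 : |a * m * ω| = |m * (a * ω)| := by ring_nf
  have := abs_nonneg (m * (a * ω))
  rw [e2]; linarith

lemma integral_spheroidalS_mul (ν : ℝ) (m : ℤ) {l l' : ℕ} (hl : m.natAbs ≤ l) (hl' : m.natAbs ≤ l') (hne : l ≠ l') :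
    ∫ θ in (0 : ℝ)..Real.pi, sin θ * (spheroidalS ν m l θ * spheroidalS ν m l' θ) = 0 := by
  have := integral_mul_sin fun θ => spheroidalS ν m l θ * spheroidalS ν m l' θ
  simp only [smul_eq_mul] at this
  rw [this]
  exact (isLineEigenfunction_spheroidalS ν m l).orthogonal (isLineEigenfunction_spheroidalS ν m l')
    fun h => hne (spheroidalEigenvalue_injOn ν m hl hl' (by linarith))

/-- The weak form of the angular equation. -/
lemma integral_angular_operator_mul_spheroidalS (ν : ℝ) (m : ℤ) (l : ℕ) {A A' A'' E : ℝ → ℂ} {B : ℝ}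
    (h1 : ∀ θ ∈ Ioo 0 π, HasDerivAt A (A' θ) θ) (h2 : ∀ θ ∈ Ioo 0 π, HasDerivAt A' (A'' θ) θ)
    (hA : ∀ θ ∈ Ioo 0 π, ‖A θ‖ ≤ B) (hA' : ∀ θ ∈ Ioo 0 π, ‖A' θ‖ ≤ B)
    (hE : ∀ θ ∈ Ioo 0 π, ‖E θ‖ ≤ B) (hEc : ContinuousOn E (Ioo 0 π))
    (heq : ∀ θ ∈ Ioo 0 π, (sin θ : ℂ) ^ 2 * E θ = (sin θ : ℂ) ^ 2 * A'' θ
      + sin θ * cos θ * A' θ - (m : ℂ) ^ 2 * A θ - (ν : ℂ) ^ 2 * (sin θ : ℂ) ^ 4 * A θ) :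
    ∫ θ in (0 : ℝ)..Real.pi, E θ * (spheroidalS ν m l θ : ℂ) * (sin θ : ℂ)
      = -((spheroidalEigenvalue ν m l + ν ^ 2 : ℝ) : ℂ) *
        ∫ θ in (0 : ℝ)..Real.pi, A θ * (spheroidalS ν m l θ : ℂ) * (sin θ : ℂ) := by
  obtain ⟨μ, hμ⟩ : ∃ μ, μ = spheroidalEigenvalue ν m l + ν ^ 2 := ⟨_, rfl⟩
  have hs := isLineEigenfunction_spheroidalS ν m l
  rw [← hμ] at hs ⊢
  obtain ⟨s, hsdef⟩ : ∃ s : ℝ → ℝ, s = fun x => spheroidalS ν m l (polarAngle x) := ⟨_, rfl⟩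
  obtain ⟨s', hs'def⟩ : ∃ s' : ℝ → ℝ, s' = fun x => -(sin (polarAngle x) * deriv (spheroidalS ν m l) (polarAngle x)) := ⟨_, rfl⟩
  rw [← hsdef, ← hs'def] at hs
  have hpm := polarAngle_mem
  have hpc : Continuous polarAngle := continuous_iff_continuousAt.2 fun x => (hasDerivAt_polarAngle x).continuousAt
  have hAc : Continuous fun x => A (polarAngle x) :=
    continuous_iff_continuousAt.2 fun x => ContinuousAt.comp (f := polarAngle) (h1 _ (hpm x)).continuousAt hpc.continuousAt
  have hEpc : Continuous fun x => E (polarAngle x) :=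
    continuous_iff_continuousAt.2 fun x => ContinuousAt.comp (f := polarAngle)
      (hEc.continuousAt (isOpen_Ioo.mem_nhds (hpm x))) hpc.continuousAt
  obtain ⟨Bs, hBs⟩ := hs.bounded
  have hB0 : 0 ≤ B := (norm_nonneg _).trans (hA _ (hpm 0))
  have hBs0 : 0 ≤ Bs := (abs_nonneg _).trans (hBs 0)
  have hwc := continuous_sechSq
  have hwcC : Continuous fun x => (sechSq x : ℂ) := Complex.continuous_ofReal.comp hwc
  have hscC : Continuous fun x => (s x : ℂ) := Complex.continuous_ofReal.comp hs.continuous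
  have hconv : ∀ Q : ℝ → ℂ, ∫ θ in (0 : ℝ)..Real.pi, Q θ * (spheroidalS ν m l θ : ℂ) * (sin θ : ℂ)
      = ∫ x, (sechSq x : ℂ) * (Q (polarAngle x) * (s x : ℂ)) := by
    intro Q
    have := integral_mul_sin fun θ => Q θ * (spheroidalS ν m l θ : ℂ)
    simp only [Complex.real_smul] at this
    simp_rw [hsdef, ← this]
    congr 1; funext θ; ring
  rw [hconv, hconv]
  have hint : ∀ Q : ℝ → ℂ, Continuous (fun x => Q (polarAngle x)) → (∀ θ ∈ Ioo 0 π, ‖Q θ‖ ≤ B) →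
      Integrable fun x => (sechSq x : ℂ) * (Q (polarAngle x) * (s x : ℂ)) := by
    intro Q hQ hQB
    refine (integrable_sechSq.mul_const (B * Bs)).mono' (hwcC.mul (hQ.mul hscC)).aestronglyMeasurable (Eventually.of_forall fun x => ?_)
    rw [norm_mul, norm_mul, Complex.norm_real, Complex.norm_real, norm_eq_abs, norm_eq_abs, abs_of_pos (sechSq_pos x)]
    have := hQB _ (hpm x)
    have := hBs x
    have := sechSq_pos x
    gcongr
  have hIE := hint E hEpc hE
  have hIA := hint A hAc hA
  rw [← integral_const_mul]
  rw [← sub_eq_zero, ← integral_sub hIE (hIA.const_mul _)]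
  have hITot := hIE.sub (hIA.const_mul (-(μ : ℂ)))
  -- the primitive
  have hd : ∀ x, HasDerivAt (fun x => -((sin (polarAngle x) : ℂ) * A' (polarAngle x)) * (s x : ℂ)
      - A (polarAngle x) * (s' x : ℂ))
      ((sechSq x : ℂ) * (E (polarAngle x) * (s x : ℂ)) - -(μ : ℂ) * ((sechSq x : ℂ) * (A (polarAngle x) * (s x : ℂ)))) x := by
    intro x
    have e1 := (h1 _ (hpm x)).scomp x (hasDerivAt_polarAngle x)
    have e2 := (h2 _ (hpm x)).scomp x (hasDerivAt_polarAngle x)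
    have e3 := ((Real.hasDerivAt_sin (polarAngle x)).comp x (hasDerivAt_polarAngle x)).ofReal_comp
    have e4 := (hs.d1 x).ofReal_comp
    have e5 := (hs.d2 x).ofReal_comp
    refine ((((e3.fun_mul e2).fun_neg).fun_mul e4).fun_sub (e1.fun_mul e5)).congr_deriv ?_
    have e6 := heq _ (hpm x)
    have e7 : (sechSq x : ℂ) = (sin (polarAngle x) : ℂ) ^ 2 := by rw [← sin_polarAngle_sq]; push_cast; rfl
    simp only [Function.comp_apply, Complex.real_smul, Complex.ofReal_neg, Complex.ofReal_mul, Complex.ofReal_add,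
      Complex.ofReal_sub, Complex.ofReal_pow, Complex.ofReal_intCast]
    rw [e7, ← mul_assoc ((sin (polarAngle x) : ℂ) ^ 2) (E _), e6]
    ring
  refine integral_eq_zero_of_hasDerivAt_of_memLp hd hITot ?_
  have hc := continuous_iff_continuousAt.2 fun x => (hd x).continuousAt
  have h1 : MemLp (fun x => √(sechSq x)) 2 := (memLp_two_iff_integrable_sq hwc.sqrt.aestronglyMeasurable).2 (by
    simpa [Real.sq_sqrt (sechSq_pos _).le] using integrable_sechSq)
  refine MemLp.of_le ((h1.const_mul (B * Bs)).add (hs.memLp_deriv.norm.const_mul B)) hc.aestronglyMeasurable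
    (Eventually.of_forall fun x => (norm_sub_le _ _).trans (le_trans ?_ (le_abs_self _)))
  rw [norm_mul, norm_neg, norm_mul, norm_mul, Complex.norm_real, Complex.norm_real, Complex.norm_real, Pi.add_apply,
    norm_eq_abs, ← Real.sqrt_sq_eq_abs, sin_polarAngle_sq, mul_comm (√_), mul_right_comm]
  have := hA _ (hpm x)
  have := hA' _ (hpm x)
  have : ‖s x‖ ≤ Bs := hBs x
  gcongr

end

section
local notation "dx" => ContinuousLinearMap.proj (R := ℝ) (φ := fun _ : Fin 4 => ℝ)

lemma hasFDerivAt_rad {x : Pt} (hx : 0 < rad x) :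
    HasFDerivAt rad ((rad x)⁻¹ • (x 1 • dx 1 + x 2 • dx 2 + x 3 • dx 3)) x := by
  have h0 : x 1 ^ 2 + x 2 ^ 2 + x 3 ^ 2 ≠ 0 := by
    intro h; unfold rad at hx; rw [h] at hx; simp at hx
  have hp := fun i => hasFDerivAt_apply (𝕜 := ℝ) i x
  have h : HasFDerivAt rad _ x := (((hp 1).mul (hp 1)).add ((hp 2).mul (hp 2))|>.add ((hp 3).mul (hp 3))|>.congr_of_eventuallyEq
    (f₁ := fun y : Pt => y 1 ^ 2 + y 2 ^ 2 + y 3 ^ 2) (Eventually.of_forall fun y => by simp [sq])).sqrt h0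
  refine h.congr_fderiv ?_
  ext v
  simp [rad]
  field_simp
  ring

lemma fderiv_rad {x : Pt} (hx : 0 < rad x) (w : Pt) : fderiv ℝ rad x w = dRad x w := by
  rw [(hasFDerivAt_rad hx).fderiv]
  simp [dRad]; ring

lemma rad_sq (x : Pt) : rad x ^ 2 = x 1 ^ 2 + x 2 ^ 2 + x 3 ^ 2 := Real.sq_sqrt (by positivity)

lemma continuous_rad : Continuous rad := by unfold rad; fun_prop

/-- `sin² θ`. -/
def sinSq (x : Pt) : ℝ := (x 1 ^ 2 + x 2 ^ 2) / rad x ^ 2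

/-- `ρ² = r² + a² cos² θ`. -/
def rhoSq (a : ℝ) (x : Pt) : ℝ := rad x ^ 2 + a ^ 2 * (x 3 ^ 2 / rad x ^ 2)

lemma cosSq_eq {x : Pt} (hx : 0 < rad x) : x 3 ^ 2 / rad x ^ 2 = 1 - sinSq x := by
  unfold sinSq
  have := rad_sq x
  field_simp
  linarith

lemma rhoSq_pos (a : ℝ) {x : Pt} (hx : 0 < rad x) : 0 < rhoSq a x := by unfold rhoSq; positivity

/-- The Kerr star coordinate field `∂_r - p T - q Ω₁`. -/
def radialField (p q : ℝ → ℝ) (x : Pt) : Pt :=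
  ![-p (rad x), x 1 / rad x + q (rad x) * x 2, x 2 / rad x - q (rad x) * x 1, x 3 / rad x]

/-- The principal null combination `(r² + a²) T + a Ω₁`. -/
def nullField (a : ℝ) (x : Pt) : Pt := ![rad x ^ 2 + a ^ 2, -(a * x 2), a * x 1, 0]

/-- The frame in which the Kerr metric takes a simple form. -/
def kerrFrame (a : ℝ) (p q : ℝ → ℝ) (x : Pt) : Fin 4 → Pt :=
  ![nullField a x, radialField p q x, ![0, x 1 * x 3, x 2 * x 3, -(x 1 ^ 2 + x 2 ^ 2)],
    ![a * sinSq x, -x 2, x 1, 0]]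

/-- The Gram matrix of the Kerr frame. -/
def kerrGram (M a : ℝ) (x : Pt) : Matrix (Fin 4) (Fin 4) ℝ :=
  !![-(Del M a (rad x) * rhoSq a x), rhoSq a x, 0, 0; rhoSq a x, 0, 0, 0;
     0, 0, rhoSq a x * (rad x ^ 2 * sinSq x), 0; 0, 0, 0, rhoSq a x * sinSq x]

variable {M a : ℝ} {p q : ℝ → ℝ} {rBL : Pt → ℝ} {x : Pt}

/-- The Kerr metric in terms of the values of the coframe on its two arguments. -/
def kerrFormCore (Δ a r s ρ q d d' v v' e e' σ : ℝ) : ℝ :=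
  ρ * σ + (d * (v' - a * (e' + s * (q * d'))) + (v - a * (e + s * (q * d))) * d')
    - Δ / ρ * ((v - a * (e + s * (q * d))) * (v' - a * (e' + s * (q * d'))))
    + (1 / ρ) * (a ^ 2 * ((r ^ 2 + a ^ 2) + ρ) * (e * e') + a ^ 2 * s * (v * v')
      - a * (r ^ 2 + a ^ 2) * (v * (e' + s * (q * d')) + (e + s * (q * d)) * v')
      + (r ^ 2 + a ^ 2) ^ 2 * (q * (d * e' + e * d') + s * q ^ 2 * (d * d')))

def etaForm (x z : Pt) : ℝ := (x 1 * z 2 - x 2 * z 1) / rad x ^ 2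

def roundForm (x w w' : Pt) : ℝ :=
  (w 1 * w' 1 + w 2 * w' 2 + w 3 * w' 3 - dRad x w * dRad x w') / rad x ^ 2

lemma kerrForm_eq (hx : 0 < rad x) (hr : rBL =ᶠ[𝓝 x] rad) (w w' : Pt) :
    kerrForm M a p q rBL x w w' = kerrFormCore (Del M a (rad x)) a (rad x) (sinSq x) (rhoSq a x) (q (rad x))
      (dRad x w) (dRad x w') (w 0 + p (rad x) * dRad x w) (w' 0 + p (rad x) * dRad x w')
      (etaForm x w) (etaForm x w') (roundForm x w w') := by
  simp only [kerrForm, hr.fderiv_eq, fderiv_rad hx, hr.eq_of_nhds]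
  rfl

lemma kerrForm_add_left (w z w' : Pt) : kerrForm M a p q rBL x (w + z) w'
    = kerrForm M a p q rBL x w w' + kerrForm M a p q rBL x z w' := by
  simp only [kerrForm, dRad, map_add, Pi.add_apply]; ring

lemma kerrForm_smul_left (c : ℝ) (w w' : Pt) : kerrForm M a p q rBL x (c • w) w' = c * kerrForm M a p q rBL x w w' := by
  simp only [kerrForm, dRad, map_smul, Pi.smul_apply, smul_eq_mul]; ring

lemma kerrForm_comm (w w' : Pt) : kerrForm M a p q rBL x w w' = kerrForm M a p q rBL x w' w := by
  simp only [kerrForm]; ring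

lemma kerrForm_eq_sum (w w' : Pt) :
    kerrForm M a p q rBL x w w' = ∑ i, ∑ j, w i * w' j * kerrMatrix M a p q rBL x i j := by
  let Bm : Pt →ₗ[ℝ] Pt →ₗ[ℝ] ℝ := LinearMap.mk₂ ℝ (fun w w' => kerrForm M a p q rBL x w w')
    kerrForm_add_left kerrForm_smul_left
    (fun w z z' => by rw [kerrForm_comm, kerrForm_add_left, kerrForm_comm z, kerrForm_comm z'])
    (fun c w z => by rw [kerrForm_comm, kerrForm_smul_left, kerrForm_comm z]; rfl)
  have h1 : ∀ w : Pt, w = ∑ i, w i • (Pi.single i 1 : Pt) := fun w => pi_eq_sum_univ' w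
  show Bm w w' = _
  conv_lhs => rw [h1 w, h1 w']
  simp only [map_sum, LinearMap.sum_apply, map_smul, LinearMap.smul_apply, smul_eq_mul]
  rw [Finset.sum_comm]
  refine sum_congr rfl fun j _ => ?_
  rw [Finset.mul_sum]
  refine sum_congr rfl fun i _ => ?_
  simp only [kerrMatrix, Matrix.of_apply]
  show _ * (_ * kerrForm M a p q rBL x (Pi.single i 1) (Pi.single j 1)) = _
  ring

lemma kerrFrame_dRad (hx : 0 < rad x) (i : Fin 4) :
    dRad x (kerrFrame a p q x i) = (![0, 1, 0, 0] : Fin 4 → ℝ) i := by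
  have h := rad_sq x
  fin_cases i <;> simp [kerrFrame, dRad, nullField, radialField]
  · field_simp; ring_nf; simp
  · field_simp; linarith
  · field_simp; ring_nf; simp
  · field_simp; ring_nf; simp

lemma kerrFrame_time (hx : 0 < rad x) (i : Fin 4) : kerrFrame a p q x i 0 + p (rad x) * dRad x (kerrFrame a p q x i)
    = (![rad x ^ 2 + a ^ 2, 0, 0, a * sinSq x] : Fin 4 → ℝ) i := by
  rw [kerrFrame_dRad hx]
  fin_cases i <;> simp [kerrFrame, nullField, radialField]

lemma kerrFrame_eta (hx : 0 < rad x) (i : Fin 4) : etaForm x (kerrFrame a p q x i)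
    = (![a * sinSq x, -(q (rad x) * sinSq x), 0, sinSq x] : Fin 4 → ℝ) i := by
  fin_cases i <;> simp [kerrFrame, nullField, radialField, etaForm, sinSq] <;> field_simp <;> ring_nf <;> simp

lemma kerrFrame_round (hx : 0 < rad x) (i j : Fin 4) : roundForm x (kerrFrame a p q x i) (kerrFrame a p q x j)
    = (!![a ^ 2 * sinSq x, -(a * (q (rad x) * sinSq x)), 0, a * sinSq x;
        -(a * (q (rad x) * sinSq x)), q (rad x) ^ 2 * sinSq x, 0, -(q (rad x) * sinSq x);
        0, 0, rad x ^ 2 * sinSq x, 0;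
        a * sinSq x, -(q (rad x) * sinSq x), 0, sinSq x] : Matrix (Fin 4) (Fin 4) ℝ) i j := by
  have h := rad_sq x
  have h2 : x 3 ^ 2 = rad x ^ 2 - (x 1 ^ 2 + x 2 ^ 2) := by linarith
  rw [roundForm, kerrFrame_dRad hx, kerrFrame_dRad hx]
  have h3 : (x 1 ^ 2 + x 2 ^ 2) = rad x ^ 2 * sinSq x := by unfold sinSq; field_simp
  have hr : rad x ≠ 0 := hx.ne'
  have e33 : x 1 * x 3 * (x 1 * x 3) + x 2 * x 3 * (x 2 * x 3) + (x 1 ^ 2 + x 2 ^ 2) * (x 1 ^ 2 + x 2 ^ 2)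
      = rad x ^ 2 * (rad x ^ 2 * (sinSq x)) := by rw [← h3]; rw [h]; ring
  rw [div_eq_iff (by positivity)]
  fin_cases i <;> fin_cases j <;> simp [kerrFrame, nullField, radialField]
  · linear_combination a ^ 2 * h3
  · field_simp; linear_combination (-a * q (rad x) * rad x) * h3
  · ring
  · linear_combination a * h3
  · field_simp; linear_combination (-a * q (rad x) * rad x) * h3
  · field_simp
    linear_combination h2 + (q (rad x) ^ 2 * rad x ^ 2) * h3
  · field_simp; ring
  · field_simp; linear_combination (-q (rad x) * rad x) * h3
  · ring
  · field_simp; ring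
  · linear_combination e33
  · ring
  · linear_combination a * h3
  · field_simp; linear_combination (-q (rad x) * rad x) * h3
  · ring
  · linear_combination h3

lemma kerrForm_kerrFrame (hx : 0 < rad x) (hr : rBL =ᶠ[𝓝 x] rad) (i j : Fin 4) :
    kerrForm M a p q rBL x (kerrFrame a p q x i) (kerrFrame a p q x j) = kerrGram M a x i j := by
  rw [kerrForm_eq hx hr, kerrFrame_time hx, kerrFrame_time hx, kerrFrame_round hx, kerrFrame_eta hx, kerrFrame_eta hx,
    kerrFrame_dRad hx, kerrFrame_dRad hx]
  have hρ := (rhoSq_pos a hx).ne'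
  obtain ⟨s, hs⟩ : ∃ s, s = sinSq x := ⟨_, rfl⟩
  obtain ⟨r, hr⟩ : ∃ r, r = rad x := ⟨_, rfl⟩
  obtain ⟨ρ, hρ'⟩ : ∃ ρ, ρ = rhoSq a x := ⟨_, rfl⟩
  have e : r ^ 2 + a ^ 2 = ρ + a ^ 2 * s := by
    rw [hρ', rhoSq, cosSq_eq hx, ← hs, ← hr]; ring
  rw [← hρ'] at hρ
  unfold kerrFormCore kerrGram
  rw [← hs, ← hr, ← hρ', e]
  fin_cases i <;> fin_cases j <;> simp <;> field_simp <;> ring_nf <;> simp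

lemma kerrGram_apply_sum (hx : 0 < rad x) (hr : rBL =ᶠ[𝓝 x] rad) :
    (Matrix.of (kerrFrame a p q x)) * kerrMatrix M a p q rBL x * (Matrix.of (kerrFrame a p q x)).transpose
      = kerrGram M a x := by
  ext i j
  rw [← kerrForm_kerrFrame hx hr, kerrForm_eq_sum]
  simp only [Matrix.mul_apply, Matrix.of_apply, Matrix.transpose_apply, Finset.sum_mul]
  rw [Finset.sum_comm]
  refine sum_congr rfl fun k _ => sum_congr rfl fun l _ => by ring

lemma det_kerrFrame (hx : 0 < rad x) : (Matrix.of (kerrFrame a p q x)).det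
    = rhoSq a x * rad x ^ 3 * sinSq x := by
  have h := rad_sq x
  have h3 : (x 1 ^ 2 + x 2 ^ 2) = rad x ^ 2 * sinSq x := by unfold sinSq; field_simp
  obtain ⟨s, hs⟩ : ∃ s, s = sinSq x := ⟨_, rfl⟩
  rw [rhoSq, cosSq_eq hx, ← hs]
  rw [← hs] at h3
  have hr : rad x ≠ 0 := hx.ne'
  simp [Matrix.det_succ_row_zero, Fin.sum_univ_succ, kerrFrame, nullField, radialField, Fin.succAbove, ← hs]
  field_simp
  linear_combination (rad x ^ 2 + a ^ 2 - a ^ 2 * s) * (-(x 1 ^ 2 + x 2 ^ 2) * h + rad x ^ 2 * h3)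

lemma sinSq_pos (hx : 0 < rad x) (hs : x 1 ^ 2 + x 2 ^ 2 ≠ 0) : 0 < sinSq x := by
  unfold sinSq; positivity

lemma isUnit_det_kerrFrame (hx : 0 < rad x) (hs : x 1 ^ 2 + x 2 ^ 2 ≠ 0) :
    IsUnit (Matrix.of (kerrFrame a p q x)).det := by
  rw [det_kerrFrame hx, isUnit_iff_ne_zero]
  have := sinSq_pos hx hs
  have := rhoSq_pos a hx
  positivity

lemma volDensity_kerrMatrix (hx : 0 < rad x) (hs : x 1 ^ 2 + x 2 ^ 2 ≠ 0) (hr : rBL =ᶠ[𝓝 x] rad) :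
    volDensity (kerrMatrix M a p q rBL) x = rhoSq a x / rad x ^ 2 := by
  have h1 := congrArg Matrix.det (kerrGram_apply_sum (M := M) (a := a) (p := p) (q := q) hx hr)
  rw [Matrix.det_mul, Matrix.det_mul, Matrix.det_transpose, det_kerrFrame hx] at h1
  have h2 : (kerrGram M a x).det = -(rhoSq a x ^ 4 * rad x ^ 2 * sinSq x ^ 2) := by
    unfold kerrGram
    simp [Matrix.det_succ_row_zero, Fin.sum_univ_succ, Fin.succAbove]
    ring
  have hsp := sinSq_pos hx hs
  have hρ := rhoSq_pos a hx
  have h3 : (kerrMatrix M a p q rBL x).det = -(rhoSq a x / rad x ^ 2) ^ 2 := by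
    rw [h2] at h1
    have h4 : (rhoSq a x * rad x ^ 3 * sinSq x) ≠ 0 := by positivity
    apply mul_left_cancel₀ h4
    apply mul_right_cancel₀ h4
    rw [h1]; field_simp
  rw [volDensity, h3, abs_neg, abs_of_nonneg (sq_nonneg _), Real.sqrt_sq (by positivity)]

/-- The inverse Kerr metric times `ρ²`. -/
def kerrCometric (M a : ℝ) (p q : ℝ → ℝ) (x : Pt) (i j : Fin 4) : ℝ :=
  Del M a (rad x) * (radialField p q x i * radialField p q x j)
    + (nullField a x i * radialField p q x j + radialField p q x i * nullField a x j)
    + ∑ k, Om k x i * Om k x j + a ^ 2 * sinSq x * (TField x i * TField x j)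
    + a * (TField x i * Om 0 x j + Om 0 x i * TField x j)

lemma kerrMatrix_inv (hx : 0 < rad x) (hs : x 1 ^ 2 + x 2 ^ 2 ≠ 0) (hr : rBL =ᶠ[𝓝 x] rad) (i j : Fin 4) :
    (kerrMatrix M a p q rBL x)⁻¹ i j = (rhoSq a x)⁻¹ * kerrCometric M a p q x i j := by
  have hsp := sinSq_pos hx hs
  have hρ := rhoSq_pos a hx
  obtain ⟨F, hF⟩ : ∃ F, F = Matrix.of (kerrFrame a p q x) := ⟨_, rfl⟩
  obtain ⟨Ni, hNi⟩ : ∃ Ni : Matrix (Fin 4) (Fin 4) ℝ, Ni = !![0, (rhoSq a x)⁻¹, 0, 0;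
    (rhoSq a x)⁻¹, Del M a (rad x) * (rhoSq a x)⁻¹, 0, 0; 0, 0, (rhoSq a x * (rad x ^ 2 * sinSq x))⁻¹, 0;
    0, 0, 0, (rhoSq a x * sinSq x)⁻¹] := ⟨_, rfl⟩
  have hNN : kerrGram M a x * Ni = 1 := by
    rw [hNi, kerrGram]
    ext i j
    fin_cases i <;> fin_cases j <;> simp [Matrix.mul_apply, Fin.sum_univ_four] <;> field_simp <;> ring_nf <;> simp
  have hFu : IsUnit F := (Matrix.isUnit_iff_isUnit_det _).2 (by rw [hF]; exact isUnit_det_kerrFrame hx hs)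
  have hgram := kerrGram_apply_sum (M := M) (a := a) (p := p) (q := q) hx hr
  rw [← hF] at hgram
  have hinv : (kerrMatrix M a p q rBL x)⁻¹ = F.transpose * Ni * F := by
    refine Matrix.inv_eq_right_inv (hFu.mul_left_cancel ?_)
    calc F * (kerrMatrix M a p q rBL x * (F.transpose * Ni * F))
        = (F * kerrMatrix M a p q rBL x * F.transpose) * Ni * F := by simp only [Matrix.mul_assoc]
      _ = F * 1 := by rw [hgram, hNN, Matrix.one_mul, Matrix.mul_one]
  have h := rad_sq x
  have h3 : (x 1 ^ 2 + x 2 ^ 2) = rad x ^ 2 * sinSq x := by unfold sinSq; field_simp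
  have key : ∀ i j, (F.transpose * Ni * F) i j = (rhoSq a x)⁻¹ * (Del M a (rad x) * (radialField p q x i * radialField p q x j)
    + (nullField a x i * radialField p q x j + radialField p q x i * nullField a x j)
    + (rad x ^ 2 * sinSq x)⁻¹ * (kerrFrame a p q x 2 i * kerrFrame a p q x 2 j)
    + (sinSq x)⁻¹ * (kerrFrame a p q x 3 i * kerrFrame a p q x 3 j)) := by
    intro i j
    simp only [Matrix.mul_apply, Fin.sum_univ_four, Matrix.transpose_apply, hF, Matrix.of_apply, hNi]
    simp [kerrFrame]
    ring
  rw [hinv, key, kerrCometric]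
  congr 1
  have key2 : (rad x ^ 2 * sinSq x)⁻¹ * (kerrFrame a p q x 2 i * kerrFrame a p q x 2 j)
    + (sinSq x)⁻¹ * (kerrFrame a p q x 3 i * kerrFrame a p q x 3 j) = ∑ k, Om k x i * Om k x j
    + a ^ 2 * sinSq x * (TField x i * TField x j) + a * (TField x i * Om 0 x j + Om 0 x i * TField x j) := by
    have hr0 := hx.ne'
    rw [← h3]
    have hsin : sinSq x = (x 1 ^ 2 + x 2 ^ 2) / rad x ^ 2 := rfl
    rw [hsin, inv_div]
    have hs' := hs
    fin_cases i <;> fin_cases j <;> simp [kerrFrame, Om, TField, Fin.sum_univ_three, sinSq] <;> (try field_simp) <;> (try rw [h]) <;> (try ring)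
  linarith

/-- The Euclidean divergence of a vector field. -/
def divergence (c : Pt → Pt) (x : Pt) : ℝ := ∑ μ : Fin 4, fderiv ℝ (fun y => c y μ) x (Pi.single μ 1)

lemma divergence_add {c d : Pt → Pt} (hc : DifferentiableAt ℝ c x) (hd : DifferentiableAt ℝ d x) :
    divergence (fun y => c y + d y) x = divergence c x + divergence d x := by
  unfold divergence
  rw [← sum_add_distrib]
  refine sum_congr rfl fun μ _ => ?_
  have h1 := differentiableAt_pi.1 hc μ
  have h2 := differentiableAt_pi.1 hd μ
  simp only [Pi.add_apply]
  rw [fderiv_fun_add h1 h2]; rfl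

lemma divergence_smul {c : Pt → Pt} {β : Pt → ℝ} (hβ : DifferentiableAt ℝ β x) (hc : DifferentiableAt ℝ c x) :
    divergence (fun y => β y • c y) x = fderiv ℝ β x (c x) + β x * divergence c x := by
  unfold divergence
  have h0 : fderiv ℝ β x (c x) = ∑ μ, c x μ * fderiv ℝ β x (Pi.single μ 1) := by
    conv_lhs => rw [pi_eq_sum_univ' (c x)]
    simp only [map_sum, map_smul, smul_eq_mul]
  rw [h0, Finset.mul_sum, ← sum_add_distrib]
  refine sum_congr rfl fun μ _ => ?_
  have h1 := differentiableAt_pi.1 hc μ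
  simp only [Pi.smul_apply, smul_eq_mul]
  rw [fderiv_fun_mul hβ h1]
  simp; ring

lemma fderiv_comp_rad {α : ℝ → ℝ} (hx : 0 < rad x) (hα : DifferentiableAt ℝ α (rad x)) (w : Pt) :
    fderiv ℝ (fun y => α (rad y)) x w = deriv α (rad x) * dRad x w := by
  have h := (hα.hasDerivAt.comp_hasFDerivAt x (hasFDerivAt_rad hx).differentiableAt.hasFDerivAt).fderiv
  have e : fderiv ℝ (fun y => α (rad y)) x = deriv α (rad x) • fderiv ℝ rad x := h
  rw [e]; simp [fderiv_rad hx]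

lemma differentiableAt_rad (hx : 0 < rad x) : DifferentiableAt ℝ rad x := (hasFDerivAt_rad hx).differentiableAt

lemma differentiableAt_comp_rad {α : ℝ → ℝ} (hx : 0 < rad x) (hα : DifferentiableAt ℝ α (rad x)) :
    DifferentiableAt ℝ (fun y => α (rad y)) x := hα.comp x (differentiableAt_rad hx)

lemma divergence_smul_radial {c : Pt → Pt} {α : ℝ → ℝ} (hx : 0 < rad x) (hα : DifferentiableAt ℝ α (rad x))
    (hc : DifferentiableAt ℝ c x) :
    divergence (fun y => α (rad y) • c y) x = deriv α (rad x) * dRad x (c x) + α (rad x) * divergence c x := by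
  rw [divergence_smul (differentiableAt_comp_rad hx hα) hc, fderiv_comp_rad hx hα]

lemma contDiff_Om (k : Fin 3) : ContDiff ℝ ∞ (Om k) := by
  rw [contDiff_pi]
  intro i
  fin_cases k <;> fin_cases i <;> simp [Om] <;> fun_prop

lemma contDiff_TField : ContDiff ℝ ∞ TField := contDiff_const

lemma dRad_Om (k : Fin 3) (x : Pt) : dRad x (Om k x) = 0 := by
  fin_cases k <;> simp [dRad, Om] <;> left <;> ring

lemma dRad_TField (x y : Pt) : dRad x (TField y) = 0 := by simp [dRad, TField]

lemma divergence_Om (k : Fin 3) : divergence (Om k) x = 0 := by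
  fin_cases k <;> simp [divergence, Fin.sum_univ_four, Om, (hasFDerivAt_apply _ _).fderiv, fderiv_fun_neg]

lemma divergence_TField : divergence TField x = 0 := by
  simp [divergence, Fin.sum_univ_four, TField]

/-- The position field. -/
def positionField (x : Pt) : Pt := ![0, x 1, x 2, x 3]

lemma contDiff_positionField : ContDiff ℝ ∞ positionField := by
  rw [contDiff_pi]
  intro i
  fin_cases i <;> simp [positionField] <;> fun_prop

lemma divergence_positionField : divergence positionField x = 3 := by
  simp [divergence, Fin.sum_univ_four, positionField, (hasFDerivAt_apply _ _).fderiv]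
  norm_num

lemma dRad_positionField (hx : 0 < rad x) : dRad x (positionField x) = rad x := by
  have := rad_sq x
  simp [dRad, positionField]
  field_simp; linarith

lemma radialField_eq : radialField p q = fun y => (rad y)⁻¹ • positionField y + ((-p (rad y)) • TField y + (-q (rad y)) • Om 0 y) := by
  funext y
  ext i
  fin_cases i <;> simp [radialField, positionField, TField, Om] <;> ring

lemma nullField_eq : nullField a = fun y => (rad y ^ 2 + a ^ 2) • TField y + a • Om 0 y := by
  funext y
  ext i
  fin_cases i <;> simp [nullField, TField, Om]

lemma divergence_smul_radial_eq_zero {c : Pt → Pt} {α : ℝ → ℝ} (hx : 0 < rad x) (hα : DifferentiableAt ℝ α (rad x))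
    (hc : ContDiffAt ℝ ∞ c x) (h1 : dRad x (c x) = 0) (h2 : divergence c x = 0) :
    DifferentiableAt ℝ (fun y => α (rad y) • c y) x ∧ divergence (fun y => α (rad y) • c y) x = 0 := by
  have hc := hc.differentiableAt (by simp)
  exact ⟨(differentiableAt_comp_rad hx hα).fun_smul hc, by rw [divergence_smul_radial hx hα hc, h1, h2]; ring⟩

lemma divergence_radialField_div_sq (hx : 0 < rad x) (hp : DifferentiableAt ℝ p (rad x)) (hq : DifferentiableAt ℝ q (rad x)) :
    divergence (fun y => (rad y ^ 2)⁻¹ • radialField p q y) x = 0 := by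
  have hP : DifferentiableAt ℝ positionField x := contDiff_positionField.differentiable (by norm_num) x
  have hr0 := hx.ne'
  have h1 : DifferentiableAt ℝ (fun r : ℝ => r⁻¹ ^ 3) (rad x) := (differentiableAt_inv hr0).pow 3
  obtain ⟨d2, e2⟩ := divergence_smul_radial_eq_zero (α := fun r => -(p r * r⁻¹ ^ 2)) hx (by fun_prop (disch := assumption))
    contDiff_TField.contDiffAt (dRad_TField x x) divergence_TField
  obtain ⟨d3, e3⟩ := divergence_smul_radial_eq_zero (α := fun r => -(q r * r⁻¹ ^ 2)) hx (by fun_prop (disch := assumption))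
    (contDiff_Om 0).contDiffAt (dRad_Om 0 x) (divergence_Om 0)
  have e : (fun y => (rad y ^ 2)⁻¹ • radialField p q y) = fun y => ((rad y)⁻¹ ^ 3) • positionField y
      + ((-(p (rad y) * (rad y)⁻¹ ^ 2)) • TField y + (-(q (rad y) * (rad y)⁻¹ ^ 2)) • Om 0 y) := by
    funext y
    rw [radialField_eq]
    module
  rw [e, divergence_add ((differentiableAt_comp_rad hx h1).fun_smul hP) (d2.fun_add d3), divergence_add d2 d3, e2, e3,
    divergence_smul_radial hx h1 hP, divergence_positionField, dRad_positionField hx,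
    ((hasDerivAt_inv hr0).fun_pow 3).deriv]
  norm_num
  field_simp
  ring

lemma dRad_nullField : dRad x (nullField a x) = 0 := by
  simp [dRad, nullField]; left; ring

lemma divergence_nullField (hx : 0 < rad x) : divergence (nullField a) x = 0 := by
  obtain ⟨d1, e1⟩ := divergence_smul_radial_eq_zero (α := fun r => r ^ 2 + a ^ 2) hx (by fun_prop)
    contDiff_TField.contDiffAt (dRad_TField x x) divergence_TField
  obtain ⟨d2, e2⟩ := divergence_smul_radial_eq_zero (α := fun _ => a) hx (by fun_prop)
    (contDiff_Om 0).contDiffAt (dRad_Om 0 x) (divergence_Om 0)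
  rw [nullField_eq, divergence_add d1 d2, e1, e2, add_zero]

lemma contDiffAt_rad (hx : 0 < rad x) : ContDiffAt ℝ ∞ rad x := by
  have h0 : x 1 ^ 2 + x 2 ^ 2 + x 3 ^ 2 ≠ 0 := by rw [← rad_sq]; positivity
  exact ContDiffAt.sqrt (by fun_prop) h0

lemma contDiffAt_comp_rad {α : ℝ → ℝ} (hx : 0 < rad x) (hα : ContDiffAt ℝ ∞ α (rad x)) :
    ContDiffAt ℝ ∞ (fun y => α (rad y)) x := hα.comp x (contDiffAt_rad hx)

lemma contDiffAt_radialField (hx : 0 < rad x) (hp : ContDiffAt ℝ ∞ p (rad x))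
    (hq : ContDiffAt ℝ ∞ q (rad x)) : ContDiffAt ℝ ∞ (radialField p q) x := by
  rw [radialField_eq]
  refine ContDiffAt.add (((contDiffAt_rad hx).inv hx.ne').smul contDiff_positionField.contDiffAt) (ContDiffAt.add ?_ ?_)
  · exact ((contDiffAt_comp_rad hx hp).neg).smul contDiff_TField.contDiffAt
  · exact ((contDiffAt_comp_rad hx hq).neg).smul (contDiff_Om 0).contDiffAt

lemma contDiffAt_nullField (hx : 0 < rad x) : ContDiffAt ℝ ∞ (nullField a) x := by
  rw [nullField_eq]
  exact ((((contDiffAt_rad hx).pow 2).add contDiffAt_const).smul contDiff_TField.contDiffAt).add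
    ((contDiff_Om 0).contDiffAt.const_smul a)

lemma contDiffAt_sinSq (hx : 0 < rad x) : ContDiffAt ℝ ∞ sinSq x := by
  unfold sinSq
  exact ContDiffAt.div (by fun_prop) ((contDiffAt_rad hx).pow 2) (by positivity)

lemma vder_eq_sum (X : Pt → Pt) (f : Pt → ℂ) (y : Pt) :
    vder X f y = ∑ ν, (X y ν) • fderiv ℝ f y (Pi.single ν 1) := by
  unfold vder
  conv_lhs => rw [pi_eq_sum_univ' (X y)]
  simp only [map_sum, map_smul]

lemma sum_fderiv_smul {c : Pt → Pt} {φ : Pt → ℂ} (hc : DifferentiableAt ℝ c x) (hφ : DifferentiableAt ℝ φ x) :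
    ∑ μ, fderiv ℝ (fun y => c y μ • φ y) x (Pi.single μ 1) = divergence c x • φ x + fderiv ℝ φ x (c x) := by
  have h0 : fderiv ℝ φ x (c x) = ∑ μ, c x μ • fderiv ℝ φ x (Pi.single μ 1) := vder_eq_sum c φ x
  rw [h0, divergence, Finset.sum_smul, ← sum_add_distrib]
  refine sum_congr rfl fun μ _ => ?_
  have h1 := differentiableAt_pi.1 hc μ
  rw [fderiv_fun_smul h1 hφ]
  simp [add_comm]

protected lemma ContDiffAt.vder {n : ℕ} {X : Pt → Pt} {f : Pt → ℂ} (hX : ContDiffAt ℝ ∞ X x) (hf : ContDiffAt ℝ (n + 1 : ℕ) f x) :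
    ContDiffAt ℝ n (vder X f) x :=
  ContDiffAt.clm_apply (hf.fderiv_right (m := n) (by norm_cast)) (hX.of_le (by exact_mod_cast le_top))

lemma ContDiffAt.vder_top {X : Pt → Pt} {f : Pt → ℂ} (hX : ContDiffAt ℝ ∞ X x) (hf : ContDiffAt ℝ ∞ f x) :
    ContDiffAt ℝ ∞ (vder X f) x :=
  ContDiffAt.clm_apply (hf.fderiv_right (m := ∞) (by norm_cast)) hX

/-- The wave operator in divergence form along the Kerr frame. -/
lemma rhoSq_mul_boxOp (hx : 0 < rad x) (hs : x 1 ^ 2 + x 2 ^ 2 ≠ 0) (hr : rBL =ᶠ[𝓝 x] rad)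
    (hp : ContDiffAt ℝ ∞ p (rad x)) (hq : ContDiffAt ℝ ∞ q (rad x)) {f : Pt → ℂ}
    (hf : ContDiffAt ℝ 2 f x) :
    (rhoSq a x : ℂ) * boxOp (kerrMatrix M a p q rBL) f x
      = vder (radialField p q) (fun y => (Del M a (rad y) : ℂ) * vder (radialField p q) f y + vder (nullField a) f y) x
        + vder (nullField a) (vder (radialField p q) f) x + ∑ k, vder (Om k) (vder (Om k) f) x
        + vder TField (fun y => ((a ^ 2 * sinSq y : ℝ) : ℂ) * vder TField f y + (a : ℂ) * vder (Om 0) f y) x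
        + vder (Om 0) (fun y => (a : ℂ) * vder TField f y) x := by
  have hρ := rhoSq_pos a hx
  have hcX := contDiffAt_radialField hx hp hq
  have hcW := contDiffAt_nullField (a := a) hx
  have hcO : ∀ k, ContDiffAt ℝ ∞ (Om k) x := fun k => (contDiff_Om k).contDiffAt
  have hcT : ContDiffAt ℝ ∞ TField x := contDiff_TField.contDiffAt
  have hf' : ContDiffAt ℝ (1 + 1 : ℕ) f x := hf
  have h1ne : ((1 : ℕ) : WithTop ℕ∞) ≠ 0 := by norm_num
  have htne : (∞ : WithTop ℕ∞) ≠ 0 := by simp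
  have hdf : ∀ {Z : Pt → Pt}, ContDiffAt ℝ ∞ Z x → DifferentiableAt ℝ (vder Z f) x := fun hZ =>
    (ContDiffAt.vder (n := 1) hZ hf').differentiableAt h1ne
  have hofReal : ∀ {β : Pt → ℝ}, ContDiffAt ℝ ∞ β x → DifferentiableAt ℝ (fun y => (β y : ℂ)) x := fun hβ =>
    Complex.ofRealCLM.differentiableAt.comp x (hβ.differentiableAt htne)
  have hDel : ContDiffAt ℝ ∞ (fun y => Del M a (rad y)) x := by
    unfold Del
    exact (((contDiffAt_rad hx).pow 2).sub (contDiffAt_const.mul (contDiffAt_rad hx))).add contDiffAt_const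
  obtain ⟨Z, hZ⟩ : ∃ Z : Fin 7 → Pt → Pt, Z = ![radialField p q, nullField a, Om 0, Om 1, Om 2, TField, Om 0] := ⟨_, rfl⟩
  obtain ⟨φ, hφ⟩ : ∃ φ : Fin 7 → Pt → ℂ, φ = ![fun y => (Del M a (rad y) : ℂ) * vder (radialField p q) f y + vder (nullField a) f y,
    vder (radialField p q) f, vder (Om 0) f, vder (Om 1) f, vder (Om 2) f,
    fun y => ((a ^ 2 * sinSq y : ℝ) : ℂ) * vder TField f y + (a : ℂ) * vder (Om 0) f y, fun y => (a : ℂ) * vder TField f y] := ⟨_, rfl⟩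
  have hZc : ∀ i, ContDiffAt ℝ ∞ (Z i) x := fun i => by
    rw [hZ]; fin_cases i; exacts [hcX, hcW, hcO 0, hcO 1, hcO 2, hcT, hcO 0]
  have hφd : ∀ i, DifferentiableAt ℝ (φ i) x := fun i => by
    rw [hφ]; fin_cases i
    exacts [((hofReal hDel).mul (hdf hcX)).add (hdf hcW), hdf hcX, hdf (hcO 0), hdf (hcO 1), hdf (hcO 2),
      ((hofReal (contDiffAt_const.mul (contDiffAt_sinSq hx))).mul (hdf hcT)).add ((hdf (hcO 0)).const_mul _), (hdf hcT).const_mul _]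
  have hdiv : ∀ i, divergence (fun y => (rad y ^ 2)⁻¹ • Z i y) x = 0 := fun i => by
    have h1 := fun i => divergence_smul_radial_eq_zero (α := fun r => (r ^ 2)⁻¹) hx ((differentiableAt_id.pow 2).inv (by simpa using hx.ne')) (hZc i)
    have hO := fun k => dRad_Om k x
    rw [hZ] at h1 ⊢; fin_cases i
    exacts [divergence_radialField_div_sq hx (hp.differentiableAt htne) (hq.differentiableAt htne),
      (h1 1 dRad_nullField (divergence_nullField hx)).2, (h1 2 (hO 0) (divergence_Om 0)).2, (h1 3 (hO 1) (divergence_Om 1)).2,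
      (h1 4 (hO 2) (divergence_Om 2)).2, (h1 5 (dRad_TField x x) divergence_TField).2, (h1 6 (hO 0) (divergence_Om 0)).2]
  have hrinv : ContDiffAt ℝ ∞ (fun y => (rad y ^ 2)⁻¹) x := ((contDiffAt_rad hx).pow 2).inv (by positivity)
  have hsm : ∀ i, DifferentiableAt ℝ (fun y => (rad y ^ 2)⁻¹ • Z i y) x := fun i => (hrinv.smul (hZc i)).differentiableAt htne
  -- the coefficients near the point
  have hnear : ∀ᶠ y in 𝓝 x, 0 < rad y ∧ y 1 ^ 2 + y 2 ^ 2 ≠ 0 ∧ rBL =ᶠ[𝓝 y] rad :=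
    (continuous_rad.continuousAt.eventually (lt_mem_nhds hx)).and
      (((by fun_prop : Continuous fun y : Pt => y 1 ^ 2 + y 2 ^ 2).continuousAt.eventually_ne hs).and hr.eventuallyEq_nhds)
  have hcoef : ∀ μ ν, (fun y => (volDensity (kerrMatrix M a p q rBL) y * (kerrMatrix M a p q rBL y)⁻¹ μ ν) •
      fderiv ℝ f y (Pi.single ν 1)) =ᶠ[𝓝 x] fun y => ((rad y ^ 2)⁻¹ * kerrCometric M a p q y μ ν) • fderiv ℝ f y (Pi.single ν 1) := by
    intro μ ν
    filter_upwards [hnear] with y ⟨h1, h2, h3⟩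
    rw [volDensity_kerrMatrix h1 h2 h3, kerrMatrix_inv h1 h2 h3]
    have := (rhoSq_pos a h1).ne'
    congr 1
    field_simp
  have hcomp : ∀ {Z : Pt → Pt}, ContDiffAt ℝ ∞ Z x → ∀ i, ContDiffAt ℝ ∞ (fun y => Z y i) x :=
    fun hZ i => contDiffAt_pi.1 hZ i
  have hcom : ∀ μ ν, DifferentiableAt ℝ (fun y => (rad y ^ 2)⁻¹ * kerrCometric M a p q y μ ν) x := by
    intro μ ν
    refine (ContDiffAt.mul hrinv ?_).differentiableAt htne
    unfold kerrCometric
    have cX := hcomp hcX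
    have cW := hcomp hcW
    have cT := hcomp hcT
    have cO := fun k => hcomp (hcO k)
    refine ContDiffAt.add (ContDiffAt.add (ContDiffAt.add (ContDiffAt.add (hDel.mul ((cX μ).mul (cX ν)))
      (((cW μ).mul (cX ν)).add ((cX μ).mul (cW ν)))) (ContDiffAt.sum fun k _ => (cO k μ).mul (cO k ν)))
      ((contDiffAt_const.mul (contDiffAt_sinSq hx)).mul ((cT μ).mul (cT ν))))
      (contDiffAt_const.mul (((cT μ).mul (cO 0 ν)).add ((cO 0 μ).mul (cT ν))))
  have hdν : ∀ ν : Fin 4, DifferentiableAt ℝ (fun y => fderiv ℝ f y (Pi.single ν 1)) x := fun ν =>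
    hdf (Z := fun _ => Pi.single ν 1) contDiffAt_const
  have hterm : ∀ μ ν, DifferentiableAt ℝ (fun y => ((rad y ^ 2)⁻¹ * kerrCometric M a p q y μ ν) • fderiv ℝ f y (Pi.single ν 1)) x :=
    fun μ ν => (hcom μ ν).smul (hdν ν)
  have hsumν : ∀ μ y, ∑ i, ((rad y ^ 2)⁻¹ • Z i y) μ • φ i y
      = ∑ ν, ((rad y ^ 2)⁻¹ * kerrCometric M a p q y μ ν) • fderiv ℝ f y (Pi.single ν 1) := by
    intro μ y
    simp [hZ, hφ, kerrCometric, vder_eq_sum, Fin.sum_univ_succ]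
    ring
  have e1 : ∀ μ : Fin 4, ∑ ν : Fin 4, fderiv ℝ (fun y => (volDensity (kerrMatrix M a p q rBL) y *
      (kerrMatrix M a p q rBL y)⁻¹ μ ν) • fderiv ℝ f y (Pi.single ν 1)) x (Pi.single μ 1)
      = ∑ i, fderiv ℝ (fun y => ((rad y ^ 2)⁻¹ • Z i y) μ • φ i y) x (Pi.single μ 1) := fun μ => by
    rw [← ContinuousLinearMap.sum_apply, ← ContinuousLinearMap.sum_apply,
      ← fderiv_fun_sum fun i _ => (differentiableAt_pi.1 (hsm i) μ).fun_smul (hφd i), funext (hsumν μ), fderiv_fun_sum fun ν _ => hterm μ ν]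
    simp only [(hcoef μ _).fderiv_eq]
  have e2 : ∀ i, ∑ μ, fderiv ℝ (fun y => ((rad y ^ 2)⁻¹ • Z i y) μ • φ i y) x (Pi.single μ 1)
      = ((rad x ^ 2)⁻¹ : ℝ) • vder (Z i) (φ i) x := fun i => by
    rw [sum_fderiv_smul (hsm i) (hφd i), hdiv, zero_smul, zero_add, map_smul]; rfl
  simp_rw [boxOp, e1]
  rw [Finset.sum_comm, volDensity_kerrMatrix hx hs hr]
  simp_rw [e2]
  have : (rhoSq a x : ℂ) ≠ 0 := by exact_mod_cast hρ.ne'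
  have hr2 : (rad x : ℂ) ≠ 0 := by exact_mod_cast hx.ne'
  simp [hZ, hφ, Fin.sum_univ_succ]
  field_simp
  ring

end

/-! ### Differentiation under an integral over a compactly carried finite measure -/

section Parametric

variable {Z : Type*} [TopologicalSpace Z] [MeasurableSpace Z] [OpensMeasurableSpace Z]
  [SecondCountableTopology Z] {μ : Measure Z} [IsFiniteMeasure μ] {w : Z → ℂ} {B : ℝ} {Kc : Set Z}

lemma integrable_mul_of_compact (hw : AEStronglyMeasurable w μ) (hB : ∀ᵐ z ∂μ, ‖w z‖ ≤ B)
    (hK : IsCompact Kc) (hKμ : ∀ᵐ z ∂μ, z ∈ Kc) {g : Z → ℂ} (hg : Continuous g) :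
    Integrable (fun z => w z * g z) μ := by
  obtain ⟨D, hD⟩ := hK.exists_bound_of_continuousOn hg.continuousOn
  refine Integrable.mono' (integrable_const (|B| * |D|)) (hw.mul hg.aestronglyMeasurable) ?_
  filter_upwards [hB, hKμ] with z h1 h2
  rw [norm_mul]
  exact mul_le_mul (h1.trans (le_abs_self _)) ((hD z h2).trans (le_abs_self _)) (norm_nonneg _) (abs_nonneg _)

lemma hasDerivAt_integral_mul_of_compact (hw : AEStronglyMeasurable w μ) (hB : ∀ᵐ z ∂μ, ‖w z‖ ≤ B)
    (hK : IsCompact Kc) (hKμ : ∀ᵐ z ∂μ, z ∈ Kc) {g g' : ℝ → Z → ℂ} {J : Set ℝ} (hJ : IsOpen J)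
    (hg : ContinuousOn (fun z : ℝ × Z => g z.1 z.2) (J ×ˢ univ))
    (hg' : ContinuousOn (fun z : ℝ × Z => g' z.1 z.2) (J ×ˢ univ))
    (hd : ∀ s ∈ J, ∀ z, HasDerivAt (fun s => g s z) (g' s z) s) {s0 : ℝ} (hs0 : s0 ∈ J) :
    HasDerivAt (fun s => ∫ z, w z * g s z ∂μ) (∫ z, w z * g' s0 z ∂μ) s0 := by
  obtain ⟨ε, hε, hεJ⟩ := Metric.isOpen_iff.1 hJ s0 hs0
  have hsub : Metric.closedBall s0 (ε / 2) ⊆ J := (Metric.closedBall_subset_ball (by linarith)).trans hεJ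
  have hsec : ∀ {k : ℝ → Z → ℂ}, ContinuousOn (fun z : ℝ × Z => k z.1 z.2) (J ×ˢ univ) → ∀ s ∈ J, Continuous (k s) := by
    intro k hk s hs
    have := hk.comp_continuous (f := fun z : Z => (s, z)) (by fun_prop) (fun z => ⟨hs, mem_univ _⟩)
    exact this
  obtain ⟨D, hD⟩ := ((isCompact_closedBall s0 (ε / 2)).prod hK).exists_bound_of_continuousOn
    (hg'.mono (prod_mono hsub (subset_univ _)))
  refine (hasDerivAt_integral_of_dominated_loc_of_deriv_le (F := fun s z => w z * g s z) (F' := fun s z => w z * g' s z)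
    (bound := fun _ => |B| * |D|) (Metric.ball_mem_nhds s0 (half_pos hε)) ?_ ?_ ?_ ?_ (integrable_const _) ?_).2
  · filter_upwards [hJ.mem_nhds hs0] with s hs
    exact hw.mul (hsec hg s hs).aestronglyMeasurable
  · exact integrable_mul_of_compact hw hB hK hKμ (hsec hg s0 hs0)
  · exact hw.mul (hsec hg' s0 hs0).aestronglyMeasurable
  · filter_upwards [hB, hKμ] with z h1 h2 s hs
    rw [norm_mul]
    exact mul_le_mul (h1.trans (le_abs_self _)) ((hD (s, z) ⟨Metric.ball_subset_closedBall hs, h2⟩).trans (le_abs_self _))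
      (norm_nonneg _) (abs_nonneg _)
  · exact ae_of_all _ fun z s hs => (hd s (hsub (Metric.ball_subset_closedBall hs)) z).const_mul _

end Parametric

/-! ### Boyer--Lindquist coordinates -/

namespace KerrSetup

variable {M a : ℝ} (K : KerrSetup M a)

/-- The region `r₊ < r < R/2`, on which the Boyer--Lindquist radius is `r`. -/
def shell : Set Pt := {x | rPlus M a < rad x ∧ rad x < K.R / 2}

lemma isOpen_shell : IsOpen K.shell :=
  (isOpen_lt continuous_const continuous_rad).inter (isOpen_lt continuous_rad continuous_const)

/-- The Boyer--Lindquist coordinate field `∂_r`. -/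
def radialBL (x : Pt) : Pt := radialField K.p K.q x + (Del M a (rad x))⁻¹ • nullField a x

lemma rad_ptBL {t r θ φ : ℝ} (hr : 0 < r) : rad (K.ptBL t r θ φ) = r := by
  have : (r * sin θ * cos (φ + K.phibar r)) ^ 2 + (r * sin θ * sin (φ + K.phibar r)) ^ 2
      + (r * cos θ) ^ 2 = r ^ 2 := by
    have h1 := Real.sin_sq_add_cos_sq θ
    have h2 := Real.sin_sq_add_cos_sq (φ + K.phibar r)
    grind
  simp only [rad, ptBL, Matrix.cons_val]
  rw [this, Real.sqrt_sq hr.le]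

lemma hasDerivAt_ptBL_t (t r θ φ : ℝ) :
    HasDerivAt (fun t => K.ptBL t r θ φ) (TField (K.ptBL t r θ φ)) t := by
  rw [hasDerivAt_pi]
  intro i
  fin_cases i
  · exact (hasDerivAt_id t).add_const _
  all_goals exact hasDerivAt_const _ _

lemma hasDerivAt_ptBL_phi (t r θ φ : ℝ) :
    HasDerivAt (fun φ => K.ptBL t r θ φ) (Om 0 (K.ptBL t r θ φ)) φ := by
  have hid := (hasDerivAt_id φ).add_const (K.phibar r)
  rw [hasDerivAt_pi]
  intro i
  fin_cases i
  · exact hasDerivAt_const _ _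
  · exact ((hid.cos).const_mul (r * sin θ)).congr_deriv (by simp [Om, ptBL])
  · exact ((hid.sin).const_mul (r * sin θ)).congr_deriv (by simp [Om, ptBL])
  · exact hasDerivAt_const _ _

/-- `∂_θ` of the point with Boyer--Lindquist coordinates `(t, r, θ, φ)`. -/
def polarField (r θ φ : ℝ) : Pt :=
  ![0, r * cos θ * cos (φ + K.phibar r), r * cos θ * sin (φ + K.phibar r), -(r * sin θ)]

lemma hasDerivAt_ptBL_theta (t r θ φ : ℝ) :
    HasDerivAt (fun θ => K.ptBL t r θ φ) (K.polarField r θ φ) θ := by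
  rw [hasDerivAt_pi]
  intro i
  fin_cases i
  · exact hasDerivAt_const _ _
  · exact (((Real.hasDerivAt_sin θ).const_mul r).mul_const _)
  · exact (((Real.hasDerivAt_sin θ).const_mul r).mul_const _)
  · exact ((Real.hasDerivAt_cos θ).const_mul r).congr_deriv (by simp [polarField])

lemma hasDerivAt_polarField (t r θ φ : ℝ) :
    HasDerivAt (fun θ => K.polarField r θ φ) (-positionField (K.ptBL t r θ φ)) θ := by
  rw [hasDerivAt_pi]
  intro i
  fin_cases i
  · exact (hasDerivAt_const θ (0 : ℝ)).congr_deriv (by simp [positionField])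
  · exact (((Real.hasDerivAt_cos θ).const_mul r).mul_const _).congr_deriv (by simp [positionField, ptBL])
  · exact (((Real.hasDerivAt_cos θ).const_mul r).mul_const _).congr_deriv (by simp [positionField, ptBL])
  · exact ((Real.hasDerivAt_sin θ).const_mul r).neg.congr_deriv (by simp [positionField, ptBL])

lemma hasDerivAt_ptBL_r (ha : |a| < M) {t r θ φ : ℝ} (hr : rPlus M a < r) :
    HasDerivAt (fun r => K.ptBL t r θ φ) (K.radialBL (K.ptBL t r θ φ)) r := by
  have hr0 := (rPlus_pos ha).trans hr
  have hφ := (K.phibar_deriv r hr).const_add φ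
  have hid := hasDerivAt_id r
  rw [hasDerivAt_pi]
  intro i
  have hrad := K.rad_ptBL (t := t) (θ := θ) (φ := φ) hr0
  fin_cases i
  · refine ((K.tbar_deriv r hr).const_add t).congr_deriv ?_
    simp [radialBL, radialField, nullField]
    grind
  · refine ((hid.mul_const (sin θ)).mul hφ.cos).congr_deriv ?_
    simp [radialBL, radialField, nullField, hrad]
    simp [ptBL]
    grind
  · refine ((hid.mul_const (sin θ)).mul hφ.sin).congr_deriv ?_
    simp [radialBL, radialField, nullField, hrad]
    simp [ptBL]
    grind
  · refine (hid.mul_const (cos θ)).congr_deriv ?_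
    simp [radialBL, radialField, nullField, hrad]
    simp [ptBL]
    field_simp

lemma continuousOn_ptBL : ContinuousOn (fun z : ℝ × ℝ × ℝ × ℝ => K.ptBL z.2.2.1 z.1 z.2.1 z.2.2.2)
    (Ioi (rPlus M a) ×ˢ univ) := by
  have h1 : ContinuousOn K.tbar (Ioi (rPlus M a)) := fun r hr => (K.tbar_deriv r hr).continuousAt.continuousWithinAt
  have h2 : ContinuousOn K.phibar (Ioi (rPlus M a)) := fun r hr => (K.phibar_deriv r hr).continuousAt.continuousWithinAt
  have h1' : ContinuousOn (fun z : ℝ × ℝ × ℝ × ℝ => K.tbar z.1) (Ioi (rPlus M a) ×ˢ univ) :=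
    h1.comp continuousOn_fst fun z hz => hz.1
  have h2' : ContinuousOn (fun z : ℝ × ℝ × ℝ × ℝ => K.phibar z.1) (Ioi (rPlus M a) ×ˢ univ) :=
    h2.comp continuousOn_fst fun z hz => hz.1
  rw [continuousOn_pi]
  intro i
  fin_cases i <;> simp [ptBL] <;> fun_prop

lemma ptBL_add_two_pi (t r θ φ : ℝ) : K.ptBL t r θ (φ + 2 * π) = K.ptBL t r θ φ := by
  have : φ + 2 * π + K.phibar r = φ + K.phibar r + 2 * π := by ring
  simp [ptBL, this]

lemma ptBL_mem_shell (ha : |a| < M) {t r θ φ : ℝ} (hr : r ∈ Ioo (rPlus M a) (K.R / 2)) : K.ptBL t r θ φ ∈ K.shell := by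
  have := K.rad_ptBL (t := t) (θ := θ) (φ := φ) ((rPlus_pos ha).trans hr.1)
  exact ⟨by simp_all, by simp_all⟩

/-- Functions smooth in `r₊ < r < R/2` and vanishing there unless `t0 ≤ t^* ≤ t1`. -/
structure IsSlab (t0 t1 : ℝ) (Φ : Pt → ℂ) : Prop where
  smooth : ∀ x ∈ K.shell, ContDiffAt ℝ ∞ Φ x
  supp : ∀ x ∈ K.shell, x 0 ∉ Icc t0 t1 → Φ x = 0

variable {K} {t0 t1 : ℝ} {Φ Ψ : Pt → ℂ}

protected lemma IsSlab.vder (h : K.IsSlab t0 t1 Φ) {X : Pt → Pt} (hX : ∀ x ∈ K.shell, ContDiffAt ℝ ∞ X x) :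
    K.IsSlab t0 t1 (vder X Φ) := by
  refine ⟨fun x hx => ContDiffAt.vder_top (hX x hx) (h.smooth x hx), fun x hx hx0 => ?_⟩
  simp [vder, (by have hc : Continuous fun y : Pt => y 0 := continuous_apply 0; filter_upwards [K.isOpen_shell.mem_nhds hx, hc.continuousAt (isClosed_Icc.isOpen_compl.mem_nhds hx0)] with y h1 h2; exact h.supp y h1 h2 : Φ =ᶠ[𝓝 x] fun _ => 0).fderiv_eq]

lemma IsSlab.add (h : K.IsSlab t0 t1 Φ) (h' : K.IsSlab t0 t1 Ψ) : K.IsSlab t0 t1 (fun x => Φ x + Ψ x) :=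
  ⟨fun x hx => (h.smooth x hx).add (h'.smooth x hx), fun x hx h0 => by rw [h.supp x hx h0, h'.supp x hx h0, add_zero]⟩

lemma IsSlab.mul (h : K.IsSlab t0 t1 Φ) {c : Pt → ℂ} (hc : ∀ x ∈ K.shell, ContDiffAt ℝ ∞ c x) :
    K.IsSlab t0 t1 (fun x => c x * Φ x) :=
  ⟨fun x hx => (hc x hx).mul (h.smooth x hx), fun x hx h0 => by rw [h.supp x hx h0, mul_zero]⟩

lemma IsSlab.sum {ι : Type*} {s : Finset ι} {f : ι → Pt → ℂ} (h : ∀ i ∈ s, K.IsSlab t0 t1 (f i)) :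
    K.IsSlab t0 t1 (fun x => ∑ i ∈ s, f i x) :=
  ⟨fun x hx => ContDiffAt.sum fun i hi => (h i hi).smooth x hx,
    fun x hx h0 => Finset.sum_eq_zero fun i hi => (h i hi).supp x hx h0⟩

lemma IsSlab.continuousOn (ha : |a| < M) (h : K.IsSlab t0 t1 Φ) :
    ContinuousOn (fun z : ℝ × ℝ × ℝ × ℝ => Φ (K.ptBL z.2.2.1 z.1 z.2.1 z.2.2.2)) (Ioo (rPlus M a) (K.R / 2) ×ˢ univ) := by
  have h1 : ContinuousOn Φ K.shell := fun x hx => (h.smooth x hx).continuousAt.continuousWithinAt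
  exact h1.comp (K.continuousOn_ptBL.mono (prod_mono Ioo_subset_Ioi_self subset_rfl)) fun z hz => K.ptBL_mem_shell ha hz.1

/-- Local uniform compactness of the time support in Boyer--Lindquist time. -/
lemma exists_time_bound (ha : |a| < M) (t0 t1 : ℝ) {r₀ : ℝ} (hr : r₀ ∈ Ioo (rPlus M a) (K.R / 2)) :
    ∃ N : ℝ, 0 < N ∧ ∀ᶠ r in 𝓝 r₀, r ∈ Ioo (rPlus M a) (K.R / 2) ∧
      ∀ Φ : Pt → ℂ, K.IsSlab t0 t1 Φ → ∀ t θ φ, t ∉ Ioc (-N) N → Φ (K.ptBL t r θ φ) = 0 := by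
  refine ⟨|t0| + |t1| + |K.tbar r₀| + 1, by positivity, ?_⟩
  have h1 : ∀ᶠ r in 𝓝 r₀, |K.tbar r| < |K.tbar r₀| + 1 := ((K.tbar_deriv r₀ hr.1).continuousAt).abs.eventually (gt_mem_nhds (by linarith))
  filter_upwards [h1, isOpen_Ioo.mem_nhds hr] with r h2 h3
  refine ⟨h3, fun Φ hΦ t θ φ ht => hΦ.supp _ (K.ptBL_mem_shell ha h3) fun h4 => ht ?_⟩
  simp only [ptBL, Matrix.cons_val_zero] at h4
  grind

end KerrSetup

section
/-! ### The Fourier transform on the cylinder -/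

/-- The Fourier kernel `e^{iωt} e^{-imφ}`. -/
def cylKernel (ω : ℝ) (m : ℤ) (z : ℝ × ℝ) : ℂ :=
  Complex.exp (I * ω * z.1) * Complex.exp (-(I * m * z.2))

/-- The Fourier transform in `t ∈ ℝ`, `φ ∈ (0, 2π)`. -/
def cylFourier (f : ℝ × ℝ → ℂ) (ω : ℝ) (m : ℤ) : ℂ :=
  ∫ t : ℝ, ∫ φ in (0 : ℝ)..(2 * π), cylKernel ω m (t, φ) * f (t, φ)

/-- Lebesgue measure on `(-N, N] × (0, 2π]`. -/
def cylMeasure (N : ℝ) : Measure (ℝ × ℝ) :=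
  (volume.restrict (Ioc (-N) N)).prod (volume.restrict (Ioc 0 (2 * π)))

instance (N : ℝ) : IsFiniteMeasure (cylMeasure N) := by unfold cylMeasure; infer_instance

variable {N : ℝ} {f g : ℝ × ℝ → ℂ} {ω : ℝ} {m : ℤ}

lemma norm_cylKernel (ω : ℝ) (m : ℤ) (z : ℝ × ℝ) : ‖cylKernel ω m z‖ = 1 := by
  rw [cylKernel, norm_mul, Complex.norm_exp, Complex.norm_exp]
  simp

lemma continuous_cylKernel (ω : ℝ) (m : ℤ) : Continuous (cylKernel ω m) := by
  unfold cylKernel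
  fun_prop

lemma cylMeasure_ae (N : ℝ) : ∀ᵐ z ∂cylMeasure N, z ∈ Icc (-N) N ×ˢ Icc (0 : ℝ) (2 * π) := by
  have h : cylMeasure N = volume.restrict (Ioc (-N) N ×ˢ Ioc 0 (2 * π)) := Measure.prod_restrict _ _
  rw [h]
  filter_upwards [ae_restrict_mem (measurableSet_Ioc.prod measurableSet_Ioc)] with z hz
  exact ⟨Ioc_subset_Icc_self hz.1, Ioc_subset_Icc_self hz.2⟩

lemma integrable_cylKernel_mul (N : ℝ) (hf : Continuous f) (ω : ℝ) (m : ℤ) :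
    Integrable (fun z => cylKernel ω m z * f z) (cylMeasure N) :=
  integrable_mul_of_compact (continuous_cylKernel ω m).aestronglyMeasurable
    (ae_of_all _ fun z => (norm_cylKernel ω m z).le) (isCompact_Icc.prod isCompact_Icc) (cylMeasure_ae N) hf

lemma cylFourier_eq_integral (hf : Continuous f) (hN : ∀ t φ, t ∉ Ioc (-N) N → f (t, φ) = 0) (ω : ℝ) (m : ℤ) :
    cylFourier f ω m = ∫ z, cylKernel ω m z * f z ∂cylMeasure N := by
  rw [cylMeasure, integral_prod _ (integrable_cylKernel_mul N hf ω m), cylFourier,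
    ← setIntegral_eq_integral_of_forall_compl_eq_zero (s := Ioc (-N) N) (fun t ht => by simp [hN t _ ht])]
  exact integral_congr_ae (ae_of_all _ fun t => (intervalIntegral.integral_of_le (by positivity)))

lemma cylFourier_add (hf : Continuous f) (hg : Continuous g) (hN : ∀ t φ, t ∉ Ioc (-N) N → f (t, φ) = 0)
    (hN' : ∀ t φ, t ∉ Ioc (-N) N → g (t, φ) = 0) (ω : ℝ) (m : ℤ) :
    cylFourier (fun z => f z + g z) ω m = cylFourier f ω m + cylFourier g ω m := by
  rw [cylFourier_eq_integral hf hN, cylFourier_eq_integral hg hN',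
    cylFourier_eq_integral (N := N) (f := fun z => f z + g z) (hf.add hg) (fun t φ ht => by rw [hN t φ ht, hN' t φ ht, add_zero]),
    ← integral_add (integrable_cylKernel_mul N hf ω m) (integrable_cylKernel_mul N hg ω m)]
  simp only [mul_add]

lemma cylFourier_const_mul (c : ℂ) (f : ℝ × ℝ → ℂ) (ω : ℝ) (m : ℤ) :
    cylFourier (fun z => c * f z) ω m = c * cylFourier f ω m := by
  simp only [cylFourier, mul_left_comm _ c, intervalIntegral.integral_const_mul, integral_const_mul]

lemma cylFourier_deriv_angle {f' : ℝ × ℝ → ℂ} (hd : ∀ t φ, HasDerivAt (fun φ => f (t, φ)) (f' (t, φ)) φ)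
    (hf' : Continuous f') (hper : ∀ t φ, f (t, φ + 2 * π) = f (t, φ)) (ω : ℝ) (m : ℤ) :
    cylFourier f' ω m = I * m * cylFourier f ω m := by
  have key : ∀ t : ℝ, ∫ φ in (0 : ℝ)..(2 * π), Complex.exp (-(I * m * φ)) * f' (t, φ)
      = I * m * ∫ φ in (0 : ℝ)..(2 * π), Complex.exp (-(I * m * φ)) * f (t, φ) := fun t => by
    have hu : ∀ φ : ℝ, HasDerivAt (fun φ : ℝ => Complex.exp (-(I * m * φ)))
        (Complex.exp (-(I * m * φ)) * -(I * m)) φ := fun φ => by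
      exact (by simpa using ((hasDerivAt_id φ).ofReal_comp.const_mul (I * m)).fun_neg : HasDerivAt (fun φ : ℝ => -(I * m * (φ : ℂ))) (-(I * m)) φ).cexp
    rw [intervalIntegral.integral_mul_deriv_eq_deriv_mul (u' := fun φ : ℝ => Complex.exp (-(I * m * φ)) * -(I * m))
      (v := fun φ => f (t, φ)) (fun φ _ => hu φ) (fun φ _ => hd t φ)
      (Continuous.intervalIntegrable (by fun_prop) _ _) (Continuous.intervalIntegrable (by fun_prop) _ _), (by rw [Complex.exp_eq_one_iff]; exact ⟨-m, by push_cast; ring⟩ : Complex.exp (-(I * m * ((2 * π : ℝ) : ℂ))) = 1), (by simp : Complex.exp (-(I * m * ((0 : ℝ) : ℂ))) = 1)]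
    have := hper t 0
    rw [zero_add] at this
    rw [this, sub_self, zero_sub, ← intervalIntegral.integral_neg, ← intervalIntegral.integral_const_mul]
    congr 1
    ext φ
    ring
  simp only [cylFourier, cylKernel, mul_assoc, intervalIntegral.integral_const_mul]
  simp only [mul_assoc] at key
  rw [← integral_const_mul, ← integral_const_mul]
  refine integral_congr_ae (ae_of_all _ fun t => ?_)
  simp only [key]
  ring

lemma cylFourier_deriv_time {f' : ℝ × ℝ → ℂ} (hd : ∀ t φ, HasDerivAt (fun t => f (t, φ)) (f' (t, φ)) t)
    (hf : Continuous f) (hf' : Continuous f') (hN : ∀ t φ, t ∉ Ioc (-N) N → f (t, φ) = 0)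
    (hN' : ∀ t φ, t ∉ Ioc (-N) N → f' (t, φ) = 0) (ω : ℝ) (m : ℤ) :
    cylFourier f' ω m = -(I * ω) * cylFourier f ω m := by
  obtain ⟨h, hh⟩ : ∃ h : ℝ → ℂ, h = fun t => ∫ φ, Complex.exp (-(I * m * φ)) * f (t, φ) ∂(volume.restrict (Ioc 0 (2 * π))) := ⟨_, rfl⟩
  obtain ⟨h', hh'⟩ : ∃ h : ℝ → ℂ, h = fun t => ∫ φ, Complex.exp (-(I * m * φ)) * f' (t, φ) ∂(volume.restrict (Ioc 0 (2 * π))) := ⟨_, rfl⟩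
  have hder : ∀ t, HasDerivAt h (h' t) t := fun t => by
    rw [hh, hh']
    refine hasDerivAt_integral_mul_of_compact (B := 1) (Kc := Icc 0 (2 * π)) (J := univ) (g := fun t φ => f (t, φ))
      (g' := fun t φ => f' (t, φ)) (by fun_prop : Continuous fun φ : ℝ => Complex.exp (-(I * m * φ))).aestronglyMeasurable
      (ae_of_all _ fun φ => ?_) isCompact_Icc ?_ isOpen_univ hf.continuousOn hf'.continuousOn
      (fun s _ φ => hd s φ) (mem_univ t)
    · rw [Complex.norm_exp]; simp
    · filter_upwards [ae_restrict_mem measurableSet_Ioc] with φ hφ using Ioc_subset_Icc_self hφ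
  have hh'c : Continuous h' := by
    rw [hh']
    have := intervalIntegral.continuous_parametric_intervalIntegral_of_continuous' (μ := volume)
      (f := fun (t φ : ℝ) => Complex.exp (-(I * m * φ)) * f' (t, φ)) (by simp only [Function.uncurry_def]; fun_prop) 0 (2 * π)
    refine this.congr fun t => intervalIntegral.integral_of_le (by positivity)
  have hhc := continuous_iff_continuousAt.2 fun t => (hder t).continuousAt
  have hsupp : ∀ t, t ∉ Ioc (-N) N → h t = 0 ∧ h' t = 0 := fun t ht => by
    rw [hh, hh']
    simp [hN t _ ht, hN' t _ ht]
  have hcs : ∀ {k : ℝ → ℂ}, (∀ t, t ∉ Ioc (-N) N → k t = 0) → HasCompactSupport k := fun hk =>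
    HasCompactSupport.intro (isCompact_Icc (a := -N) (b := N)) fun t ht => hk t fun h1 => ht (Ioc_subset_Icc_self h1)
  have hu : ∀ t : ℝ, HasDerivAt (fun t : ℝ => Complex.exp (I * ω * t)) (Complex.exp (I * ω * t) * (I * ω)) t := fun t => by
    exact (by simpa using (hasDerivAt_id t).ofReal_comp.const_mul (I * ω) : HasDerivAt (fun t : ℝ => I * ω * (t : ℂ)) (I * ω) t).cexp
  have huc : Continuous fun t : ℝ => Complex.exp (I * ω * t) := by fun_prop
  have hint : ∀ {k v : ℝ → ℂ}, Continuous k → Continuous v → (∀ t, t ∉ Ioc (-N) N → v t = 0) → Integrable (k * v) :=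
    fun hk hv h0 => (hk.mul hv).integrable_of_hasCompactSupport (hcs fun t ht => by simp [h0 t ht])
  have hF : ∀ {k : ℝ × ℝ → ℂ}, cylFourier k ω m = ∫ t : ℝ, Complex.exp (I * ω * t) *
      ∫ φ, Complex.exp (-(I * m * φ)) * k (t, φ) ∂(volume.restrict (Ioc 0 (2 * π))) := by
    intro k
    simp only [cylFourier, cylKernel, mul_assoc, intervalIntegral.integral_const_mul]
    refine integral_congr_ae (ae_of_all _ fun t => ?_)
    simp only
    rw [intervalIntegral.integral_of_le (by positivity)]
  rw [hF, hF]
  have := integral_mul_deriv_eq_deriv_mul_of_integrable (u := fun t : ℝ => Complex.exp (I * ω * t)) (v := h)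
    (u' := fun t : ℝ => Complex.exp (I * ω * t) * (I * ω)) (v' := h')
    (fun t _ => hu t) (fun t _ => hder t)
    (hint huc hh'c fun t ht => (hsupp t ht).2) (hint (by fun_prop) hhc fun t ht => (hsupp t ht).1)
    (hint huc hhc fun t ht => (hsupp t ht).1)
  rw [hh'] at this
  rw [this, hh, neg_mul, ← integral_const_mul]
  congr 2
  ext t
  ring

lemma hasDerivAt_cylFourier {k k' : ℝ → ℝ × ℝ → ℂ} (hk : Continuous fun z : ℝ × ℝ × ℝ => k z.1 z.2)
    (hk' : Continuous fun z : ℝ × ℝ × ℝ => k' z.1 z.2) (hd : ∀ s z, HasDerivAt (fun s => k s z) (k' s z) s)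
    (hN : ∀ s t φ, t ∉ Ioc (-N) N → k s (t, φ) = 0) (hN' : ∀ s t φ, t ∉ Ioc (-N) N → k' s (t, φ) = 0) (ω : ℝ) (m : ℤ) (s : ℝ) :
    HasDerivAt (fun s => cylFourier (k s) ω m) (cylFourier (k' s) ω m) s := by
  have hc : ∀ {k : ℝ → ℝ × ℝ → ℂ}, (Continuous fun z : ℝ × ℝ × ℝ => k z.1 z.2) → ∀ s, Continuous (k s) := fun hk s =>
    hk.comp (by fun_prop : Continuous fun z : ℝ × ℝ => (s, z))
  rw [cylFourier_eq_integral (N := N) (hc hk' s) (hN' s)]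
  simp_rw [fun s => cylFourier_eq_integral (N := N) (hc hk s) (hN s) ω m]
  exact hasDerivAt_integral_mul_of_compact (B := 1) (J := univ) (continuous_cylKernel ω m).aestronglyMeasurable
    (ae_of_all _ fun z => (norm_cylKernel ω m z).le) (isCompact_Icc.prod isCompact_Icc) (cylMeasure_ae N)
    isOpen_univ hk.continuousOn hk'.continuousOn (fun s _ z => hd s z) (mem_univ s)

end

/-- `ρ² □` in divergence form along the Kerr frame. -/
def kerrWave (M a : ℝ) (p q : ℝ → ℝ) (f : Pt → ℂ) (x : Pt) : ℂ :=
  vder (radialField p q) (fun y => (Del M a (rad y) : ℂ) * vder (radialField p q) f y + vder (nullField a) f y) x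
    + vder (nullField a) (vder (radialField p q) f) x + ∑ k, vder (Om k) (vder (Om k) f) x
    + vder TField (fun y => ((a ^ 2 * sinSq y : ℝ) : ℂ) * vder TField f y + (a : ℂ) * vder (Om 0) f y) x
    + vder (Om 0) (fun y => (a : ℂ) * vder TField f y) x

/-- The angular part `∑ Ω_k² + a² sin²θ T²` of `ρ² □`. -/
def angularOp (a : ℝ) (f : Pt → ℂ) (x : Pt) : ℂ :=
  ∑ k, vder (Om k) (vder (Om k) f) x + ((a ^ 2 * sinSq x : ℝ) : ℂ) * vder TField (vder TField f) x

lemma vder_fun_add {X : Pt → Pt} {f g : Pt → ℂ} {x : Pt} (hf : DifferentiableAt ℝ f x) (hg : DifferentiableAt ℝ g x) :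
    vder X (fun y => f y + g y) x = vder X f x + vder X g x := by
  simp [vder, fderiv_fun_add hf hg]

lemma vder_fun_mul {X : Pt → Pt} {f g : Pt → ℂ} {x : Pt} (hf : DifferentiableAt ℝ f x) (hg : DifferentiableAt ℝ g x) :
    vder X (fun y => f y * g y) x = vder X f x * g x + f x * vder X g x := by
  simp [vder, fderiv_fun_mul hf hg]
  ring

lemma vder_const_mul {X : Pt → Pt} {f : Pt → ℂ} {x : Pt} (c : ℂ) (hf : DifferentiableAt ℝ f x) :
    vder X (fun y => c * f y) x = c * vder X f x := by
  simp [vder, fderiv_const_mul hf]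

lemma vder_congr {X : Pt → Pt} {f g : Pt → ℂ} {x : Pt} (h : f =ᶠ[𝓝 x] g) : vder X f x = vder X g x := by
  rw [vder, vder, h.fderiv_eq]

lemma vder_ofReal {X : Pt → Pt} {β : Pt → ℝ} {x : Pt} (h : DifferentiableAt ℝ β x) :
    vder X (fun y => (β y : ℂ)) x = ((fderiv ℝ β x (X x) : ℝ) : ℂ) := by
  have := (Complex.ofRealCLM.hasFDerivAt.comp x h.hasFDerivAt).fderiv
  rw [vder, show (fun y => (β y : ℂ)) = Complex.ofRealCLM ∘ β from rfl, this]
  rfl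

lemma fderiv_sinSq_TField {x : Pt} (hx : 0 < rad x) : fderiv ℝ sinSq x (TField x) = 0 := by
  have h1 : DifferentiableAt ℝ sinSq x := (contDiffAt_sinSq hx).differentiableAt (by simp)
  have h2 : HasDerivAt (fun s : ℝ => sinSq (x + s • TField x)) (fderiv ℝ sinSq x (TField x)) 0 := by
    have h3 : HasFDerivAt sinSq (fderiv ℝ sinSq x) (x + (0 : ℝ) • TField x) := by simpa using h1.hasFDerivAt
    have h4 : HasDerivAt (fun s : ℝ => x + s • TField x) (TField x) 0 := by
      simpa using ((hasDerivAt_id (0 : ℝ)).smul_const (TField x)).const_add x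
    exact h3.comp_hasDerivAt 0 h4
  have h5 : (fun s : ℝ => sinSq (x + s • TField x)) = fun _ => sinSq x := by
    ext s
    simp [sinSq, rad, TField]
  rw [h5] at h2
  exact h2.unique (hasDerivAt_const _ _)

namespace KerrSetup

variable {M a : ℝ} {K : KerrSetup M a} {t0 t1 : ℝ} {Φ Ψ : Pt → ℂ} {r N : ℝ}

lemma shell_rad_pos (ha : |a| < M) {x : Pt} (hx : x ∈ K.shell) : 0 < rad x := (rPlus_pos ha).trans hx.1

lemma contDiffAt_p (ha : |a| < M) (hr : rPlus M a < r) : ContDiffAt ℝ ∞ K.p r :=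
  K.p_smooth.contDiffAt (Ioi_mem_nhds ((rMinus_lt_rPlus ha).trans hr))

lemma contDiffAt_q (ha : |a| < M) (hr : rPlus M a < r) : ContDiffAt ℝ ∞ K.q r :=
  K.q_smooth.contDiffAt (Ioi_mem_nhds ((rMinus_lt_rPlus ha).trans hr))

lemma contDiffAt_Del_rad {x : Pt} (hx : 0 < rad x) : ContDiffAt ℝ ∞ (fun y => Del M a (rad y)) x := by
  unfold Del
  exact (((contDiffAt_rad hx).pow 2).sub (contDiffAt_const.mul (contDiffAt_rad hx))).add contDiffAt_const

lemma contDiffAt_ofReal {β : Pt → ℝ} {x : Pt} (h : ContDiffAt ℝ ∞ β x) :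
    ContDiffAt ℝ ∞ (fun y => (β y : ℂ)) x :=
  Complex.ofRealCLM.contDiff.contDiffAt.comp x h

lemma contDiffAt_radial (ha : |a| < M) {x : Pt} (hx : x ∈ K.shell) : ContDiffAt ℝ ∞ (radialField K.p K.q) x :=
  contDiffAt_radialField (shell_rad_pos ha hx) (contDiffAt_p ha hx.1) (contDiffAt_q ha hx.1)

lemma contDiffAt_radialBL (ha : |a| < M) {x : Pt} (hx : x ∈ K.shell) : ContDiffAt ℝ ∞ K.radialBL x := by
  have h := shell_rad_pos ha hx
  exact (contDiffAt_radial ha hx).add (((contDiffAt_Del_rad h).inv (Del_pos ha hx.1).ne').smul (contDiffAt_nullField h))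

lemma contDiffAt_TField {x : Pt} : ContDiffAt ℝ ∞ TField x := contDiff_TField.contDiffAt

lemma contDiffAt_Om {x : Pt} (k : Fin 3) : ContDiffAt ℝ ∞ (Om k) x := (contDiff_Om k).contDiffAt

lemma IsSlab.differentiableAt (h : K.IsSlab t0 t1 Φ) {x : Pt} (hx : x ∈ K.shell) : DifferentiableAt ℝ Φ x :=
  (h.smooth x hx).differentiableAt (by simp)

protected lemma IsSlab.T (h : K.IsSlab t0 t1 Φ) : K.IsSlab t0 t1 (vder TField Φ) := h.vder fun _ _ => contDiffAt_TField

protected lemma IsSlab.Om (h : K.IsSlab t0 t1 Φ) (k : Fin 3) : K.IsSlab t0 t1 (vder (Om k) Φ) := h.vder fun _ _ => contDiffAt_Om k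

protected lemma IsSlab.angularOp (ha : |a| < M) (h : K.IsSlab t0 t1 Φ) : K.IsSlab t0 t1 (angularOp a Φ) :=
  (IsSlab.sum fun k _ => (h.Om k).Om k).add
    (h.T.T.mul fun x hx => contDiffAt_ofReal (contDiffAt_const.mul (contDiffAt_sinSq (shell_rad_pos ha hx))))

lemma IsSlab.Del_mul (ha : |a| < M) (h : K.IsSlab t0 t1 Φ) : K.IsSlab t0 t1 (fun x => (Del M a (rad x) : ℂ) * Φ x) :=
  h.mul fun x hx => contDiffAt_ofReal (contDiffAt_Del_rad (shell_rad_pos ha hx))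

protected lemma IsSlab.kerrWave (ha : |a| < M) (h : K.IsSlab t0 t1 Φ) : K.IsSlab t0 t1 (kerrWave M a K.p K.q Φ) := by
  have hX := h.vder (X := radialField K.p K.q) fun x hx => contDiffAt_radial ha hx
  have hnull : ∀ x ∈ K.shell, ContDiffAt ℝ ∞ (nullField a) x := fun x hx => contDiffAt_nullField (shell_rad_pos ha hx)
  have hc : ∀ c : ℂ, ∀ x ∈ K.shell, ContDiffAt ℝ ∞ (fun _ : Pt => c) x := fun c x _ => contDiffAt_const
  exact ((((((hX.Del_mul ha).add (h.vder hnull)).vder (X := radialField K.p K.q) fun x hx => contDiffAt_radial ha hx).add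
    (hX.vder hnull)).add (IsSlab.sum fun k _ => (h.Om k).Om k)).add
    ((h.T.mul fun x hx => contDiffAt_ofReal (contDiffAt_const.mul (contDiffAt_sinSq (shell_rad_pos ha hx)))).add
      ((h.Om 0).mul (hc a))).T).add ((h.T.mul (hc a)).Om 0)

lemma vder_radialBL {f : Pt → ℂ} {x : Pt} :
    vder K.radialBL f x = vder (radialField K.p K.q) f x + ((Del M a (rad x))⁻¹ : ℝ) * vder (nullField a) f x := by
  simp [vder, radialBL]

lemma kerrWave_eq (ha : |a| < M) (h : K.IsSlab t0 t1 Φ) {x : Pt} (hx : x ∈ K.shell) :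
    kerrWave M a K.p K.q Φ x = vder K.radialBL (fun y => (Del M a (rad y) : ℂ) * vder K.radialBL Φ y) x
      - ((Del M a (rad x))⁻¹ : ℝ) * vder (nullField a) (vder (nullField a) Φ) x + angularOp a Φ x
      + a * vder TField (vder (Om 0) Φ) x + a * vder (Om 0) (vder TField Φ) x := by
  have hx0 := shell_rad_pos ha hx
  have hX := h.vder (X := radialField K.p K.q) fun x hx => contDiffAt_radial ha hx
  have hnull : ∀ x ∈ K.shell, ContDiffAt ℝ ∞ (nullField a) x := fun x hx => contDiffAt_nullField (shell_rad_pos ha hx)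
  have hW := h.vder hnull
  have hΔ : (Del M a (rad x) : ℂ) ≠ 0 := by exact_mod_cast (Del_pos ha hx.1).ne'
  have e1 : (fun y => (Del M a (rad y) : ℂ) * vder K.radialBL Φ y) =ᶠ[𝓝 x]
      fun y => (Del M a (rad y) : ℂ) * vder (radialField K.p K.q) Φ y + vder (nullField a) Φ y := by
    filter_upwards [K.isOpen_shell.mem_nhds hx] with y hy
    have hΔ : (Del M a (rad y) : ℂ) ≠ 0 := by exact_mod_cast (Del_pos ha hy.1).ne'
    rw [vder_radialBL]
    push_cast
    field_simp
  have dΔ : DifferentiableAt ℝ (fun y => Del M a (rad y)) x := (contDiffAt_Del_rad hx0).differentiableAt (by simp)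
  have dΔ' : DifferentiableAt ℝ (fun y => (Del M a (rad y) : ℂ)) x :=
    (contDiffAt_ofReal (contDiffAt_Del_rad hx0)).differentiableAt (by simp)
  have ds' : DifferentiableAt ℝ (fun y => ((a ^ 2 * sinSq y : ℝ) : ℂ)) x :=
    (contDiffAt_ofReal (contDiffAt_const.mul (contDiffAt_sinSq hx0))).differentiableAt (by simp)
  have hWΔ : vder (nullField a) (fun y => (Del M a (rad y) : ℂ)) x = 0 := by
    rw [vder_ofReal dΔ]
    have h2 : DifferentiableAt ℝ (Del M a) (rad x) := by unfold Del; fun_prop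
    rw [fderiv_comp_rad hx0 h2]
    have : dRad x (nullField a x) = 0 := by simp [dRad, nullField]; left; ring
    simp [this]
  have hTs : vder TField (fun y => ((a ^ 2 * sinSq y : ℝ) : ℂ)) x = 0 := by
    have h1 : DifferentiableAt ℝ sinSq x := (contDiffAt_sinSq hx0).differentiableAt (by simp)
    rw [vder_ofReal (h1.const_mul _), fderiv_const_mul h1]
    simp [fderiv_sinSq_TField hx0]
  rw [vder_congr e1, vder_radialBL, kerrWave, angularOp,
    vder_fun_add (X := nullField a) (dΔ'.fun_mul (hX.differentiableAt hx)) (hW.differentiableAt hx),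
    vder_fun_mul dΔ' (hX.differentiableAt hx), hWΔ,
    vder_fun_add (X := TField) (ds'.fun_mul (h.T.differentiableAt hx)) (((h.Om 0).differentiableAt hx).const_mul _),
    vder_fun_mul ds' (h.T.differentiableAt hx), hTs, vder_const_mul _ ((h.Om 0).differentiableAt hx),
    vder_const_mul _ (h.T.differentiableAt hx)]
  push_cast
  field_simp
  ring

end KerrSetup

lemma fderiv_Om (k : Fin 3) (x w : Pt) : fderiv ℝ (Om k) x w = Om k w := by
  have h : ∃ L : Pt →L[ℝ] Pt, ∀ y, L y = Om k y := by
    refine ⟨LinearMap.toContinuousLinearMap { toFun := Om k, map_add' := ?_, map_smul' := ?_ }, fun y => rfl⟩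
    · intro x y; ext i; fin_cases k <;> fin_cases i <;> simp [Om] <;> ring
    · intro c x; ext i; fin_cases k <;> fin_cases i <;> simp [Om]
  obtain ⟨L, hL⟩ := h
  rw [show Om k = L from (funext hL).symm, L.hasFDerivAt.fderiv]

lemma vder_vder {X Y : Pt → Pt} {f : Pt → ℂ} {x : Pt} (hY : DifferentiableAt ℝ Y x) (hf : DifferentiableAt ℝ (fderiv ℝ f) x) :
    vder X (vder Y f) x = (fderiv ℝ (fderiv ℝ f) x (X x)) (Y x) + fderiv ℝ f x (fderiv ℝ Y x (X x)) := by
  have h := (hf.hasFDerivAt.clm_apply hY.hasFDerivAt).fderiv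
  rw [vder, show vder Y f = fun y => fderiv ℝ f y (Y y) from rfl, h]
  simp [add_comm]

namespace KerrSetup

variable {M a : ℝ} {K : KerrSetup M a} {t0 t1 : ℝ} {Φ Ψ : Pt → ℂ} {r N ω : ℝ} {m : ℤ}

variable (K t0 t1) in
/-- At radius `r`, slab functions are supported in `-N < t ≤ N`. -/
def TimeBound (r N : ℝ) : Prop :=
  ∀ Φ : Pt → ℂ, K.IsSlab t0 t1 Φ → ∀ t θ φ, t ∉ Ioc (-N) N → Φ (K.ptBL t r θ φ) = 0

lemma fourierBL_eq (Φ : Pt → ℂ) (r θ ω : ℝ) (m : ℤ) :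
    K.fourierBL Φ r θ ω m = cylFourier (fun z => Φ (K.ptBL z.1 r θ z.2)) ω m := rfl

lemma fourierBL_congr {θ : ℝ} (h : ∀ t φ, Φ (K.ptBL t r θ φ) = Ψ (K.ptBL t r θ φ)) :
    K.fourierBL Φ r θ ω m = K.fourierBL Ψ r θ ω m := by
  simp only [fourierBL, h]

lemma fourierBL_mul {θ : ℝ} {c : Pt → ℂ} {c₀ : ℂ} (h : ∀ t φ, c (K.ptBL t r θ φ) = c₀) :
    K.fourierBL (fun x => c x * Φ x) r θ ω m = c₀ * K.fourierBL Φ r θ ω m := by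
  simp only [fourierBL_eq, h, cylFourier_const_mul]

lemma IsSlab.fderiv_differentiableAt (h : K.IsSlab t0 t1 Φ) {x : Pt} (hx : x ∈ K.shell) :
    DifferentiableAt ℝ (fderiv ℝ Φ) x :=
  ((h.smooth x hx).fderiv_right (m := 1) (by norm_cast)).differentiableAt (by simp)

lemma sinSq_ptBL {t θ φ : ℝ} (hr : 0 < r) : sinSq (K.ptBL t r θ φ) = sin θ ^ 2 := by
  rw [sinSq, K.rad_ptBL hr]
  simp only [ptBL, Matrix.cons_val]
  have := Real.sin_sq_add_cos_sq (φ + K.phibar r)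
  field_simp
  linear_combination (sin θ ^ 2) * this

/-- `sin²θ` times the round Laplacian in polar coordinates. -/
lemma sin_sq_mul_angular (L : Pt →L[ℝ] ℂ) (H : Pt →L[ℝ] Pt →L[ℝ] ℂ) (t r θ φ : ℝ) :
    (sin θ : ℂ) ^ 2 * ∑ k, (H (Om k (K.ptBL t r θ φ)) (Om k (K.ptBL t r θ φ)) + L (Om k (Om k (K.ptBL t r θ φ))))
      = (sin θ : ℂ) ^ 2 * (H (K.polarField r θ φ) (K.polarField r θ φ) + L (-positionField (K.ptBL t r θ φ)))
        + sin θ * cos θ * L (K.polarField r θ φ)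
        + (H (Om 0 (K.ptBL t r θ φ)) (Om 0 (K.ptBL t r θ φ)) + L (Om 0 (Om 0 (K.ptBL t r θ φ)))) := by
  have hv : ∀ u v w : ℝ, (![0, u, v, w] : Pt) = u • Pi.single 1 1 + v • Pi.single 2 1 + w • Pi.single 3 1 := by
    intro u v w
    ext i
    fin_cases i <;> simp
  have hL : ∀ u v w : ℝ, L ![0, u, v, w] = u * L (Pi.single 1 1) + v * L (Pi.single 2 1) + w * L (Pi.single 3 1) := by
    intro u v w
    simp [hv]
  have hH : ∀ u v w u' v' w' : ℝ, H ![0, u, v, w] ![0, u', v', w']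
      = u * (u' * H (Pi.single 1 1) (Pi.single 1 1) + v' * H (Pi.single 1 1) (Pi.single 2 1) + w' * H (Pi.single 1 1) (Pi.single 3 1))
      + v * (u' * H (Pi.single 2 1) (Pi.single 1 1) + v' * H (Pi.single 2 1) (Pi.single 2 1) + w' * H (Pi.single 2 1) (Pi.single 3 1))
      + w * (u' * H (Pi.single 3 1) (Pi.single 1 1) + v' * H (Pi.single 3 1) (Pi.single 2 1) + w' * H (Pi.single 3 1) (Pi.single 3 1)) := by
    intro u v w u' v' w'
    simp only [hv, map_add, map_smul, ContinuousLinearMap.add_apply, ContinuousLinearMap.smul_apply, Complex.real_smul]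
    ring
  have h1 : (sin θ : ℂ) ^ 2 = 1 - (cos θ : ℂ) ^ 2 := by
    have := Real.sin_sq_add_cos_sq θ
    rw [eq_sub_iff_add_eq]
    exact_mod_cast this
  have h2 : (sin (φ + K.phibar r) : ℂ) ^ 2 = 1 - (cos (φ + K.phibar r) : ℂ) ^ 2 := by
    have := Real.sin_sq_add_cos_sq (φ + K.phibar r)
    rw [eq_sub_iff_add_eq]
    exact_mod_cast this
  obtain ⟨s, hs⟩ : ∃ s, s = sin θ := ⟨_, rfl⟩
  obtain ⟨c, hc⟩ : ∃ s, s = cos θ := ⟨_, rfl⟩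
  obtain ⟨s', hs'⟩ : ∃ s, s = sin (φ + K.phibar r) := ⟨_, rfl⟩
  obtain ⟨c', hc'⟩ : ∃ s, s = cos (φ + K.phibar r) := ⟨_, rfl⟩
  rw [← hs, ← hc] at h1
  rw [← hs', ← hc'] at h2
  rw [Fin.sum_univ_three]
  simp only [Om, ptBL, polarField, positionField, ← hs, ← hc, ← hs', ← hc', Matrix.cons_val, map_neg]
  simp only [hL, hH, Complex.ofReal_mul, Complex.ofReal_neg, Complex.ofReal_zero]
  generalize H (Pi.single 1 1) (Pi.single 1 1) = a11
  generalize H (Pi.single 1 1) (Pi.single 2 1) = a12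
  generalize H (Pi.single 1 1) (Pi.single 3 1) = a13
  generalize H (Pi.single 2 1) (Pi.single 1 1) = a21
  generalize H (Pi.single 2 1) (Pi.single 2 1) = a22
  generalize H (Pi.single 2 1) (Pi.single 3 1) = a23
  generalize H (Pi.single 3 1) (Pi.single 1 1) = a31
  generalize H (Pi.single 3 1) (Pi.single 2 1) = a32
  generalize H (Pi.single 3 1) (Pi.single 3 1) = a33
  generalize L (Pi.single 1 1) = l1
  generalize L (Pi.single 2 1) = l2
  generalize L (Pi.single 3 1) = l3
  generalize (s : ℂ) = s at *
  generalize (c : ℂ) = c at *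
  generalize (s' : ℂ) = s' at *
  generalize (c' : ℂ) = c' at *
  generalize (r : ℂ) = r at *
  have e1 : s ^ 3 = s * (1 - c ^ 2) := by rw [← h1]; ring
  have e2 : s ^ 4 = (1 - c ^ 2) ^ 2 := by rw [← h1]; ring
  ring_nf
  simp only [h1, h2, e1, e2]
  ring

section
variable (ha : |a| < M) (h : K.IsSlab t0 t1 Φ) (hr : r ∈ Ioo (rPlus M a) (K.R / 2))
include ha h hr

lemma IsSlab.continuous_slice :
    Continuous fun z : ℝ × ℝ × ℝ => Φ (K.ptBL z.2.1 r z.1 z.2.2) :=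
  (h.continuousOn ha).comp_continuous (f := fun z : ℝ × ℝ × ℝ => (r, z)) (by fun_prop) fun z => ⟨hr, mem_univ _⟩

lemma IsSlab.continuous_cyl (θ : ℝ) :
    Continuous fun z : ℝ × ℝ => Φ (K.ptBL z.1 r θ z.2) :=
  (h.continuous_slice ha hr).comp (by fun_prop : Continuous fun z : ℝ × ℝ => (θ, z))

lemma fourierBL_add (h' : K.IsSlab t0 t1 Ψ) (θ : ℝ) :
    K.fourierBL (fun x => Φ x + Ψ x) r θ ω m = K.fourierBL Φ r θ ω m + K.fourierBL Ψ r θ ω m := by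
  obtain ⟨N, -, hN⟩ := exists_time_bound (K := K) ha t0 t1 hr
  have hN := hN.self_of_nhds.2
  exact cylFourier_add (N := N) (h.continuous_cyl ha hr θ) (h'.continuous_cyl ha hr θ)
    (fun t φ ht => hN _ h _ _ _ ht) (fun t φ ht => hN _ h' _ _ _ ht) ω m

lemma IsSlab.fourierBL_T (θ : ℝ) :
    K.fourierBL (vder TField Φ) r θ ω m = -(I * ω) * K.fourierBL Φ r θ ω m := by
  obtain ⟨N, -, hN⟩ := exists_time_bound (K := K) ha t0 t1 hr
  have hN := hN.self_of_nhds.2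
  refine cylFourier_deriv_time (N := N) (fun t φ => ?_) (h.continuous_cyl ha hr θ) (h.T.continuous_cyl ha hr θ)
    (fun t φ ht => hN _ h _ _ _ ht) (fun t φ ht => hN _ h.T _ _ _ ht) ω m
  exact (h.differentiableAt (K.ptBL_mem_shell ha hr)).hasFDerivAt.comp_hasDerivAt (f := fun t => K.ptBL t r θ φ) t (K.hasDerivAt_ptBL_t t r θ φ)

lemma IsSlab.fourierBL_Om (θ : ℝ) :
    K.fourierBL (vder (Om 0) Φ) r θ ω m = I * m * K.fourierBL Φ r θ ω m := by
  rw [fourierBL_eq, fourierBL_eq]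
  refine cylFourier_deriv_angle (fun t φ => ?_) ((h.Om 0).continuous_cyl ha hr θ) (fun t φ => ?_) ω m
  · exact (h.differentiableAt (K.ptBL_mem_shell ha hr)).hasFDerivAt.comp_hasDerivAt (f := fun φ => K.ptBL t r θ φ) φ (K.hasDerivAt_ptBL_phi t r θ φ)
  · simp only [ptBL_add_two_pi]

lemma IsSlab.sin_sq_mul_angularOp (t θ φ : ℝ) :
    (sin θ : ℂ) ^ 2 * angularOp a Φ (K.ptBL t r θ φ)
      = (sin θ : ℂ) ^ 2 * ((fderiv ℝ (fderiv ℝ Φ) (K.ptBL t r θ φ) (K.polarField r θ φ)) (K.polarField r θ φ)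
          + fderiv ℝ Φ (K.ptBL t r θ φ) (-positionField (K.ptBL t r θ φ)))
        + sin θ * cos θ * fderiv ℝ Φ (K.ptBL t r θ φ) (K.polarField r θ φ)
        + vder (Om 0) (vder (Om 0) Φ) (K.ptBL t r θ φ)
        + (a : ℂ) ^ 2 * (sin θ : ℂ) ^ 4 * vder TField (vder TField Φ) (K.ptBL t r θ φ) := by
  have hx := K.ptBL_mem_shell ha hr (t := t) (θ := θ) (φ := φ)
  have h2 := h.fderiv_differentiableAt hx
  have hO : ∀ k, vder (Om k) (vder (Om k) Φ) (K.ptBL t r θ φ)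
      = (fderiv ℝ (fderiv ℝ Φ) (K.ptBL t r θ φ) (Om k (K.ptBL t r θ φ))) (Om k (K.ptBL t r θ φ))
        + fderiv ℝ Φ (K.ptBL t r θ φ) (Om k (Om k (K.ptBL t r θ φ))) := fun k => by
    rw [vder_vder ((contDiff_Om k).differentiable (by simp) _) h2, fderiv_Om]
  rw [angularOp, mul_add]
  simp_rw [hO]
  rw [sin_sq_mul_angular (K := K) (fderiv ℝ Φ (K.ptBL t r θ φ)) (fderiv ℝ (fderiv ℝ Φ) (K.ptBL t r θ φ)) t r θ φ,
    sinSq_ptBL ((rPlus_pos ha).trans hr.1)]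
  simp only [Complex.ofReal_mul, Complex.ofReal_pow]
  ring

end

end KerrSetup

namespace KerrSetup

variable {M a : ℝ} {K : KerrSetup M a} {t0 t1 : ℝ} {Φ Ψ : Pt → ℂ} {r N ω : ℝ} {m : ℤ}

lemma continuous_polarField_comp (r : ℝ) : Continuous fun z : ℝ × ℝ × ℝ => K.polarField r z.1 z.2.2 := by
  rw [continuous_pi_iff]
  intro i
  fin_cases i <;> simp [polarField] <;> fun_prop

lemma continuous_ptBL (r : ℝ) : Continuous fun z : ℝ × ℝ × ℝ => K.ptBL z.2.1 r z.1 z.2.2 := by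
  rw [continuous_pi_iff]
  intro i
  fin_cases i <;> simp [ptBL] <;> fun_prop

variable (K Φ) in
/-- `∂_θ` of a function along Boyer--Lindquist coordinates. -/
def dTheta (r θ : ℝ) (z : ℝ × ℝ) : ℂ := fderiv ℝ Φ (K.ptBL z.1 r θ z.2) (K.polarField r θ z.2)

variable (K Φ) in
/-- `∂_θ²` of a function along Boyer--Lindquist coordinates. -/
def dTheta2 (r θ : ℝ) (z : ℝ × ℝ) : ℂ :=
  (fderiv ℝ (fderiv ℝ Φ) (K.ptBL z.1 r θ z.2) (K.polarField r θ z.2)) (K.polarField r θ z.2)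
    + fderiv ℝ Φ (K.ptBL z.1 r θ z.2) (-positionField (K.ptBL z.1 r θ z.2))

lemma eq_zero_of_hasDerivAt {g g' : ℝ → ℂ} (hd : ∀ θ, HasDerivAt g (g' θ) θ) (h0 : ∀ θ, g θ = 0) (θ : ℝ) : g' θ = 0 := by
  have h1 := hd θ
  rw [show g = fun _ => 0 from funext h0] at h1
  exact h1.unique (hasDerivAt_const _ _)

lemma exists_timeBound (ha : |a| < M) (hr : r ∈ Ioo (rPlus M a) (K.R / 2)) : ∃ N, K.TimeBound t0 t1 r N := by
  obtain ⟨N, -, hN⟩ := exists_time_bound (K := K) ha t0 t1 hr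
  exact ⟨N, hN.self_of_nhds.2⟩

lemma carter_eq (Φ : Pt → ℂ) (ω : ℝ) (m : ℤ) (l : ℕ) (r : ℝ) :
    K.carter Φ ω m l r = ∫ θ in (0 : ℝ)..Real.pi, K.fourierBL Φ r θ ω m * (spheroidalS (a * ω) m l θ : ℂ) * (sin θ : ℂ) := rfl

lemma spheroidalS_bound (ν : ℝ) (m : ℤ) (l : ℕ) : ∃ B, ∀ θ ∈ Ioo 0 π, ‖(spheroidalS ν m l θ : ℂ) * (sin θ : ℂ)‖ ≤ B := by
  obtain ⟨B, hB⟩ := (spheroidalS_spec ν m l).1.bounded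
  refine ⟨B, fun θ hθ => ?_⟩
  rw [norm_mul, Complex.norm_real, Complex.norm_real]
  calc _ ≤ |spheroidalS ν m l θ| * 1 := by
        gcongr
        · exact le_rfl
        · exact Real.abs_sin_le_one θ
    _ ≤ B := by rw [mul_one]; exact hB θ hθ

lemma aestronglyMeasurable_spheroidalS (ν : ℝ) (m : ℤ) (l : ℕ) :
    AEStronglyMeasurable (fun θ => (spheroidalS ν m l θ : ℂ) * (sin θ : ℂ)) (volume.restrict (Ioo 0 π)) := by
  have h : ContinuousOn (spheroidalS ν m l) (Ioo 0 π) := (spheroidalS_spec ν m l).1.contDiff.continuousOn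
  refine ContinuousOn.aestronglyMeasurable ?_ measurableSet_Ioo
  exact (Complex.continuous_ofReal.comp_continuousOn h).mul (by fun_prop)

lemma carter_eq_setIntegral (Φ : Pt → ℂ) (ω : ℝ) (m : ℤ) (l : ℕ) (r : ℝ) :
    K.carter Φ ω m l r = ∫ θ in Ioo 0 π, ((spheroidalS (a * ω) m l θ : ℂ) * (sin θ : ℂ)) * K.fourierBL Φ r θ ω m := by
  rw [carter_eq, intervalIntegral.integral_of_le Real.pi_pos.le, integral_Ioc_eq_integral_Ioo]
  congr 1
  ext θ
  ring

lemma ae_Ioo_mem_Icc {s t : ℝ} : ∀ᵐ θ ∂(volume.restrict (Ioo s t)), θ ∈ Icc s t := by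
  filter_upwards [ae_restrict_mem measurableSet_Ioo] with θ hθ using Ioo_subset_Icc_self hθ

lemma ae_bound_spheroidalS (ν : ℝ) (m : ℤ) (l : ℕ) : ∃ B, ∀ᵐ θ ∂(volume.restrict (Ioo 0 π)),
    ‖(spheroidalS ν m l θ : ℂ) * (sin θ : ℂ)‖ ≤ B := by
  obtain ⟨B, hB⟩ := spheroidalS_bound ν m l
  exact ⟨B, by filter_upwards [ae_restrict_mem measurableSet_Ioo] with θ hθ using hB θ hθ⟩

lemma carter_congr {c : ℂ} (l : ℕ) (h : ∀ θ ∈ Ioo 0 π, K.fourierBL Φ r θ ω m = c * K.fourierBL Ψ r θ ω m) :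
    K.carter Φ ω m l r = c * K.carter Ψ ω m l r := by
  rw [carter_eq_setIntegral, carter_eq_setIntegral, ← integral_const_mul]
  refine setIntegral_congr_fun measurableSet_Ioo fun θ hθ => ?_
  simp only [h θ hθ]
  ring

section
variable (ha : |a| < M) (h : K.IsSlab t0 t1 Φ) (hr : r ∈ Ioo (rPlus M a) (K.R / 2))
include ha h hr

lemma IsSlab.hasDerivAt_theta (θ : ℝ) (z : ℝ × ℝ) :
    HasDerivAt (fun θ => Φ (K.ptBL z.1 r θ z.2)) (K.dTheta Φ r θ z) θ :=
  (h.differentiableAt (K.ptBL_mem_shell ha hr)).hasFDerivAt.comp_hasDerivAt (f := fun θ => K.ptBL z.1 r θ z.2) θ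
    (K.hasDerivAt_ptBL_theta z.1 r θ z.2)

lemma IsSlab.hasDerivAt_dTheta (θ : ℝ) (z : ℝ × ℝ) :
    HasDerivAt (fun θ => K.dTheta Φ r θ z) (K.dTheta2 Φ r θ z) θ := by
  have h1 := (h.fderiv_differentiableAt (K.ptBL_mem_shell ha hr)).hasFDerivAt.comp_hasDerivAt (f := fun θ => K.ptBL z.1 r θ z.2) θ
    (K.hasDerivAt_ptBL_theta z.1 r θ z.2)
  exact h1.clm_apply (K.hasDerivAt_polarField z.1 r θ z.2)

lemma IsSlab.continuous_fderiv :
    Continuous fun z : ℝ × ℝ × ℝ => fderiv ℝ Φ (K.ptBL z.2.1 r z.1 z.2.2) := by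
  have h1 : ContinuousOn (fderiv ℝ Φ) K.shell := fun x hx => (h.fderiv_differentiableAt hx).continuousAt.continuousWithinAt
  exact h1.comp_continuous (continuous_ptBL r) fun z => K.ptBL_mem_shell ha hr

lemma IsSlab.continuous_dTheta :
    Continuous fun z : ℝ × ℝ × ℝ => K.dTheta Φ r z.1 z.2 :=
  (h.continuous_fderiv ha hr).clm_apply (continuous_polarField_comp r)

lemma IsSlab.continuous_dTheta2 :
    Continuous fun z : ℝ × ℝ × ℝ => K.dTheta2 Φ r z.1 z.2 := by
  have h2 : ContinuousOn (fderiv ℝ (fderiv ℝ Φ)) K.shell := fun x hx =>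
    ((((h.smooth x hx).fderiv_right (m := 1) (by norm_cast)).fderiv_right (m := 0) (by norm_cast)).continuousAt).continuousWithinAt
  have h3 : Continuous fun z : ℝ × ℝ × ℝ => fderiv ℝ (fderiv ℝ Φ) (K.ptBL z.2.1 r z.1 z.2.2) :=
    h2.comp_continuous (continuous_ptBL r) fun z => K.ptBL_mem_shell ha hr
  have hpos : Continuous fun z : ℝ × ℝ × ℝ => -positionField (K.ptBL z.2.1 r z.1 z.2.2) :=
    (contDiff_positionField.continuous.comp (continuous_ptBL r)).neg
  exact ((h3.clm_apply (continuous_polarField_comp r)).clm_apply (continuous_polarField_comp r)).add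
    ((h.continuous_fderiv ha hr).clm_apply hpos)

lemma IsSlab.dTheta_eq_zero
    (hN : K.TimeBound t0 t1 r N) (θ : ℝ) {t φ : ℝ} (ht : t ∉ Ioc (-N) N) : K.dTheta Φ r θ (t, φ) = 0 :=
  eq_zero_of_hasDerivAt (fun θ => h.hasDerivAt_theta ha hr θ (t, φ)) (fun θ => hN _ h _ _ _ ht) θ

lemma IsSlab.dTheta2_eq_zero
    (hN : K.TimeBound t0 t1 r N) (θ : ℝ) {t φ : ℝ} (ht : t ∉ Ioc (-N) N) : K.dTheta2 Φ r θ (t, φ) = 0 :=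
  eq_zero_of_hasDerivAt (fun θ => h.hasDerivAt_dTheta ha hr θ (t, φ)) (fun θ => h.dTheta_eq_zero ha hr hN _ ht) θ

lemma IsSlab.hasDerivAt_fourierBL (ω : ℝ) (m : ℤ) (θ : ℝ) :
    HasDerivAt (fun θ => K.fourierBL Φ r θ ω m) (cylFourier (K.dTheta Φ r θ) ω m) θ := by
  obtain ⟨N, hN⟩ := exists_timeBound (K := K) (t0 := t0) (t1 := t1) ha hr
  exact hasDerivAt_cylFourier (N := N) (k := fun θ z => Φ (K.ptBL z.1 r θ z.2)) (h.continuous_slice ha hr)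
    (h.continuous_dTheta ha hr) (fun θ z => h.hasDerivAt_theta ha hr θ z) (fun θ t φ ht => hN _ h _ _ _ ht)
    (fun θ t φ ht => h.dTheta_eq_zero ha hr hN θ ht) ω m θ

lemma IsSlab.hasDerivAt_fourierBL' (ω : ℝ) (m : ℤ) (θ : ℝ) :
    HasDerivAt (fun θ => cylFourier (K.dTheta Φ r θ) ω m) (cylFourier (K.dTheta2 Φ r θ) ω m) θ := by
  obtain ⟨N, hN⟩ := exists_timeBound (K := K) (t0 := t0) (t1 := t1) ha hr
  exact hasDerivAt_cylFourier (N := N) (h.continuous_dTheta ha hr) (h.continuous_dTheta2 ha hr)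
    (fun θ z => h.hasDerivAt_dTheta ha hr θ z) (fun θ t φ ht => h.dTheta_eq_zero ha hr hN θ ht)
    (fun θ t φ ht => h.dTheta2_eq_zero ha hr hN θ ht) ω m θ

lemma IsSlab.continuous_fourierBL (ω : ℝ) (m : ℤ) :
    Continuous fun θ => K.fourierBL Φ r θ ω m :=
  continuous_iff_continuousAt.2 fun θ => (h.hasDerivAt_fourierBL ha hr ω m θ).continuousAt

lemma IsSlab.sin_sq_mul_fourierBL (ω : ℝ) (m : ℤ) (θ : ℝ) :
    (sin θ : ℂ) ^ 2 * K.fourierBL (angularOp a Φ) r θ ω m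
      = (sin θ : ℂ) ^ 2 * cylFourier (K.dTheta2 Φ r θ) ω m + sin θ * cos θ * cylFourier (K.dTheta Φ r θ) ω m
        - (m : ℂ) ^ 2 * K.fourierBL Φ r θ ω m - ((a * ω : ℝ) : ℂ) ^ 2 * (sin θ : ℂ) ^ 4 * K.fourierBL Φ r θ ω m := by
  obtain ⟨N, hN⟩ := exists_timeBound (K := K) (t0 := t0) (t1 := t1) ha hr
  have hsec : ∀ {k : ℝ → ℝ × ℝ → ℂ}, (Continuous fun z : ℝ × ℝ × ℝ => k z.1 z.2) → Continuous (k θ) := fun hk =>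
    hk.comp (by fun_prop : Continuous fun z : ℝ × ℝ => (θ, z))
  have c2 := hsec (h.continuous_dTheta2 ha hr)
  have c1 := hsec (h.continuous_dTheta ha hr)
  have cO := ((h.Om 0).Om 0).continuous_cyl ha hr θ
  have cT := h.T.T.continuous_cyl ha hr θ
  have v2 : ∀ t φ, t ∉ Ioc (-N) N → K.dTheta2 Φ r θ (t, φ) = 0 := fun t φ ht => h.dTheta2_eq_zero ha hr hN θ ht
  have v1 : ∀ t φ, t ∉ Ioc (-N) N → K.dTheta Φ r θ (t, φ) = 0 := fun t φ ht => h.dTheta_eq_zero ha hr hN θ ht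
  have vO := fun t φ ht => hN _ ((h.Om 0).Om 0) t θ φ ht
  have vT := fun t φ ht => hN _ h.T.T t θ φ ht
  have eO : K.fourierBL (vder (Om 0) (vder (Om 0) Φ)) r θ ω m
      = -(m : ℂ) ^ 2 * K.fourierBL Φ r θ ω m := by
    rw [(h.Om 0).fourierBL_Om ha hr, h.fourierBL_Om ha hr]
    linear_combination ((m : ℂ) ^ 2 * K.fourierBL Φ r θ ω m) * Complex.I_sq
  have eT : K.fourierBL (vder TField (vder TField Φ)) r θ ω m
      = -(ω : ℂ) ^ 2 * K.fourierBL Φ r θ ω m := by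
    rw [h.T.fourierBL_T ha hr, h.fourierBL_T ha hr]
    linear_combination ((ω : ℂ) ^ 2 * K.fourierBL Φ r θ ω m) * Complex.I_sq
  rw [fourierBL_eq] at eO eT
  rw [fourierBL_eq (Φ := angularOp a Φ), ← cylFourier_const_mul]
  have e : (fun z : ℝ × ℝ => (sin θ : ℂ) ^ 2 * angularOp a Φ (K.ptBL z.1 r θ z.2))
      = fun z => (((sin θ : ℂ) ^ 2 * K.dTheta2 Φ r θ z + (sin θ * cos θ : ℂ) * K.dTheta Φ r θ z)
        + vder (Om 0) (vder (Om 0) Φ) (K.ptBL z.1 r θ z.2))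
        + ((a : ℂ) ^ 2 * (sin θ : ℂ) ^ 4) * vder TField (vder TField Φ) (K.ptBL z.1 r θ z.2) :=
    funext fun z => h.sin_sq_mul_angularOp ha hr z.1 θ z.2
  rw [e, cylFourier_add (N := N) (by fun_prop) (by fun_prop) (fun t φ ht => by simp only [v2 t φ ht, v1 t φ ht, vO t φ ht]; ring)
      (fun t φ ht => by simp only [vT t φ ht]; ring),
    cylFourier_add (N := N) (by fun_prop) (by fun_prop) (fun t φ ht => by simp only [v2 t φ ht, v1 t φ ht]; ring)
      (fun t φ ht => vO t φ ht),
    cylFourier_add (N := N) (by fun_prop) (by fun_prop) (fun t φ ht => by simp only [v2 t φ ht]; ring)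
      (fun t φ ht => by simp only [v1 t φ ht]; ring),
    cylFourier_const_mul, cylFourier_const_mul, cylFourier_const_mul, eO, eT, Complex.ofReal_mul]
  ring

/-- The angular operator acts on the Carter coefficients by `-Λ`. -/
lemma IsSlab.carter_angularOp (ω : ℝ) (m : ℤ) (l : ℕ) :
    K.carter (angularOp a Φ) ω m l r = -(LambdaFreq a ω m l : ℂ) * K.carter Φ ω m l r := by
  have hA := h.hasDerivAt_fourierBL ha hr ω m
  have hA' := h.hasDerivAt_fourierBL' ha hr ω m
  have hE := (h.angularOp ha).continuous_fourierBL ha hr ω m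
  obtain ⟨B1, hB1⟩ := (isCompact_Icc (a := 0) (b := π)).exists_bound_of_continuousOn (h.continuous_fourierBL ha hr ω m).continuousOn
  obtain ⟨B2, hB2⟩ := (isCompact_Icc (a := 0) (b := π)).exists_bound_of_continuousOn
    (continuous_iff_continuousAt.2 fun θ => (hA' θ).continuousAt).continuousOn
  obtain ⟨B3, hB3⟩ := (isCompact_Icc (a := 0) (b := π)).exists_bound_of_continuousOn hE.continuousOn
  have := integral_angular_operator_mul_spheroidalS (a * ω) m l (B := max B1 (max B2 B3)) (fun θ _ => hA θ) (fun θ _ => hA' θ)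
    (fun θ hθ => (hB1 θ (Ioo_subset_Icc_self hθ)).trans (le_max_left _ _))
    (fun θ hθ => (hB2 θ (Ioo_subset_Icc_self hθ)).trans ((le_max_left _ _).trans (le_max_right _ _)))
    (fun θ hθ => (hB3 θ (Ioo_subset_Icc_self hθ)).trans ((le_max_right _ _).trans (le_max_right _ _)))
    hE.continuousOn (fun θ _ => h.sin_sq_mul_fourierBL ha hr ω m θ)
  rw [carter_eq, carter_eq, this, LambdaFreq]
  congr 3
  ring_nf

/-! ### Carter coefficients -/

lemma IsSlab.integrable_carter (ω : ℝ) (m : ℤ) (l : ℕ) :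
    Integrable (fun θ => ((spheroidalS (a * ω) m l θ : ℂ) * (sin θ : ℂ)) * K.fourierBL Φ r θ ω m) (volume.restrict (Ioo 0 π)) := by
  obtain ⟨B, hB⟩ := ae_bound_spheroidalS (a * ω) m l
  exact integrable_mul_of_compact (aestronglyMeasurable_spheroidalS (a * ω) m l) hB isCompact_Icc ae_Ioo_mem_Icc
    (h.continuous_fourierBL ha hr ω m)

lemma carter_add (h' : K.IsSlab t0 t1 Ψ) (l : ℕ) :
    K.carter (fun x => Φ x + Ψ x) ω m l r = K.carter Φ ω m l r + K.carter Ψ ω m l r := by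
  rw [carter_eq_setIntegral, carter_eq_setIntegral, carter_eq_setIntegral,
    ← integral_add (h.integrable_carter ha hr ω m l) (h'.integrable_carter ha hr ω m l)]
  simp only [fourierBL_add ha h hr h', mul_add]

/-- Carter coefficients may be differentiated in `r` along `∂_r`. -/
lemma IsSlab.hasDerivAt_carter (ω : ℝ) (m : ℤ) (l : ℕ) :
    HasDerivAt (K.carter Φ ω m l) (K.carter (vder K.radialBL Φ) ω m l r) r := by
  have h' := h.vder (X := K.radialBL) fun x hx => contDiffAt_radialBL ha hx
  obtain ⟨N, -, hN⟩ := exists_time_bound (K := K) ha t0 t1 hr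
  obtain ⟨B, hB⟩ := ae_bound_spheroidalS (a * ω) m l
  obtain ⟨μ, hμ⟩ : ∃ μ : Measure (ℝ × ℝ × ℝ), μ = (volume.restrict (Ioo 0 π)).prod (cylMeasure N) := ⟨_, rfl⟩
  have hfin : IsFiniteMeasure μ := by rw [hμ]; infer_instance
  obtain ⟨w, hw⟩ : ∃ w : ℝ × ℝ × ℝ → ℂ, w = fun z => ((spheroidalS (a * ω) m l z.1 : ℂ) * (sin z.1 : ℂ)) * cylKernel ω m z.2 := ⟨_, rfl⟩
  have hwm : AEStronglyMeasurable w μ := by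
    rw [hw, hμ]
    exact (aestronglyMeasurable_spheroidalS (a * ω) m l).comp_fst.mul
      ((continuous_cylKernel ω m).comp continuous_snd).aestronglyMeasurable
  have hfst : ∀ {P : ℝ → Prop}, (∀ᵐ θ ∂(volume.restrict (Ioo 0 π)), P θ) → ∀ᵐ z ∂μ, P z.1 := fun hP => by
    rw [hμ]; exact Measure.quasiMeasurePreserving_fst.ae hP
  have hsnd : ∀ {P : ℝ × ℝ → Prop}, (∀ᵐ z ∂(cylMeasure N), P z) → ∀ᵐ z ∂μ, P z.2 := fun hP => by
    rw [hμ]; exact Measure.quasiMeasurePreserving_snd.ae hP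
  have hwB : ∀ᵐ z ∂μ, ‖w z‖ ≤ B := by
    filter_upwards [hfst hB] with z hz
    rw [hw]
    simp only
    rw [norm_mul, norm_cylKernel, mul_one]
    exact hz
  have hKμ : ∀ᵐ z ∂μ, z ∈ Icc 0 π ×ˢ (Icc (-N) N ×ˢ Icc (0 : ℝ) (2 * π)) := by
    filter_upwards [hfst ae_Ioo_mem_Icc, hsnd (cylMeasure_ae N)] with z h1 h2 using ⟨h1, h2⟩
  have hK := (isCompact_Icc (a := 0) (b := π)).prod ((isCompact_Icc (a := -N) (b := N)).prod (isCompact_Icc (a := (0:ℝ)) (b := 2 * π)))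
  have hrep : ∀ᶠ s in 𝓝 r, ∀ {Ψ : Pt → ℂ}, K.IsSlab t0 t1 Ψ → K.carter Ψ ω m l s = ∫ z, w z * Ψ (K.ptBL z.2.1 s z.1 z.2.2) ∂μ := by
    filter_upwards [hN] with s hs Ψ hΨ
    have hint := integrable_mul_of_compact hwm hwB hK hKμ (hΨ.continuous_slice ha hs.1)
    rw [hμ] at hint ⊢
    rw [integral_prod _ hint, carter_eq_setIntegral]
    refine integral_congr_ae (ae_of_all _ fun θ => ?_)
    simp only [hw]
    rw [fourierBL_eq, cylFourier_eq_integral (N := N) (hΨ.continuous_cyl ha hs.1 θ) (fun t φ ht => hs.2 _ hΨ _ _ _ ht),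
      ← integral_const_mul]
    congr 1
    ext z
    ring
  rw [hrep.self_of_nhds h']
  refine HasDerivAt.congr_of_eventuallyEq ?_ (hrep.mono fun s hs => hs h)
  refine hasDerivAt_integral_mul_of_compact (g := fun s z => Φ (K.ptBL z.2.1 s z.1 z.2.2))
    (g' := fun s z => vder K.radialBL Φ (K.ptBL z.2.1 s z.1 z.2.2)) hwm hwB hK hKμ isOpen_Ioo (h.continuousOn ha)
    (h'.continuousOn ha) (fun s hs z => ?_) hr
  exact (h.differentiableAt (K.ptBL_mem_shell ha hs)).hasFDerivAt.comp_hasDerivAt (f := fun r => K.ptBL z.2.1 r z.1 z.2.2) s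
    (K.hasDerivAt_ptBL_r ha hs.1)

end

end KerrSetup

lemma multiDer_two (X Y : Pt → Pt) (κ : Fin 2 → ℕ) (f : Pt → ℂ) :
    multiDer ![X, Y] κ f = (vder X)^[κ 0] ((vder Y)^[κ 1] f) := by
  simp [multiDer, List.finRange_succ]

/-- The coefficient of the zeroth order term of the radial equation. -/
def radialQ (M a ω : ℝ) (m : ℤ) (Λ r : ℝ) : ℝ :=
  ((r ^ 2 + a ^ 2) * ω - a * m) ^ 2 / Del M a r + 2 * a * ω * m - Λ

/-- Passage from the radial equation for `U` to the Schrödinger form for `√(r²+a²) U`. -/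
lemma dStar_dStar_sqrt_mul {M a ω Λ : ℝ} (ha : |a| < M) {m : ℤ} {I : Set ℝ} (hI : IsOpen I) (hI' : I ⊆ Ioi (rPlus M a))
    {U U1 W : ℝ → ℂ} (h1 : ∀ r ∈ I, HasDerivAt U (U1 r) r)
    (h2 : ∀ r ∈ I, HasDerivAt (fun r => (Del M a r : ℂ) * U1 r) (W r) r) {r : ℝ} (hr : r ∈ I) :
    dStar M a (dStar M a fun r => (√(r ^ 2 + a ^ 2) : ℂ) * U r) r
        + ((ω ^ 2 - Vfull M a ω m Λ r : ℝ) : ℂ) * ((√(r ^ 2 + a ^ 2) : ℂ) * U r)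
      = ((Del M a r / ((r ^ 2 + a ^ 2) * √(r ^ 2 + a ^ 2)) : ℝ) : ℂ) * (W r + (radialQ M a ω m Λ r : ℂ) * U r) := by
  obtain ⟨s, hs⟩ : ∃ s : ℝ → ℝ, s = fun r => √(r ^ 2 + a ^ 2) := ⟨_, rfl⟩
  have hpos : ∀ r ∈ I, 0 < r := fun r hr => (rPlus_pos ha).trans (hI' hr)
  have hspos : ∀ r ∈ I, 0 < s r := fun r hr => by
    have := hpos r hr
    rw [hs]; positivity
  have hsq : ∀ r, s r ^ 2 = r ^ 2 + a ^ 2 := fun r => by rw [hs]; exact Real.sq_sqrt (by positivity)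
  have hsd : ∀ r ∈ I, HasDerivAt s (r / s r) r := by
    intro r hr
    have h0 : r ^ 2 + a ^ 2 ≠ 0 := by have := hpos r hr; positivity
    have := ((hasDerivAt_pow 2 r).add_const (a ^ 2)).sqrt h0
    rw [hs]
    refine this.congr_deriv ?_
    have : √(r ^ 2 + a ^ 2) ≠ 0 := by have := hspos r hr; rw [hs] at this; exact this.ne'
    field_simp
    norm_num
  have e1 : ∀ r ∈ I, dStar M a (fun r => (√(r ^ 2 + a ^ 2) : ℂ) * U r) r
      = ((Del M a r * r / s r ^ 3 : ℝ) : ℂ) * U r + (((s r)⁻¹ : ℝ) : ℂ) * ((Del M a r : ℂ) * U1 r) := by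
    intro r hr
    have hd : HasDerivAt (fun r => (s r : ℂ) * U r) (((r / s r : ℝ) : ℂ) * U r + (s r : ℂ) * U1 r) r :=
      (hsd r hr).ofReal_comp.fun_mul (h1 r hr)
    have hs0 : (s r : ℂ) ≠ 0 := by exact_mod_cast (hspos r hr).ne'
    rw [show (fun r => (√(r ^ 2 + a ^ 2) : ℂ) * U r) = fun r => (s r : ℂ) * U r by rw [hs], dStar, hd.deriv, ← hsq,
      Complex.real_smul]
    push_cast
    field_simp
  have hΔd : HasDerivAt (fun r => Del M a r * r / s r ^ 3)
      ((((2 * r - 2 * M) * r + Del M a r) * s r ^ 3 - Del M a r * r * (3 * s r ^ 2 * (r / s r))) / (s r ^ 3) ^ 2) r := by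
    have := ((((hasDerivAt_Del : HasDerivAt (Del M a) _ r)).mul (hasDerivAt_id r)).div ((hsd r hr).pow 3) (pow_ne_zero 3 (hspos r hr).ne'))
    refine this.congr_deriv ?_
    simp
  have hsinv : HasDerivAt (fun r => (s r)⁻¹) (-(r / s r) / s r ^ 2) r := (hsd r hr).inv (hspos r hr).ne'
  have hD := (hΔd.ofReal_comp.fun_mul (h1 r hr)).fun_add (hsinv.ofReal_comp.fun_mul (h2 r hr))
  have hev : dStar M a (fun r => (√(r ^ 2 + a ^ 2) : ℂ) * U r) =ᶠ[𝓝 r] fun r =>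
      ((Del M a r * r / s r ^ 3 : ℝ) : ℂ) * U r + (((s r)⁻¹ : ℝ) : ℂ) * ((Del M a r : ℂ) * U1 r) := by
    filter_upwards [hI.mem_nhds hr] with r hr using e1 r hr
  rw [dStar, hev.deriv_eq, hD.deriv, Vfull, V0, V1, radialQ, Complex.real_smul, show √(r ^ 2 + a ^ 2) = s r by rw [hs], ← hsq]
  have hs0 : (s r : ℂ) ≠ 0 := by exact_mod_cast (hspos r hr).ne'
  have hΔ0 : (Del M a r : ℂ) ≠ 0 := by exact_mod_cast (Del_pos ha (hI' hr)).ne'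
  have hΔe : (Del M a r : ℂ) = (s r : ℂ) ^ 2 - 2 * M * r := by
    have := hsq r
    have h3 : Del M a r = s r ^ 2 - 2 * M * r := by rw [this, Del]; ring
    rw [h3]; push_cast; ring
  have ha2 : (a : ℂ) ^ 2 = (s r : ℂ) ^ 2 - (r : ℂ) ^ 2 := by
    have := hsq r
    have h3 : a ^ 2 = s r ^ 2 - r ^ 2 := by rw [this]; ring
    exact_mod_cast h3
  push_cast
  field_simp
  rw [hΔe]
  ring_nf
  simp only [show (a : ℂ) ^ 2 = (s r : ℂ) ^ 2 - (r : ℂ) ^ 2 from ha2]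
  ring

namespace KerrSetup

variable {M a : ℝ} {K : KerrSetup M a} {t0 t1 : ℝ} {Φ Ψ : Pt → ℂ} {r N ω : ℝ} {m : ℤ} {l : ℕ}

lemma carter_congr_shell (ha : |a| < M) (hr : r ∈ Ioo (rPlus M a) (K.R / 2)) (h : ∀ x ∈ K.shell, Φ x = Ψ x) :
    K.carter Φ ω m l r = K.carter Ψ ω m l r := by
  simpa using carter_congr (c := 1) l fun θ hθ => by
    rw [one_mul]
    exact fourierBL_congr fun t φ => h _ (K.ptBL_mem_shell ha hr)

lemma carter_mul {c : ℝ → ℂ} (ha : |a| < M) (hr : r ∈ Ioo (rPlus M a) (K.R / 2)) :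
    K.carter (fun x => c (rad x) * Φ x) ω m l r = c r * K.carter Φ ω m l r :=
  carter_congr l fun θ _ => fourierBL_mul fun t φ => by rw [K.rad_ptBL ((rPlus_pos ha).trans hr.1)]

protected lemma IsSlab.nullField (ha : |a| < M) (h : K.IsSlab t0 t1 Φ) : K.IsSlab t0 t1 (vder (nullField a) Φ) :=
  h.vder fun x hx => contDiffAt_nullField (shell_rad_pos ha hx)

protected lemma IsSlab.radialBL (ha : |a| < M) (h : K.IsSlab t0 t1 Φ) : K.IsSlab t0 t1 (vder K.radialBL Φ) :=
  h.vder fun x hx => contDiffAt_radialBL ha hx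

lemma IsSlab.T_iterate (h : K.IsSlab t0 t1 Φ) (n : ℕ) : K.IsSlab t0 t1 ((vder TField)^[n] Φ) := by
  induction n with
  | zero => exact h
  | succ n ih => rw [Function.iterate_succ_apply']; exact ih.T

lemma IsSlab.Om_iterate (h : K.IsSlab t0 t1 Φ) (n : ℕ) : K.IsSlab t0 t1 ((vder (Om 0))^[n] Φ) := by
  induction n with
  | zero => exact h
  | succ n ih => rw [Function.iterate_succ_apply']; exact ih.Om 0

protected lemma IsSlab.multiDer (h : K.IsSlab t0 t1 Φ) (κ : Fin 2 → ℕ) : K.IsSlab t0 t1 (multiDer ![TField, Om 0] κ Φ) := by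
  rw [multiDer_two]
  exact (h.Om_iterate _).T_iterate _

/-- The symbol of `T^{κ0} Ω₁^{κ1}`. -/
def symbol (κ : Fin 2 → ℕ) (ω : ℝ) (m : ℤ) : ℂ := (-(I * ω)) ^ κ 0 * (I * m) ^ κ 1

section
variable (ha : |a| < M) (h : K.IsSlab t0 t1 Φ) (hr : r ∈ Ioo (rPlus M a) (K.R / 2))
include ha h hr

lemma IsSlab.carter_T :
    K.carter (vder TField Φ) ω m l r = -(I * ω) * K.carter Φ ω m l r :=
  carter_congr l fun θ _ => h.fourierBL_T ha hr θ

lemma IsSlab.carter_Om :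
    K.carter (vder (Om 0) Φ) ω m l r = I * m * K.carter Φ ω m l r :=
  carter_congr l fun θ _ => h.fourierBL_Om ha hr θ

lemma IsSlab.carter_nullField :
    K.carter (vder (nullField a) Φ) ω m l r
      = -(I * (((r ^ 2 + a ^ 2) * ω - a * m : ℝ) : ℂ)) * K.carter Φ ω m l r := by
  have e : ∀ x ∈ K.shell, vder (nullField a) Φ x
      = ((rad x ^ 2 + a ^ 2 : ℝ) : ℂ) * vder TField Φ x + (a : ℂ) * vder (Om 0) Φ x := by
    intro x _
    rw [nullField_eq]
    simp [vder]
  rw [carter_congr_shell ha hr e, carter_add ha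
    (h.T.mul fun x hx => contDiffAt_ofReal (((contDiffAt_rad (shell_rad_pos ha hx)).pow 2).add contDiffAt_const)) hr
    ((h.Om 0).mul fun x _ => contDiffAt_const),
    carter_mul (c := fun r => ((r ^ 2 + a ^ 2 : ℝ) : ℂ)) ha hr, carter_mul (c := fun _ => (a : ℂ)) ha hr, h.carter_T ha hr,
    h.carter_Om ha hr]
  push_cast
  ring

lemma IsSlab.hasDerivAt_Del_mul_carter :
    HasDerivAt (fun r => (Del M a r : ℂ) * K.carter (vder K.radialBL Φ) ω m l r)
      (K.carter (vder K.radialBL fun y => (Del M a (rad y) : ℂ) * vder K.radialBL Φ y) ω m l r) r := by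
  refine (((h.radialBL ha).Del_mul ha).hasDerivAt_carter ha hr ω m l).congr_of_eventuallyEq ?_
  filter_upwards [isOpen_Ioo.mem_nhds hr] with s hs
  exact (carter_mul (c := fun r => (Del M a r : ℂ)) ha hs).symm

/-- The separated wave equation. -/
lemma IsSlab.carter_kerrWave :
    K.carter (kerrWave M a K.p K.q Φ) ω m l r
      = K.carter (vder K.radialBL fun y => (Del M a (rad y) : ℂ) * vder K.radialBL Φ y) ω m l r
        + (radialQ M a ω m (LambdaFreq a ω m l) r : ℂ) * K.carter Φ ω m l r := by
  have e : ∀ x ∈ K.shell, kerrWave M a K.p K.q Φ x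
      = (((vder K.radialBL (fun y => (Del M a (rad y) : ℂ) * vder K.radialBL Φ y) x
      + ((-(Del M a (rad x))⁻¹ : ℝ) : ℂ) * vder (nullField a) (vder (nullField a) Φ) x)
      + angularOp a Φ x)
      + a * vder TField (vder (Om 0) Φ) x)
      + a * vder (Om 0) (vder TField Φ) x := by
    intro x hx
    rw [kerrWave_eq ha h hx]
    push_cast
    ring
  have s1 := ((h.radialBL ha).Del_mul ha).radialBL ha
  have s2 : K.IsSlab t0 t1 fun x => ((-(Del M a (rad x))⁻¹ : ℝ) : ℂ) * vder (nullField a) (vder (nullField a) Φ) x :=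
    ((h.nullField ha).nullField ha).mul fun x hx => contDiffAt_ofReal
      (((contDiffAt_Del_rad (shell_rad_pos ha hx)).inv (Del_pos ha hx.1).ne').neg)
  have s3 := h.angularOp ha
  have s4 : K.IsSlab t0 t1 fun x => (a : ℂ) * vder TField (vder (Om 0) Φ) x :=
    (h.Om 0).T.mul fun x _ => contDiffAt_const
  have s5 : K.IsSlab t0 t1 fun x => (a : ℂ) * vder (Om 0) (vder TField Φ) x :=
    (h.T.Om 0).mul fun x _ => contDiffAt_const
  rw [carter_congr_shell ha hr e, carter_add ha (((s1.add s2).add s3).add s4) hr s5, carter_add ha ((s1.add s2).add s3) hr s4,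
    carter_add ha (s1.add s2) hr s3, carter_add ha s1 hr s2, carter_mul (c := fun r => ((-(Del M a r)⁻¹ : ℝ) : ℂ)) ha hr,
    carter_mul (c := fun _ => (a : ℂ)) ha hr, carter_mul (c := fun _ => (a : ℂ)) ha hr, (h.nullField ha).carter_nullField ha hr,
    h.carter_nullField ha hr, h.carter_angularOp ha hr, (h.Om 0).carter_T ha hr, h.carter_Om ha hr, h.T.carter_Om ha hr,
    h.carter_T ha hr, radialQ]
  have hΔ0 : (Del M a r : ℂ) ≠ 0 := by exact_mod_cast (Del_pos ha hr.1).ne'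
  push_cast
  field_simp
  ring_nf
  simp only [Complex.I_sq]
  ring

lemma IsSlab.carter_multiDer (κ : Fin 2 → ℕ) :
    K.carter (multiDer ![TField, Om 0] κ Φ) ω m l r = symbol κ ω m * K.carter Φ ω m l r := by
  have h1 : ∀ n, K.carter ((vder (Om 0))^[n] Φ) ω m l r = (I * m) ^ n * K.carter Φ ω m l r := by
    intro n
    induction n with
    | zero => simp
    | succ n ih => rw [Function.iterate_succ_apply', (h.Om_iterate n).carter_Om ha hr, ih]; ring
  have h2 : ∀ n, K.carter ((vder TField)^[n] ((vder (Om 0))^[κ 1] Φ)) ω m l r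
      = (-(I * ω)) ^ n * K.carter ((vder (Om 0))^[κ 1] Φ) ω m l r := by
    intro n
    induction n with
    | zero => simp
    | succ n ih => rw [Function.iterate_succ_apply', ((h.Om_iterate (κ 1)).T_iterate n).carter_T ha hr, ih]; ring
  rw [multiDer_two, h2, h1, symbol]
  ring

/-- The radial equation for the modes of a slab function. -/
lemma IsSlab.radial_equation (κ : Fin 2 → ℕ) :
    dStar M a (dStar M a fun r => (√(r ^ 2 + a ^ 2) : ℂ) * K.carter (multiDer ![TField, Om 0] κ Φ) ω m l r) r
        + ((ω ^ 2 - Vfull M a ω m (LambdaFreq a ω m l) r : ℝ) : ℂ) *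
          ((√(r ^ 2 + a ^ 2) : ℂ) * K.carter (multiDer ![TField, Om 0] κ Φ) ω m l r)
      = ((Del M a r / ((r ^ 2 + a ^ 2) * √(r ^ 2 + a ^ 2)) : ℝ) : ℂ) *
        K.carter (multiDer ![TField, Om 0] κ (kerrWave M a K.p K.q Φ)) ω m l r := by
  have hκ := h.multiDer κ
  rw [dStar_dStar_sqrt_mul ha (isOpen_Ioo (a := rPlus M a) (b := K.R / 2)) Ioo_subset_Ioi_self
    (U1 := fun r => symbol κ ω m * K.carter (vder K.radialBL Φ) ω m l r)
    (W := fun r => symbol κ ω m * K.carter (vder K.radialBL fun y => (Del M a (rad y) : ℂ) * vder K.radialBL Φ y) ω m l r)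
    (fun r hr => ?_) (fun r hr => ?_) hr, (h.kerrWave ha).carter_multiDer ha hr κ, h.carter_kerrWave ha hr, h.carter_multiDer ha hr κ]
  · ring
  · refine ((h.hasDerivAt_carter ha hr ω m l).const_mul (symbol κ ω m)).congr_of_eventuallyEq ?_
    filter_upwards [isOpen_Ioo.mem_nhds hr] with s hs using h.carter_multiDer ha hs κ
  · refine ((h.hasDerivAt_Del_mul_carter ha hr).const_mul (symbol κ ω m)).congr_of_eventuallyEq (Eventually.of_forall fun s => ?_)
    simp only
    ring

end

lemma IsSlab.contDiffOn_carter (ha : |a| < M) (n : ℕ) : ∀ {Φ : Pt → ℂ}, K.IsSlab t0 t1 Φ →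
    ContDiffOn ℝ n (K.carter Φ ω m l) (Ioo (rPlus M a) (K.R / 2)) := by
  induction n with
  | zero =>
    intro Φ h
    exact contDiffOn_zero.2 fun r hr => (h.hasDerivAt_carter ha hr ω m l).continuousAt.continuousWithinAt
  | succ n ih =>
    intro Φ h
    rw [show ((n + 1 : ℕ) : WithTop ℕ∞) = (n : WithTop ℕ∞) + 1 by norm_cast, contDiffOn_succ_iff_deriv_of_isOpen isOpen_Ioo]
    refine ⟨fun r hr => (h.hasDerivAt_carter ha hr ω m l).differentiableAt.differentiableWithinAt, by simp, ?_⟩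
    exact (ih (h.radialBL ha)).congr fun r hr => (h.hasDerivAt_carter ha hr ω m l).deriv

end KerrSetup

open scoped FourierTransform SchwartzMap ComplexConjugate

/-- Bessel's inequality for orthonormal functions. -/
lemma tsum_sq_integral_le {X ι : Type*} [MeasurableSpace X] {μ : Measure X} {e : ι → X → ℂ} {f : X → ℂ} [DecidableEq ι]
    (he : ∀ i, MemLp (e i) 2 μ) (hon : ∀ i j, ∫ x, conj (e i x) * e j x ∂μ = if i = j then 1 else 0) (hf : MemLp f 2 μ) :
    ∑' i, ofReal (‖∫ x, conj (e i x) * f x ∂μ‖ ^ 2) ≤ ∫⁻ x, ofReal (‖f x‖ ^ 2) ∂μ := by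
  have hin : ∀ {u v : X → ℂ} (hu : MemLp u 2 μ) (hv : MemLp v 2 μ), inner ℂ (hu.toLp u) (hv.toLp v) = ∫ x, conj (u x) * v x ∂μ := by
    intro u v hu hv
    rw [L2.inner_def]
    refine integral_congr_ae ?_
    filter_upwards [hu.coeFn_toLp, hv.coeFn_toLp] with x h1 h2
    rw [h1, h2, RCLike.inner_apply, mul_comm]
  have hO : Orthonormal ℂ fun i => (he i).toLp (e i) := by
    rw [orthonormal_iff_ite]
    intro i j
    rw [hin, hon]
  have h1 := hO.tsum_inner_products_le (hf.toLp f)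
  have h2 := hO.inner_products_summable (hf.toLp f)
  have h3 : ‖hf.toLp f‖ ^ 2 = ∫ x, ‖f x‖ ^ 2 ∂μ := by
    have := hin hf hf
    rw [inner_self_eq_norm_sq_to_K] at this
    have e : (fun x => conj (f x) * f x) = fun x => ((‖f x‖ ^ 2 : ℝ) : ℂ) := by
      ext x
      rw [RCLike.conj_mul]
      norm_cast
    rw [e, integral_complex_ofReal] at this
    exact Complex.ofReal_injective (by rw [← this]; push_cast; rfl)
  rw [← ofReal_integral_eq_lintegral_ofReal (hf.integrable_norm_pow (by norm_num)) (ae_of_all _ fun x => by positivity), ← h3]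
  simp_rw [hin] at h1 h2
  rw [← ENNReal.ofReal_tsum_of_nonneg (fun i => by positivity) h2]
  exact ofReal_le_ofReal h1

lemma memLp_two_of_bound {X : Type*} [MeasurableSpace X] {μ : Measure X} [IsFiniteMeasure μ] {f : X → ℂ} {B : ℝ}
    (hf : AEStronglyMeasurable f μ) (hB : ∀ᵐ x ∂μ, ‖f x‖ ≤ B) : MemLp f 2 μ :=
  MemLp.of_bound hf B hB

/-- Bessel's inequality for Fourier series. -/
lemma tsum_fourier_le {f : ℝ → ℂ} (hf : Continuous f) :
    ∑' m : ℤ, ofReal (‖∫ φ in (0 : ℝ)..(2 * π), Complex.exp (-(I * m * φ)) * f φ‖ ^ 2)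
      ≤ ofReal (2 * π) * ∫⁻ φ in Ioc 0 (2 * π), ofReal (‖f φ‖ ^ 2) := by
  obtain ⟨c, hc⟩ : ∃ c : ℝ, c = (√(2 * π))⁻¹ := ⟨_, rfl⟩
  have hc2 : c ^ 2 = (2 * π)⁻¹ := by rw [hc, inv_pow, Real.sq_sqrt (by positivity)]
  obtain ⟨D, hD⟩ := (isCompact_Icc (a := (0:ℝ)) (b := 2 * π)).exists_bound_of_continuousOn hf.continuousOn
  have hconj : ∀ (m : ℤ) (φ : ℝ), conj ((c : ℂ) * Complex.exp (I * m * φ)) = (c : ℂ) * Complex.exp (-(I * m * φ)) := by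
    intro m φ
    rw [map_mul, Complex.conj_ofReal, ← Complex.exp_conj]
    simp
  have hnorm : ∀ (m : ℤ) (φ : ℝ), ‖Complex.exp (I * m * φ)‖ = 1 := fun m φ => by
    rw [Complex.norm_exp]; simp
  have h := tsum_sq_integral_le (μ := volume.restrict (Ioc 0 (2 * π))) (f := f)
    (e := fun (m : ℤ) (φ : ℝ) => (c : ℂ) * Complex.exp (I * m * φ)) (fun m => ?_) (fun m n => ?_) ?_
  · have e1 : ∀ m : ℤ, ofReal (‖∫ φ in (0 : ℝ)..(2 * π), Complex.exp (-(I * m * φ)) * f φ‖ ^ 2)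
        = ofReal (2 * π) * ofReal (‖∫ φ in Ioc 0 (2 * π), conj ((c : ℂ) * Complex.exp (I * m * φ)) * f φ‖ ^ 2) := by
      intro m
      simp_rw [hconj, mul_assoc]
      rw [integral_const_mul, norm_mul, mul_pow, Complex.norm_real, norm_eq_abs, sq_abs, hc2, ← ofReal_mul (by positivity),
        intervalIntegral.integral_of_le (by positivity)]
      congr 1
      field_simp
    simp_rw [e1]
    rw [ENNReal.tsum_mul_left]
    gcongr
  · exact memLp_two_of_bound (B := |c|) (by fun_prop : Continuous _).aestronglyMeasurable (ae_of_all _ fun φ => by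
      rw [norm_mul, hnorm, Complex.norm_real, mul_one, norm_eq_abs])
  · have e2 : ∀ φ : ℝ, conj ((c : ℂ) * Complex.exp (I * m * φ)) * ((c : ℂ) * Complex.exp (I * n * φ))
        = ((2 * π)⁻¹ : ℝ) * Complex.exp ((I * (n - m)) * φ) := by
      intro φ
      rw [hconj, ← hc2]
      have : Complex.exp (I * (n - m) * φ) = Complex.exp (-(I * m * φ)) * Complex.exp (I * n * φ) := by
        rw [← Complex.exp_add]; congr 1; ring
      rw [this]
      push_cast
      ring
    simp_rw [e2]
    rw [integral_const_mul, ← intervalIntegral.integral_of_le (by positivity)]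
    split_ifs with hmn
    · subst hmn
      have hpi : (π : ℂ) ≠ 0 := by exact_mod_cast Real.pi_ne_zero
      simp
      field_simp
    · have h0 : I * ((n : ℂ) - m) ≠ 0 := by
        refine mul_ne_zero Complex.I_ne_zero (sub_ne_zero.2 ?_)
        exact Int.cast_injective.ne (Ne.symm hmn)
      rw [integral_exp_mul_complex h0]
      have : Complex.exp (I * (n - m) * ((2 * π : ℝ) : ℂ)) = 1 := by
        rw [Complex.exp_eq_one_iff]
        exact ⟨n - m, by push_cast; ring⟩
      rw [this]
      simp
  · exact memLp_two_of_bound (B := D) hf.aestronglyMeasurable (by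
      filter_upwards [ae_restrict_mem measurableSet_Ioc] with φ hφ using hD φ (Ioc_subset_Icc_self hφ))

lemma lintegral_fourier_eq (g : 𝓢(ℝ, ℂ)) :
    ∫⁻ ω : ℝ, ofReal (‖∫ t : ℝ, Complex.exp (I * ω * t) * g t‖ ^ 2)
      = ofReal (2 * π) * ∫⁻ t, ofReal (‖g t‖ ^ 2) := by
  have e1 : ∀ ω : ℝ, ∫ t : ℝ, Complex.exp (I * ω * t) * g t = (𝓕 g) (-(2 * π)⁻¹ * ω) := by
    intro ω
    rw [SchwartzMap.fourier_coe, Real.fourier_eq']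
    refine integral_congr_ae (ae_of_all _ fun t => ?_)
    simp only [smul_eq_mul]
    congr 2
    simp only [RCLike.inner_apply, conj_trivial]
    push_cast
    have hpi : (π : ℂ) ≠ 0 := by exact_mod_cast Real.pi_ne_zero
    field_simp
  have hI : ∀ k : 𝓢(ℝ, ℂ), Integrable fun x => ‖k x‖ ^ 2 := fun k => (k.memLp 2 volume).integrable_norm_pow (by norm_num)
  have hne : -(2 * π)⁻¹ ≠ 0 := neg_ne_zero.2 (by positivity)
  have hpl := SchwartzMap.integral_norm_sq_fourier g
  obtain ⟨k, hk⟩ : ∃ k : 𝓢(ℝ, ℂ), k = 𝓕 g := ⟨_, rfl⟩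
  rw [← hk] at hpl
  simp_rw [e1, ← hk]
  have hsc : ∫ x : ℝ, ‖k (-(2 * π)⁻¹ * x)‖ ^ 2 = |(-(2 * π)⁻¹)⁻¹| • ∫ x, ‖k x‖ ^ 2 :=
    Measure.integral_comp_mul_left (fun x => ‖k x‖ ^ 2) (-(2 * π)⁻¹)
  have hI' : Integrable fun x : ℝ => ‖k (-(2 * π)⁻¹ * x)‖ ^ 2 := (hI k).comp_mul_left' hne
  rw [← ofReal_integral_eq_lintegral_ofReal hI' (ae_of_all _ fun x => by positivity),
    ← ofReal_integral_eq_lintegral_ofReal (hI g) (ae_of_all _ fun x => by positivity),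
    hsc, hpl, smul_eq_mul, ofReal_mul (by positivity)]
  congr 2
  rw [inv_neg, inv_inv, abs_neg, abs_of_pos (by positivity)]

section Cylinder

variable {f : ℝ × ℝ → ℂ} {N : ℝ}

/-- The `m`-th Fourier coefficient in the angle. -/
def angleCoeff (m : ℤ) (f : ℝ × ℝ → ℂ) (t : ℝ) : ℂ :=
  ∫ φ in (0 : ℝ)..(2 * π), Complex.exp (-(I * m * φ)) * f (t, φ)

lemma contDiff_angleCoeff (m : ℤ) (n : ℕ) : ∀ {f : ℝ × ℝ → ℂ}, ContDiff ℝ ∞ f → ContDiff ℝ n (angleCoeff m f) := by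
  have hder : ∀ {f : ℝ × ℝ → ℂ}, ContDiff ℝ ∞ f → ∀ t, HasDerivAt (angleCoeff m f) (angleCoeff m (fun z => fderiv ℝ f z (1, 0)) t) t := by
    intro f hf t
    have hf' : Continuous fun z => fderiv ℝ f z (1, 0) := (hf.continuous_fderiv (by simp)).clm_apply continuous_const
    have hcw : Continuous fun φ : ℝ => Complex.exp (-(I * m * φ)) := by fun_prop
    have := hasDerivAt_integral_mul_of_compact (μ := volume.restrict (Ioc 0 (2 * π))) (B := 1) (Kc := Icc 0 (2 * π))
      (J := univ) (g := fun t φ => f (t, φ)) (s0 := t)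
      (g' := fun t φ => fderiv ℝ f (t, φ) (1, 0)) hcw.aestronglyMeasurable
      (ae_of_all _ fun φ => by rw [Complex.norm_exp]; simp) isCompact_Icc
      (by filter_upwards [ae_restrict_mem measurableSet_Ioc] with φ hφ using Ioc_subset_Icc_self hφ) isOpen_univ hf.continuous.continuousOn hf'.continuousOn
      (fun s _ φ => ?_) (mem_univ t)
    · unfold angleCoeff
      simp_rw [intervalIntegral.integral_of_le Real.two_pi_pos.le]
      exact this
    · have h1 : HasDerivAt (fun s : ℝ => (s, φ)) ((1 : ℝ), (0 : ℝ)) s := (hasDerivAt_id s).prodMk (hasDerivAt_const s φ)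
      exact (hf.differentiable (by simp) (s, φ)).hasFDerivAt.comp_hasDerivAt s h1
  induction n with
  | zero =>
    intro f hf
    exact contDiff_zero.2 (continuous_iff_continuousAt.2 fun t => (hder hf t).continuousAt)
  | succ n ih =>
    intro f hf
    rw [show ((n + 1 : ℕ) : WithTop ℕ∞) = (n : WithTop ℕ∞) + 1 by norm_cast, contDiff_succ_iff_deriv]
    refine ⟨fun t => (hder hf t).differentiableAt, by simp, ?_⟩
    rw [show deriv (angleCoeff m f) = angleCoeff m (fun z => fderiv ℝ f z (1, 0)) from funext fun t => (hder hf t).deriv]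
    exact ih ((hf.fderiv_right (m := ∞) (by norm_cast)).clm_apply contDiff_const)

lemma cylFourier_eq_angleCoeff (f : ℝ × ℝ → ℂ) (ω : ℝ) (m : ℤ) :
    cylFourier f ω m = ∫ t : ℝ, Complex.exp (I * ω * t) * angleCoeff m f t := by
  simp only [cylFourier, cylKernel, angleCoeff, mul_assoc, intervalIntegral.integral_const_mul]

/-- Plancherel and Bessel on the cylinder. -/
lemma tsum_lintegral_cylFourier_le (hf : ContDiff ℝ ∞ f) (hN : ∀ t φ, t ∉ Ioc (-N) N → f (t, φ) = 0) :
    ∑' m : ℤ, ∫⁻ ω : ℝ, ofReal (‖cylFourier f ω m‖ ^ 2)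
      ≤ ofReal ((2 * π) ^ 2) * ∫⁻ t : ℝ, ∫⁻ φ in Ioc 0 (2 * π), ofReal (‖f (t, φ)‖ ^ 2) := by
  have hsm : ∀ m, ContDiff ℝ ∞ (angleCoeff m f) := fun m => contDiff_infty.2 fun n => contDiff_angleCoeff m n hf
  have hcs : ∀ m, HasCompactSupport (angleCoeff m f) := fun m =>
    HasCompactSupport.intro (isCompact_Icc (a := -N) (b := N)) fun t ht => by
      have : ∀ φ, f (t, φ) = 0 := fun φ => hN t φ fun h1 => ht (Ioc_subset_Icc_self h1)
      simp [angleCoeff, this]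
  have e1 : ∀ m, ∫⁻ ω : ℝ, ofReal (‖cylFourier f ω m‖ ^ 2)
      = ofReal (2 * π) * ∫⁻ t, ofReal (‖angleCoeff m f t‖ ^ 2) := by
    intro m
    have := lintegral_fourier_eq ((hcs m).toSchwartzMap (hsm m))
    simp_rw [cylFourier_eq_angleCoeff]
    exact this
  simp_rw [e1]
  rw [ENNReal.tsum_mul_left, ← lintegral_tsum fun m => by
    have := (hsm m).continuous
    exact (ENNReal.continuous_ofReal.comp (this.norm.pow 2)).measurable.aemeasurable]
  have h2 : ∫⁻ t, ∑' m, ofReal (‖angleCoeff m f t‖ ^ 2)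
      ≤ ∫⁻ t, ofReal (2 * π) * ∫⁻ φ in Ioc 0 (2 * π), ofReal (‖f (t, φ)‖ ^ 2) :=
    lintegral_mono fun t => tsum_fourier_le (f := fun φ => f (t, φ)) (hf.continuous.comp (by fun_prop))
  rw [lintegral_const_mul' _ _ ofReal_ne_top] at h2
  calc _ ≤ _ := mul_le_mul_right h2 _
    _ = _ := by rw [← mul_assoc, ← ofReal_mul (by positivity), sq]

end Cylinder

lemma lintegral_fin_succ {n : ℕ} {F : (Fin (n + 1) → ℝ) → ENNReal} (hF : Measurable F) :
    ∫⁻ y, F y = ∫⁻ s : ℝ, ∫⁻ z : Fin n → ℝ, F (Fin.cons s z) := by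
  have h := (volume_preserving_piFinSuccAbove (fun _ : Fin (n + 1) => ℝ) 0).symm
  have hm : Measurable fun w : ℝ × (Fin n → ℝ) => F ((MeasurableEquiv.piFinSuccAbove (fun _ => ℝ) 0).symm w) :=
    hF.comp (MeasurableEquiv.measurable _)
  rw [← h.lintegral_comp hF, Measure.volume_eq_prod, lintegral_prod _ hm.aemeasurable]
  simp [MeasurableEquiv.piFinSuccAbove, Fin.insertNthEquiv, Fin.cons]

lemma lintegral_fin_succ_le {n : ℕ} (F : (Fin (n + 1) → ℝ) → ENNReal) :
    ∫⁻ y, F y ≤ ∫⁻ s : ℝ, ∫⁻ z : Fin n → ℝ, F (Fin.cons s z) := by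
  have h := (volume_preserving_piFinSuccAbove (fun _ : Fin (n + 1) => ℝ) 0).symm
  rw [← h.lintegral_comp_emb (MeasurableEquiv.measurableEmbedding _), Measure.volume_eq_prod]
  refine (lintegral_prod_le _).trans (le_of_eq ?_)
  simp [MeasurableEquiv.piFinSuccAbove, Fin.insertNthEquiv, Fin.cons]

lemma measurable_cons {n : ℕ} : Measurable fun w : ℝ × (Fin n → ℝ) => (Fin.cons w.1 w.2 : Fin (n + 1) → ℝ) := by
  rw [measurable_pi_iff]
  intro i
  refine Fin.cases ?_ (fun j => ?_) i
  · simpa using measurable_fst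
  · simpa using (by fun_prop : Measurable fun w : ℝ × (Fin n → ℝ) => w.2 j)

lemma lintegral_fin_four {F : (Fin 4 → ℝ) → ENNReal} (hF : Measurable F) :
    ∫⁻ y, F y = ∫⁻ r : ℝ, ∫⁻ θ : ℝ, ∫⁻ t : ℝ, ∫⁻ φ : ℝ, F ![r, θ, t, φ] := by
  have hc : ∀ {n : ℕ} (s : ℝ), Measurable fun z : Fin n → ℝ => (Fin.cons s z : Fin (n + 1) → ℝ) := fun s =>
    measurable_cons.comp (by fun_prop : Measurable fun z => (s, z))
  rw [lintegral_fin_succ hF]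
  refine lintegral_congr fun r => ?_
  have h1 : Measurable fun z => F (Fin.cons r z) := hF.comp (hc r)
  rw [lintegral_fin_succ h1]
  refine lintegral_congr fun θ => ?_
  have h2 : Measurable fun z => F (Fin.cons r (Fin.cons θ z)) := h1.comp (hc θ)
  rw [lintegral_fin_succ h2]
  refine lintegral_congr fun t => ?_
  have h3 : Measurable fun z => F (Fin.cons r (Fin.cons θ (Fin.cons t z))) := h2.comp (hc t)
  rw [lintegral_fin_succ h3]
  refine lintegral_congr fun φ => ?_
  rw [lintegral_unique]
  simp only [Measure.volume_pi_eq_dirac (default : Fin 0 → ℝ), measure_univ, mul_one, Function.comp]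
  rfl

namespace KerrSetup

variable {M a : ℝ} {K : KerrSetup M a} {t0 t1 : ℝ} {Φ Ψ : Pt → ℂ} {ρ N ω : ℝ} {m : ℤ} {l : ℕ}

variable (K) in
/-- Boyer--Lindquist coordinates `(r, θ, t, φ)` as a map of `ℝ⁴`. -/
def coordBL (y : Fin 4 → ℝ) : Pt := K.ptBL (y 2) (y 0) (y 1) (y 3)

variable (K) in
/-- The Jacobian matrix of Boyer--Lindquist coordinates. -/
def jacBL (y : Fin 4 → ℝ) : Matrix (Fin 4) (Fin 4) ℝ :=
  let c := cos (y 3 + K.phibar (y 0))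
  let s := sin (y 3 + K.phibar (y 0))
  let t' := (y 0 ^ 2 + a ^ 2) / Del M a (y 0) - K.p (y 0)
  let φ' := a / Del M a (y 0) - K.q (y 0)
  !![t', 0, 1, 0;
    sin (y 1) * c - y 0 * sin (y 1) * s * φ', y 0 * cos (y 1) * c, 0, -(y 0 * sin (y 1) * s);
    sin (y 1) * s + y 0 * sin (y 1) * c * φ', y 0 * cos (y 1) * s, 0, y 0 * sin (y 1) * c;
    cos (y 1), -(y 0 * sin (y 1)), 0, 0]

lemma hasFDerivAt_coordBL {y : Fin 4 → ℝ} (hy : rPlus M a < y 0) :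
    HasFDerivAt K.coordBL (LinearMap.toContinuousLinearMap (Matrix.toLin' (K.jacBL y))) y := by
  have hp := fun i => hasFDerivAt_apply (𝕜 := ℝ) i y
  have ht := (K.tbar_deriv _ hy).comp_hasFDerivAt y (hp 0)
  have hφ := (hp 3).fun_add ((K.phibar_deriv _ hy).comp_hasFDerivAt y (hp 0))
  rw [hasFDerivAt_pi']
  intro i
  fin_cases i
  · refine ((hp 2).fun_add ht).congr_fderiv ?_
    ext w
    simp [jacBL, Matrix.mulVec, dotProduct, Fin.sum_univ_four]
    ring
  · refine (((hp 0).mul (hp 1).sin).mul hφ.cos).congr_fderiv ?_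
    ext w
    simp [jacBL, Matrix.mulVec, dotProduct, Fin.sum_univ_four]
    ring
  · refine (((hp 0).mul (hp 1).sin).mul hφ.sin).congr_fderiv ?_
    ext w
    simp [jacBL, Matrix.mulVec, dotProduct, Fin.sum_univ_four]
    ring
  · refine ((hp 0).mul (hp 1).cos).congr_fderiv ?_
    ext w
    simp [jacBL, Matrix.mulVec, dotProduct, Fin.sum_univ_four]
    ring

lemma det_jacBL (y : Fin 4 → ℝ) : (K.jacBL y).det = y 0 ^ 2 * sin (y 1) := by
  have h1 := Real.sin_sq_add_cos_sq (y 1)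
  have h2 := Real.sin_sq_add_cos_sq (y 3 + K.phibar (y 0))
  simp [jacBL, Matrix.det_succ_row_zero, Fin.sum_univ_succ, Matrix.submatrix, Fin.succAbove]
  generalize sin (y 1) = s at *
  generalize cos (y 1) = c at *
  generalize sin (y 3 + K.phibar (y 0)) = s' at *
  generalize cos (y 3 + K.phibar (y 0)) = c' at *
  generalize y 0 = r at *
  linear_combination (r ^ 2 * s * s ^ 2 + r ^ 2 * s * c ^ 2) * h2 + r ^ 2 * s * h1

lemma injOn_coordBL (ha : |a| < M) : InjOn K.coordBL {y | rPlus M a < y 0 ∧ y 1 ∈ Ioo 0 π ∧ y 3 ∈ Ioc 0 (2 * π)} := by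
  intro y ⟨hy0, hy1, hy3⟩ z ⟨hz0, hz1, hz3⟩ h
  have hp := rPlus_pos ha
  have h0 : y 0 = z 0 := by
    have := congrArg rad h
    simp only [coordBL] at this
    rwa [K.rad_ptBL (hp.trans hy0), K.rad_ptBL (hp.trans hz0)] at this
  have hr : 0 < z 0 := hp.trans hz0
  have c0 := congrFun h 0
  have c1 := congrFun h 1
  have c2 := congrFun h 2
  have c3 := congrFun h 3
  simp only [coordBL, ptBL, Matrix.cons_val, h0] at c0 c1 c2 c3
  have h1 : y 1 = z 1 := Real.injOn_cos (Ioo_subset_Icc_self hy1) (Ioo_subset_Icc_self hz1) (mul_left_cancel₀ hr.ne' c3)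
  have hs : 0 < sin (z 1) := Real.sin_pos_of_pos_of_lt_pi hz1.1 hz1.2
  rw [h1] at c1 c2
  have e1 := mul_left_cancel₀ (mul_pos hr hs).ne' c1
  have e2 := mul_left_cancel₀ (mul_pos hr hs).ne' c2
  have h3 : y 3 = z 3 := by
    have h4 : cos (y 3 - z 3) = 1 := by
      have : y 3 - z 3 = (y 3 + K.phibar (z 0)) - (z 3 + K.phibar (z 0)) := by ring
      rw [this, Real.cos_sub, e1, e2]
      linear_combination Real.sin_sq_add_cos_sq (z 3 + K.phibar (z 0))
    obtain ⟨n, hn⟩ := (Real.cos_eq_one_iff _).1 h4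
    have hpi := Real.two_pi_pos
    have hn1 : (n : ℝ) < 1 := by
      by_contra hcon
      push Not at hcon
      nlinarith [hy3.2, hz3.1]
    have hn2 : (-1 : ℝ) < n := by
      by_contra hcon
      push Not at hcon
      nlinarith [hy3.1, hz3.2]
    have : n = 0 := by
      have h5 : n < 1 := by exact_mod_cast hn1
      have h6 : -1 < n := by exact_mod_cast hn2
      omega
    rw [this] at hn
    simp at hn
    linarith
  ext i
  fin_cases i
  · exact h0
  · exact h1
  · simp; linarith
  · exact h3

/-- Integration in Boyer--Lindquist coordinates. -/
lemma IsSlab.lintegral_coord_le (ha : |a| < M) (h : K.IsSlab t0 t1 Φ) (hρ : ρ < K.R / 2) :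
    ∫⁻ r in Ioc (rPlus M a) ρ, ∫⁻ θ in Ioo 0 π, ofReal (sin θ) *
        ∫⁻ t : ℝ, ∫⁻ φ in Ioc 0 (2 * π), ofReal (‖Φ (K.ptBL t r θ φ)‖ ^ 2)
      ≤ ofReal ((rPlus M a ^ 2)⁻¹) * ∫⁻ x in {x | rPlus M a < rad x ∧ rad x ≤ ρ}, ofReal (‖Φ x‖ ^ 2) := by
  have hp := rPlus_pos ha
  obtain ⟨s, hs⟩ : ∃ s : Set (Fin 4 → ℝ), s = {y | y 0 ∈ Ioc (rPlus M a) ρ ∧ y 1 ∈ Ioo 0 π ∧ y 3 ∈ Ioc 0 (2 * π)} := ⟨_, rfl⟩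
  have hsm : MeasurableSet s := by
    rw [hs]
    exact (measurableSet_Ioc.preimage (measurable_pi_apply 0)).inter ((measurableSet_Ioo.preimage (measurable_pi_apply 1)).inter
      (measurableSet_Ioc.preimage (measurable_pi_apply 3)))
  have hcont : ContinuousOn (fun y => Φ (K.coordBL y)) s := by
    have := (h.continuousOn ha).comp (f := fun y : Fin 4 → ℝ => (y 0, y 1, y 2, y 3)) (s := s) (by fun_prop)
      (fun y hy => by rw [hs] at hy; exact ⟨⟨hy.1.1, hy.1.2.trans_lt hρ⟩, mem_univ _⟩)
    exact this
  have hFm : Measurable (s.indicator fun y => ofReal (y 0 ^ 2 * sin (y 1)) * ofReal (‖Φ (K.coordBL y)‖ ^ 2)) := by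
    have h1 : Measurable (s.indicator fun y => Φ (K.coordBL y)) := by
      classical
      have := hcont.measurable_piecewise (g := fun _ => (0 : ℂ)) continuousOn_const hsm
      rw [← piecewise_eq_indicator]
      exact this
    have h2 : Measurable fun y : Fin 4 → ℝ => ofReal (y 0 ^ 2 * sin (y 1)) *
        ofReal (‖s.indicator (fun y => Φ (K.coordBL y)) y‖ ^ 2) :=
      (by fun_prop : Measurable fun y : Fin 4 → ℝ => y 0 ^ 2 * sin (y 1)).ennreal_ofReal.mul (h1.norm.pow_const 2).ennreal_ofReal
    convert h2 using 1
    ext y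
    by_cases hy : y ∈ s <;> simp [hy]
  have hinj : InjOn K.coordBL s := (injOn_coordBL ha).mono fun y hy => by
    rw [hs] at hy; exact ⟨hy.1.1, hy.2⟩
  have hchange := lintegral_image_eq_lintegral_abs_det_fderiv_mul volume hsm
    (fun y hy => (hasFDerivAt_coordBL (K := K) (by rw [hs] at hy; exact hy.1.1)).hasFDerivWithinAt) hinj
    (fun x => ofReal (‖Φ x‖ ^ 2))
  have himg : K.coordBL '' s ⊆ {x | rPlus M a < rad x ∧ rad x ≤ ρ} := by
    rintro _ ⟨y, hy, rfl⟩
    rw [hs] at hy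
    have := K.rad_ptBL (t := y 2) (θ := y 1) (φ := y 3) (hp.trans hy.1.1)
    exact ⟨by rw [coordBL, this]; exact hy.1.1, by rw [coordBL, this]; exact hy.1.2⟩
  have hstep : ∫⁻ r in Ioc (rPlus M a) ρ, ∫⁻ θ in Ioo 0 π, ofReal (sin θ) *
        ∫⁻ t : ℝ, ∫⁻ φ in Ioc 0 (2 * π), ofReal (‖Φ (K.ptBL t r θ φ)‖ ^ 2)
      ≤ ofReal ((rPlus M a ^ 2)⁻¹) * ∫⁻ y, s.indicator (fun y => ofReal (y 0 ^ 2 * sin (y 1)) * ofReal (‖Φ (K.coordBL y)‖ ^ 2)) y := by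
    rw [lintegral_fin_four hFm, ← lintegral_const_mul' _ _ ofReal_ne_top, ← lintegral_indicator measurableSet_Ioc]
    refine lintegral_mono fun r => ?_
    by_cases hr : r ∈ Ioc (rPlus M a) ρ
    · rw [indicator_of_mem hr, ← lintegral_const_mul' _ _ ofReal_ne_top, ← lintegral_indicator measurableSet_Ioo]
      refine lintegral_mono fun θ => ?_
      by_cases hθ : θ ∈ Ioo 0 π
      · rw [indicator_of_mem hθ, ← lintegral_const_mul' _ _ ofReal_ne_top, ← lintegral_const_mul' _ _ ofReal_ne_top]
        refine lintegral_mono fun t => ?_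
        rw [← lintegral_const_mul' _ _ ofReal_ne_top, ← lintegral_const_mul' _ _ ofReal_ne_top, ← lintegral_indicator measurableSet_Ioc]
        refine lintegral_mono fun φ => ?_
        by_cases hφ : φ ∈ Ioc 0 (2 * π)
        · have hmem : ![r, θ, t, φ] ∈ s := by rw [hs]; exact ⟨hr, hθ, hφ⟩
          rw [indicator_of_mem hφ, indicator_of_mem hmem, ← mul_assoc, ← ofReal_mul (p := (rPlus M a ^ 2)⁻¹) (by positivity)]
          refine mul_le_mul' (ofReal_le_ofReal ?_) le_rfl
          have hsin := Real.sin_pos_of_pos_of_lt_pi hθ.1 hθ.2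
          have hrr : rPlus M a ^ 2 ≤ r ^ 2 := by have := hr.1; gcongr
          simp only [Matrix.cons_val_zero, Matrix.cons_val_one]
          rw [← mul_assoc]
          refine le_mul_of_one_le_left hsin.le ?_
          rw [inv_mul_eq_div, one_le_div (by positivity)]
          exact hrr
        · rw [indicator_of_notMem hφ]; exact zero_le
      · rw [indicator_of_notMem hθ]; exact zero_le
    · rw [indicator_of_notMem hr]; exact zero_le
  refine hstep.trans (mul_le_mul_right ?_ _)
  rw [lintegral_indicator hsm]
  calc _ = ∫⁻ y in s, ofReal |(LinearMap.toContinuousLinearMap (Matrix.toLin' (K.jacBL y))).det| * ofReal (‖Φ (K.coordBL y)‖ ^ 2) := by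
        refine setLIntegral_congr_fun hsm fun y hy => ?_
        rw [hs] at hy
        have hsin := Real.sin_pos_of_pos_of_lt_pi hy.2.1.1 hy.2.1.2
        have hd : (LinearMap.toContinuousLinearMap (Matrix.toLin' (K.jacBL y))).det = (K.jacBL y).det := by
          rw [LinearMap.det_toContinuousLinearMap, LinearMap.det_toLin']
        simp only [hd, det_jacBL]
        rw [abs_of_nonneg (by positivity)]
    _ = ∫⁻ x in K.coordBL '' s, ofReal (‖Φ x‖ ^ 2) := hchange.symm
    _ ≤ _ := lintegral_mono_set himg

end KerrSetup

open scoped ComplexConjugate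
namespace KerrSetup

variable {M a : ℝ} {K : KerrSetup M a} {t0 t1 : ℝ} {Φ Ψ : Pt → ℂ} {r ρ N ω : ℝ} {m : ℤ} {l : ℕ}

lemma continuousOn_cylKernel_mul (ha : |a| < M) (h : K.IsSlab t0 t1 Φ) (m : ℤ) :
    ContinuousOn (fun z : ((ℝ × ℝ × ℝ) × ℝ) × ℝ => cylKernel z.1.1.1 m (z.1.2, z.2) * Φ (K.ptBL z.1.2 z.1.1.2.1 z.1.1.2.2 z.2))
      {z | z.1.1.2.1 ∈ Ioo (rPlus M a) (K.R / 2)} := by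
  refine ContinuousOn.mul ?_ ?_
  · unfold cylKernel
    fun_prop
  · exact (h.continuousOn ha).comp (f := fun z : ((ℝ × ℝ × ℝ) × ℝ) × ℝ => (z.1.1.2.1, z.1.1.2.2, z.1.2, z.2)) (by fun_prop)
      fun z hz => ⟨hz, mem_univ _⟩

lemma IsSlab.stronglyMeasurable_fourierBL (ha : |a| < M) (h : K.IsSlab t0 t1 Φ) (m : ℤ) :
    ∃ F : ℝ × ℝ × ℝ → ℂ, StronglyMeasurable F ∧ ∀ ω r θ, r ∈ Ioo (rPlus M a) (K.R / 2) → F (ω, r, θ) = K.fourierBL Φ r θ ω m := by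
  classical
  obtain ⟨S, hS⟩ : ∃ S : Set (((ℝ × ℝ × ℝ) × ℝ) × ℝ), S = {z | z.1.1.2.1 ∈ Ioo (rPlus M a) (K.R / 2)} := ⟨_, rfl⟩
  have hSm : MeasurableSet S := by
    rw [hS]
    exact measurableSet_Ioo.preimage (by fun_prop : Measurable fun z : ((ℝ × ℝ × ℝ) × ℝ) × ℝ => z.1.1.2.1)
  have hk := (continuousOn_cylKernel_mul ha h m).measurable_piecewise (g := fun _ => (0 : ℂ)) continuousOn_const (hS ▸ hSm)
  have h1 := hk.stronglyMeasurable.integral_prod_right' (ν := volume.restrict (Ioc 0 (2 * π)))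
  have h2 := h1.integral_prod_right' (ν := (volume : Measure ℝ))
  refine ⟨_, h2, fun ω r θ hr => ?_⟩
  rw [fourierBL_eq, cylFourier]
  refine integral_congr_ae (ae_of_all _ fun t => ?_)
  simp only
  rw [intervalIntegral.integral_of_le Real.two_pi_pos.le]
  refine integral_congr_ae (ae_of_all _ fun φ => ?_)
  simp only
  rw [piecewise_eq_of_mem]
  exact hr

section
variable (ha : |a| < M) (h : K.IsSlab t0 t1 Φ) (hr : r ∈ Ioo (rPlus M a) (K.R / 2))
include ha h hr

/-- Bessel's inequality for spheroidal harmonics. -/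
lemma IsSlab.tsum_carter_le (ω : ℝ) (m : ℤ) :
    ∑' l : {l : ℕ // m.natAbs ≤ l}, ofReal (‖K.carter Φ ω m l r‖ ^ 2)
      ≤ ∫⁻ θ in Ioo 0 π, ofReal (sin θ) * ofReal (‖K.fourierBL Φ r θ ω m‖ ^ 2) := by
  have hsin : ∀ θ ∈ Ioo 0 π, 0 < sin θ := fun θ hθ => Real.sin_pos_of_pos_of_lt_pi hθ.1 hθ.2
  have hsq : ∀ θ ∈ Ioo 0 π, (√(sin θ) : ℂ) * (√(sin θ) : ℂ) = (sin θ : ℂ) := fun θ hθ => by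
    rw [← Complex.ofReal_mul, Real.mul_self_sqrt (hsin θ hθ).le]
  have hSm : ∀ l : ℕ, AEStronglyMeasurable (fun θ => (spheroidalS (a * ω) m l θ : ℂ) * (√(sin θ) : ℂ)) (volume.restrict (Ioo 0 π)) := by
    intro l
    have h : ContinuousOn (spheroidalS (a * ω) m l) (Ioo 0 π) := (spheroidalS_spec (a * ω) m l).1.contDiff.continuousOn
    refine ContinuousOn.aestronglyMeasurable ?_ measurableSet_Ioo
    refine (Complex.continuous_ofReal.comp_continuousOn h).mul (Continuous.continuousOn ?_)
    exact Complex.continuous_ofReal.comp (Real.continuous_sqrt.comp Real.continuous_sin)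
  have hfm : Continuous fun θ => (√(sin θ) : ℂ) * K.fourierBL Φ r θ ω m :=
    (Complex.continuous_ofReal.comp (Real.continuous_sqrt.comp Real.continuous_sin)).mul (h.continuous_fourierBL ha hr ω m)
  obtain ⟨D, hD⟩ := (isCompact_Icc (a := (0:ℝ)) (b := π)).exists_bound_of_continuousOn hfm.continuousOn
  have hB := tsum_sq_integral_le (μ := volume.restrict (Ioo 0 π)) (f := fun θ => (√(sin θ) : ℂ) * K.fourierBL Φ r θ ω m)
    (e := fun (l : {l : ℕ // m.natAbs ≤ l}) θ => (spheroidalS (a * ω) m l θ : ℂ) * (√(sin θ) : ℂ)) (fun l => ?_) (fun i j => ?_) ?_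
  · have e1 : ∀ l : {l : ℕ // m.natAbs ≤ l}, K.carter Φ ω m l r = ∫ θ in Ioo 0 π,
        conj ((spheroidalS (a * ω) m l θ : ℂ) * (√(sin θ) : ℂ)) * ((√(sin θ) : ℂ) * K.fourierBL Φ r θ ω m) := by
      intro l
      rw [carter_eq_setIntegral]
      refine setIntegral_congr_fun measurableSet_Ioo fun θ hθ => ?_
      simp only [map_mul, Complex.conj_ofReal]
      rw [← hsq θ hθ]
      ring
    simp_rw [e1]
    refine hB.trans (le_of_eq ?_)
    refine setLIntegral_congr_fun measurableSet_Ioo fun θ hθ => ?_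
    rw [norm_mul, mul_pow, Complex.norm_real, norm_eq_abs, sq_abs, Real.sq_sqrt (hsin θ hθ).le, ofReal_mul (hsin θ hθ).le]
  · obtain ⟨B, hB⟩ := (spheroidalS_spec (a * ω) m l).1.bounded
    refine memLp_two_of_bound (B := B) (hSm l) ?_
    filter_upwards [ae_restrict_mem measurableSet_Ioo] with θ hθ
    rw [norm_mul, Complex.norm_real, Complex.norm_real, norm_eq_abs, norm_eq_abs, abs_of_nonneg (Real.sqrt_nonneg _)]
    calc _ ≤ |spheroidalS (a * ω) m l θ| * 1 := by
          gcongr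
          exact Real.sqrt_le_one.2 (Real.sin_le_one θ)
      _ ≤ B := by rw [mul_one]; exact hB θ hθ
  · have e2 : ∫ θ in Ioo 0 π, conj ((spheroidalS (a * ω) m i θ : ℂ) * (√(sin θ) : ℂ)) * ((spheroidalS (a * ω) m j θ : ℂ) * (√(sin θ) : ℂ))
        = ((∫ θ in (0 : ℝ)..Real.pi, sin θ * (spheroidalS (a * ω) m i θ * spheroidalS (a * ω) m j θ) : ℝ) : ℂ) := by
      rw [intervalIntegral.integral_of_le Real.pi_pos.le, integral_Ioc_eq_integral_Ioo, ← integral_complex_ofReal]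
      refine setIntegral_congr_fun measurableSet_Ioo fun θ hθ => ?_
      simp only [map_mul, Complex.conj_ofReal, Complex.ofReal_mul]
      rw [← hsq θ hθ]
      ring
    rw [e2]
    split_ifs with hij
    · subst hij
      have := (spheroidalS_spec (a * ω) m i).2
      rw [show (fun θ => sin θ * (spheroidalS (a * ω) m i θ * spheroidalS (a * ω) m i θ)) = fun θ => spheroidalS (a * ω) m i θ ^ 2 * sin θ from
        funext fun θ => by ring, this, Complex.ofReal_one]
    · rw [integral_spheroidalS_mul (a * ω) m i.2 j.2 fun h => hij (Subtype.ext h), Complex.ofReal_zero]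
  · refine memLp_two_of_bound (B := D) hfm.aestronglyMeasurable ?_
    filter_upwards [ae_restrict_mem measurableSet_Ioo] with θ hθ using hD θ (Ioo_subset_Icc_self hθ)

lemma IsSlab.contDiff_cyl (θ : ℝ) :
    ContDiff ℝ ∞ fun z : ℝ × ℝ => Φ (K.ptBL z.1 r θ z.2) := by
  have h1 : ContDiff ℝ ∞ fun z : ℝ × ℝ => K.ptBL z.1 r θ z.2 := by
    rw [contDiff_pi]
    intro i
    fin_cases i <;> simp [ptBL] <;> fun_prop
  exact contDiff_iff_contDiffAt.2 fun z => (h.smooth _ (K.ptBL_mem_shell ha hr)).comp z h1.contDiffAt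

end

/-- The spectral sum of the Carter coefficients is controlled by the physical space integral. -/
lemma IsSlab.spectral_bound (ha : |a| < M) (h : K.IsSlab t0 t1 Φ) (hρ : ρ < K.R / 2) :
    ∃ Q : ℝ → ENNReal, Measurable Q ∧
      (∀ ω, ∑' m : ℤ, ∑' l : {l : ℕ // m.natAbs ≤ l}, ∫⁻ r in Ioc (rPlus M a) ρ, ofReal (‖K.carter Φ ω m l r‖ ^ 2) ≤ Q ω) ∧
      ∫⁻ ω, Q ω ≤ ofReal ((2 * π) ^ 2 * (rPlus M a ^ 2)⁻¹) *
        ∫⁻ x in {x | rPlus M a < rad x ∧ rad x ≤ ρ}, ofReal (‖Φ x‖ ^ 2) := by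
  have hI : Ioc (rPlus M a) ρ ⊆ Ioo (rPlus M a) (K.R / 2) := fun r hr => ⟨hr.1, hr.2.trans_lt hρ⟩
  choose F hFm hF using fun m => h.stronglyMeasurable_fourierBL ha m
  obtain ⟨q, hq⟩ : ∃ q : ℤ → ℝ → ENNReal, q = fun m ω => ∫⁻ r in Ioc (rPlus M a) ρ, ∫⁻ θ in Ioo 0 π,
      ofReal (sin θ) * ofReal (‖F m (ω, r, θ)‖ ^ 2) := ⟨_, rfl⟩
  have hm : ∀ {X : Type} [MeasurableSpace X] (m : ℤ) {u v w : X → ℝ}, Measurable u → Measurable v → Measurable w →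
      Measurable fun x => ofReal (sin (w x)) * ofReal (‖F m (u x, v x, w x)‖ ^ 2) := by
    intro X _ m u v w hu hv hw
    have h1 : Measurable fun x => F m (u x, v x, w x) := (hFm m).measurable.comp (hu.prodMk (hv.prodMk hw))
    have h2 : Measurable fun x => sin (w x) := Real.measurable_sin.comp hw
    exact h2.ennreal_ofReal.mul (h1.norm.pow_const 2).ennreal_ofReal
  have hm3 : ∀ m, Measurable fun z : (ℝ × ℝ) × ℝ => ofReal (sin z.2) * ofReal (‖F m (z.1.1, z.1.2, z.2)‖ ^ 2) :=
    fun m => hm m (by fun_prop) (by fun_prop) (by fun_prop)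
  have hm2 : ∀ m, Measurable fun z : ℝ × ℝ => ∫⁻ θ in Ioo 0 π, ofReal (sin θ) * ofReal (‖F m (z.1, z.2, θ)‖ ^ 2) :=
    fun m => (hm3 m).lintegral_prod_right'
  have hqm : ∀ m, Measurable (q m) := fun m => by rw [hq]; exact (hm2 m).lintegral_prod_right'
  refine ⟨fun ω => ∑' m, q m ω, Measurable.ennreal_tsum hqm, fun ω => ?_, ?_⟩
  · refine ENNReal.tsum_le_tsum fun m => ?_
    rw [← lintegral_tsum fun l => ?_]
    · rw [hq]
      refine setLIntegral_mono' measurableSet_Ioc fun r hr => ?_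
      refine (h.tsum_carter_le ha (hI hr) ω m).trans (le_of_eq ?_)
      simp_rw [hF m ω r _ (hI hr)]
    · have hc : ContinuousOn (K.carter Φ ω m l) (Ioc (rPlus M a) ρ) := fun r hr =>
        (h.hasDerivAt_carter ha (hI hr) ω m l).continuousAt.continuousWithinAt
      exact (((hc.aestronglyMeasurable measurableSet_Ioc).norm.aemeasurable).pow_const 2).ennreal_ofReal
  · have hcoord := h.lintegral_coord_le ha hρ
    have hsm : ∀ m, Measurable fun z : (ℝ × ℝ) × ℝ => ofReal (sin z.1.2) * ofReal (‖F m (z.2, z.1.1, z.1.2)‖ ^ 2) :=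
      fun m => hm m (by fun_prop) (by fun_prop) (by fun_prop)
    calc ∫⁻ ω, ∑' m, q m ω = ∑' m, ∫⁻ ω, q m ω := lintegral_tsum fun m => (hqm m).aemeasurable
      _ = ∑' m, ∫⁻ r in Ioc (rPlus M a) ρ, ∫⁻ θ in Ioo 0 π, ∫⁻ ω, ofReal (sin θ) * ofReal (‖F m (ω, r, θ)‖ ^ 2) := by
          congr 1
          ext m
          rw [hq]
          simp only
          rw [lintegral_lintegral_swap (hm2 m).aemeasurable]
          refine lintegral_congr fun r => ?_
          rw [lintegral_lintegral_swap]
          exact (hm m (u := fun z : ℝ × ℝ => z.1) (v := fun _ => r) (w := fun z : ℝ × ℝ => z.2) (by fun_prop) (by fun_prop) (by fun_prop)).aemeasurable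
      _ = ∫⁻ r in Ioc (rPlus M a) ρ, ∫⁻ θ in Ioo 0 π, ∑' m, ∫⁻ ω, ofReal (sin θ) * ofReal (‖F m (ω, r, θ)‖ ^ 2) := by
          rw [← lintegral_tsum fun m => ?_]
          · refine lintegral_congr fun r => ?_
            rw [← lintegral_tsum fun m => ?_]
            exact (((hsm m).lintegral_prod_right').comp (by fun_prop : Measurable fun θ : ℝ => (r, θ))).aemeasurable
          · exact ((hsm m).lintegral_prod_right').lintegral_prod_right'.aemeasurable
      _ ≤ ∫⁻ r in Ioc (rPlus M a) ρ, ∫⁻ θ in Ioo 0 π, ofReal ((2 * π) ^ 2) * (ofReal (sin θ) *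
            ∫⁻ t : ℝ, ∫⁻ φ in Ioc 0 (2 * π), ofReal (‖Φ (K.ptBL t r θ φ)‖ ^ 2)) := by
          refine setLIntegral_mono' measurableSet_Ioc fun r hr => ?_
          refine lintegral_mono fun θ => ?_
          obtain ⟨N, hN⟩ := exists_timeBound (K := K) (t0 := t0) (t1 := t1) ha (hI hr)
          have := tsum_lintegral_cylFourier_le (h.contDiff_cyl ha (hI hr) θ) (fun t φ ht => hN _ h t θ φ ht)
          simp_rw [lintegral_const_mul' _ _ ofReal_ne_top, hF _ _ _ _ (hI hr), ENNReal.tsum_mul_left, fourierBL_eq]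
          rw [mul_left_comm]
          exact mul_le_mul_right this _
      _ = ofReal ((2 * π) ^ 2) * ∫⁻ r in Ioc (rPlus M a) ρ, ∫⁻ θ in Ioo 0 π, ofReal (sin θ) *
            ∫⁻ t : ℝ, ∫⁻ φ in Ioc 0 (2 * π), ofReal (‖Φ (K.ptBL t r θ φ)‖ ^ 2) := by
          simp_rw [lintegral_const_mul' _ _ ofReal_ne_top]
      _ ≤ _ := by
          rw [ofReal_mul (by positivity), mul_assoc]
          exact mul_le_mul_right hcoord _

end KerrSetup

/-- The degeneration function is `1` in the elliptic range. -/
lemma IsChiNat.eq_one_of_elliptic {M a ωhigh εwidth α btrap b ω Λ r : ℝ} {m : ℤ} {χ : ℝ → ℝ → ℤ → ℝ → ℝ}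
    (hχ : IsChiNat M a ωhigh εwidth α btrap χ) (hω : 0 < ωhigh) (hb : 0 < b) (hbt : btrap ≤ b / 4)
    (hadm : Admissible a ω m Λ) (hr : rPlus M a < r) (hV : b / 2 * ω ^ 2 ≤ V0 M a ω m Λ r - ω ^ 2) : χ r ω m Λ = 1 := by
  refine hχ.eq_one ω m Λ hadm ?_ r hr
  rintro ⟨⟨-, h1, -⟩, s, ⟨-, hs⟩, h2⟩
  have h3 := hs r hr
  have h4 := (abs_le.1 h2).2
  have h5 : 0 < ω ^ 2 := by
    have : 0 < |ω| := hω.trans_le h1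
    rw [← sq_abs]; positivity
  nlinarith

namespace KerrSetup

variable {M a : ℝ} {K : KerrSetup M a} {t0 t1 : ℝ} {Φ : Pt → ℂ}

/-- The elliptic integrand. -/
def elpDensity (M a Rpot b γ : ℝ) (u : ℝ → ℂ) (ω : ℝ) (m : ℤ) (Λ r : ℝ) : ℝ :=
  Del M a r * (r ^ 2)⁻¹ * iotaElliptic M a Rpot b γ r ω m Λ * (V0 M a ω m Λ r - ω ^ 2) ^ 2 * ‖u r‖ ^ 2

/-- The trapping energy integrand. -/
def natDensity (M a : ℝ) (χ : ℝ → ℝ → ℤ → ℝ → ℝ) (u : ℝ → ℂ) (ω : ℝ) (m : ℤ) (Λ r : ℝ) : ℝ :=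
  Del M a r * (r ^ 2)⁻¹ * (‖dStar M a u r‖ ^ 2 + χ r ω m Λ * (ω ^ 2 + r⁻¹ * (m : ℝ) ^ 2 + r⁻¹ * Λ) * ‖u r‖ ^ 2)

lemma lintStar_elpDensity_le (ha : |a| < M) (Rpot b γ : ℝ) (u : ℝ → ℂ) (ω : ℝ) (m : ℤ) (Λ : ℝ) :
    lintStar M a (Ioc (rPlus M a) (1.2 * Rpot)) (elpDensity M a Rpot b γ u ω m Λ)
      ≤ ofReal ((rPlus M a ^ 2)⁻¹) * lintStar M a (Ioc (rElliptic M a γ ω m) (1.2 * Rpot))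
        (fun r => Del M a r * (r ^ 2)⁻¹ * iotaV M a b ω m Λ r * (V0 M a ω m Λ r - ω ^ 2) ^ 2 * ‖(√(r ^ 2 + a ^ 2) : ℂ) * u r‖ ^ 2) := by
  have hp := rPlus_pos ha
  unfold lintStar
  obtain ⟨G, hG⟩ : ∃ G : ℝ → ENNReal, G = fun r => ofReal (Del M a r * (r ^ 2)⁻¹ * iotaV M a b ω m Λ r *
    (V0 M a ω m Λ r - ω ^ 2) ^ 2 * ‖(√(r ^ 2 + a ^ 2) : ℂ) * u r‖ ^ 2 * ((r ^ 2 + a ^ 2) / Del M a r)) := ⟨_, rfl⟩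
  calc _ ≤ ∫⁻ r in Ioc (rPlus M a) (1.2 * Rpot), (Ioc (rElliptic M a γ ω m) (1.2 * Rpot)).indicator
          (fun r => ofReal ((rPlus M a ^ 2)⁻¹) * G r) r := by
        refine setLIntegral_mono' measurableSet_Ioc fun r hr => ?_
        by_cases hi : (1 + b) * ω ^ 2 ≤ V0 M a ω m Λ r ∧ rElliptic M a γ ω m < r ∧ r ≤ 1.2 * Rpot
        · have h1 : b * ω ^ 2 ≤ V0 M a ω m Λ r - ω ^ 2 := by linarith [hi.1]
          have hΔ := Del_pos ha hr.1
          have hmem : r ∈ Ioc (rElliptic M a γ ω m) (1.2 * Rpot) := ⟨hi.2.1, hi.2.2⟩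
          rw [indicator_of_mem hmem, hG]
          simp only
          rw [← ofReal_mul (by positivity)]
          refine ofReal_le_ofReal ?_
          rw [elpDensity, iotaElliptic, if_pos hi, iotaV, if_pos h1, norm_mul, mul_pow, Complex.norm_real, norm_eq_abs, sq_abs,
            Real.sq_sqrt (by positivity)]
          have h2 : 1 ≤ (rPlus M a ^ 2)⁻¹ * (r ^ 2 + a ^ 2) := by
            rw [inv_mul_eq_div, one_le_div (by positivity)]
            nlinarith [hr.1, sq_nonneg a]
          obtain ⟨X, hX⟩ : ∃ X, X = Del M a r * (r ^ 2)⁻¹ * (V0 M a ω m Λ r - ω ^ 2) ^ 2 * ‖u r‖ ^ 2 * ((r ^ 2 + a ^ 2) / Del M a r) := ⟨_, rfl⟩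
          have hX0 : 0 ≤ X := by rw [hX]; positivity
          calc _ = X := by rw [hX]; ring
            _ ≤ (rPlus M a ^ 2)⁻¹ * (r ^ 2 + a ^ 2) * X := le_mul_of_one_le_left hX0 h2
            _ = _ := by rw [hX]; ring
        · rw [elpDensity, iotaElliptic, if_neg hi]
          simp
    _ ≤ ∫⁻ r in Ioc (rElliptic M a γ ω m) (1.2 * Rpot), ofReal ((rPlus M a ^ 2)⁻¹) * G r := by
        rw [lintegral_indicator measurableSet_Ioc, Measure.restrict_restrict measurableSet_Ioc]
        exact lintegral_mono_set inter_subset_left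
    _ = _ := by rw [lintegral_const_mul' _ _ ofReal_ne_top, hG]

lemma elliptic_weight_le (ha : |a| < M) {ρ r ω Λ b ωhigh εwidth α btrap : ℝ} {m : ℤ} {χ : ℝ → ℝ → ℤ → ℝ → ℝ} {u : ℝ → ℂ} {h : ℂ}
    (hχ : IsChiNat M a ωhigh εwidth α btrap χ) (hω : 0 < ωhigh) (hb : 0 < b) (hbt : btrap ≤ b / 4)
    (hadm : Admissible a ω m Λ) (hr : rPlus M a < r) (hrρ : r ≤ ρ) :
    Del M a r * (r ^ 2)⁻¹ * iotaV M a (b / 2) ω m Λ r * ((ω ^ 2 + Λ) * ‖(√(r ^ 2 + a ^ 2) : ℂ) * u r‖ ^ 2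
        + ‖((Del M a r / ((r ^ 2 + a ^ 2) * √(r ^ 2 + a ^ 2)) : ℝ) : ℂ) * h‖ ^ 2) * ((r ^ 2 + a ^ 2) / Del M a r)
      ≤ 2 * ρ ^ 2 * (1 + ρ) * (natDensity M a χ u ω m Λ r * ((r ^ 2 + a ^ 2) / Del M a r)) + (rPlus M a ^ 2)⁻¹ * ‖h‖ ^ 2 := by
  have hp := rPlus_pos ha
  have hr0 : 0 < r := hp.trans hr
  have hρ0 : 0 < ρ := hr0.trans_le hrρ
  have hΔ := Del_pos ha hr
  have hΛ := hadm.nonneg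
  have ha2 := sq_le_of_rPlus_lt ha hr
  have hM := mass_pos ha
  have hχ0 := hχ.nonneg r ω m Λ
  have hι : 0 ≤ iotaV M a (b / 2) ω m Λ r ∧ iotaV M a (b / 2) ω m Λ r ≤ 1 := by unfold iotaV; split_ifs <;> norm_num
  have hB : 0 < r ^ 2 + a ^ 2 := by positivity
  have e1 : ‖(√(r ^ 2 + a ^ 2) : ℂ) * u r‖ ^ 2 = (r ^ 2 + a ^ 2) * ‖u r‖ ^ 2 := by
    rw [norm_mul, mul_pow, Complex.norm_real, norm_eq_abs, sq_abs, Real.sq_sqrt hB.le]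
  have e2 : ‖((Del M a r / ((r ^ 2 + a ^ 2) * √(r ^ 2 + a ^ 2)) : ℝ) : ℂ) * h‖ ^ 2 = Del M a r ^ 2 / (r ^ 2 + a ^ 2) ^ 3 * ‖h‖ ^ 2 := by
    rw [norm_mul, mul_pow, Complex.norm_real, norm_eq_abs, sq_abs, div_pow, mul_pow, Real.sq_sqrt hB.le]
    ring
  obtain ⟨W, hW⟩ : ∃ W, W = Del M a r * (r ^ 2)⁻¹ * ((r ^ 2 + a ^ 2) / Del M a r) := ⟨_, rfl⟩
  have hW0 : 0 ≤ W := by rw [hW]; positivity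
  have h1 : iotaV M a (b / 2) ω m Λ r * ((ω ^ 2 + Λ) * ((r ^ 2 + a ^ 2) * ‖u r‖ ^ 2))
      ≤ 2 * ρ ^ 2 * (1 + ρ) * (‖dStar M a u r‖ ^ 2 + χ r ω m Λ * (ω ^ 2 + r⁻¹ * (m : ℝ) ^ 2 + r⁻¹ * Λ) * ‖u r‖ ^ 2) := by
    by_cases hV : b / 2 * ω ^ 2 ≤ V0 M a ω m Λ r - ω ^ 2
    · rw [hχ.eq_one_of_elliptic hω hb hbt hadm hr hV, iotaV, if_pos hV, one_mul, one_mul]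
      have hB2 : r ^ 2 + a ^ 2 ≤ 2 * ρ ^ 2 := by nlinarith
      have hN : ω ^ 2 + Λ ≤ (1 + ρ) * (ω ^ 2 + r⁻¹ * (m : ℝ) ^ 2 + r⁻¹ * Λ) := by
        have i1 : Λ ≤ ρ * (r⁻¹ * Λ) := by
          rw [← mul_assoc]
          refine le_mul_of_one_le_left hΛ ?_
          rw [← div_eq_mul_inv, one_le_div hr0]; exact hrρ
        have i2 : 0 ≤ r⁻¹ * (m : ℝ) ^ 2 := by positivity
        have i3 : 0 ≤ r⁻¹ * Λ := by positivity
        nlinarith [sq_nonneg ω, mul_nonneg hρ0.le (sq_nonneg ω), mul_nonneg hρ0.le i2]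
      calc (ω ^ 2 + Λ) * ((r ^ 2 + a ^ 2) * ‖u r‖ ^ 2)
          ≤ ((1 + ρ) * (ω ^ 2 + r⁻¹ * (m : ℝ) ^ 2 + r⁻¹ * Λ)) * ((2 * ρ ^ 2) * ‖u r‖ ^ 2) := by gcongr
        _ = 2 * ρ ^ 2 * (1 + ρ) * ((ω ^ 2 + r⁻¹ * (m : ℝ) ^ 2 + r⁻¹ * Λ) * ‖u r‖ ^ 2) := by ring
        _ ≤ _ := by
            gcongr
            linarith [sq_nonneg ‖dStar M a u r‖]
    · rw [iotaV, if_neg hV, zero_mul]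
      positivity
  have h2 : iotaV M a (b / 2) ω m Λ r * (W * (Del M a r ^ 2 / (r ^ 2 + a ^ 2) ^ 3 * ‖h‖ ^ 2)) ≤ (rPlus M a ^ 2)⁻¹ * ‖h‖ ^ 2 := by
    have hΔB : Del M a r ≤ r ^ 2 + a ^ 2 := by unfold Del; nlinarith
    have i1 : W * (Del M a r ^ 2 / (r ^ 2 + a ^ 2) ^ 3) ≤ (rPlus M a ^ 2)⁻¹ := by
      have e : W * (Del M a r ^ 2 / (r ^ 2 + a ^ 2) ^ 3) = (Del M a r / (r ^ 2 + a ^ 2)) ^ 2 * (r ^ 2)⁻¹ := by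
        rw [hW]; field_simp
      rw [e]
      have i2 : Del M a r / (r ^ 2 + a ^ 2) ≤ 1 := (div_le_one hB).2 hΔB
      have i3 : (r ^ 2)⁻¹ ≤ (rPlus M a ^ 2)⁻¹ := by
        apply inv_anti₀ (by positivity)
        gcongr
      calc _ ≤ 1 ^ 2 * (rPlus M a ^ 2)⁻¹ := by gcongr
        _ = _ := by ring
    calc _ ≤ 1 * (W * (Del M a r ^ 2 / (r ^ 2 + a ^ 2) ^ 3 * ‖h‖ ^ 2)) := by gcongr; exact hι.2
      _ = (W * (Del M a r ^ 2 / (r ^ 2 + a ^ 2) ^ 3)) * ‖h‖ ^ 2 := by ring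
      _ ≤ _ := by gcongr
  rw [e1, e2, natDensity]
  calc _ = W * (iotaV M a (b / 2) ω m Λ r * ((ω ^ 2 + Λ) * ((r ^ 2 + a ^ 2) * ‖u r‖ ^ 2)))
        + iotaV M a (b / 2) ω m Λ r * (W * (Del M a r ^ 2 / (r ^ 2 + a ^ 2) ^ 3 * ‖h‖ ^ 2)) := by rw [hW]; ring
    _ ≤ W * (2 * ρ ^ 2 * (1 + ρ) * (‖dStar M a u r‖ ^ 2 + χ r ω m Λ * (ω ^ 2 + r⁻¹ * (m : ℝ) ^ 2 + r⁻¹ * Λ) * ‖u r‖ ^ 2))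
        + (rPlus M a ^ 2)⁻¹ * ‖h‖ ^ 2 := add_le_add (mul_le_mul_of_nonneg_left h1 hW0) h2
    _ = _ := by rw [hW]; ring

lemma radii_order (ha : |a| < M) (K : KerrSetup M a) : 1.3 * K.Rpot < K.R / 2 ∧ 1.3 * K.Rpot ≤ K.Rfreq ∧ rPlus M a < K.Rpot ∧ 0 < K.Rpot := by
  obtain ⟨-, -, -, -, -, -, h1, h2, h3⟩ := K.params
  have := mass_pos ha
  have := rPlus_le ha
  refine ⟨by linarith, by linarith, by linarith, by linarith⟩

/-- The elliptic estimate for the modes of a slab function. -/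
theorem IsSlab.elliptic_bound (ha : |a| < M) (K : KerrSetup M a) {b γ : ℝ} (hb : 0 < b) (hγ : 0 < γ) :
    ∃ C : ℝ, 0 < C ∧ ∀ {ωhigh εwidth α btrap : ℝ} {χ : ℝ → ℝ → ℤ → ℝ → ℝ}, IsChiNat M a ωhigh εwidth α btrap χ → 0 < ωhigh →
      btrap ≤ b / 4 → ∀ {t0 t1 : ℝ} {Φ : Pt → ℂ}, K.IsSlab t0 t1 Φ → ∀ κ : Fin 2 → ℕ,
      freqInt M a (1.2 * K.Rpot) (fun ω m l => elpDensity M a K.Rpot b γ (K.carter (multiDer ![TField, Om 0] κ Φ) ω m l) ω m (LambdaFreq a ω m l))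
        ≤ ofReal C * (freqInt M a K.Rfreq (fun ω m l => natDensity M a χ (K.carter (multiDer ![TField, Om 0] κ Φ) ω m l) ω m (LambdaFreq a ω m l))
          + ∫⁻ x in {x | rPlus M a < rad x ∧ rad x ≤ 1.3 * K.Rpot},
            ofReal (‖multiDer ![TField, Om 0] κ (kerrWave M a K.p K.q Φ) x‖ ^ 2)) := by
  obtain ⟨hRR, hRf, hRp, hR0⟩ := radii_order ha K
  have hp := rPlus_pos ha
  obtain ⟨C1, hC1, hmain⟩ := fixed_frequency_local ha (Rpot := K.Rpot) (b := b) (γ := γ) (ρ := K.R / 2) K.params.2.2.2.2.2.2.1 hb hγ hRR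
  obtain ⟨ρ, hρ⟩ : ∃ ρ, ρ = 1.3 * K.Rpot := ⟨_, rfl⟩
  have hρ0 : 0 < ρ := by rw [hρ]; positivity
  obtain ⟨C2, hC2⟩ : ∃ C2, C2 = 2 * ρ ^ 2 * (1 + ρ) + (rPlus M a ^ 2)⁻¹ := ⟨_, rfl⟩
  have hC₂0 : 0 < C2 := by rw [hC2]; positivity
  obtain ⟨C3, hC3⟩ : ∃ C3, C3 = (rPlus M a ^ 2)⁻¹ * (C1 * C2) := ⟨_, rfl⟩
  have hC₃0 : 0 < C3 := by rw [hC3]; positivity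
  refine ⟨C3 * max 1 ((2 * π) ^ 2 * (rPlus M a ^ 2)⁻¹), by positivity, ?_⟩
  intro ωhigh εwidth α btrap χ hχ hω hbt t0 t1 Φ hΦ κ
  obtain ⟨H, hH⟩ : ∃ H, H = multiDer ![TField, Om 0] κ (kerrWave M a K.p K.q Φ) := ⟨_, rfl⟩
  have hHs : K.IsSlab t0 t1 H := by rw [hH]; exact (hΦ.kerrWave ha).multiDer κ
  obtain ⟨U, hU⟩ : ∃ U, U = multiDer ![TField, Om 0] κ Φ := ⟨_, rfl⟩
  have hUs : K.IsSlab t0 t1 U := by rw [hU]; exact hΦ.multiDer κ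
  rw [← hH, ← hU, ← hρ]
  have hsub : Ioc (rPlus M a) ρ ⊆ Ioo (rPlus M a) (K.R / 2) := fun r hr => ⟨hr.1, hr.2.trans_lt (hρ ▸ hRR)⟩
  -- single frequency
  have hfreq : ∀ ω m l, lintStar M a (Ioc (rPlus M a) (1.2 * K.Rpot)) (elpDensity M a K.Rpot b γ (K.carter U ω m l) ω m (LambdaFreq a ω m l))
      ≤ ofReal C3 * (lintStar M a (Ioc (rPlus M a) K.Rfreq) (natDensity M a χ (K.carter U ω m l) ω m (LambdaFreq a ω m l))
        + ∫⁻ r in Ioc (rPlus M a) ρ, ofReal (‖K.carter H ω m l r‖ ^ 2)) := by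
    intro ω m l
    have hadm := admissible_LambdaFreq a ω m l
    have hcd : ContDiffOn ℝ 2 (fun r => (√(r ^ 2 + a ^ 2) : ℂ) * K.carter U ω m l r) (Ioo (rPlus M a) (K.R / 2)) := by
      refine ContDiffOn.mul ?_ (hUs.contDiffOn_carter ha 2)
      refine Complex.ofRealCLM.contDiff.comp_contDiffOn (ContDiffOn.sqrt (by fun_prop) fun r hr => ?_)
      have : 0 < r := hp.trans hr.1
      positivity
    have h1 := hmain ω m (LambdaFreq a ω m l) hadm _
      (fun r => ((Del M a r / ((r ^ 2 + a ^ 2) * √(r ^ 2 + a ^ 2)) : ℝ) : ℂ) * K.carter H ω m l r) hcd (fun r hr => by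
      have := hΦ.radial_equation ha hr κ (ω := ω) (m := m) (l := l)
      rw [← hH, ← hU] at this
      exact this)
    have h2 : lintStar M a (Ioc (max (0.99 * rElliptic M a γ ω m) (rPlus M a)) (1.3 * K.Rpot))
        (fun r => Del M a r * (r ^ 2)⁻¹ * iotaV M a (b / 2) ω m (LambdaFreq a ω m l) r
          * ((ω ^ 2 + LambdaFreq a ω m l) * ‖(√(r ^ 2 + a ^ 2) : ℂ) * K.carter U ω m l r‖ ^ 2
            + ‖((Del M a r / ((r ^ 2 + a ^ 2) * √(r ^ 2 + a ^ 2)) : ℝ) : ℂ) * K.carter H ω m l r‖ ^ 2))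
        ≤ ofReal C2 * (lintStar M a (Ioc (rPlus M a) K.Rfreq) (natDensity M a χ (K.carter U ω m l) ω m (LambdaFreq a ω m l))
          + ∫⁻ r in Ioc (rPlus M a) ρ, ofReal (‖K.carter H ω m l r‖ ^ 2)) := by
      have hmeas : AEMeasurable (fun r => ofReal (‖K.carter H ω m l r‖ ^ 2)) (volume.restrict (Ioc (rPlus M a) ρ)) := by
        have hc : ContinuousOn (K.carter H ω m l) (Ioc (rPlus M a) ρ) := fun r hr =>
          (hHs.hasDerivAt_carter ha (hsub hr) ω m l).continuousAt.continuousWithinAt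
        exact (((hc.aestronglyMeasurable measurableSet_Ioc).norm.aemeasurable).pow_const 2).ennreal_ofReal
      unfold lintStar
      rw [← hρ]
      calc _ ≤ ∫⁻ r in Ioc (max (0.99 * rElliptic M a γ ω m) (rPlus M a)) ρ, ofReal C2 *
              (ofReal (natDensity M a χ (K.carter U ω m l) ω m (LambdaFreq a ω m l) r * ((r ^ 2 + a ^ 2) / Del M a r))
                + ofReal (‖K.carter H ω m l r‖ ^ 2)) := by
            refine setLIntegral_mono' measurableSet_Ioc fun r hr => ?_
            have hr1 : rPlus M a < r := (le_max_right _ _).trans_lt hr.1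
            have hr0 : 0 < r := hp.trans hr1
            have hΔ := Del_pos ha hr1
            have hχ0 := hχ.nonneg r ω m (LambdaFreq a ω m l)
            have hΛ := hadm.nonneg
            have hn0 : 0 ≤ natDensity M a χ (K.carter U ω m l) ω m (LambdaFreq a ω m l) r * ((r ^ 2 + a ^ 2) / Del M a r) := by
              unfold natDensity; positivity
            rw [← ofReal_add hn0 (by positivity), ← ofReal_mul hC₂0.le]
            refine ofReal_le_ofReal ((elliptic_weight_le ha hχ hω hb hbt hadm hr1 hr.2).trans ?_)
            rw [hC2]
            have i1 : 0 ≤ (rPlus M a ^ 2)⁻¹ * (natDensity M a χ (K.carter U ω m l) ω m (LambdaFreq a ω m l) r * ((r ^ 2 + a ^ 2) / Del M a r)) := by positivity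
            have i2 : 0 ≤ 2 * ρ ^ 2 * (1 + ρ) * ‖K.carter H ω m l r‖ ^ 2 := by positivity
            linarith
        _ ≤ ∫⁻ r in Ioc (rPlus M a) ρ, ofReal C2 *
              (ofReal (natDensity M a χ (K.carter U ω m l) ω m (LambdaFreq a ω m l) r * ((r ^ 2 + a ^ 2) / Del M a r))
                + ofReal (‖K.carter H ω m l r‖ ^ 2)) := lintegral_mono_set (Ioc_subset_Ioc_left (le_max_right _ _))
        _ = ofReal C2 * ((∫⁻ r in Ioc (rPlus M a) ρ,
              ofReal (natDensity M a χ (K.carter U ω m l) ω m (LambdaFreq a ω m l) r * ((r ^ 2 + a ^ 2) / Del M a r)))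
                + ∫⁻ r in Ioc (rPlus M a) ρ, ofReal (‖K.carter H ω m l r‖ ^ 2)) := by
            rw [lintegral_const_mul' _ _ ofReal_ne_top, lintegral_add_right' _ hmeas]
        _ ≤ _ := by
            exact mul_le_mul_right (add_le_add (lintegral_mono_set (Ioc_subset_Ioc_right (hρ ▸ hRf))) le_rfl) _
    calc _ ≤ _ := lintStar_elpDensity_le ha K.Rpot b γ (K.carter U ω m l) ω m (LambdaFreq a ω m l)
      _ ≤ ofReal ((rPlus M a ^ 2)⁻¹) * (ofReal C1 * (ofReal C2 *
          (lintStar M a (Ioc (rPlus M a) K.Rfreq) (natDensity M a χ (K.carter U ω m l) ω m (LambdaFreq a ω m l))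
          + ∫⁻ r in Ioc (rPlus M a) ρ, ofReal (‖K.carter H ω m l r‖ ^ 2)))) :=
          mul_le_mul_right (h1.trans (mul_le_mul_right h2 _)) _
      _ = _ := by rw [hC3, ofReal_mul (by positivity), ofReal_mul hC1.le]; ring
  obtain ⟨Q, hQm, hQ, hQI⟩ := hHs.spectral_bound ha (ρ := ρ) (hρ ▸ hRR)
  obtain ⟨S, hS⟩ : ∃ S, S = ∫⁻ x in {x | rPlus M a < rad x ∧ rad x ≤ ρ}, ofReal (‖H x‖ ^ 2) := ⟨_, rfl⟩
  rw [← hS] at hQI ⊢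
  obtain ⟨D, hD⟩ : ∃ D, D = max 1 ((2 * π) ^ 2 * (rPlus M a ^ 2)⁻¹) := ⟨_, rfl⟩
  rw [← hD]
  have hD1 : 1 ≤ ofReal D := by rw [hD]; exact ENNReal.one_le_ofReal.2 (le_max_left _ _)
  unfold freqInt
  calc _ ≤ ∫⁻ ω : ℝ, ofReal C3 * ((∑' m : ℤ, ∑' l : {l : ℕ // m.natAbs ≤ l}, lintStar M a (Ioc (rPlus M a) K.Rfreq)
            (natDensity M a χ (K.carter U ω m l) ω m (LambdaFreq a ω m l))) + Q ω) := by
        refine lintegral_mono fun ω => ?_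
        calc _ ≤ ∑' m : ℤ, ∑' l : {l : ℕ // m.natAbs ≤ l}, ofReal C3 * (lintStar M a (Ioc (rPlus M a) K.Rfreq) (natDensity M a χ (K.carter U ω m l) ω m (LambdaFreq a ω m l))
                + ∫⁻ r in Ioc (rPlus M a) ρ, ofReal (‖K.carter H ω m l r‖ ^ 2)) :=
              ENNReal.tsum_le_tsum fun m => ENNReal.tsum_le_tsum fun l => hfreq ω m l
          _ = ofReal C3 * ((∑' m : ℤ, ∑' l : {l : ℕ // m.natAbs ≤ l}, lintStar M a (Ioc (rPlus M a) K.Rfreq)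
                (natDensity M a χ (K.carter U ω m l) ω m (LambdaFreq a ω m l))) +
                ∑' m : ℤ, ∑' l : {l : ℕ // m.natAbs ≤ l}, ∫⁻ r in Ioc (rPlus M a) ρ, ofReal (‖K.carter H ω m l r‖ ^ 2)) := by
              simp_rw [ENNReal.tsum_mul_left, ENNReal.tsum_add]
          _ ≤ _ := mul_le_mul_right (add_le_add le_rfl (hQ ω)) _
    _ = ofReal C3 * ((∫⁻ ω : ℝ, ∑' m : ℤ, ∑' l : {l : ℕ // m.natAbs ≤ l}, lintStar M a (Ioc (rPlus M a) K.Rfreq)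
            (natDensity M a χ (K.carter U ω m l) ω m (LambdaFreq a ω m l))) + ∫⁻ ω, Q ω) := by
        rw [lintegral_const_mul' _ _ ofReal_ne_top, lintegral_add_right _ hQm]
    _ ≤ ofReal C3 * (ofReal D * (∫⁻ ω : ℝ, ∑' m : ℤ, ∑' l : {l : ℕ // m.natAbs ≤ l}, lintStar M a (Ioc (rPlus M a) K.Rfreq)
            (natDensity M a χ (K.carter U ω m l) ω m (LambdaFreq a ω m l))) + ofReal D * S) := by
        refine mul_le_mul_right (add_le_add (le_mul_of_one_le_left zero_le hD1) (hQI.trans ?_)) _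
        refine mul_le_mul_left (ofReal_le_ofReal ?_) _
        rw [hD]; exact le_max_right _ _
    _ = _ := by rw [ofReal_mul hC₃0.le]; ring

end KerrSetup

/-- Smoothness at every point of a set. -/
def SmoothOn {E : Type*} [NormedAddCommGroup E] [NormedSpace ℝ E] (O : Set Pt) (f : Pt → E) : Prop :=
  ∀ y ∈ O, ContDiffAt ℝ ∞ f y

/-- Stationarity: invariance under the flow of `T`. -/
def Stationary {E : Type*} (f : Pt → E) : Prop := ∀ (s : ℝ) x, f (x + s • TField x) = f x

section Smooth

variable {E : Type*} [NormedAddCommGroup E] [NormedSpace ℝ E] {O : Set Pt} {f g : Pt → ℂ} {X Y : Pt → Pt} {x : Pt}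

lemma SmoothOn.mono {O' : Set Pt} {f : Pt → E} (h : SmoothOn O f) (hO : O' ⊆ O) : SmoothOn O' f := fun y hy => h y (hO hy)

lemma SmoothOn.differentiableAt {f : Pt → E} (h : SmoothOn O f) (hx : x ∈ O) : DifferentiableAt ℝ f x :=
  (h x hx).differentiableAt (by simp)

lemma SmoothOn.add {f g : Pt → E} (hf : SmoothOn O f) (hg : SmoothOn O g) : SmoothOn O (fun y => f y + g y) :=
  fun y hy => (hf y hy).add (hg y hy)

lemma SmoothOn.mul (hf : SmoothOn O f) (hg : SmoothOn O g) : SmoothOn O (fun y => f y * g y) :=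
  fun y hy => (hf y hy).mul (hg y hy)

protected lemma SmoothOn.vder (hX : SmoothOn O X) (hf : SmoothOn O f) : SmoothOn O (vder X f) :=
  fun y hy => ContDiffAt.vder_top (hX y hy) (hf y hy)

lemma SmoothOn.sum {ι : Type*} {s : Finset ι} {f : ι → Pt → E} (h : ∀ i ∈ s, SmoothOn O (f i)) :
    SmoothOn O (fun y => ∑ i ∈ s, f i y) := fun y hy => ContDiffAt.sum fun i hi => h i hi y hy

lemma SmoothOn.congr {f g : Pt → E} (hO : IsOpen O) (hf : SmoothOn O f) (h : ∀ y ∈ O, g y = f y) : SmoothOn O g := fun y hy =>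
  (hf y hy).congr_of_eventuallyEq (by filter_upwards [hO.mem_nhds hy] with z hz using h z hz)

lemma SmoothOn.vder_iterate (hX : SmoothOn O X) (hf : SmoothOn O f) (n : ℕ) : SmoothOn O ((vder X)^[n] f) := by
  induction n with
  | zero => exact hf
  | succ n ih => rw [Function.iterate_succ_apply']; exact hX.vder ih

lemma multiDer_succ {n : ℕ} (X : Fin (n + 1) → Pt → Pt) (κ : Fin (n + 1) → ℕ) (f : Pt → ℂ) :
    multiDer X κ f = (vder (X 0))^[κ 0] (multiDer (fun i => X i.succ) (fun i => κ i.succ) f) := by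
  simp [multiDer, List.finRange_succ, List.foldr_map]

protected lemma SmoothOn.multiDer {n : ℕ} {X : Fin n → Pt → Pt} (hX : ∀ i, SmoothOn O (X i)) (hf : SmoothOn O f) (κ : Fin n → ℕ) :
    SmoothOn O (multiDer X κ f) := by
  induction n with
  | zero => exact hf
  | succ n ih =>
    rw [multiDer_succ]
    exact (hX 0).vder_iterate (ih (fun i => hX i.succ) _) _

lemma multiDer_all_zero {n : ℕ} (X : Fin n → Pt → Pt) (f : Pt → ℂ) : multiDer X 0 f = f := by
  induction n with
  | zero => rfl
  | succ n ih => rw [multiDer_succ]; exact ih (fun i => X i.succ)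

/-- A field may be prepended to an ordered product whose fields come later. -/
lemma multiDer_add_single {n : ℕ} (X : Fin n → Pt → Pt) (κ : Fin n → ℕ) {j : Fin n} (h : ∀ l < j, κ l = 0) (f : Pt → ℂ) :
    multiDer X (κ + Pi.single j 1) f = vder (X j) (multiDer X κ f) := by
  induction n with
  | zero => exact j.elim0
  | succ n ih =>
    rw [multiDer_succ, multiDer_succ]
    refine Fin.cases (fun h => ?_) (fun j h => ?_) j h
    · have e : (fun i : Fin n => (κ + Pi.single (0 : Fin (n + 1)) 1 : Fin (n + 1) → ℕ) i.succ) = fun i => κ i.succ := by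
        ext i; simp [Pi.single_apply, Fin.succ_ne_zero]
      rw [e]
      simp [Function.iterate_succ_apply']
    · have e : (fun i : Fin n => (κ + Pi.single j.succ 1 : Fin (n + 1) → ℕ) i.succ) = (fun i => κ i.succ) + Pi.single j 1 := by
        ext i; simp [Pi.single_apply]
      have h0 : κ 0 = 0 := h 0 (Fin.succ_pos j)
      have e0 : (κ + Pi.single j.succ 1 : Fin (n + 1) → ℕ) 0 = 0 := by simp [h0, Pi.single_apply, (Fin.succ_ne_zero j).symm]
      rw [e, e0, h0]
      exact ih (fun i => X i.succ) (fun i => κ i.succ) fun l hl => h l.succ (Fin.succ_lt_succ_iff.2 hl)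

/-- The commutator of two vector fields. -/
def bracket (X Y : Pt → Pt) (x : Pt) : Pt := fderiv ℝ Y x (X x) - fderiv ℝ X x (Y x)

lemma vder_comm (hX : DifferentiableAt ℝ X x) (hY : DifferentiableAt ℝ Y x) (hf : ContDiffAt ℝ 2 f x) :
    vder X (vder Y f) x = vder Y (vder X f) x + vder (bracket X Y) f x := by
  have h1 : DifferentiableAt ℝ (fderiv ℝ f) x := (hf.fderiv_right (m := 1) (by norm_num)).differentiableAt (by simp)
  rw [vder_vder hY h1, vder_vder hX h1]
  have hs : IsSymmSndFDerivAt ℝ f x := hf.isSymmSndFDerivAt (by simp)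
  rw [hs.eq]
  simp [vder, bracket]

protected lemma SmoothOn.bracket (hX : SmoothOn O X) (hY : SmoothOn O Y) : SmoothOn O (bracket X Y) := fun y hy =>
  (((hY y hy).fderiv_right (m := ∞) (by norm_cast)).clm_apply (hX y hy)).sub
    (((hX y hy).fderiv_right (m := ∞) (by norm_cast)).clm_apply (hY y hy))

protected lemma Stationary.fderiv {f : Pt → E} (h : Stationary f) : Stationary (fderiv ℝ f) := by
  intro s x
  have : (fun y => f (y + s • TField x)) = f := funext fun y => h s y
  rw [← fderiv_comp_add_right, this]

protected lemma Stationary.bracket (hX : Stationary X) (hY : Stationary Y) : Stationary (bracket X Y) := fun s x => by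
  simp only [bracket, hX.fderiv s x, hY.fderiv s x, hX s x, hY s x]

protected lemma Stationary.vder (hX : Stationary X) (hf : Stationary f) : Stationary (vder X f) := fun s x => by
  simp only [vder, hX s x, hf.fderiv s x]

end Smooth

section Linear

variable {O : Set Pt}

lemma contDiffAt_det {n : ℕ} {A : Pt → Matrix (Fin n) (Fin n) ℝ} {x : Pt} (h : ∀ i j, ContDiffAt ℝ ∞ (fun y => A y i j) x) :
    ContDiffAt ℝ ∞ (fun y => (A y).det) x := by
  simp_rw [Matrix.det_apply]
  exact ContDiffAt.sum fun σ _ => (contDiffAt_prod fun i _ => h _ _).const_smul _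

lemma contDiffAt_inv_matrix {n : ℕ} {A : Pt → Matrix (Fin n) (Fin n) ℝ} {x : Pt} (h : ∀ i j, ContDiffAt ℝ ∞ (fun y => A y i j) x)
    (hd : (A x).det ≠ 0) (i j : Fin n) : ContDiffAt ℝ ∞ (fun y => (A y)⁻¹ i j) x := by
  simp only [Matrix.inv_def, Ring.inverse_eq_inv', Matrix.smul_apply, smul_eq_mul]
  refine ((contDiffAt_det h).inv hd).mul ?_
  simp only [Matrix.adjugate_apply]
  refine contDiffAt_det fun k l => ?_
  simp only [Matrix.updateRow_apply]
  split_ifs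
  · exact contDiffAt_const
  · exact h k l

/-- A smooth stationary field is a combination of smooth stationary spanning fields with smooth stationary coefficients. -/
lemma exists_coefficients {n : ℕ} {D : Fin n → Pt → Pt} (hD : ∀ i, SmoothOn O (D i)) (hDs : ∀ i, Stationary (D i))
    (hspan : ∀ x ∈ O, Submodule.span ℝ (range fun i => D i x) = ⊤) {X : Pt → Pt} (hX : SmoothOn O X) (hXs : Stationary X) :
    ∃ c : Fin n → Pt → ℝ, (∀ i, SmoothOn O (c i)) ∧ (∀ i, Stationary (c i)) ∧ ∀ x ∈ O, X x = ∑ i, c i x • D i x := by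
  obtain ⟨A, hA⟩ : ∃ A : Pt → Matrix (Fin 4) (Fin n) ℝ, A = fun x => Matrix.of fun μ i => D i x μ := ⟨_, rfl⟩
  obtain ⟨G, hG⟩ : ∃ G : Pt → Matrix (Fin 4) (Fin 4) ℝ, G = fun x => A x * (A x).transpose := ⟨_, rfl⟩
  have hAs : ∀ (s : ℝ) x, A (x + s • TField x) = A x := fun s x => by
    rw [hA]
    ext μ i
    simp only [Matrix.of_apply, hDs i s x]
  have hdet : ∀ x ∈ O, (G x).det ≠ 0 := by
    intro x hx
    have hinj : Function.Injective (A x).vecMul := by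
      refine (injective_iff_map_eq_zero (Matrix.vecMulLinear (A x))).2 ?_
      intro v hv
      have h1 : ∀ i, ∑ μ, v μ * D i x μ = 0 := fun i => by
        have := congr_fun hv i
        simpa [Matrix.vecMul, dotProduct, hA] using this
      obtain ⟨φ, hφ⟩ : ∃ φ : Pt →ₗ[ℝ] ℝ, φ = ∑ μ, v μ • LinearMap.proj μ := ⟨_, rfl⟩
      have h2 : Submodule.span ℝ (range fun i => D i x) ≤ LinearMap.ker φ := by
        rw [Submodule.span_le]
        rintro _ ⟨i, rfl⟩
        simpa [hφ] using h1 i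
      rw [hspan x hx] at h2
      ext μ
      have h3 : φ (Pi.single μ 1) = 0 := LinearMap.mem_ker.1 (h2 trivial)
      simpa [hφ, Pi.single_apply] using h3
    have := Matrix.PosDef.mul_conjTranspose_self (A x) hinj
    rw [hG]
    simpa using this.det_pos.ne'
  refine ⟨fun i x => ∑ μ, A x μ i * ∑ ν, (G x)⁻¹ μ ν * X x ν, ?_, ?_, ?_⟩
  · intro i x hx
    have cA : ∀ μ i, ContDiffAt ℝ ∞ (fun y => A y μ i) x := fun μ i => by
      rw [hA]; exact contDiffAt_pi.1 (hD i x hx) μ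
    have cG : ∀ μ ν, ContDiffAt ℝ ∞ (fun y => G y μ ν) x := fun μ ν => by
      rw [hG]
      simp only [Matrix.mul_apply, Matrix.transpose_apply]
      exact ContDiffAt.sum fun i _ => (cA μ i).mul (cA ν i)
    exact ContDiffAt.sum fun μ _ => (cA μ i).mul (ContDiffAt.sum fun ν _ =>
      (contDiffAt_inv_matrix cG (hdet x hx) μ ν).mul (contDiffAt_pi.1 (hX x hx) ν))
  · intro i s x
    have : G (x + s • TField x) = G x := by rw [hG]; simp only [hAs s x]
    simp only [hAs s x, this, hXs s x]
  · intro x hx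
    have h1 : (A x).mulVec ((A x).transpose.mulVec ((G x)⁻¹.mulVec (X x))) = X x := by
      rw [Matrix.mulVec_mulVec, Matrix.mulVec_mulVec, show A x * (A x).transpose = G x by rw [hG],
        Matrix.mul_nonsing_inv _ (isUnit_iff_ne_zero.2 (hdet x hx)), Matrix.one_mulVec]
    ext ρ
    conv_lhs => rw [← h1]
    simp only [Matrix.mulVec, dotProduct, Matrix.transpose_apply, Finset.sum_apply, Pi.smul_apply, smul_eq_mul]
    refine sum_congr rfl fun i _ => ?_
    rw [mul_comm]
    simp [hA]

end Linear

lemma mem_multiIdx {n N : ℕ} {κ : Fin n → ℕ} : κ ∈ multiIdx n N ↔ ∑ i, κ i < N := by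
  simp only [multiIdx, Finset.mem_filter, Fintype.mem_piFinset, Finset.mem_range, and_iff_right_iff_imp]
  exact fun h i => (Finset.single_le_sum (f := κ) (fun _ _ => Nat.zero_le _) (Finset.mem_univ i)).trans_lt h

/-- Smooth stationary coefficients. -/
structure IsCoef (U : Set Pt) (c : Pt → ℂ) : Prop where
  smooth : SmoothOn U c
  stationary : Stationary c

/-- Smooth stationary fields which span the tangent spaces. -/
structure IsFrame {N : ℕ} (U : Set Pt) (D : Fin N → Pt → Pt) : Prop where
  isOpen : IsOpen U
  smooth : ∀ i, SmoothOn U (D i)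
  stationary : ∀ i, Stationary (D i)
  span : ∀ x ∈ U, Submodule.span ℝ (range fun i => D i x) = ⊤

/-- Differential operators of order at most `n`, written in ordered products of the frame fields with
smooth stationary coefficients. -/
def IsOp {N : ℕ} (U : Set Pt) (D : Fin N → Pt → Pt) (n : ℕ) (P : (Pt → ℂ) → Pt → ℂ) : Prop :=
  ∃ c : (Fin N → ℕ) → Pt → ℂ, (∀ κ, IsCoef U (c κ)) ∧ ∀ O, IsOpen O → O ⊆ U → ∀ f, SmoothOn O f → ∀ x ∈ O,
    P f x = ∑ κ ∈ multiIdx N (n + 1), c κ x * multiDer D κ f x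

section

variable {U : Set Pt} {N n m : ℕ} {D : Fin N → Pt → Pt} {P Q : (Pt → ℂ) → Pt → ℂ} {c : Pt → ℂ} {X : Pt → Pt}

lemma isCoef_const (z : ℂ) : IsCoef U fun _ => z := ⟨fun _ _ => contDiffAt_const, fun _ _ => rfl⟩

lemma IsCoef.add {d : Pt → ℂ} (hc : IsCoef U c) (hd : IsCoef U d) : IsCoef U (fun x => c x + d x) :=
  ⟨hc.smooth.add hd.smooth, fun s x => by simp only [hc.stationary s x, hd.stationary s x]⟩

lemma IsCoef.mul {d : Pt → ℂ} (hc : IsCoef U c) (hd : IsCoef U d) : IsCoef U (fun x => c x * d x) :=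
  ⟨hc.smooth.mul hd.smooth, fun s x => by simp only [hc.stationary s x, hd.stationary s x]⟩

protected lemma IsCoef.vder (hc : IsCoef U c) (hX : SmoothOn U X) (hXs : Stationary X) : IsCoef U (vder X c) :=
  ⟨hX.vder hc.smooth, hXs.vder hc.stationary⟩

lemma IsCoef.ofReal {c : Pt → ℝ} (h : SmoothOn U c) (hs : Stationary c) : IsCoef U (fun x => (c x : ℂ)) :=
  ⟨fun x hx => Complex.ofRealCLM.contDiff.contDiffAt.comp x (h x hx), fun s x => by simp only [hs s x]⟩

lemma IsOp.congr (hP : IsOp U D n P) (h : ∀ O, IsOpen O → O ⊆ U → ∀ f, SmoothOn O f → ∀ x ∈ O, Q f x = P f x) : IsOp U D n Q := by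
  obtain ⟨c, hc, h'⟩ := hP
  exact ⟨c, hc, fun O hO hU f hf x hx => by rw [h O hO hU f hf x hx, h' O hO hU f hf x hx]⟩

lemma IsOp.mono (hP : IsOp U D n P) (h : n ≤ m) : IsOp U D m P := by
  obtain ⟨c, hc, h'⟩ := hP
  refine ⟨fun κ => if ∑ i, κ i < n + 1 then c κ else fun _ => 0, fun κ => ?_, fun O hO hU f hf x hx => ?_⟩
  · dsimp only
    split_ifs
    · exact hc κ
    · exact isCoef_const 0
  · rw [h' O hO hU f hf x hx]
    have hsub : multiIdx N (n + 1) ⊆ multiIdx N (m + 1) := fun κ hκ => mem_multiIdx.2 ((mem_multiIdx.1 hκ).trans_le (by omega))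
    rw [← Finset.sum_subset hsub]
    · exact sum_congr rfl fun κ hκ => by dsimp only; rw [if_pos (mem_multiIdx.1 hκ)]
    · intro κ _ hκ
      dsimp only
      rw [if_neg fun h => hκ (mem_multiIdx.2 h), zero_mul]

lemma IsOp.add (hP : IsOp U D n P) (hQ : IsOp U D n Q) : IsOp U D n (fun f x => P f x + Q f x) := by
  obtain ⟨c, hc, h⟩ := hP
  obtain ⟨d, hd, h'⟩ := hQ
  refine ⟨fun κ x => c κ x + d κ x, fun κ => (hc κ).add (hd κ), fun O hO hU f hf x hx => ?_⟩
  dsimp only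
  rw [h O hO hU f hf x hx, h' O hO hU f hf x hx, ← sum_add_distrib]
  exact sum_congr rfl fun κ _ => by ring

lemma IsOp.coef_mul (hP : IsOp U D n P) (hc : IsCoef U c) : IsOp U D n (fun f x => c x * P f x) := by
  obtain ⟨d, hd, h'⟩ := hP
  refine ⟨fun κ x => c x * d κ x, fun κ => hc.mul (hd κ), fun O hO hU f hf x hx => ?_⟩
  dsimp only
  rw [h' O hO hU f hf x hx, Finset.mul_sum]
  exact sum_congr rfl fun κ _ => by ring

lemma isOp_multiDer (κ : Fin N → ℕ) (h : ∑ i, κ i ≤ n) : IsOp U D n (multiDer D κ) := by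
  classical
  refine ⟨fun μ x => if μ = κ then 1 else 0, fun μ => isCoef_const _, fun O hO hU f hf x hx => ?_⟩
  simp only [ite_mul, one_mul, zero_mul, Finset.sum_ite_eq']
  rw [if_pos (mem_multiIdx.2 (by omega))]

lemma isOp_id : IsOp U D n (fun f => f) := by
  have := isOp_multiDer (U := U) (D := D) (n := n) 0 (by simp)
  exact this.congr fun O _ _ f _ x _ => by rw [multiDer_all_zero]

lemma isOp_zero : IsOp U D n (fun _ _ => 0) :=
  ⟨fun _ _ => 0, fun _ => isCoef_const 0, fun O hO hU f hf x hx => by simp⟩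

lemma IsOp.sum {ι : Type*} {s : Finset ι} {P : ι → (Pt → ℂ) → Pt → ℂ} (h : ∀ i ∈ s, IsOp U D n (P i)) :
    IsOp U D n (fun f x => ∑ i ∈ s, P i f x) := by
  classical
  induction s using Finset.induction_on with
  | empty => simpa using isOp_zero
  | insert i s hi ih =>
    simp only [Finset.sum_insert hi]
    exact (h i (Finset.mem_insert_self i s)).add (ih fun j hj => h j (Finset.mem_insert_of_mem hj))

lemma IsOp.smooth (hD : IsFrame U D) (hP : IsOp U D n P) {O : Set Pt} (hO : IsOpen O) (hU : O ⊆ U) {f : Pt → ℂ} (hf : SmoothOn O f) :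
    SmoothOn O (P f) := by
  obtain ⟨c, hc, h⟩ := hP
  refine SmoothOn.congr hO ?_ fun y hy => h O hO hU f hf y hy
  exact SmoothOn.sum fun κ _ => ((hc κ).smooth.mono hU).mul (SmoothOn.multiDer (fun i => (hD.smooth i).mono hU) hf κ)

lemma vder_congr_on {O : Set Pt} (hO : IsOpen O) {f g : Pt → ℂ} (h : ∀ y ∈ O, f y = g y) {x : Pt} (hx : x ∈ O) :
    vder X f x = vder X g x := vder_congr (by filter_upwards [hO.mem_nhds hx] with y hy using h y hy)

lemma vder_sum {ι : Type*} {s : Finset ι} {f : ι → Pt → ℂ} {x : Pt} (h : ∀ i ∈ s, DifferentiableAt ℝ (f i) x) :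
    vder X (fun y => ∑ i ∈ s, f i y) x = ∑ i ∈ s, vder X (f i) x := by
  simp only [vder]
  rw [fderiv_fun_sum h]
  simp

/-- The composition of a field with an operator, provided the frame products are known to compose. -/
lemma IsOp.vder_of (hD : IsFrame U D)
    (hyp : ∀ κ, ∑ i, κ i ≤ n → ∀ i, IsOp U D (n + 1) (fun f => vder (D i) (multiDer D κ f)))
    (hP : IsOp U D n P) (hX : SmoothOn U X) (hXs : Stationary X) : IsOp U D (n + 1) (fun f => vder X (P f)) := by
  obtain ⟨e, he, hes, hX'⟩ := exists_coefficients hD.smooth hD.stationary hD.span hX hXs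
  obtain ⟨c, hc, h⟩ := hP
  have key : IsOp U D (n + 1) (fun f x => ∑ κ ∈ multiIdx N (n + 1), (vder X (c κ) x * multiDer D κ f x
      + c κ x * ∑ i, (e i x : ℂ) * vder (D i) (multiDer D κ f) x)) := by
    refine IsOp.sum fun κ hκ => ?_
    have hκ' : ∑ i, κ i ≤ n := by have := mem_multiIdx.1 hκ; omega
    exact ((isOp_multiDer κ (by omega)).coef_mul ((hc κ).vder hX hXs)).add
      ((IsOp.sum fun i _ => (hyp κ hκ' i).coef_mul (IsCoef.ofReal (he i) (hes i))).coef_mul (hc κ))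
  refine key.congr fun O hO hU f hf x hx => ?_
  have hm : ∀ κ, SmoothOn O (multiDer D κ f) := fun κ => SmoothOn.multiDer (fun i => (hD.smooth i).mono hU) hf κ
  rw [vder_congr_on hO (h O hO hU f hf) hx, vder_sum fun κ _ => (((hc κ).smooth.mono hU).mul (hm κ)).differentiableAt hx]
  refine sum_congr rfl fun κ _ => ?_
  rw [vder_fun_mul (((hc κ).smooth.mono hU).differentiableAt hx) ((hm κ).differentiableAt hx)]
  congr 2
  simp only [vder]
  rw [hX' x (hU hx)]
  simp

/-- Prepending a frame field to an ordered product changes it, up to lower order, into an ordered product. -/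
lemma IsFrame.prepend (hD : IsFrame U D) (κ : Fin N → ℕ) (i : Fin N) :
    ∃ R, IsOp U D (∑ i, κ i) R ∧ ∀ O, IsOpen O → O ⊆ U → ∀ f, SmoothOn O f → ∀ x ∈ O,
      vder (D i) (multiDer D κ f) x = multiDer D (κ + Pi.single i 1) f x + R f x := by
  classical
  obtain ⟨n, hn⟩ : ∃ n, n = ∑ i, κ i := ⟨_, rfl⟩
  rw [← hn]
  induction n using Nat.strong_induction_on generalizing κ i with
  | _ n ih =>
  by_cases h0 : ∀ l < i, κ l = 0
  · exact ⟨fun _ _ => 0, isOp_zero, fun O _ _ f _ x _ => by rw [multiDer_add_single D κ h0, add_zero]⟩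
  push Not at h0
  obtain ⟨l0, hl0, hκl0⟩ := h0
  obtain ⟨j, hj, hjmin⟩ : ∃ j, κ j ≠ 0 ∧ ∀ l < j, κ l = 0 := by
    obtain ⟨j, hj, hmin⟩ := WellFounded.has_min (wellFounded_lt (α := Fin N)) {l | κ l ≠ 0} ⟨l0, hκl0⟩
    exact ⟨j, hj, fun l hl => by by_contra h; exact hmin l h hl⟩
  have hji : j < i := lt_of_le_of_lt (by by_contra h; exact hκl0 (hjmin l0 (not_le.1 h))) hl0
  obtain ⟨κ', hκ'⟩ : ∃ κ', κ' = κ - Pi.single j 1 := ⟨_, rfl⟩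
  have hκe : κ = κ' + Pi.single j 1 := by
    rw [hκ']; ext l
    by_cases hl : l = j
    · subst hl; simp; omega
    · simp [hl]
  have hκ'0 : ∀ l < j, κ' l = 0 := fun l hl => by rw [hκ']; simp [hjmin l hl]
  have hsum : ∑ l, κ l = ∑ l, κ' l + 1 := by rw [hκe]; simp [sum_add_distrib]
  obtain ⟨k, hk⟩ : ∃ k, k = ∑ l, κ' l := ⟨_, rfl⟩
  have hnk : n = k + 1 := by omega
  have hyp : ∀ μ : Fin N → ℕ, ∑ i, μ i ≤ k → ∀ i, IsOp U D (k + 1) (fun f => vder (D i) (multiDer D μ f)) := by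
    intro μ hμ l
    obtain ⟨R, hR, hR'⟩ := ih (∑ i, μ i) (by omega) μ l rfl
    have h1 : IsOp U D (k + 1) (multiDer D (μ + Pi.single l 1)) := isOp_multiDer _ (by simp [sum_add_distrib]; omega)
    exact (h1.add (hR.mono (by omega))).congr hR'
  obtain ⟨R, hR, hR'⟩ := ih k (by omega) κ' i hk
  have hbs : SmoothOn U (bracket (D i) (D j)) := (hD.smooth i).bracket (hD.smooth j)
  have hbt : Stationary (bracket (D i) (D j)) := (hD.stationary i).bracket (hD.stationary j)
  refine ⟨fun f x => vder (D j) (R f) x + vder (bracket (D i) (D j)) (multiDer D κ' f) x, ?_, ?_⟩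
  · rw [hnk]
    exact (IsOp.vder_of hD hyp hR (hD.smooth j) (hD.stationary j)).add (IsOp.vder_of hD hyp (isOp_multiDer κ' hk.ge) hbs hbt)
  · intro O hO hU f hf x hx
    have hm : ∀ κ, SmoothOn O (multiDer D κ f) := fun κ => SmoothOn.multiDer (fun i => (hD.smooth i).mono hU) hf κ
    have e1 : multiDer D κ f = vder (D j) (multiDer D κ' f) := by rw [hκe]; exact multiDer_add_single D κ' hκ'0 f
    have e2 : multiDer D (κ + Pi.single i 1) f = vder (D j) (multiDer D (κ' + Pi.single i 1) f) := by
      rw [hκe, add_right_comm]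
      refine multiDer_add_single D _ (fun l hl => ?_) f
      simp [hκ'0 l hl, (hl.trans hji).ne]
    rw [e1, e2, vder_comm ((hD.smooth i).mono hU |>.differentiableAt hx) ((hD.smooth j).mono hU |>.differentiableAt hx)
      ((hm κ' x hx).of_le (WithTop.coe_le_coe.2 le_top)), vder_congr_on hO (hR' O hO hU f hf) hx,
      vder_fun_add ((hm _).differentiableAt hx) ((hR.smooth hD hO hU hf).differentiableAt hx)]
    ring

/-- The composition of a smooth stationary field with an operator. -/
protected lemma IsOp.vder (hD : IsFrame U D) (hP : IsOp U D n P) (hX : SmoothOn U X) (hXs : Stationary X) :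
    IsOp U D (n + 1) (fun f => vder X (P f)) := by
  refine IsOp.vder_of hD (fun μ hμ l => ?_) hP hX hXs
  obtain ⟨R, hR, hR'⟩ := hD.prepend μ l
  have h1 : IsOp U D (n + 1) (multiDer D (μ + Pi.single l 1)) := isOp_multiDer _ (by simp [sum_add_distrib]; omega)
  exact (h1.add (hR.mono (by omega))).congr hR'

end

/-- Operators `Q` of order `n` whose commutator with the multiplication by a function `C` of time is a sum of derivatives
of `C` times operators of lower order. -/
def IsLeibniz {N : ℕ} (U : Set Pt) (D : Fin N → Pt → Pt) (n : ℕ) (Q : (Pt → ℂ) → Pt → ℂ) : Prop :=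
  IsOp U D n Q ∧ ∃ Ql : ℕ → (Pt → ℂ) → Pt → ℂ, (∀ l m, n = m + 1 → IsOp U D m (Ql l)) ∧ (∀ l, n ≤ l → Ql l = fun _ _ => 0) ∧
    ∀ O, IsOpen O → O ⊆ U → ∀ f, SmoothOn O f → ∀ C : ℝ → ℝ, ContDiff ℝ ∞ C → ∀ x ∈ O,
      Q (fun y => (C (y 0) : ℂ) * f y) x
        = (C (x 0) : ℂ) * Q f x + ∑ l ∈ Finset.range n, ((iteratedDeriv (l + 1) C (x 0) : ℝ) : ℂ) * Ql l f x

section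

variable {U : Set Pt} {N n m : ℕ} {D : Fin N → Pt → Pt} {P Q : (Pt → ℂ) → Pt → ℂ} {c : Pt → ℂ} {X : Pt → Pt}

lemma isLeibniz_id : IsLeibniz U D 0 (fun f => f) :=
  ⟨isOp_id, fun _ _ _ => 0, fun l m h => by omega, fun _ _ => rfl, fun O _ _ f _ C _ x _ => by simp⟩

lemma IsLeibniz.add (hP : IsLeibniz U D n P) (hQ : IsLeibniz U D n Q) : IsLeibniz U D n (fun f x => P f x + Q f x) := by
  obtain ⟨h1, Pl, hPl, hPz, hP'⟩ := hP
  obtain ⟨h2, Ql, hQl, hQz, hQ'⟩ := hQ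
  refine ⟨h1.add h2, fun l f x => Pl l f x + Ql l f x, fun l m h => (hPl l m h).add (hQl l m h), fun l hl => ?_, ?_⟩
  · funext f x
    simp [hPz l hl, hQz l hl]
  · intro O hO hU f hf C hC x hx
    dsimp only
    rw [hP' O hO hU f hf C hC x hx, hQ' O hO hU f hf C hC x hx]
    simp only [mul_add, sum_add_distrib]
    ring

lemma IsLeibniz.coef_mul (hP : IsLeibniz U D n P) (hc : IsCoef U c) : IsLeibniz U D n (fun f x => c x * P f x) := by
  obtain ⟨h1, Pl, hPl, hPz, hP'⟩ := hP
  refine ⟨h1.coef_mul hc, fun l f x => c x * Pl l f x, fun l m h => (hPl l m h).coef_mul hc, fun l hl => ?_, ?_⟩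
  · funext f x
    simp [hPz l hl]
  · intro O hO hU f hf C hC x hx
    dsimp only
    rw [hP' O hO hU f hf C hC x hx, mul_add, Finset.mul_sum]
    congr 1
    · ring
    · exact sum_congr rfl fun l _ => by ring

lemma vder_time {C : ℝ → ℝ} {x : Pt} (h : DifferentiableAt ℝ C (x 0)) :
    DifferentiableAt ℝ (fun y : Pt => (C (y 0) : ℂ)) x ∧
      vder X (fun y => (C (y 0) : ℂ)) x = ((deriv C (x 0) : ℝ) : ℂ) * (X x 0 : ℂ) := by
  have h1 : HasFDerivAt (fun y : Pt => C (y 0)) _ x := h.hasDerivAt.comp_hasFDerivAt x (hasFDerivAt_apply (𝕜 := ℝ) (F' := fun _ => ℝ) 0 x)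
  refine ⟨Complex.ofRealCLM.differentiableAt.comp x h1.differentiableAt, ?_⟩
  rw [vder_ofReal h1.differentiableAt, h1.fderiv]
  simp

lemma contDiff_iteratedDeriv {C : ℝ → ℝ} (hC : ContDiff ℝ ∞ C) (l : ℕ) : ContDiff ℝ ∞ (iteratedDeriv l C) := by
  induction l with
  | zero => simpa using hC
  | succ l ih => rw [iteratedDeriv_succ]; exact (contDiff_infty_iff_deriv.1 ih).2

protected lemma IsLeibniz.vder (hD : IsFrame U D) (hQ : IsLeibniz U D n Q) (hX : SmoothOn U X) (hXs : Stationary X) :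
    IsLeibniz U D (n + 1) (fun f => vder X (Q f)) := by
  obtain ⟨h1, Ql, hQl, hQz, hQ'⟩ := hQ
  have hXQ : ∀ l, IsOp U D n (fun f => vder X (Ql l f)) := by
    intro l
    rcases n with _ | n
    · rw [show Ql l = fun _ _ => 0 from hQz l (Nat.zero_le _)]
      exact isOp_zero.congr fun O _ _ f _ x _ => by simp [vder]
    · exact (hQl l n rfl).vder hD hX hXs
  have hQn : ∀ l, IsOp U D n (Ql l) := by
    intro l
    rcases n with _ | n
    · rw [show Ql l = fun _ _ => 0 from hQz l (Nat.zero_le _)]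
      exact isOp_zero
    · exact (hQl l n rfl).mono (by omega)
  have ht : IsCoef U (fun x => (X x 0 : ℂ)) := IsCoef.ofReal (fun x hx => contDiffAt_pi.1 (hX x hx) 0) (fun s x => by simp only [hXs s x])
  refine ⟨h1.vder hD hX hXs, fun l f x => vder X (Ql l f) x + (X x 0 : ℂ) * (match l with | 0 => Q f x | l + 1 => Ql l f x),
    fun l m h => ?_, fun l hl => ?_, ?_⟩
  · obtain rfl : n = m := by omega
    rcases l with _ | l
    · exact (hXQ 0).add (h1.coef_mul ht)
    · exact (hXQ (l + 1)).add ((hQn l).coef_mul ht)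
  · rcases l with _ | l
    · omega
    · funext f x
      simp [hQz l (by omega), hQz (l + 1) (by omega), vder]
  · intro O hO hU f hf C hC x hx
    have hCl : ∀ l y, DifferentiableAt ℝ (iteratedDeriv l C) y := fun l y => ((contDiff_iteratedDeriv hC l).differentiable (by simp)) y
    have hC0 : DifferentiableAt ℝ C (x 0) := by simpa using hCl 0 (x 0)
    have dQ : DifferentiableAt ℝ (Q f) x := (h1.smooth hD hO hU hf).differentiableAt hx
    have dQl : ∀ l, DifferentiableAt ℝ (Ql l f) x := fun l => ((hQn l).smooth hD hO hU hf).differentiableAt hx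
    dsimp only
    rw [vder_congr_on hO (hQ' O hO hU f hf C hC) hx,
      vder_fun_add ((vder_time (X := X) hC0).1.fun_mul dQ)
        (DifferentiableAt.fun_sum fun l _ => (vder_time (X := X) (hCl (l + 1) (x 0))).1.fun_mul (dQl l)),
      vder_fun_mul (vder_time (X := X) hC0).1 dQ, (vder_time hC0).2,
      vder_sum fun l _ => (vder_time (X := X) (hCl (l + 1) (x 0))).1.fun_mul (dQl l)]
    have e1 : ∀ l, vder X (fun y => ((iteratedDeriv (l + 1) C (y 0) : ℝ) : ℂ) * Ql l f y) x
        = ((iteratedDeriv (l + 1 + 1) C (x 0) : ℝ) : ℂ) * ((X x 0 : ℂ) * Ql l f x)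
          + ((iteratedDeriv (l + 1) C (x 0) : ℝ) : ℂ) * vder X (Ql l f) x := fun l => by
      rw [vder_fun_mul (vder_time (X := X) (hCl (l + 1) (x 0))).1 (dQl l), (vder_time (hCl (l + 1) (x 0))).2,
        iteratedDeriv_succ (n := l + 1)]
      ring
    have e2 : ∑ l ∈ Finset.range n, ((iteratedDeriv (l + 1) C (x 0) : ℝ) : ℂ) * vder X (Ql l f) x
        = ∑ l ∈ Finset.range n, ((iteratedDeriv (l + 1 + 1) C (x 0) : ℝ) : ℂ) * vder X (Ql (l + 1) f) x
          + ((iteratedDeriv 1 C (x 0) : ℝ) : ℂ) * vder X (Ql 0 f) x := by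
      have h3 := Finset.sum_range_succ' (fun l => ((iteratedDeriv (l + 1) C (x 0) : ℝ) : ℂ) * vder X (Ql l f) x) n
      rw [Finset.sum_range_succ, hQz n le_rfl] at h3
      simpa [vder] using h3
    simp only [e1, sum_add_distrib]
    rw [e2, Finset.sum_range_succ']
    simp only [mul_add, sum_add_distrib, zero_add, iteratedDeriv_one]
    ring

lemma IsLeibniz.vder_iterate (hD : IsFrame U D) (hQ : IsLeibniz U D n Q) (hX : SmoothOn U X) (hXs : Stationary X) (i : ℕ) :
    IsLeibniz U D (i + n) (fun f => (vder X)^[i] (Q f)) := by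
  induction i with
  | zero => simpa using hQ
  | succ i ih =>
    have := ih.vder hD hX hXs
    rw [show i + 1 + n = i + n + 1 by omega]
    simpa only [Function.iterate_succ_apply'] using this

end

namespace KerrSetup

variable {M a : ℝ} (K : KerrSetup M a)

/-- The region `r > r₀`. -/
def exterior : Set Pt := {x | K.r0 < rad x}

lemma r0_pos (ha : |a| < M) : 0 < K.r0 := by
  have h1 := K.params.1
  have hM := mass_pos ha
  have h2 : √(M ^ 2 - a ^ 2) ≤ M := by
    rw [Real.sqrt_le_left hM.le]
    nlinarith [sq_nonneg a]
  unfold rMinus at h1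
  linarith

lemma exterior_rad_pos (ha : |a| < M) {x : Pt} (hx : x ∈ K.exterior) : 0 < rad x := (K.r0_pos ha).trans hx

lemma stationary_rad : Stationary rad := fun s x => by simp [rad, TField]

lemma stationary_Om (k : Fin 3) : Stationary (Om k) := fun s x => by fin_cases k <;> simp [Om, TField]

lemma stationary_TField : Stationary TField := fun _ _ => rfl

lemma isFrame_DT (ha : |a| < M) : IsFrame K.exterior K.DT := by
  have hpos : ∀ x ∈ K.exterior, rMinus M a < rad x := fun x hx => K.params.1.trans hx
  have hop : IsOpen {x : Pt | rMinus M a < rad x} := isOpen_lt continuous_const continuous_rad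
  refine ⟨isOpen_lt continuous_const continuous_rad, fun i x hx => ?_, fun i => ?_, fun x hx => ?_⟩
  · fin_cases i
    · exact K.L_smooth.contDiffAt (hop.mem_nhds (hpos x hx))
    · exact K.Lb_smooth.contDiffAt (hop.mem_nhds (hpos x hx))
    · exact contDiffAt_Om 0
    · exact contDiffAt_Om 1
    · exact contDiffAt_Om 2
  · fin_cases i
    · exact K.L_inv.1
    · exact K.Lb_inv.1
    · exact stationary_Om 0
    · exact stationary_Om 1
    · exact stationary_Om 2
  · rw [← K.L_span x (le_of_lt hx)]
    congr 1
    ext v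
    simp [DT, Fin.exists_fin_succ, eq_comm]
    tauto

lemma IsCoef.bounded (ha : |a| < M) {c : Pt → ℂ} (hc : IsCoef K.exterior c) (ρ : ℝ) :
    ∃ B : ℝ, ∀ x, rPlus M a ≤ rad x → rad x ≤ ρ → ‖c x‖ ≤ B := by
  obtain ⟨S, hS⟩ : ∃ S : Set Pt, S = {x | x 0 = 0 ∧ rPlus M a ≤ rad x ∧ rad x ≤ ρ} := ⟨_, rfl⟩
  have hSc : IsCompact S := by
    refine Metric.isCompact_of_isClosed_isBounded ?_ ?_
    · rw [hS]
      exact (isClosed_eq (continuous_apply 0) continuous_const).inter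
        ((isClosed_le continuous_const continuous_rad).inter (isClosed_le continuous_rad continuous_const))
    · refine (Metric.isBounded_closedBall (x := (0 : Pt)) (r := |ρ|)).subset fun x hx => ?_
      rw [hS] at hx
      obtain ⟨h0, -, h2⟩ := hx
      have h3 : rad x ^ 2 ≤ ρ ^ 2 := by have : 0 ≤ rad x := Real.sqrt_nonneg _; nlinarith
      rw [rad_sq] at h3
      rw [mem_closedBall_zero_iff, pi_norm_le_iff_of_nonneg (abs_nonneg ρ)]
      intro i
      rw [norm_eq_abs]
      refine sq_le_sq.1 ?_
      fin_cases i
      · simp [h0]; positivity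
      all_goals simp; nlinarith [sq_nonneg (x 1), sq_nonneg (x 2), sq_nonneg (x 3)]
  have hcc : ContinuousOn c S := fun x hx => by
    rw [hS] at hx
    exact (hc.smooth x (K.params.2.1.trans_le hx.2.1)).continuousAt.continuousWithinAt
  obtain ⟨B, hB⟩ := hSc.exists_bound_of_continuousOn hcc
  refine ⟨B, fun x h1 h2 => ?_⟩
  have h3 := hB (x + (-(x 0)) • TField x) (by
    rw [hS]
    refine ⟨by simp [TField], ?_⟩
    rw [stationary_rad]
    exact ⟨h1, h2⟩)
  rwa [hc.stationary] at h3

/-- Operators are dominated by the ordered products of the spanning fields. -/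
lemma IsOp.bound (ha : |a| < M) {n : ℕ} {P : (Pt → ℂ) → Pt → ℂ} (hP : IsOp K.exterior K.DT n P) (ρ : ℝ) :
    ∃ B : ℝ, 0 ≤ B ∧ ∀ O, IsOpen O → O ⊆ K.exterior → ∀ f, SmoothOn O f → ∀ x ∈ O, rPlus M a ≤ rad x → rad x ≤ ρ →
      ‖P f x‖ ^ 2 ≤ B * ∑ κ ∈ multiIdx 5 (n + 1), ‖multiDer K.DT κ f x‖ ^ 2 := by
  obtain ⟨c, hc, h⟩ := hP
  choose B hB using fun κ => IsCoef.bounded K ha (hc κ) ρ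
  refine ⟨∑ κ ∈ multiIdx 5 (n + 1), B κ ^ 2, Finset.sum_nonneg fun κ _ => sq_nonneg _, fun O hO hU f hf x hx h1 h2 => ?_⟩
  rw [h O hO hU f hf x hx]
  calc _ ≤ (∑ κ ∈ multiIdx 5 (n + 1), B κ * ‖multiDer K.DT κ f x‖) ^ 2 := by
        refine pow_le_pow_left₀ (norm_nonneg _) ((norm_sum_le _ _).trans (sum_le_sum fun κ _ => ?_)) 2
        rw [norm_mul]
        exact mul_le_mul_of_nonneg_right (hB κ x h1 h2) (norm_nonneg _)
    _ ≤ _ := Finset.sum_mul_sq_le_sq_mul_sq _ _ _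

lemma isLeibniz_kerrWave (ha : |a| < M) (κ : Fin 2 → ℕ) :
    IsLeibniz K.exterior K.DT (κ 0 + (κ 1 + 2)) (fun f => multiDer ![TField, Om 0] κ (kerrWave M a K.p K.q f)) := by
  have hD := K.isFrame_DT ha
  have hr : ∀ {x : Pt}, x ∈ K.exterior → 0 < rad x := fun hx => K.exterior_rad_pos ha hx
  have sX : SmoothOn K.exterior (radialField K.p K.q) := fun x hx => contDiffAt_radialField (hr hx)
    (K.p_smooth.contDiffAt (Ioi_mem_nhds (K.params.1.trans hx))) (K.q_smooth.contDiffAt (Ioi_mem_nhds (K.params.1.trans hx)))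
  have sW : SmoothOn K.exterior (nullField a) := fun x hx => contDiffAt_nullField (hr hx)
  have sT : SmoothOn K.exterior TField := fun x _ => contDiffAt_TField
  have sO : ∀ k, SmoothOn K.exterior (Om k) := fun k x _ => contDiffAt_Om k
  have tX : Stationary (radialField K.p K.q) := fun s x => by
    unfold radialField; rw [stationary_rad s x]; simp [TField]
  have tW : Stationary (nullField a) := fun s x => by
    unfold nullField; rw [stationary_rad s x]; simp [TField]
  have cΔ : IsCoef K.exterior (fun x => ((Del M a (rad x) : ℝ) : ℂ)) :=
    IsCoef.ofReal (fun x hx => contDiffAt_Del_rad (hr hx)) (fun s x => by simp only [stationary_rad s x])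
  have cs : IsCoef K.exterior (fun x => ((a ^ 2 * sinSq x : ℝ) : ℂ)) :=
    IsCoef.ofReal (fun x hx => contDiffAt_const.mul (contDiffAt_sinSq (hr hx)))
      (fun s x => by simp only [sinSq, stationary_rad s x]; simp [TField])
  have d1 : ∀ {X : Pt → Pt}, SmoothOn K.exterior X → Stationary X → IsLeibniz K.exterior K.DT 1 (fun f => vder X f) :=
    fun hX hXs => isLeibniz_id.vder hD hX hXs
  have main : IsLeibniz K.exterior K.DT 2 (kerrWave M a K.p K.q) := by
    have h1 := ((((d1 sX tX).coef_mul cΔ).add (d1 sW tW)).vder hD sX tX)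
    have h2 := (d1 sX tX).vder hD sW tW
    have h3 := fun k => (d1 (sO k) (stationary_Om k)).vder hD (sO k) (stationary_Om k)
    have h4 := (((d1 sT stationary_TField).coef_mul cs).add ((d1 (sO 0) (stationary_Om 0)).coef_mul (isCoef_const (a : ℂ)))).vder hD sT stationary_TField
    have h5 := ((d1 sT stationary_TField).coef_mul (isCoef_const (a : ℂ))).vder hD (sO 0) (stationary_Om 0)
    have h6 := ((((h1.add h2).add (((h3 0).add (h3 1)).add (h3 2))).add h4).add h5)
    convert h6 using 1
    funext f x
    simp only [kerrWave, Fin.sum_univ_three]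
  have := (main.vder_iterate hD (sO 0) (stationary_Om 0) (κ 1)).vder_iterate hD sT stationary_TField (κ 0)
  simpa only [multiDer_two] using this

end KerrSetup

section

variable {O : Set Pt} {b f g : Pt → ℂ} {X : Pt → Pt} {x : Pt}

lemma vder_iterate_congr_on (hO : IsOpen O) (h : ∀ y ∈ O, f y = g y) (n : ℕ) :
    ∀ x ∈ O, (vder X)^[n] f x = (vder X)^[n] g x := by
  induction n with
  | zero => exact h
  | succ n ih =>
    intro x hx
    rw [Function.iterate_succ_apply', Function.iterate_succ_apply']
    exact vder_congr_on hO ih hx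

lemma multiDer_congr_on {n : ℕ} {X : Fin n → Pt → Pt} (hO : IsOpen O) (h : ∀ y ∈ O, f y = g y) (κ : Fin n → ℕ) :
    ∀ x ∈ O, multiDer X κ f x = multiDer X κ g x := by
  induction n with
  | zero => exact h
  | succ n ih =>
    rw [multiDer_succ, multiDer_succ]
    exact vder_iterate_congr_on hO (ih _) _

lemma vder_iterate_mul (hO : IsOpen O) (hX : SmoothOn O X) (hb : SmoothOn O b) (hg : SmoothOn O g) (h : ∀ y ∈ O, vder X b y = 0)
    (n : ℕ) : ∀ x ∈ O, (vder X)^[n] (fun y => b y * g y) x = b x * (vder X)^[n] g x := by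
  induction n with
  | zero => exact fun _ _ => rfl
  | succ n ih =>
    intro x hx
    rw [Function.iterate_succ_apply', Function.iterate_succ_apply', vder_congr_on hO ih hx,
      vder_fun_mul (hb.differentiableAt hx) ((hX.vder_iterate hg n).differentiableAt hx), h x hx, zero_mul, zero_add]

lemma vder_TField_eq_zero (hf : DifferentiableAt ℝ f x) (hs : Stationary f) : vder TField f x = 0 := by
  have h2 : HasDerivAt (fun s : ℝ => f (x + s • TField x)) (fderiv ℝ f x (TField x)) 0 := by
    have h3 : HasFDerivAt f (fderiv ℝ f x) (x + (0 : ℝ) • TField x) := by simpa using hf.hasFDerivAt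
    have h4 : HasDerivAt (fun s : ℝ => x + s • TField x) (TField x) 0 := by
      simpa using ((hasDerivAt_id (0 : ℝ)).smul_const (TField x)).const_add x
    exact h3.comp_hasDerivAt 0 h4
  rw [show (fun s : ℝ => f (x + s • TField x)) = fun _ => f x from funext fun s => hs s x] at h2
  exact h2.unique (hasDerivAt_const _ _)

lemma vder_Om_eq_zero (hf : DifferentiableAt ℝ f x) (hs : ∀ s x, f (rotAxis s x) = f x) : vder (Om 0) f x = 0 := by
  have h2 : HasDerivAt (fun s : ℝ => f (rotAxis s x)) (fderiv ℝ f x (Om 0 x)) 0 := by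
    have h0 : rotAxis 0 x = x := by ext i; fin_cases i <;> simp [rotAxis]
    have h3 : HasFDerivAt f (fderiv ℝ f x) (rotAxis 0 x) := by rw [h0]; exact hf.hasFDerivAt
    have h4 : HasDerivAt (fun s : ℝ => rotAxis s x) (Om 0 x) 0 := by
      rw [hasDerivAt_pi]
      intro i
      fin_cases i
      · exact hasDerivAt_const _ _
      · exact (((Real.hasDerivAt_cos 0).mul_const (x 1)).sub ((Real.hasDerivAt_sin 0).mul_const (x 2))).congr_deriv (by simp [Om])
      · exact (((Real.hasDerivAt_sin 0).mul_const (x 1)).add ((Real.hasDerivAt_cos 0).mul_const (x 2))).congr_deriv (by simp [Om])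
      · exact hasDerivAt_const _ _
    exact h3.comp_hasDerivAt 0 h4
  rw [show (fun s : ℝ => f (rotAxis s x)) = fun _ => f x from funext fun s => hs s x] at h2
  exact h2.unique (hasDerivAt_const _ _)

lemma rad_rotAxis (s : ℝ) (x : Pt) : rad (rotAxis s x) = rad x := by
  unfold rad rotAxis
  congr 1
  simp
  linear_combination (x 1 ^ 2 + x 2 ^ 2) * Real.sin_sq_add_cos_sq s

lemma contDiffAt_rhoSq (a : ℝ) (hx : 0 < rad x) : ContDiffAt ℝ ∞ (rhoSq a) x := by
  unfold rhoSq
  exact ((contDiffAt_rad hx).pow 2).add (contDiffAt_const.mul (ContDiffAt.div (by fun_prop) ((contDiffAt_rad hx).pow 2) (by positivity)))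

lemma multiDer_rhoSq_mul (a : ℝ) (hO : IsOpen O) (hpos : ∀ y ∈ O, 0 < rad y) (hg : SmoothOn O g) (κ : Fin 2 → ℕ) (hx : x ∈ O) :
    multiDer ![TField, Om 0] κ (fun y => (rhoSq a y : ℂ) * g y) x = (rhoSq a x : ℂ) * multiDer ![TField, Om 0] κ g x := by
  have hb : SmoothOn O (fun y => (rhoSq a y : ℂ)) := fun y hy => KerrSetup.contDiffAt_ofReal (contDiffAt_rhoSq a (hpos y hy))
  have sT : SmoothOn O TField := fun x _ => KerrSetup.contDiffAt_TField
  have sO : SmoothOn O (Om 0) := fun x _ => KerrSetup.contDiffAt_Om 0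
  rw [multiDer_two, multiDer_two]
  rw [vder_iterate_congr_on hO (vder_iterate_mul hO sO hb hg (fun y hy => vder_Om_eq_zero (hb.differentiableAt hy) fun s z => by
    rw [rhoSq, rhoSq, rad_rotAxis]; simp [rotAxis]) (κ 1)) (κ 0) x hx]
  exact vder_iterate_mul hO sT hb (sO.vder_iterate hg _) (fun y hy => vder_TField_eq_zero (hb.differentiableAt hy) fun s z => by
    rw [rhoSq, rhoSq, KerrSetup.stationary_rad]; simp [TField]) (κ 0) x hx

end

namespace KerrSetup

variable {M a : ℝ} (K : KerrSetup M a)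

lemma Rpot_lt_R (ha : |a| < M) : 0 < K.R := by
  obtain ⟨h1, -, -, h4⟩ := radii_order ha K
  linarith

lemma tau_eq (x : Pt) (hx : rad x ≤ K.R) : K.tau x = x 0 := by simp [tau, hSigma, hx]

/-- The squared temporal cutoff. -/
def cutoffSq (t0 t1 t : ℝ) : ℝ := K.cutoff t0 t1 t ^ 2

lemma contDiff_cutoffSq (t0 t1 : ℝ) : ContDiff ℝ ∞ (K.cutoffSq t0 t1) :=
  ((K.rise_smooth.1.comp (contDiff_id.sub contDiff_const)).mul (K.rise_smooth.2.comp (contDiff_const.sub contDiff_id))).pow 2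

lemma cutoffSq_mem (t0 t1 t : ℝ) : K.cutoffSq t0 t1 t ∈ Icc (0 : ℝ) 1 := by
  obtain ⟨⟨h1, h2⟩, -⟩ := K.rise_range (t - t0)
  obtain ⟨-, h3, h4⟩ := K.rise_range (t1 - t)
  refine ⟨sq_nonneg _, ?_⟩
  exact pow_le_one₀ (mul_nonneg h1 h3) (mul_le_one₀ h2 h3 h4)

lemma cutoffSq_eq_zero {t0 t1 t : ℝ} (h : t ≤ t0 ∨ t1 ≤ t) : K.cutoffSq t0 t1 t = 0 := by
  rcases h with h | h
  · simp [cutoffSq, cutoff, (K.rise_eq.1 (t - t0) (by linarith)).1]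
  · simp [cutoffSq, cutoff, (K.rise_eq.1 (t1 - t) (by linarith)).2]

lemma cutPsi_eq {t0 t1 : ℝ} {ψ : Pt → ℂ} {x : Pt} (hx : rad x ≤ K.R) :
    K.cutPsi t0 t1 ψ x = (K.cutoffSq t0 t1 (x 0) : ℂ) * ψ x := by
  simp [cutPsi, cutoffSq, K.tau_eq x hx]

lemma isSlab_cutPsi (ha : |a| < M) {t0 t1 : ℝ} {ψ : Pt → ℂ}
    (hψ : ∃ U : Set Pt, IsOpen U ∧ K.region t0 t1 ⊆ U ∧ ContDiffOn ℝ ∞ ψ U) : K.IsSlab t0 t1 (K.cutPsi t0 t1 ψ) := by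
  obtain ⟨U, hU, hsub, hψ⟩ := hψ
  have hR := K.Rpot_lt_R ha
  have hle : ∀ x ∈ K.shell, rad x ≤ K.R := fun x hx => by have := hx.2; linarith
  have hev : ∀ x ∈ K.shell, K.cutPsi t0 t1 ψ =ᶠ[𝓝 x] fun y => (K.cutoffSq t0 t1 (y 0) : ℂ) * ψ y := fun x hx => by
    filter_upwards [K.isOpen_shell.mem_nhds hx] with y hy using K.cutPsi_eq (hle y hy)
  have hout : ∀ t, t ∉ Icc t0 t1 → t < t0 ∨ t1 < t := fun t ht => by
    by_contra h; push Not at h; exact ht ⟨h.1, h.2⟩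
  refine ⟨fun x hx => ?_, fun x hx hx0 => ?_⟩
  · by_cases h : x 0 ∈ Icc t0 t1
    · have hxU : x ∈ U := hsub ⟨(K.params.2.1.trans hx.1).le, by rw [K.tau_eq x (hle x hx)]; exact h.1, by
        rw [K.tau_eq x (hle x hx)]; exact h.2⟩
      refine ContDiffAt.congr_of_eventuallyEq ?_ (hev x hx)
      refine ContDiffAt.mul (contDiffAt_ofReal ?_) (hψ.contDiffAt (hU.mem_nhds hxU))
      exact (K.contDiff_cutoffSq t0 t1).contDiffAt.comp x (by fun_prop)
    · have h0 : K.cutPsi t0 t1 ψ =ᶠ[𝓝 x] fun _ => 0 := by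
        have hopen : ∀ᶠ y : Pt in 𝓝 x, y 0 < t0 ∨ t1 < y 0 :=
          ((isOpen_lt (continuous_apply (0 : Fin 4)) continuous_const).union
            (isOpen_lt continuous_const (continuous_apply (0 : Fin 4)))).mem_nhds (hout _ h)
        filter_upwards [hev x hx, hopen] with y h1 h2
        rw [h1, K.cutoffSq_eq_zero (h2.imp le_of_lt le_of_lt)]
        simp
      exact contDiffAt_const.congr_of_eventuallyEq h0
  · rw [K.cutPsi_eq (hle x hx), K.cutoffSq_eq_zero ((hout _ hx0).imp le_of_lt le_of_lt)]
    simp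

lemma iteratedDeriv_cutoffSq_bound (l : ℕ) : ∃ B : ℝ, 0 ≤ B ∧ ∀ t0 t1, t0 + 2 ≤ t1 → ∀ t ∈ Ioo t0 t1,
    |iteratedDeriv (l + 1) (K.cutoffSq t0 t1) t| ≤ B ∧
      (t0 + 1 / 2 < t → t < t1 - 1 / 2 → iteratedDeriv (l + 1) (K.cutoffSq t0 t1) t = 0) := by
  obtain ⟨f, hf⟩ : ∃ f : ℝ → ℝ, f = fun s => K.rise s ^ 2 := ⟨_, rfl⟩
  obtain ⟨g, hg⟩ : ∃ g : ℝ → ℝ, g = fun s => K.fall (-s) ^ 2 := ⟨_, rfl⟩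
  have hfs : ContDiff ℝ ∞ f := by rw [hf]; exact K.rise_smooth.1.pow 2
  have hgs : ContDiff ℝ ∞ g := by rw [hg]; exact (K.rise_smooth.2.comp contDiff_neg).pow 2
  obtain ⟨B1, hB1⟩ := (isCompact_Icc (a := (0 : ℝ)) (b := 1 / 2)).exists_bound_of_continuousOn
    (contDiff_iteratedDeriv hfs (l + 1)).continuous.continuousOn
  obtain ⟨B2, hB2⟩ := (isCompact_Icc (a := (-(1 / 2) : ℝ)) (b := 0)).exists_bound_of_continuousOn
    (contDiff_iteratedDeriv hgs (l + 1)).continuous.continuousOn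
  have hconst : ∀ {h : ℝ → ℝ} {t : ℝ}, h =ᶠ[𝓝 t] (fun _ => 1) → iteratedDeriv (l + 1) h t = 0 := fun hh => by
    rw [hh.iteratedDeriv_eq, iteratedDeriv_const]; simp
  refine ⟨max 0 (max B1 B2), le_max_left _ _, fun t0 t1 hτ t ht => ?_⟩
  rcases lt_or_ge t (t1 - 1 / 2) with h | h
  · have hev : K.cutoffSq t0 t1 =ᶠ[𝓝 t] fun s => f (s - t0) := by
      filter_upwards [Iio_mem_nhds h] with s hs
      have hs' : s < t1 - 1 / 2 := hs
      simp [cutoffSq, cutoff, (K.rise_eq.2 (t1 - s) (by linarith)).2, hf]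
    rw [hev.iteratedDeriv_eq, iteratedDeriv_comp_sub_const]
    have hz : 1 / 2 < t - t0 → iteratedDeriv (l + 1) f (t - t0) = 0 := fun h1 => hconst (by
      filter_upwards [Ioi_mem_nhds h1] with s hs
      have hs' : 1 / 2 < s := hs
      simp [hf, (K.rise_eq.2 s hs'.le).1])
    refine ⟨?_, fun h1 _ => hz (by linarith)⟩
    rcases lt_or_ge (1 / 2) (t - t0) with h1 | h1
    · simp [hz h1]
    · exact (hB1 (t - t0) ⟨by linarith [ht.1], h1⟩).trans ((le_max_left _ _).trans (le_max_right _ _))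
  · have hev : K.cutoffSq t0 t1 =ᶠ[𝓝 t] fun s => g (s - t1) := by
      filter_upwards [Ioi_mem_nhds (show t0 + 1 / 2 < t by linarith)] with s hs
      have hs' : t0 + 1 / 2 < s := hs
      simp [cutoffSq, cutoff, (K.rise_eq.2 (s - t0) (by linarith)).1, hg]
    rw [hev.iteratedDeriv_eq, iteratedDeriv_comp_sub_const]
    refine ⟨?_, fun _ h1 => absurd h1 (not_lt.2 h)⟩
    exact (hB2 (t - t1) ⟨by linarith, by linarith [ht.2]⟩).trans ((le_max_right _ _).trans (le_max_right _ _))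

/-- The part of the shell strictly between the times `t0` and `t1`. -/
def openSlab (t0 t1 : ℝ) : Set Pt := {x | x ∈ K.shell ∧ t0 < x 0 ∧ x 0 < t1}

lemma isOpen_openSlab (t0 t1 : ℝ) : IsOpen (K.openSlab t0 t1) :=
  K.isOpen_shell.inter ((isOpen_lt continuous_const (continuous_apply 0)).inter (isOpen_lt (continuous_apply 0) continuous_const))

lemma openSlab_subset_exterior (t0 t1 : ℝ) : K.openSlab t0 t1 ⊆ K.exterior := fun x hx => K.params.2.1.trans hx.1.1

lemma openSlab_subset_region (ha : |a| < M) (t0 t1 : ℝ) : K.openSlab t0 t1 ⊆ K.region t0 t1 := fun x hx => by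
  have hR := K.Rpot_lt_R ha
  have : rad x ≤ K.R := by have := hx.1.2; linarith
  exact ⟨(K.openSlab_subset_exterior t0 t1 hx).le, by rw [K.tau_eq x this]; exact hx.2.1.le, by rw [K.tau_eq x this]; exact hx.2.2.le⟩

lemma kerrWave_eq_rhoSq_mul (ha : |a| < M) {t0 t1 : ℝ} {ψ F : Pt → ℂ} (hψ : SmoothOn (K.openSlab t0 t1) ψ)
    (hF : ∀ x ∈ K.region t0 t1, K.box ψ x = F x) {x : Pt} (hx : x ∈ K.openSlab t0 t1) (hs : x 1 ^ 2 + x 2 ^ 2 ≠ 0) :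
    kerrWave M a K.p K.q ψ x = (rhoSq a x : ℂ) * F x := by
  have h0 := shell_rad_pos ha hx.1
  have hr : K.rBL =ᶠ[𝓝 x] rad := by
    filter_upwards [K.isOpen_shell.mem_nhds hx.1] with y hy using K.rBL_eq y hy.2.le
  rw [← hF x (K.openSlab_subset_region ha t0 t1 hx)]
  exact (rhoSq_mul_boxOp h0 hs hr (contDiffAt_p ha hx.1.1) (contDiffAt_q ha hx.1.1)
    ((hψ x hx).of_le (WithTop.coe_le_coe.2 le_top))).symm

/-- The multi-index of `T^{κ0} Ω₁^{κ1}` among the commutation fields. -/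
def liftIdx (κ : Fin 2 → ℕ) : Fin 8 → ℕ := ![κ 0, κ 1, 0, 0, 0, 0, 0, 0]

lemma multiDer_DF (κ : Fin 2 → ℕ) (F : Pt → ℂ) :
    multiDer K.DF (liftIdx κ) F = multiDer ![TField, Om 0] κ F := by
  rw [multiDer_two]
  simp [multiDer, List.finRange_succ, DF, liftIdx]

open Classical in
/-- The wave operator applied to the cut-off function: the source, and terms carried by the supports of the derivatives of the
cutoff. -/
theorem commuted_source_bound (ha : |a| < M) (κ : Fin 2 → ℕ) : ∃ B : ℝ, 0 ≤ B ∧ ∀ t0 t1, t0 + 2 ≤ t1 → ∀ ψ F : Pt → ℂ,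
    (∃ U : Set Pt, IsOpen U ∧ K.region t0 t1 ⊆ U ∧ ContDiffOn ℝ ∞ ψ U) → (∀ x ∈ K.region t0 t1, K.box ψ x = F x) →
    ∀ x ∈ K.openSlab t0 t1, rad x ≤ 1.3 * K.Rpot → x 1 ^ 2 + x 2 ^ 2 ≠ 0 →
      ‖multiDer ![TField, Om 0] κ (kerrWave M a K.p K.q (K.cutPsi t0 t1 ψ)) x‖ ^ 2
        ≤ B * (‖multiDer K.DF (liftIdx κ) F x‖ ^ 2
          + if x 0 ≤ t0 + 1 / 2 ∨ t1 - 1 / 2 ≤ x 0 then ∑ μ ∈ multiIdx 5 (κ 0 + κ 1 + 2), ‖multiDer K.DT μ ψ x‖ ^ 2 else 0) := by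
  obtain ⟨n, hn⟩ : ∃ n, n = κ 0 + (κ 1 + 2) := ⟨_, rfl⟩
  obtain ⟨-, Ql, hQl, -, hexp⟩ := K.isLeibniz_kerrWave ha κ
  choose B hB0 hB using fun l => IsOp.bound K ha (hQl l (κ 0 + κ 1 + 1) (by omega)) (1.3 * K.Rpot)
  choose D hD0 hD using K.iteratedDeriv_cutoffSq_bound
  obtain ⟨E, hE⟩ : ∃ E, E = ((1.3 * K.Rpot) ^ 2 + a ^ 2) ^ 2 := ⟨_, rfl⟩
  have hE0 : 0 ≤ E := by rw [hE]; positivity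
  obtain ⟨S, hS⟩ : ∃ S, S = ∑ l ∈ Finset.range n, D l ^ 2 * B l := ⟨_, rfl⟩
  have hS0 : 0 ≤ S := by rw [hS]; exact Finset.sum_nonneg fun l _ => mul_nonneg (sq_nonneg _) (hB0 l)
  refine ⟨2 * E + 2 * n * S, by positivity, ?_⟩
  intro t0 t1 hτ ψ F hψ hF x hx hρ hs
  have hsm : SmoothOn (K.openSlab t0 t1) ψ := by
    obtain ⟨U, hU, hsub, hψ⟩ := hψ
    exact fun y hy => hψ.contDiffAt (hU.mem_nhds (hsub (K.openSlab_subset_region ha t0 t1 hy)))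
  have hR := K.Rpot_lt_R ha
  -- the expansion
  have e1 : multiDer ![TField, Om 0] κ (kerrWave M a K.p K.q (K.cutPsi t0 t1 ψ)) x
      = multiDer ![TField, Om 0] κ (kerrWave M a K.p K.q (fun y => (K.cutoffSq t0 t1 (y 0) : ℂ) * ψ y)) x := by
    have hcut : ∀ y ∈ K.openSlab t0 t1, K.cutPsi t0 t1 ψ y = (K.cutoffSq t0 t1 (y 0) : ℂ) * ψ y := fun y hy =>
      K.cutPsi_eq (by have := hy.1.2; linarith)
    have hO := K.isOpen_openSlab t0 t1
    have hv : ∀ {f g : Pt → ℂ} (X : Pt → Pt), (∀ y ∈ K.openSlab t0 t1, f y = g y) → ∀ y ∈ K.openSlab t0 t1, vder X f y = vder X g y :=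
      fun X h y hy => vder_congr_on hO h hy
    refine multiDer_congr_on hO (fun y hy => ?_) κ x hx
    unfold kerrWave
    refine congr_arg₂ _ (congr_arg₂ _ (congr_arg₂ _ (congr_arg₂ _ ?_ ?_) ?_) ?_) ?_
    · exact hv _ (fun z hz => by rw [hv _ hcut z hz, hv _ hcut z hz]) y hy
    · exact hv _ (hv _ hcut) y hy
    · exact sum_congr rfl fun k _ => hv _ (hv _ hcut) y hy
    · exact hv _ (fun z hz => by rw [hv _ hcut z hz, hv _ hcut z hz]) y hy
    · exact hv _ (fun z hz => by rw [hv _ hcut z hz]) y hy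
  have e2 := hexp _ (K.isOpen_openSlab t0 t1) (K.openSlab_subset_exterior t0 t1) ψ hsm _ (K.contDiff_cutoffSq t0 t1) x hx
  -- the source
  have e3 : multiDer ![TField, Om 0] κ (kerrWave M a K.p K.q ψ) x
      = (rhoSq a x : ℂ) * multiDer ![TField, Om 0] κ F x := by
    obtain ⟨O, hO⟩ : ∃ O, O = K.openSlab t0 t1 ∩ {y | y 1 ^ 2 + y 2 ^ 2 ≠ 0} := ⟨_, rfl⟩
    have hOo : IsOpen O := by
      rw [hO]; exact (K.isOpen_openSlab t0 t1).inter (isOpen_ne_fun (by fun_prop) continuous_const)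
    have hxO : x ∈ O := by rw [hO]; exact ⟨hx, hs⟩
    have heq : ∀ y ∈ O, kerrWave M a K.p K.q ψ y = (rhoSq a y : ℂ) * F y := fun y hy => by
      rw [hO] at hy; exact K.kerrWave_eq_rhoSq_mul ha hsm hF hy.1 hy.2
    have hpos : ∀ y ∈ O, 0 < rad y := fun y hy => by rw [hO] at hy; exact shell_rad_pos ha hy.1.1
    have hFs : SmoothOn O F := by
      have hk : SmoothOn O (kerrWave M a K.p K.q ψ) := by
        have h0 : IsOp K.exterior K.DT _ _ := (K.isLeibniz_kerrWave ha 0).1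
        simp only [multiDer_all_zero] at h0
        refine h0.smooth (K.isFrame_DT ha) hOo ?_ (hsm.mono ?_)
        · rw [hO]; exact inter_subset_left.trans (K.openSlab_subset_exterior t0 t1)
        · rw [hO]; exact inter_subset_left
      have hinv : SmoothOn O (fun y => (((rhoSq a y)⁻¹ : ℝ) : ℂ)) := fun y hy =>
        contDiffAt_ofReal ((contDiffAt_rhoSq a (hpos y hy)).inv (rhoSq_pos a (hpos y hy)).ne')
      refine (hinv.mul hk).congr hOo fun y hy => ?_
      rw [heq y hy]
      have : (rhoSq a y : ℂ) ≠ 0 := by exact_mod_cast (rhoSq_pos a (hpos y hy)).ne'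
      push_cast
      field_simp
    rw [multiDer_congr_on hOo heq κ x hxO]
    exact multiDer_rhoSq_mul a hOo hpos hFs κ hxO
  obtain ⟨A, hA⟩ : ∃ A, A = multiDer ![TField, Om 0] κ F x := ⟨_, rfl⟩
  obtain ⟨W, hW⟩ : ∃ W, W = ∑ μ ∈ multiIdx 5 (κ 0 + κ 1 + 2), ‖multiDer K.DT μ ψ x‖ ^ 2 := ⟨_, rfl⟩
  have hW0 : 0 ≤ W := by rw [hW]; exact Finset.sum_nonneg fun _ _ => sq_nonneg _
  dsimp only at e2
  rw [e1, e2, e3, multiDer_DF, ← hA, ← hW, ← hn]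
  obtain ⟨G, hG⟩ : ∃ G, G = ∑ l ∈ Finset.range n, ((iteratedDeriv (l + 1) (K.cutoffSq t0 t1) (x 0) : ℝ) : ℂ) * Ql l ψ x := ⟨_, rfl⟩
  have hG2 : ‖G‖ ^ 2 ≤ n * S * (if x 0 ≤ t0 + 1 / 2 ∨ t1 - 1 / 2 ≤ x 0 then W else 0) := by
    split_ifs with hl
    · calc ‖G‖ ^ 2 ≤ (∑ l ∈ Finset.range n, D l * ‖Ql l ψ x‖) ^ 2 := by
            refine pow_le_pow_left₀ (norm_nonneg _) ?_ 2
            rw [hG]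
            refine (norm_sum_le _ _).trans (sum_le_sum fun l _ => ?_)
            rw [norm_mul, Complex.norm_real]
            exact mul_le_mul_of_nonneg_right (hD l t0 t1 hτ (x 0) ⟨hx.2.1, hx.2.2⟩).1 (norm_nonneg _)
        _ ≤ n * ∑ l ∈ Finset.range n, (D l * ‖Ql l ψ x‖) ^ 2 := by
            have := sq_sum_le_card_mul_sum_sq (s := Finset.range n) (f := fun l => D l * ‖Ql l ψ x‖)
            simpa using this
        _ ≤ n * ∑ l ∈ Finset.range n, D l ^ 2 * B l * W := by
            refine mul_le_mul_of_nonneg_left (sum_le_sum fun l _ => ?_) (Nat.cast_nonneg n)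
            rw [mul_pow, mul_assoc]
            refine mul_le_mul_of_nonneg_left ?_ (sq_nonneg _)
            rw [hW]
            exact hB l _ (K.isOpen_openSlab t0 t1) (K.openSlab_subset_exterior t0 t1) ψ hsm x hx hx.1.1.le hρ
        _ = n * S * W := by rw [hS, ← Finset.sum_mul]; ring
    · push Not at hl
      have : G = 0 := by
        rw [hG]
        refine Finset.sum_eq_zero fun l _ => ?_
        rw [(hD l t0 t1 hτ (x 0) ⟨hx.2.1, hx.2.2⟩).2 hl.1 hl.2]
        simp
      simp [this]
  have hA2 : ‖(K.cutoffSq t0 t1 (x 0) : ℂ) * ((rhoSq a x : ℂ) * A)‖ ^ 2 ≤ E * ‖A‖ ^ 2 := by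
    obtain ⟨c0, c1⟩ := K.cutoffSq_mem t0 t1 (x 0)
    have hx0 := shell_rad_pos ha hx.1
    have hρ' : rhoSq a x ≤ (1.3 * K.Rpot) ^ 2 + a ^ 2 := by
      unfold rhoSq
      have h1 : x 3 ^ 2 / rad x ^ 2 ≤ 1 := by
        rw [div_le_one (by positivity), rad_sq]; nlinarith [sq_nonneg (x 1), sq_nonneg (x 2)]
      have h2 : rad x ^ 2 ≤ (1.3 * K.Rpot) ^ 2 := by gcongr
      nlinarith [sq_nonneg a]
    rw [norm_mul, norm_mul, Complex.norm_real, Complex.norm_real, Real.norm_of_nonneg c0, Real.norm_of_nonneg (rhoSq_pos a hx0).le,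
      mul_pow, mul_pow, hE]
    have h3 : K.cutoffSq t0 t1 (x 0) ^ 2 ≤ 1 := pow_le_one₀ c0 c1
    have h4 : rhoSq a x ^ 2 ≤ ((1.3 * K.Rpot) ^ 2 + a ^ 2) ^ 2 := pow_le_pow_left₀ (rhoSq_pos a hx0).le hρ' 2
    calc _ ≤ 1 * (((1.3 * K.Rpot) ^ 2 + a ^ 2) ^ 2 * ‖A‖ ^ 2) := by gcongr
      _ = _ := one_mul _
  rw [← hG]
  obtain ⟨I, hI⟩ : ∃ I : ℝ, I = if x 0 ≤ t0 + 1 / 2 ∨ t1 - 1 / 2 ≤ x 0 then W else 0 := ⟨_, rfl⟩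
  have hI0 : 0 ≤ I := by rw [hI]; split_ifs <;> simp [hW0]
  rw [← hI] at hG2 ⊢
  obtain ⟨V, hV⟩ : ∃ V, V = (K.cutoffSq t0 t1 (x 0) : ℂ) * ((rhoSq a x : ℂ) * A) := ⟨_, rfl⟩
  rw [← hV] at hA2 ⊢
  have hn0 : (0 : ℝ) ≤ n := Nat.cast_nonneg n
  calc ‖V + G‖ ^ 2 ≤ (‖V‖ + ‖G‖) ^ 2 := pow_le_pow_left₀ (norm_nonneg _) (norm_add_le _ _) 2
    _ ≤ 2 * ‖V‖ ^ 2 + 2 * ‖G‖ ^ 2 := by nlinarith [sq_nonneg (‖V‖ - ‖G‖)]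
    _ ≤ 2 * (E * ‖A‖ ^ 2) + 2 * (n * S * I) := by linarith
    _ ≤ _ := by
        have i1 : 0 ≤ E * I := mul_nonneg hE0 hI0
        have i2 : 0 ≤ n * S * ‖A‖ ^ 2 := by positivity
        nlinarith

end KerrSetup

lemma ae_off_axis_four : ∀ᵐ x : Pt, x 1 ^ 2 + x 2 ^ 2 ≠ 0 := by
  have h : ∀ᵐ x : Pt, x 1 ≠ 0 := Measure.ae_eval_ne (fun _ : Fin 4 => (volume : Measure ℝ)) 1 0
  filter_upwards [h] with x hx
  positivity

lemma ae_off_axis_three : ∀ᵐ y : Fin 3 → ℝ, y 0 ^ 2 + y 1 ^ 2 ≠ 0 := by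
  have h : ∀ᵐ y : Fin 3 → ℝ, y 0 ≠ 0 := Measure.ae_eval_ne (fun _ : Fin 3 => (volume : Measure ℝ)) 0 0
  filter_upwards [h] with y hy
  positivity

lemma cons_eq_vec (s : ℝ) (z : Fin 3 → ℝ) : (Fin.cons s z : Pt) = ![s, z 0, z 1, z 2] := by
  ext i; fin_cases i <;> rfl

namespace KerrSetup

variable {M a : ℝ} (K : KerrSetup M a)

open Classical in
/-- The integrand of the energy. -/
def energyDensity (f : Pt → ℂ) (x : Pt) : ℝ :=
  K.sqL f x + sqAng f x + (if rad x ≤ K.R then K.sqLb f x else 0) + (rad x ^ 2)⁻¹ * ‖f x‖ ^ 2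

lemma energy_eq (k : ℕ) (ψ : Pt → ℂ) (τ : ℝ) :
    K.energy k ψ τ = ∑ κ ∈ multiIdx 5 (k + 1), K.sliceInt τ (K.energyDensity (multiDer K.DT κ ψ)) := rfl

lemma sqAng_nonneg (f : Pt → ℂ) (x : Pt) : 0 ≤ sqAng f x := Finset.sum_nonneg fun i _ => by positivity

lemma energyDensity_nonneg (f : Pt → ℂ) (x : Pt) : 0 ≤ K.energyDensity f x := by
  have := sqAng_nonneg f x
  unfold energyDensity sqL sqLb
  split_ifs <;> positivity

/-- Every derivative of order at most `k + 1` is controlled by the energy density of order `k`. -/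
lemma exists_energyDensity_bound (k : ℕ) {μ : Fin 5 → ℕ} (hμ : μ ∈ multiIdx 5 (k + 2)) {ρ : ℝ} (hρ : ρ ≤ K.R) :
    ∃ ν ∈ multiIdx 5 (k + 1), ∀ ψ x, 0 < rad x → rad x ≤ ρ →
      ‖multiDer K.DT μ ψ x‖ ^ 2 ≤ (1 + ρ ^ 2) * K.energyDensity (multiDer K.DT ν ψ) x := by
  have hμ' := mem_multiIdx.1 hμ
  by_cases hk : ∑ i, μ i < k + 1
  · refine ⟨μ, mem_multiIdx.2 hk, fun ψ x h0 h1 => ?_⟩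
    obtain ⟨f, hf⟩ : ∃ f, f = multiDer K.DT μ ψ := ⟨_, rfl⟩
    rw [← hf]
    have h2 : (rad x ^ 2)⁻¹ * ‖f x‖ ^ 2 ≤ K.energyDensity f x := by
      have := sqAng_nonneg f x
      unfold energyDensity sqL sqLb
      split_ifs <;> nlinarith [sq_nonneg ‖vder K.L f x‖, sq_nonneg ‖vder K.Lb f x‖]
    calc ‖f x‖ ^ 2 = rad x ^ 2 * ((rad x ^ 2)⁻¹ * ‖f x‖ ^ 2) := by field_simp
      _ ≤ ρ ^ 2 * K.energyDensity f x := by gcongr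
      _ ≤ _ := by nlinarith [K.energyDensity_nonneg f x]
  · have hne : ∃ j, μ j ≠ 0 := by
      by_contra h
      push Not at h
      simp [h] at hk
    obtain ⟨j, hj, hjmin⟩ : ∃ j, μ j ≠ 0 ∧ ∀ l < j, μ l = 0 := by
      obtain ⟨j, hj, hmin⟩ := WellFounded.has_min (wellFounded_lt (α := Fin 5)) {l | μ l ≠ 0} hne
      exact ⟨j, hj, fun l hl => by by_contra h; exact hmin l h hl⟩
    obtain ⟨ν, hν⟩ : ∃ ν, ν = μ - Pi.single j 1 := ⟨_, rfl⟩
    have hμe : μ = ν + Pi.single j 1 := by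
      rw [hν]; ext l
      by_cases hl : l = j
      · subst hl; simp; omega
      · simp [hl]
    have hν0 : ∀ l < j, ν l = 0 := fun l hl => by rw [hν]; simp [hjmin l hl]
    have hsum : ∑ l, μ l = ∑ l, ν l + 1 := by rw [hμe]; simp [sum_add_distrib]
    refine ⟨ν, mem_multiIdx.2 (by omega), fun ψ x h0 h1 => ?_⟩
    rw [hμe, multiDer_add_single _ _ hν0]
    obtain ⟨f, hf⟩ : ∃ f, f = multiDer K.DT ν ψ := ⟨_, rfl⟩
    rw [← hf]
    have hang := sqAng_nonneg f x
    have hen := K.energyDensity_nonneg f x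
    have i1 : (rad x ^ 2)⁻¹ * ‖f x‖ ^ 2 ≥ 0 := by positivity
    have i2 : K.sqL f x ≥ 0 := sq_nonneg _
    have i3 : K.sqLb f x ≥ 0 := sq_nonneg _
    have hed : K.energyDensity f x = K.sqL f x + sqAng f x + K.sqLb f x + (rad x ^ 2)⁻¹ * ‖f x‖ ^ 2 := by
      rw [energyDensity, if_pos (h1.trans hρ)]
    have hΩ : ∀ i : Fin 3, ‖vder (Om i) f x‖ ^ 2 ≤ (1 + ρ ^ 2) * K.energyDensity f x := by
      intro i
      have h2 : (rad x ^ 2)⁻¹ * ‖vder (Om i) f x‖ ^ 2 ≤ sqAng f x :=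
        Finset.single_le_sum (f := fun i : Fin 3 => (rad x ^ 2)⁻¹ * ‖vder (Om i) f x‖ ^ 2) (fun _ _ => by positivity) (Finset.mem_univ i)
      calc _ = rad x ^ 2 * ((rad x ^ 2)⁻¹ * ‖vder (Om i) f x‖ ^ 2) := by field_simp
        _ ≤ ρ ^ 2 * K.energyDensity f x := by
          refine mul_le_mul (by gcongr) (h2.trans (by rw [hed]; linarith)) (by positivity) (by positivity)
        _ ≤ _ := by nlinarith
    have hone : K.energyDensity f x ≤ (1 + ρ ^ 2) * K.energyDensity f x := by nlinarith [mul_nonneg (sq_nonneg ρ) hen]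
    fin_cases j
    · refine le_trans ?_ hone
      show K.sqL f x ≤ _
      rw [hed]; linarith
    · refine le_trans ?_ hone
      show K.sqLb f x ≤ _
      rw [hed]; linarith
    · exact hΩ 0
    · exact hΩ 1
    · exact hΩ 2

lemma gMat_inv_zero_zero (ha : |a| < M) {x : Pt} (hx : 0 < rad x) (hR : rad x < K.R / 2) (hs : x 1 ^ 2 + x 2 ^ 2 ≠ 0) :
    -(K.gMat x)⁻¹ 0 0 = (rhoSq a x)⁻¹ * (2 * K.p (rad x) * (rad x ^ 2 + a ^ 2) - Del M a (rad x) * K.p (rad x) ^ 2 - a ^ 2 * sinSq x)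
      ∧ volDensity K.gMat x = rhoSq a x / rad x ^ 2 := by
  have hr : K.rBL =ᶠ[𝓝 x] rad := by
    filter_upwards [(isOpen_lt continuous_rad continuous_const).mem_nhds hR] with y hy using K.rBL_eq y (le_of_lt hy)
  refine ⟨?_, volDensity_kerrMatrix hx hs hr⟩
  rw [show (K.gMat x)⁻¹ 0 0 = _ from kerrMatrix_inv hx hs hr 0 0]
  simp [kerrCometric, radialField, nullField, Om, TField, Fin.sum_univ_three]
  ring

/-- The induced volume of the slices is bounded below. -/
lemma sliceDensity_lower (ha : |a| < M) {ρ : ℝ} (hρ : ρ < K.R / 2) : ∃ c : ℝ, 0 < c ∧ ∀ x, rPlus M a ≤ rad x → rad x ≤ ρ →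
    x 1 ^ 2 + x 2 ^ 2 ≠ 0 → c ≤ K.sliceDensity x := by
  have hp := rPlus_pos ha
  have hR := K.Rpot_lt_R ha
  obtain ⟨N, hN⟩ : ∃ N : ℝ → ℝ, N = fun r => 2 * K.p r * (r ^ 2 + a ^ 2) - Del M a r * K.p r ^ 2 - a ^ 2 := ⟨_, rfl⟩
  have hpc : ContinuousOn K.p (Icc (rPlus M a) ρ) := fun r hr =>
    (K.p_smooth.contDiffAt (Ioi_mem_nhds ((rMinus_lt_rPlus ha).trans_le hr.1))).continuousAt.continuousWithinAt
  have hNc : ContinuousOn N (Icc (rPlus M a) ρ) := by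
    rw [hN]; unfold Del
    fun_prop
  have hNpos : ∀ r ∈ Icc (rPlus M a) ρ, 0 < N r := by
    intro r hr
    have hr0 : 0 < r := hp.trans_le hr.1
    obtain ⟨x, hx⟩ : ∃ x : Pt, x = ![0, r, 0, 0] := ⟨_, rfl⟩
    have hrad : rad x = r := by rw [hx]; simp [rad, Real.sqrt_sq hr0.le]
    have hs : x 1 ^ 2 + x 2 ^ 2 ≠ 0 := by rw [hx]; simp; positivity
    have h1 := K.spacelike x (by rw [hrad]; exact K.params.2.1.le.trans hr.1) (by rw [hrad]; linarith [hr.2])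
    obtain ⟨h2, -⟩ := K.gMat_inv_zero_zero ha (x := x) (by rw [hrad]; exact hr0) (by rw [hrad]; linarith [hr.2]) hs
    have hsin : sinSq x = 1 := by rw [sinSq, hrad, hx]; simp [hr0.ne']
    have h3 : 0 < -(K.gMat x)⁻¹ 0 0 := by linarith [show (K.gMat x)⁻¹ 0 0 < 0 from h1]
    rw [h2, hrad, hsin, mul_one] at h3
    have h4 := pos_of_mul_pos_right h3 (inv_nonneg.2 (rhoSq_pos a (x := x) (by rw [hrad]; exact hr0)).le)
    rw [hN]; exact h4
  rcases le_or_gt (rPlus M a) ρ with hle | hlt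
  swap
  · exact ⟨1, one_pos, fun x h1 h2 _ => absurd (h1.trans h2) (not_le.2 hlt)⟩
  obtain ⟨r₁, hr₁, hmin⟩ := isCompact_Icc.exists_isMinOn (nonempty_Icc.2 hle) hNc
  have hn0 := hNpos r₁ hr₁
  have hρ0 : 0 < ρ := hp.trans_le hle
  refine ⟨√(N r₁) / ρ, by positivity, fun x h1 h2 hs => ?_⟩
  have hx0 : 0 < rad x := hp.trans_le h1
  have hρx := rhoSq_pos a hx0
  obtain ⟨e1, e2⟩ := K.gMat_inv_zero_zero ha hx0 (h2.trans_lt hρ) hs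
  have hs1 : sinSq x ≤ 1 := by
    unfold sinSq
    rw [div_le_one (by positivity), rad_sq]; nlinarith [sq_nonneg (x 3)]
  have h3 : N r₁ ≤ 2 * K.p (rad x) * (rad x ^ 2 + a ^ 2) - Del M a (rad x) * K.p (rad x) ^ 2 - a ^ 2 * sinSq x := by
    have h4 : N r₁ ≤ N (rad x) := hmin ⟨h1, h2⟩
    rw [hN] at h4 ⊢
    dsimp only at h4 ⊢
    nlinarith [sq_nonneg a]
  have hle : rad x ≤ K.R := by linarith
  rw [sliceDensity, if_pos hle, e1, e2]
  obtain ⟨Z, hZ⟩ : ∃ Z, Z = 2 * K.p (rad x) * (rad x ^ 2 + a ^ 2) - Del M a (rad x) * K.p (rad x) ^ 2 - a ^ 2 * sinSq x := ⟨_, rfl⟩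
  rw [← hZ] at h3 ⊢
  have hg : rad x ^ 2 ≤ rhoSq a x := by unfold rhoSq; have : 0 ≤ a ^ 2 * (x 3 ^ 2 / rad x ^ 2) := by positivity
                                        linarith
  have h5 : rhoSq a x * √((rhoSq a x)⁻¹ * Z) = √(rhoSq a x) * √Z := by
    rw [Real.sqrt_mul (inv_nonneg.2 hρx.le), Real.sqrt_inv, ← mul_assoc]
    congr 1
    rw [← div_eq_mul_inv, Real.div_sqrt]
  calc √(N r₁) / ρ ≤ √Z / rad x := div_le_div₀ (Real.sqrt_nonneg _) (Real.sqrt_le_sqrt h3) hx0 h2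
    _ = rad x * √Z / rad x ^ 2 := by field_simp
    _ ≤ √(rhoSq a x) * √Z / rad x ^ 2 := by
        gcongr
        exact Real.le_sqrt_of_sq_le hg
    _ = _ := by rw [← h5]; ring

/-- The two time layers which carry the derivatives of the cutoff. -/
def layer (t0 t1 : ℝ) : Set ℝ := Ioc t0 (t0 + 1 / 2) ∪ Ico (t1 - 1 / 2) t1

/-- The part of spacetime over the time layers with `r₊ < r ≤ ρ`. -/
def layerRegion (M a ρ t0 t1 : ℝ) : Set Pt := {x | x 0 ∈ layer t0 t1 ∧ rPlus M a < rad x ∧ rad x ≤ ρ}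

lemma measurableSet_layerRegion (ρ t0 t1 : ℝ) : MeasurableSet (layerRegion M a ρ t0 t1) :=
  ((measurable_pi_apply 0) (measurableSet_Ioc.union measurableSet_Ico)).inter
    ((measurableSet_lt measurable_const continuous_rad.measurable).inter (measurableSet_le continuous_rad.measurable measurable_const))

/-- Integrals over the time layers are controlled by the supremum of the energy. -/
lemma lintegral_layer_le (ha : |a| < M) (k : ℕ) : ∃ C : ℝ, 0 ≤ C ∧ ∀ t0 t1, t0 + 2 ≤ t1 → ∀ ψ : Pt → ℂ,
    ∀ μ ∈ multiIdx 5 (k + 2), ∫⁻ x in layerRegion M a (1.3 * K.Rpot) t0 t1, ofReal (‖multiDer K.DT μ ψ x‖ ^ 2)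
      ≤ ofReal C * ⨆ τ ∈ Icc t0 t1, K.energy k ψ τ := by
  obtain ⟨hRR, -, -, -⟩ := radii_order ha K
  obtain ⟨ρ, hρ⟩ : ∃ ρ, ρ = 1.3 * K.Rpot := ⟨_, rfl⟩
  rw [← hρ] at hRR ⊢
  have hR := K.Rpot_lt_R ha
  have hρR : ρ ≤ K.R := by linarith
  obtain ⟨c, hc, hcl⟩ := K.sliceDensity_lower ha hRR
  refine ⟨(1 + ρ ^ 2) * c⁻¹, by positivity, ?_⟩
  intro t0 t1 hτ ψ μ hμ
  obtain ⟨ν, hν, hdens⟩ := K.exists_energyDensity_bound k hμ hρR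
  obtain ⟨S, hS⟩ : ∃ S, S = ⨆ τ ∈ Icc t0 t1, K.energy k ψ τ := ⟨_, rfl⟩
  obtain ⟨L, hL⟩ : ∃ L, L = layerRegion M a ρ t0 t1 := ⟨_, rfl⟩
  obtain ⟨g, hg⟩ : ∃ g : Pt → ENNReal, g = fun x => ofReal (‖multiDer K.DT μ ψ x‖ ^ 2) := ⟨_, rfl⟩
  obtain ⟨f, hf⟩ : ∃ f, f = multiDer K.DT ν ψ := ⟨_, rfl⟩
  have hdens := hdens ψ
  rw [← hf] at hdens
  rw [← hS, ← hL, ← hg, ← lintegral_indicator (by rw [hL]; exact measurableSet_layerRegion ρ t0 t1)]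
  refine (lintegral_fin_succ_le _).trans ?_
  have hsup : ∀ s ∈ layer t0 t1, K.sliceInt s (K.energyDensity f) ≤ S := by
    intro s hs
    have hsI : s ∈ Icc t0 t1 := by
      rcases hs with hs | hs
      · exact ⟨hs.1.le, by linarith [hs.2]⟩
      · exact ⟨by linarith [hs.1], hs.2.le⟩
    have h1 : K.sliceInt s (K.energyDensity f) ≤ K.energy k ψ s := by
      rw [energy_eq, hf]
      exact Finset.single_le_sum (f := fun κ => K.sliceInt s (K.energyDensity (multiDer K.DT κ ψ))) (fun _ _ => zero_le) hν
    rw [hS]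
    exact h1.trans (le_iSup₂ (f := fun τ (_ : τ ∈ Icc t0 t1) => K.energy k ψ τ) s hsI)
  have hinner : ∀ s, ∫⁻ z : Fin 3 → ℝ, L.indicator g (Fin.cons s z)
      ≤ (layer t0 t1).indicator (fun _ => ofReal ((1 + ρ ^ 2) * c⁻¹) * S) s := by
    intro s
    by_cases hs : s ∈ layer t0 t1
    swap
    · rw [indicator_of_notMem hs, nonpos_iff_eq_zero]
      rw [show (fun z : Fin 3 → ℝ => L.indicator g (Fin.cons s z)) = fun _ => 0 from funext fun z =>
        indicator_of_notMem (fun h => hs (by rw [hL] at h; exact h.1)) _]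
      simp
    rw [indicator_of_mem hs]
    refine le_trans ?_ (mul_le_mul_right (hsup s hs) _)
    have hmeas : MeasurableSet {y : Fin 3 → ℝ | K.r0 ≤ rad ![0, y 0, y 1, y 2]} := by
      refine measurableSet_le measurable_const (continuous_rad.measurable.comp ?_)
      exact (continuous_pi fun i => by fin_cases i <;> simp <;> fun_prop).measurable
    unfold sliceInt
    rw [← lintegral_const_mul' _ _ ofReal_ne_top, ← lintegral_indicator hmeas]
    refine lintegral_mono_ae ?_
    filter_upwards [ae_off_axis_three] with z hz
    by_cases hzL : (Fin.cons s z : Pt) ∈ L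
    swap
    · rw [indicator_of_notMem hzL]; exact zero_le
    rw [indicator_of_mem hzL]
    rw [cons_eq_vec] at hzL ⊢
    have hrad : rad ![s, z 0, z 1, z 2] = rad ![0, z 0, z 1, z 2] := by simp [rad]
    rw [hL] at hzL
    obtain ⟨-, h1, h2⟩ := hzL
    have hmem : z ∈ {y : Fin 3 → ℝ | K.r0 ≤ rad ![0, y 0, y 1, y 2]} := by
      show K.r0 ≤ _
      rw [← hrad]
      exact (K.params.2.1.trans h1).le
    have hh : K.hSigma (rad ![0, z 0, z 1, z 2]) = 0 := by
      rw [← hrad, hSigma, if_pos (h2.trans hρR)]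
    rw [indicator_of_mem hmem]
    rw [hh, add_zero, hg, ← ofReal_mul (by positivity)]
    refine ofReal_le_ofReal ?_
    obtain ⟨x, hx⟩ : ∃ x : Pt, x = ![s, z 0, z 1, z 2] := ⟨_, rfl⟩
    rw [← hx] at h1 h2 ⊢
    have hsx : x 1 ^ 2 + x 2 ^ 2 ≠ 0 := by rw [hx]; exact hz
    have h3 := hdens x ((rPlus_pos ha).trans h1) h2
    have h4 := hcl x h1.le h2 hsx
    have h5 := K.energyDensity_nonneg f x
    calc _ ≤ (1 + ρ ^ 2) * K.energyDensity f x := h3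
      _ = (1 + ρ ^ 2) * c⁻¹ * (K.energyDensity f x * c) := by field_simp
      _ ≤ _ := by gcongr
  refine (lintegral_mono hinner).trans ?_
  rw [lintegral_indicator (show MeasurableSet (layer t0 t1) from measurableSet_Ioc.union measurableSet_Ico), setLIntegral_const]
  refine mul_le_of_le_one_right zero_le ?_
  refine (measure_union_le _ _).trans ?_
  rw [Real.volume_Ioc, Real.volume_Ico, ← ofReal_add (by norm_num) (by norm_num)]
  norm_num

end KerrSetup

namespace KerrSetup

variable {M a : ℝ} (K : KerrSetup M a)

lemma liftIdx_mem {k : ℕ} {κ : Fin 2 → ℕ} (hκ : κ ∈ multiIdx 2 (k + 1)) : liftIdx κ ∈ multiIdx 8 (k + 1) := by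
  rw [mem_multiIdx] at hκ ⊢
  simpa [liftIdx, Fin.sum_univ_succ] using hκ

/-- The source term is controlled by the source norm. -/
lemma lintegral_source_le (ha : |a| < M) : ∃ C : ℝ, 0 ≤ C ∧ ∀ (k : ℕ) (t0 t1 : ℝ) (F : Pt → ℂ), ∀ κ ∈ multiIdx 2 (k + 1),
    ∫⁻ x in {x : Pt | t0 < x 0 ∧ x 0 < t1 ∧ rPlus M a < rad x ∧ rad x ≤ 1.3 * K.Rpot},
      ofReal (‖multiDer K.DF (liftIdx κ) F x‖ ^ 2) ≤ ofReal C * K.sourceX k t0 t1 F := by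
  obtain ⟨hRR, -, -, -⟩ := radii_order ha K
  have hR := K.Rpot_lt_R ha
  obtain ⟨c, _, hc, hvol⟩ := K.vol_comparable
  refine ⟨c⁻¹, by positivity, fun k t0 t1 F κ hκ => ?_⟩
  obtain ⟨A, hA⟩ : ∃ A, A = {x : Pt | t0 < x 0 ∧ x 0 < t1 ∧ rPlus M a < rad x ∧ rad x ≤ 1.3 * K.Rpot} := ⟨_, rfl⟩
  have hAm : MeasurableSet A := by
    rw [hA]
    exact (measurableSet_lt measurable_const (measurable_pi_apply 0)).inter ((measurableSet_lt (measurable_pi_apply 0) measurable_const).inter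
      ((measurableSet_lt measurable_const continuous_rad.measurable).inter (measurableSet_le continuous_rad.measurable measurable_const)))
  have hsub : A ⊆ K.region t0 t1 ∩ {x | rPlus M a ≤ rad x ∧ rad x ≤ 1.3 * K.Rpot} := by
    rw [hA]
    rintro x ⟨h1, h2, h3, h4⟩
    exact ⟨K.openSlab_subset_region ha t0 t1 ⟨⟨h3, h4.trans_lt hRR⟩, h1, h2⟩, h3.le, h4⟩
  rw [← hA]
  calc _ ≤ ∫⁻ x in A, ofReal c⁻¹ * ofReal (‖multiDer K.DF (liftIdx κ) F x‖ ^ 2 * volDensity K.gMat x) := by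
        refine setLIntegral_mono' hAm fun x hx => ?_
        rw [← ofReal_mul (by positivity)]
        refine ofReal_le_ofReal ?_
        have h1 : c ≤ volDensity K.gMat x := (hvol x (hsub hx).1.1).1
        calc _ = c⁻¹ * (‖multiDer K.DF (liftIdx κ) F x‖ ^ 2 * c) := by field_simp
          _ ≤ _ := by gcongr
    _ = ofReal c⁻¹ * ∫⁻ x in A, ofReal (‖multiDer K.DF (liftIdx κ) F x‖ ^ 2 * volDensity K.gMat x) :=
        lintegral_const_mul' _ _ ofReal_ne_top
    _ ≤ _ := by
        refine mul_le_mul_right ((lintegral_mono_set hsub).trans ?_) _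
        exact Finset.single_le_sum (f := fun κ => K.bulkInt (K.region t0 t1 ∩ {x | rPlus M a ≤ rad x ∧ rad x ≤ 1.3 * K.Rpot}) fun x =>
          ‖multiDer K.DF κ F x‖ ^ 2) (fun _ _ => zero_le) (liftIdx_mem hκ)

/-- The inhomogeneity of the cut-off equation is controlled by the energy and the source. -/
theorem lintegral_cutPsi_le (ha : |a| < M) {k : ℕ} {κ : Fin 2 → ℕ} (hκ : κ ∈ multiIdx 2 (k + 1)) : ∃ C : ℝ, 0 ≤ C ∧
    ∀ t0 t1, t0 + 2 ≤ t1 → ∀ ψ F : Pt → ℂ,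
    (∃ U : Set Pt, IsOpen U ∧ K.region t0 t1 ⊆ U ∧ ContDiffOn ℝ ∞ ψ U) → (∀ x ∈ K.region t0 t1, K.box ψ x = F x) →
    ∫⁻ x in {x | rPlus M a < rad x ∧ rad x ≤ 1.3 * K.Rpot}, ofReal
      (‖multiDer ![TField, Om 0] κ (kerrWave M a K.p K.q (K.cutPsi t0 t1 ψ)) x‖ ^ 2)
      ≤ ofReal C * ((⨆ τ ∈ Icc t0 t1, K.energy k ψ τ) + K.sourceX k t0 t1 F) := by
  classical
  obtain ⟨hRR, -, -, -⟩ := radii_order ha K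
  obtain ⟨B, hB0, hB⟩ := K.commuted_source_bound ha κ
  obtain ⟨C1, hC1, hlayer⟩ := K.lintegral_layer_le ha k
  obtain ⟨C2, hC2, hsource⟩ := K.lintegral_source_le ha
  obtain ⟨J, hJ⟩ : ∃ J, J = multiIdx 5 (κ 0 + κ 1 + 2) := ⟨_, rfl⟩
  have hJk : ∀ μ ∈ J, μ ∈ multiIdx 5 (k + 2) := fun μ hμ => by
    rw [hJ, mem_multiIdx] at hμ
    rw [mem_multiIdx] at hκ ⊢
    rw [Fin.sum_univ_two] at hκ
    omega
  refine ⟨B * (C2 + J.card * C1), by positivity, ?_⟩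
  intro t0 t1 hτ ψ F hψ hF
  obtain ⟨S, hS⟩ : ∃ S, S = ⨆ τ ∈ Icc t0 t1, K.energy k ψ τ := ⟨_, rfl⟩
  obtain ⟨E, hE⟩ : ∃ E : Set Pt, E = {x | rPlus M a < rad x ∧ rad x ≤ 1.3 * K.Rpot} := ⟨_, rfl⟩
  have hEm : MeasurableSet E := by
    rw [hE]
    exact (measurableSet_lt measurable_const continuous_rad.measurable).inter (measurableSet_le continuous_rad.measurable measurable_const)
  obtain ⟨A, hA⟩ : ∃ A, A = {x : Pt | t0 < x 0 ∧ x 0 < t1 ∧ rPlus M a < rad x ∧ rad x ≤ 1.3 * K.Rpot} := ⟨_, rfl⟩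
  have hAm : MeasurableSet A := by
    rw [hA]
    exact (measurableSet_lt measurable_const (measurable_pi_apply 0)).inter ((measurableSet_lt (measurable_pi_apply 0) measurable_const).inter
      ((measurableSet_lt measurable_const continuous_rad.measurable).inter (measurableSet_le continuous_rad.measurable measurable_const)))
  obtain ⟨L, hL⟩ : ∃ L, L = layerRegion M a (1.3 * K.Rpot) t0 t1 := ⟨_, rfl⟩
  have hLm : MeasurableSet L := by rw [hL]; exact measurableSet_layerRegion _ _ _
  obtain ⟨f, hf⟩ : ∃ f : Pt → ENNReal, f = fun x => ofReal (‖multiDer K.DF (liftIdx κ) F x‖ ^ 2) := ⟨_, rfl⟩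
  obtain ⟨g, hg⟩ : ∃ g : (Fin 5 → ℕ) → Pt → ENNReal, g = fun μ x => ofReal (‖multiDer K.DT μ ψ x‖ ^ 2) := ⟨_, rfl⟩
  obtain ⟨H, hH⟩ : ∃ H, H = multiDer ![TField, Om 0] κ (kerrWave M a K.p K.q (K.cutPsi t0 t1 ψ)) := ⟨_, rfl⟩
  have hHs : K.IsSlab t0 t1 H := by rw [hH]; exact ((K.isSlab_cutPsi ha hψ).kerrWave ha).multiDer κ
  rw [← hS, ← hE, ← hH, ← lintegral_indicator hEm]
  have hLsub : L ⊆ K.openSlab t0 t1 := by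
    rw [hL]
    rintro x ⟨h0, h1, h2⟩
    refine ⟨⟨h1, h2.trans_lt hRR⟩, ?_⟩
    rcases h0 with h0 | h0
    · exact ⟨h0.1, by linarith [h0.2]⟩
    · exact ⟨by linarith [h0.1], h0.2⟩
  have hsm : SmoothOn (K.openSlab t0 t1) ψ := by
    obtain ⟨U, hU, hsub, hψ⟩ := hψ
    exact fun y hy => hψ.contDiffAt (hU.mem_nhds (hsub (K.openSlab_subset_region ha t0 t1 hy)))
  have hgm : ∀ μ, AEMeasurable (L.indicator (g μ)) := by
    intro μ
    have hc : ContinuousOn (multiDer K.DT μ ψ) L := fun x hx =>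
      (SmoothOn.multiDer (fun i => ((K.isFrame_DT ha).smooth i).mono (K.openSlab_subset_exterior t0 t1)) hsm μ x (hLsub hx)).continuousAt.continuousWithinAt
    rw [aemeasurable_indicator_iff hLm, hg]
    exact ((hc.aestronglyMeasurable hLm).norm.aemeasurable.pow_const 2).ennreal_ofReal
  have hne : ∀ c : ℝ, ∀ᵐ x : Pt, x 0 ≠ c := fun c => Measure.ae_eval_ne (fun _ : Fin 4 => (volume : Measure ℝ)) 0 c
  have hpt : ∀ᵐ x : Pt, E.indicator (fun x => ofReal (‖H x‖ ^ 2)) x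
      ≤ ofReal B * (A.indicator f x + ∑ μ ∈ J, L.indicator (g μ) x) := by
    filter_upwards [ae_off_axis_four, hne t0, hne t1] with x hs h0 h1
    by_cases hxE : x ∈ E
    swap
    · rw [indicator_of_notMem hxE]; exact zero_le
    rw [indicator_of_mem hxE]
    rw [hE] at hxE
    have hsh : x ∈ K.shell := ⟨hxE.1, hxE.2.trans_lt hRR⟩
    by_cases ht : x 0 ∈ Icc t0 t1
    swap
    · rw [hHs.supp x hsh ht]; simp
    have ht0 : t0 < x 0 := lt_of_le_of_ne ht.1 (Ne.symm h0)
    have ht1 : x 0 < t1 := lt_of_le_of_ne ht.2 h1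
    have hxA : x ∈ A := by rw [hA]; exact ⟨ht0, ht1, hxE.1, hxE.2⟩
    have h2 := hB t0 t1 hτ ψ F hψ hF x ⟨hsh, ht0, ht1⟩ hxE.2 hs
    rw [← hH, ← hJ] at h2
    refine (ofReal_le_ofReal h2).trans ?_
    rw [ofReal_mul hB0, ofReal_add (sq_nonneg _) (by split_ifs <;> positivity), indicator_of_mem hxA]
    refine mul_le_mul_right (add_le_add (by rw [hf]) ?_) _
    split_ifs with hl
    · have hxL : x ∈ L := by
        rw [hL]
        exact ⟨hl.imp (fun h => ⟨ht0, h⟩) (fun h => ⟨h, ht1⟩), hxE⟩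
      rw [ENNReal.ofReal_sum_of_nonneg fun _ _ => sq_nonneg _]
      refine sum_le_sum fun μ _ => ?_
      rw [indicator_of_mem hxL, hg]
    · simp
  refine (lintegral_mono_ae hpt).trans ?_
  rw [lintegral_const_mul' _ _ ofReal_ne_top, lintegral_add_right' _ (Finset.aemeasurable_fun_sum _ fun μ _ => hgm μ),
    lintegral_finsetSum' _ fun μ _ => hgm μ, lintegral_indicator hAm]
  have i1 : ∫⁻ x in A, f x ≤ ofReal C2 * K.sourceX k t0 t1 F := by
    rw [hf, hA]; exact hsource k t0 t1 F κ hκ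
  have i2 : ∑ μ ∈ J, ∫⁻ x, L.indicator (g μ) x ≤ J.card * (ofReal C1 * S) := by
    rw [← nsmul_eq_mul]
    refine Finset.sum_le_card_nsmul _ _ _ fun μ hμ => ?_
    rw [lintegral_indicator hLm, hg, hL, hS]
    exact hlayer t0 t1 hτ ψ μ (hJk μ hμ)
  rw [ofReal_mul hB0, ofReal_add hC2 (by positivity), ofReal_mul (Nat.cast_nonneg _), ENNReal.ofReal_natCast, mul_assoc]
  refine mul_le_mul_right ((add_le_add i1 i2).trans ?_) _
  obtain ⟨X, hX⟩ : ∃ X, X = K.sourceX k t0 t1 F := ⟨_, rfl⟩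
  rw [← hX, add_mul, ← mul_assoc]
  gcongr
  · exact le_add_self
  · exact le_self_add

/-- The elliptic estimate for one commutation. -/
theorem freqInt_elpDensity_le (ha : |a| < M) {b γ : ℝ} (hb : 0 < b) (hγ : 0 < γ) {k : ℕ} {κ : Fin 2 → ℕ} (hκ : κ ∈ multiIdx 2 (k + 1))
    {ωhigh εwidth α btrap : ℝ} {χ : ℝ → ℝ → ℤ → ℝ → ℝ} (hχ : IsChiNat M a ωhigh εwidth α btrap χ) (hω : 0 < ωhigh) (hbt : btrap ≤ b / 4)
    (δ : ℝ) : ∃ C : ℝ, 0 ≤ C ∧ ∀ t0 t1, t0 + 2 ≤ t1 → ∀ ψ F : Pt → ℂ,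
    (∃ U : Set Pt, IsOpen U ∧ K.region t0 t1 ⊆ U ∧ ContDiffOn ℝ ∞ ψ U) → (∀ x ∈ K.region t0 t1, K.box ψ x = F x) →
    freqInt M a (1.2 * K.Rpot) (fun ω m l => elpDensity M a K.Rpot b γ (K.mode κ t0 t1 ψ ω m l) ω m (LambdaFreq a ω m l))
      ≤ ofReal C * (K.chiX δ k t0 t1 ψ + K.natX χ k t0 t1 ψ + K.sourceX k t0 t1 F) := by
  obtain ⟨C1, hC1, h1⟩ := IsSlab.elliptic_bound ha K hb hγ
  obtain ⟨C2, hC2, h2⟩ := K.lintegral_cutPsi_le ha hκ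
  refine ⟨C1 * max 1 C2, by positivity, fun t0 t1 hτ ψ F hψ hF => ?_⟩
  refine (h1 hχ hω hbt (K.isSlab_cutPsi ha hψ) κ).trans ?_
  rw [ofReal_mul hC1.le, mul_assoc]
  refine mul_le_mul_right ?_ _
  obtain ⟨D, hD⟩ : ∃ D, D = ofReal (max 1 C2) := ⟨_, rfl⟩
  have hD1 : 1 ≤ D := by rw [hD]; exact ENNReal.one_le_ofReal.2 (le_max_left _ _)
  have hnat : freqInt M a K.Rfreq (fun ω m l => natDensity M a χ (K.mode κ t0 t1 ψ ω m l) ω m (LambdaFreq a ω m l)) ≤ K.natX χ k t0 t1 ψ :=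
    Finset.single_le_sum (f := fun κ => freqInt M a K.Rfreq (fun ω m l => natDensity M a χ (K.mode κ t0 t1 ψ ω m l) ω m (LambdaFreq a ω m l)))
      (fun _ _ => zero_le) hκ
  have hsup : (⨆ τ ∈ Icc t0 t1, K.energy k ψ τ) ≤ K.chiX δ k t0 t1 ψ := by
    unfold chiX
    rw [add_assoc]
    exact le_self_add
  have h3 := h2 t0 t1 hτ ψ F hψ hF
  rw [← hD]
  calc _ ≤ K.natX χ k t0 t1 ψ + D * (K.chiX δ k t0 t1 ψ + K.sourceX k t0 t1 F) := by
        refine add_le_add hnat (h3.trans ?_)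
        rw [hD]
        gcongr
        exact le_max_right _ _
    _ ≤ D * K.natX χ k t0 t1 ψ + D * (K.chiX δ k t0 t1 ψ + K.sourceX k t0 t1 F) :=
        add_le_add (le_mul_of_one_le_left zero_le hD1) le_rfl
    _ = _ := by ring

end KerrSetup
end KerrElliptic
end

open KerrElliptic in
theorem proposition3p4 (M a : ℝ) (ha : |a| < M) :
    -- the fixed-frequency estimate
    (∀ Rpot b γ : ℝ, 5 * M < Rpot → 0 < b → 0 < γ →
      ∃ C : ℝ, 0 < C ∧ ∀ (ω : ℝ) (m : ℤ) (Λ : ℝ), Admissible a ω m Λ →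
        ∀ u G : ℝ → ℂ, ContDiffOn ℝ 2 u (Set.Ioi (rPlus M a)) → RadialODE M a ω m Λ u G →
          lintStar M a (Set.Ioc (rElliptic M a γ ω m) (1.2 * Rpot))
              (fun r => Del M a r * (r ^ 2)⁻¹ * iotaV M a b ω m Λ r
                * (V0 M a ω m Λ r - ω ^ 2) ^ 2 * ‖u r‖ ^ 2)
            ≤ ENNReal.ofReal C *
              lintStar M a
                (Set.Ioc (max (0.99 * rElliptic M a γ ω m) (rPlus M a)) (1.3 * Rpot))
                (fun r => Del M a r * (r ^ 2)⁻¹ * iotaV M a (b / 2) ω m Λ r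
                  * ((ω ^ 2 + Λ) * ‖u r‖ ^ 2 + ‖G r‖ ^ 2))) ∧
    -- the estimate for solutions of the inhomogeneous wave equation
    (∀ b : ℝ, 0 < b → ∃ b₀ : ℝ, 0 < b₀ ∧
      ∀ (K : KerrSetup M a) (γ ωhigh εwidth α btrap δ : ℝ),
        0 < γ → 0 < ωhigh → 0 < εwidth → 0 < α → 0 < btrap → btrap ≤ b₀ → 0 < δ → δ < 1 / 10 →
        ∀ χ : ℝ → ℝ → ℤ → ℝ → ℝ, IsChiNat M a ωhigh εwidth α btrap χ →
        ∀ k : ℕ, ∃ C : ℝ, 0 < C ∧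
          ∀ τ₀ τ₁ : ℝ, τ₀ + 2 ≤ τ₁ → ∀ ψ F : Pt → ℂ,
            (∃ U : Set Pt, IsOpen U ∧ K.region τ₀ τ₁ ⊆ U ∧ ContDiffOn ℝ (⊤ : ℕ∞) ψ U) →
            (∀ x ∈ K.region τ₀ τ₁, K.box ψ x = F x) →
            K.elpX b γ k τ₀ τ₁ ψ ≤ ENNReal.ofReal C *
              (K.chiX δ k τ₀ τ₁ ψ + K.natX χ k τ₀ τ₁ ψ + K.sourceX k τ₀ τ₁ F)) := by
  constructor
  · intro Rpot b γ hR hb hγ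
    obtain ⟨C, hC, h⟩ := fixed_frequency_local ha (ρ := 1.3 * Rpot + 1) hR hb hγ (by linarith)
    refine ⟨C, hC, fun ω m Λ hadm u G hu hode => ?_⟩
    exact h ω m Λ hadm u G (hu.mono Set.Ioo_subset_Ioi_self) (fun r hr => hode r hr.1)
  · intro b hb
    refine ⟨b / 4, by positivity, ?_⟩
    intro K γ ωhigh εwidth α btrap δ hγ hω hε hα hbt0 hbt hδ hδ' χ hχ k
    choose! C hC0 hC using fun (κ : Fin 2 → ℕ) (hκ : κ ∈ multiIdx 2 (k + 1)) =>
      K.freqInt_elpDensity_le ha hb hγ hκ hχ hω hbt δ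
    have hS : 0 ≤ ∑ κ ∈ multiIdx 2 (k + 1), C κ := Finset.sum_nonneg hC0
    refine ⟨∑ κ ∈ multiIdx 2 (k + 1), C κ + 1, by linarith, fun τ₀ τ₁ hτ ψ F hψ hF => ?_⟩
    refine (Finset.sum_le_sum fun κ hκ => hC κ hκ τ₀ τ₁ hτ ψ F hψ hF).trans ?_
    rw [← Finset.sum_mul, ← ENNReal.ofReal_sum_of_nonneg hC0]
    exact mul_le_mul_left (ENNReal.ofReal_le_ofReal (by linarith)) _
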